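/- A spider with $d\ge 1$ legs is the metric space obtained by gluing $d$ half-lines $l_1,\dots,l_d$ at their common endpoint, the center (so $d$ is the degree of the center). The point on leg $l$ at distance $x\ge 0$ from the center is written $(l,x)$, and $\mathrm{dist}((l,x),(l',x'))=|x-x'|$ if $l=l'$ and $x+x'$ if $l\ne l'$. Let $r\ge 1$ be an integer, let $u_1,\dots,u_n$ be users and $f_1,\dots,f_m$ facilities on the spider, each given by its leg and its distance from the center, where the users, and likewise the facilities, are listed in nondecreasing order of their distance from the center. * *$r$-gather clustering*: partition the users into clusters with at least $r$ users each, so that the maximum diameter $\max_{u,v\in C}\mathrm{dist}(u,v)$ of a cluster $C$ is minimum. * *$r$-gathering*: assign to each user $u$ a facility $\pi(u)$, so that every facility has either no user or at least $r$ users, and the maximum of $\mathrm{dist}(u,\pi(u))$ over all users is minimum. Algorithms run on a real RAM with unit-cost operations, whose integer words have $O(\log B)$ bits, $B$ being the expression inside the $O(\cdot)$ of the time bound, and whose real numbers can be added, subtracted and compared. To solve a problem means to output an optimal solution together with its value, or to report that no feasible solution exists. **Theorem 2.** There is an algorithm that solves the $r$-gather clustering problem on a spider in $O(2^d r^4 d^5+n)$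 time. Similarly, there is an algorithm that solves the $r$-gathering problem on a spider in $O(2^d r^4 d^5+n+m)$ time. The constants hidden in $O(\cdot)$ are absolute. -/

import Mathlib

open scoped NNReal

namespace RGather

/-! ### Spiders -/

/-- The point at distance `pos` from the center on leg number `leg` of a spider with `d` legs
(half-lines glued together at their endpoint, the center).  The points with `pos = 0` all
represent the center; they are at distance `0` from each other. -/
structure SpiderPoint (d : ℕ) where
  leg : Fin d
  pos : ℝ≥0

/-- The spider metric (a pseudometric on representatives, because the center has `d` of them). -/
noncomputable instance (d : ℕ) : PseudoMetricSpace (SpiderPoint d) where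
  dist p q := if p.leg = q.leg then |(p.pos : ℝ) - q.pos| else (p.pos : ℝ) + q.pos
  dist_self p := by simp
  dist_comm p q := by
    simp only [eq_comm (a := q.leg), abs_sub_comm (q.pos : ℝ), add_comm (q.pos : ℝ)]
  dist_triangle p q s := by
    have hp : (0 : ℝ) ≤ p.pos := p.pos.2
    have hq : (0 : ℝ) ≤ q.pos := q.pos.2
    have hs : (0 : ℝ) ≤ s.pos := s.pos.2
    have key : p.leg = q.leg → q.leg = s.leg → p.leg = s.leg := fun h h' => h.trans h'
    have key' : p.leg = q.leg → p.leg = s.leg → q.leg = s.leg := fun h h' => h.symm.trans h'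
    have key'' : q.leg = s.leg → p.leg = s.leg → p.leg = q.leg := fun h h' => h'.trans h.symm
    split_ifs <;> try tauto
    all_goals
      have a1 := le_abs_self ((p.pos : ℝ) - q.pos)
      have a2 := neg_abs_le ((p.pos : ℝ) - q.pos)
      have a3 := le_abs_self ((q.pos : ℝ) - s.pos)
      have a4 := neg_abs_le ((q.pos : ℝ) - s.pos)
      first
        | linarith
        | exact abs_le.2 ⟨by linarith, by linarith⟩

/-! ### The two optimization problems, in any metric space -/

section Problems

variable {M : Type*} [PseudoMetricSpace M] {n m : ℕ}

/-- The largest distance between two users of the cluster `C`. -/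
noncomputable def clusterDiam (u : Fin n → M) (C : Finset (Fin n)) : ℝ≥0 :=
  (C ×ˢ C).sup fun p => nndist (u p.1) (u p.2)

/-- A partition of the users into clusters is feasible if every cluster has at least `r` users. -/
def ClusteringFeasible (r : ℕ) (P : Finpartition (Finset.univ : Finset (Fin n))) : Prop :=
  ∀ C ∈ P.parts, r ≤ C.card

/-- The largest diameter of a cluster. -/
noncomputable def clusteringCost (u : Fin n → M)
    (P : Finpartition (Finset.univ : Finset (Fin n))) : ℝ≥0 :=
  P.parts.sup (clusterDiam u)

/-- Optimal solutions of the `r`-gather clustering problem. -/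
def ClusteringOptimal (r : ℕ) (u : Fin n → M)
    (P : Finpartition (Finset.univ : Finset (Fin n))) : Prop :=
  ClusteringFeasible r P ∧
    ∀ Q : Finpartition (Finset.univ : Finset (Fin n)),
      ClusteringFeasible r Q → clusteringCost u P ≤ clusteringCost u Q

/-- An assignment of users to facilities is feasible if every facility gets either no user or at
least `r` users. -/
def GatheringFeasible (r : ℕ) (π : Fin n → Fin m) : Prop :=
  ∀ j, (Finset.univ.filter fun i => π i = j).card = 0 ∨
    r ≤ (Finset.univ.filter fun i => π i = j).card

/-- The largest distance from a user to its assigned facility. -/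
noncomputable def gatheringCost (u : Fin n → M) (f : Fin m → M) (π : Fin n → Fin m) : ℝ≥0 :=
  Finset.univ.sup fun i => nndist (u i) (f (π i))

/-- Optimal solutions of the `r`-gathering problem. -/
def GatheringOptimal (r : ℕ) (u : Fin n → M) (f : Fin m → M) (π : Fin n → Fin m) : Prop :=
  GatheringFeasible r π ∧
    ∀ ρ : Fin n → Fin m, GatheringFeasible r ρ → gatheringCost u f π ≤ gatheringCost u f ρ

end Problems

/-! ### The machine model

A real RAM: a memory of integer words and a memory of real numbers, with indirect addressing
through integer words.  Programs are finite texts in a structured language (assignment,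
sequence, branching, loop).  Integer words are natural numbers below a word bound `W`; a program
that computes a value `≥ W` is stuck.  Real numbers can only be added, subtracted and compared;
they cannot be converted to integers.  Every constant, memory access, arithmetic operation,
comparison and assignment costs one step. -/

/-- Memory: cell `i` of the integer array `a` is `ints a i`, cell `i` of the real array `a` is
`reals a i`.  (The text of a program mentions only finitely many arrays.) -/
structure Store where
  ints : ℕ → ℕ → ℕ
  reals : ℕ → ℕ → ℝ

/-- Integer expressions. -/
inductive IExp where
  | const (c : ℕ)
  | read (a : ℕ) (i : IExp)
  | add (e₁ e₂ : IExp)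
  | sub (e₁ e₂ : IExp)
  | mul (e₁ e₂ : IExp)
  | div (e₁ e₂ : IExp)

/-- A result has to fit into a word. -/
def word (W v : ℕ) : Option ℕ := if v < W then some v else none

/-- Value of an integer expression; `sub` is truncated at `0` and `div` rounds down. -/
def IExp.eval (W : ℕ) (s : Store) : IExp → Option ℕ
  | .const c => word W c
  | .read a i => (i.eval W s).bind fun x => word W (s.ints a x)
  | .add e₁ e₂ => (e₁.eval W s).bind fun x => (e₂.eval W s).bind fun y => word W (x + y)
  | .sub e₁ e₂ => (e₁.eval W s).bind fun x => (e₂.eval W s).bind fun y => word W (x - y)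
  | .mul e₁ e₂ => (e₁.eval W s).bind fun x => (e₂.eval W s).bind fun y => word W (x * y)
  | .div e₁ e₂ => (e₁.eval W s).bind fun x => (e₂.eval W s).bind fun y => word W (x / y)

/-- Number of steps to evaluate an integer expression. -/
def IExp.cost : IExp → ℕ
  | .const _ => 1
  | .read _ i => i.cost + 1
  | .add e₁ e₂ => e₁.cost + e₂.cost + 1
  | .sub e₁ e₂ => e₁.cost + e₂.cost + 1
  | .mul e₁ e₂ => e₁.cost + e₂.cost + 1
  | .div e₁ e₂ => e₁.cost + e₂.cost + 1

/-- Real expressions. -/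
inductive RExp where
  | zero
  | read (a : ℕ) (i : IExp)
  | add (x₁ x₂ : RExp)
  | sub (x₁ x₂ : RExp)

/-- Value of a real expression. -/
noncomputable def RExp.eval (W : ℕ) (s : Store) : RExp → Option ℝ
  | .zero => some 0
  | .read a i => (i.eval W s).map fun x => s.reals a x
  | .add x₁ x₂ => (x₁.eval W s).bind fun x => (x₂.eval W s).map fun y => x + y
  | .sub x₁ x₂ => (x₁.eval W s).bind fun x => (x₂.eval W s).map fun y => x - y

/-- Number of steps to evaluate a real expression. -/
def RExp.cost : RExp → ℕ
  | .zero => 1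
  | .read _ i => i.cost + 1
  | .add x₁ x₂ => x₁.cost + x₂.cost + 1
  | .sub x₁ x₂ => x₁.cost + x₂.cost + 1

/-- Comparisons `≤` of two integers or of two reals. -/
inductive Test where
  | intLe (e₁ e₂ : IExp)
  | realLe (x₁ x₂ : RExp)

open Classical in
/-- Outcome of a comparison. -/
noncomputable def Test.eval (W : ℕ) (s : Store) : Test → Option Bool
  | .intLe e₁ e₂ => (e₁.eval W s).bind fun x => (e₂.eval W s).map fun y => decide (x ≤ y)
  | .realLe x₁ x₂ => (x₁.eval W s).bind fun x => (x₂.eval W s).map fun y => decide (x ≤ y)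

/-- Number of steps of a comparison. -/
def Test.cost : Test → ℕ
  | .intLe e₁ e₂ => e₁.cost + e₂.cost + 1
  | .realLe x₁ x₂ => x₁.cost + x₂.cost + 1

/-- Programs. -/
inductive Program where
  | skip
  | setInt (a : ℕ) (i e : IExp)
  | setReal (a : ℕ) (i : IExp) (x : RExp)
  | seq (p q : Program)
  | ite (b : Test) (p q : Program)
  | loop (b : Test) (p : Program)

/-- The store after writing `v` into cell `i` of the integer array `a`. -/
def Store.setInt (s : Store) (a i v : ℕ) : Store :=
  { s with ints := fun a' i' => if a' = a ∧ i' = i then v else s.ints a' i' }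

/-- The store after writing `v` into cell `i` of the real array `a`. -/
def Store.setReal (s : Store) (a i : ℕ) (v : ℝ) : Store :=
  { s with reals := fun a' i' => if a' = a ∧ i' = i then v else s.reals a' i' }

/-- `Run W p s s' t`: with word bound `W`, the program `p` started in the store `s` terminates
in the store `s'` after `t` steps. -/
inductive Run (W : ℕ) : Program → Store → Store → ℕ → Prop
  | skip (s : Store) : Run W .skip s s 1
  | setInt {s : Store} {a : ℕ} {i e : IExp} {x v : ℕ}
      (hi : i.eval W s = some x) (he : e.eval W s = some v) :
      Run W (.setInt a i e) s (s.setInt a x v) (i.cost + e.cost + 1)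
  | setReal {s : Store} {a : ℕ} {i : IExp} {e : RExp} {x : ℕ} {v : ℝ}
      (hi : i.eval W s = some x) (he : e.eval W s = some v) :
      Run W (.setReal a i e) s (s.setReal a x v) (i.cost + e.cost + 1)
  | seq {p q : Program} {s s₁ s₂ : Store} {t₁ t₂ : ℕ}
      (hp : Run W p s s₁ t₁) (hq : Run W q s₁ s₂ t₂) :
      Run W (.seq p q) s s₂ (t₁ + t₂)
  | iteTrue {b : Test} {p q : Program} {s s₁ : Store} {t : ℕ}
      (hb : b.eval W s = some true) (hp : Run W p s s₁ t) :
      Run W (.ite b p q) s s₁ (b.cost + t)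
  | iteFalse {b : Test} {p q : Program} {s s₁ : Store} {t : ℕ}
      (hb : b.eval W s = some false) (hq : Run W q s s₁ t) :
      Run W (.ite b p q) s s₁ (b.cost + t)
  | loopTrue {b : Test} {p : Program} {s s₁ s₂ : Store} {t₁ t₂ : ℕ}
      (hb : b.eval W s = some true) (hp : Run W p s s₁ t₁)
      (hl : Run W (.loop b p) s₁ s₂ t₂) :
      Run W (.loop b p) s s₂ (b.cost + t₁ + t₂)
  | loopFalse {b : Test} {p : Program} {s : Store} (hb : b.eval W s = some false) :
      Run W (.loop b p) s s b.cost

/-! ### Input and output conventions -/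

/-- The initial store for `n` users `u` and `m` facilities `f` on a spider with `d` legs.
Integer array `0` holds `d, r, n, m`; integer arrays `1` and `2` hold the legs of the users and of
the facilities, real arrays `0` and `1` their distances from the center; all else is zero. -/
noncomputable def inputStore {d n m : ℕ} (r : ℕ) (u : Fin n → SpiderPoint d)
    (f : Fin m → SpiderPoint d) : Store where
  ints
    | 0, 0 => d
    | 0, 1 => r
    | 0, 2 => n
    | 0, 3 => m
    | 1, i => if h : i < n then ((u ⟨i, h⟩).leg : ℕ) else 0
    | 2, j => if h : j < m then ((f ⟨j, h⟩).leg : ℕ) else 0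
    | _, _ => 0
  reals
    | 0, i => if h : i < n then ((u ⟨i, h⟩).pos : ℝ) else 0
    | 1, j => if h : j < m then ((f ⟨j, h⟩).pos : ℝ) else 0
    | _, _ => 0

/-- The final store `s` answers the `r`-gather clustering problem: either cell `0` of integer
array `3` is `1`, integer array `4` labels the users by the clusters of an optimal solution, and
cell `0` of real array `2` is the optimal value; or cell `0` of integer array `3` is `0`, and
there is no feasible solution. -/
def ClusteringAnswer {d n : ℕ} (r : ℕ) (u : Fin n → SpiderPoint d) (s : Store) : Prop :=
  (s.ints 3 0 = 1 ∧ ∃ P : Finpartition (Finset.univ : Finset (Fin n)),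
      ClusteringOptimal r u P ∧
      (∀ i j : Fin n, s.ints 4 i = s.ints 4 j ↔ P.part i = P.part j) ∧
      s.reals 2 0 = clusteringCost u P) ∨
  (s.ints 3 0 = 0 ∧
    ¬ ∃ P : Finpartition (Finset.univ : Finset (Fin n)), ClusteringFeasible r P)

/-- The final store `s` answers the `r`-gathering problem: either cell `0` of integer array `3` is
`1`, integer array `4` lists the facilities assigned to the users by an optimal solution, and
cell `0` of real array `2` is the optimal value; or cell `0` of integer array `3` is `0`, and
there is no feasible solution. -/
def GatheringAnswer {d n m : ℕ} (r : ℕ) (u : Fin n → SpiderPoint d) (f : Fin m → SpiderPoint d)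
    (s : Store) : Prop :=
  (s.ints 3 0 = 1 ∧ ∃ π : Fin n → Fin m,
      GatheringOptimal r u f π ∧
      (∀ i : Fin n, s.ints 4 i = π i) ∧
      s.reals 2 0 = gatheringCost u f π) ∨
  (s.ints 3 0 = 0 ∧ ¬ ∃ π : Fin n → Fin m, GatheringFeasible r π)

end RGather

namespace RGather

/-! ### The decision version at a fixed threshold: exchange arguments -/

section
/-! ### Exchanging the members of a cluster -/

/-! Fix a target value. A cluster is then admitted for one of two reasons: it lies in an interval of
a single leg, or it lies in a ball that reaches the center of the spider. A ball of the second kind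
only imposes a largest distance on each leg, so users can be exchanged between such "central"
clusters. Take a clustering with the fewest central clusters and, among these, with the smallest sum
of the numbers of the users in them. Then the central users form a prefix of each leg
(`Config.prefix`), and the central cluster whose ball center is farthest out may be assumed to
consist of all central users of one leg and of the first central users of the other legs
(`Feas.exists_first_cluster`). This cluster finishes the central part of a leg, and the argument is
applied anew to what remains; so each central cluster closes a leg. After splitting oversized parts
(`exists_short`) it takes at most `2 * r` users of any leg that stays open, hence only the first `2
* r * d` users of a leg ever matter for central clusters (`bestCost_le`).

The dynamic program scans these `O(r d²)` users by distance from the center. Its state consists of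
the position, the set of closed legs, the outermost own-leg user of the current cluster, and the
number of users that this cluster still needs. Each user offers three choices: close its leg, take
it, or take it and complete the cluster. The minimal value is at most every threshold at which the
instance is feasible (`bestCost_le_of_feas`), and the recorded choices lead back to a clustering
that attains it (`trace_spec`, `Traced.solution`). Thresholds occur only in the proof; the program
minimizes directly. Optimality follows by taking as threshold the cost of an arbitrary feasible
solution.

The users left on a closed leg are cut into intervals. The cheapest way for all suffixes of all legs
satisfies a min-max recurrence, which a monotone queue solves in linear time (`lineTable_spec`). For
gathering, the best facility of an interval is the one nearest to the midpoint of its extreme users,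
and pointers to it move in one direction only; for central clusters it is found by bisection, and
the logarithm is absorbed by the time bound (`multi_time_le`).

On the machine side, a total semantics with a bound `N` on stored integers is used together with
triples for time (`Tm`, `Tr`). A value of an expression is at most a power of `N` with exponent
fixed by the program text, so words of `O(log B)` bits suffice (`Ex.run`, `fits_of_measure`). -/

theorem exists_exchange (U : Finset ℕ) (c : ℕ → ℕ) (i₀ : ℕ) (M' : Finset ℕ) (hM' : M' ⊆ U)
    (hcard : M'.card = (U.filter (c · = i₀)).card) :
    ∃ c' : ℕ → ℕ, U.filter (c' · = i₀) = M' ∧ ∀ i, i ≠ i₀ →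
      (U.filter (c' · = i)).card = (U.filter (c · = i)).card ∧
      (U.filter (c · = i)) \ M' ⊆ U.filter (c' · = i) ∧
      U.filter (c' · = i) ⊆ U.filter (c · = i) ∪ (U.filter (c · = i₀) \ M') := by
  classical
  set M := U.filter (c · = i₀) with hM
  have hcard' : (M \ M').card = (M' \ M).card := by grind
  -- As many users leave the cluster as enter it; each leaving user goes to the old cluster of its
  -- partner.
  let e : (M \ M' : Finset ℕ) ≃ (M' \ M : Finset ℕ) := Finset.equivOfCardEq hcard'
  let c' : ℕ → ℕ := fun u => if u ∈ M' then i₀ else if h : u ∈ M \ M' then c (e ⟨u, h⟩) else c u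
  have ce : ∀ u (h : u ∈ M \ M'), u ∉ M' := by grind
  have c2 : ∀ u (h : u ∈ M \ M'), c' u = c (e ⟨u, h⟩) := fun u h => by
    simp only [c', ce u h, if_false, h, dif_pos]
  have c3 : ∀ u, u ∉ M' → u ∉ M → c' u = c u := fun u h h' => by grind
  have e1 : ∀ x : (M \ M' : Finset ℕ), (e x : ℕ) ∈ M' ∧ (e x : ℕ) ∈ U ∧ c (e x) ≠ i₀ := fun x => by
    grind
  refine ⟨c', ?_, ?_⟩
  · ext u; simp; constructor
    · rintro ⟨hu, h⟩; by_contra hn; by_cases hm : u ∈ M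
      · rw [c2 u (Finset.mem_sdiff.2 ⟨hm, hn⟩)] at h; grind
      · rw [c3 u hn hm] at h; grind
    · grind
  · intro i hi; refine ⟨?_, ?_, ?_⟩
    -- Sizes are kept: send every newcomer to the user that it replaces.
    · refine Finset.card_bij (fun u _ => if h : u ∈ M \ M' then (e ⟨u, h⟩ : ℕ) else u) ?_ ?_ ?_
      · intro u hu; rw [Finset.mem_filter] at hu; have hn : u ∉ M' := by grind
        by_cases h : u ∈ M \ M'
        · simp only [h, dif_pos, Finset.mem_filter]; rw [← c2 u h]; exact ⟨(e1 _).2.1, hu.2⟩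
        · have hm : u ∉ M := by grind
          simp only [h, dif_neg, Finset.mem_filter, not_false_eq_true]; rw [← c3 u hn hm]; exact hu
      · intro u hu v hv huv; by_cases h : u ∈ M \ M' <;> by_cases h' : v ∈ M \ M'
        · simp only [h, h', dif_pos] at huv; simpa using e.injective (Subtype.ext huv)
        all_goals grind
      · intro v hv; by_cases h : v ∈ M'
        · have hm : v ∉ M := by grind
          obtain ⟨x, hx⟩ := e.surjective ⟨v, Finset.mem_sdiff.2 ⟨h, hm⟩⟩; grind
        all_goals grind
    · intro u hu; simp at hu; have hm : u ∉ M := by grind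
      rw [Finset.mem_filter, c3 u hu.2 hm]; exact hu.1
    all_goals grind

theorem exists_initial (S : Finset ℕ) (m : ℕ) (h : m ≤ S.card) :
    ∃ T ⊆ S, T.card = m ∧ ∀ t ∈ T, ∀ s ∈ S, s ∉ T → t < s := by
  classical
  induction m with
  | zero => exact ⟨∅, by simp, rfl, by simp⟩
  | succ m ih =>
    obtain ⟨T, hTS, hT, hlt⟩ := ih (by omega)
    have hne : (S \ T).Nonempty := by rw [← Finset.card_pos, Finset.card_sdiff_of_subset hTS]; omega
    have hx := Finset.min'_mem _ hne; set x := (S \ T).min' hne; rw [Finset.mem_sdiff] at hx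
    refine ⟨insert x T, ?_, ?_, ?_⟩
    · grind
    · rw [Finset.card_insert_of_notMem hx.2, hT]
    · intro t ht s hs hsT; simp at ht hsT; rcases ht with rfl | ht
      · exact lt_of_le_of_ne (Finset.min'_le _ _ (Finset.mem_sdiff.2 ⟨hs, hsT.2⟩)) (Ne.symm hsT.1)
      · grind

/-! ### Clusters at a given threshold -/

/-- Users `0, …, n-1` on legs of a spider, numbered by distance from the center. -/
structure Users where
  n : ℕ
  r : ℕ
  d : ℕ
  leg : ℕ → ℕ
  pos : ℕ → ℝ
  hr : 1 ≤ r
  hd : 1 ≤ d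
  leg_lt : ∀ u, u < n → leg u < d
  mono : Monotone pos
  nonneg : ∀ u, 0 ≤ pos u

/-- The clusters admitted at some threshold: subsets of balls of radius `rad` around the admissible
centers (given by leg and distance), and intervals of a leg admitted by `line`. -/
structure Threshold where
  rad : ℝ
  cent : ℕ → ℝ → Prop
  cent_nonneg : ∀ {b y}, cent b y → 0 ≤ y
  line : ℕ → ℕ → Prop

variable (U : Users) (T : Threshold)

/-- All members of `C` lie in the ball around the point at distance `y` on leg `b`. -/
def InBall (b : ℕ) (y : ℝ) (C : Finset ℕ) : Prop :=
  ∀ u ∈ C, U.pos u ≤ if U.leg u = b then T.rad + y else T.rad - y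

/-- Balls carry no lower bound on the leg of their center: for both thresholds used later the
admissible centers satisfy `y ≤ rad`, so the ball reaches the center of the spider. Clusters of one
leg that are served from farther out are covered by `line`. -/
def ClusterOk (C : Finset ℕ) : Prop := (∃ b y, T.cent b y ∧ InBall U T b y C) ∨
  ∃ i j, T.line i j ∧ U.leg i = U.leg j ∧ ∀ u ∈ C, U.leg u = U.leg i ∧ i ≤ u ∧ u ≤ j

/-- `S` can be partitioned into admitted clusters with at least `r` members. -/
def Feas (S : Finset ℕ) : Prop :=
  ∃ c : ℕ → ℕ, ∀ i, (S.filter (c · = i)).Nonempty →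
    U.r ≤ (S.filter (c · = i)).card ∧ ClusterOk U T (S.filter (c · = i))

variable {U T}

theorem InBall.mono {b : ℕ} {y : ℝ} {C C' : Finset ℕ} (h : InBall U T b y C) (hC : C' ⊆ C) :
    InBall U T b y C' := fun u hu => h u (hC hu)

theorem ClusterOk.mono {C C' : Finset ℕ} (h : ClusterOk U T C) (hC : C' ⊆ C) :
    ClusterOk U T C' := by
  rcases h with ⟨b, y, hc, hb⟩ | ⟨i, j, h1, h2, h3⟩
  · exact Or.inl ⟨b, y, hc, hb.mono hC⟩
  · exact Or.inr ⟨i, j, h1, h2, fun u hu => h3 u (hC hu)⟩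

/-- Inside one leg both kinds of admission depend only on the extreme members of the cluster, so
everything between them may be exchanged freely. -/
theorem ClusterOk.convex {l : ℕ} {C C' : Finset ℕ} (h : ClusterOk U T C)
    (hC : ∀ u ∈ C, U.leg u = l) (hC' : ∀ u ∈ C', U.leg u = l)
    (hlo : ∀ u ∈ C', ∃ v ∈ C, v ≤ u) (hhi : ∀ u ∈ C', ∃ v ∈ C, u ≤ v) : ClusterOk U T C' := by
  rcases h with ⟨b, y, hc, hb⟩ | ⟨i, j, h1, h2, h3⟩
  · refine Or.inl ⟨b, y, hc, fun u hu => ?_⟩; obtain ⟨v, hv, huv⟩ := hhi u hu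
    rw [hC' u hu, ← hC v hv]; exact (U.mono huv).trans (hb v hv)
  · refine Or.inr ⟨i, j, h1, h2, fun u hu => ?_⟩; grind

theorem Feas.empty : Feas U T ∅ := ⟨id, fun i h => by simp at h⟩

theorem Feas.single {C : Finset ℕ} (h : U.r ≤ C.card) (h' : ClusterOk U T C) : Feas U T C :=
  ⟨fun _ => 0, fun i hi => by
    obtain ⟨u, hu⟩ := hi; obtain rfl := (Finset.mem_filter.1 hu).2
    simpa using ⟨h, h'⟩⟩

theorem Feas.union {S S' : Finset ℕ} (h : Feas U T S) (h' : Feas U T S') (hd : Disjoint S S') :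
    Feas U T (S ∪ S') := by
  classical
  obtain ⟨c, hc⟩ := h; obtain ⟨c', hc'⟩ := h'
  let f : ℕ → ℕ := fun u => if u ∈ S then 2 * c u else 2 * c' u + 1
  have even : ∀ i, (S ∪ S').filter (f · = 2 * i) = S.filter (c · = i) := fun i => by grind
  have odd : ∀ i, (S ∪ S').filter (f · = 2 * i + 1) = S'.filter (c' · = i) := fun i => by
    ext u; simp only [Finset.mem_filter, Finset.mem_union, f]; by_cases hu : u ∈ S
    · have := Finset.disjoint_left.1 hd hu; grind
    · simp [hu]
  refine ⟨f, fun i hi => ?_⟩; obtain ⟨k, rfl | rfl⟩ := Nat.even_or_odd' i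
  all_goals simp_all

theorem Feas.split {S C : Finset ℕ} (hCS : C ⊆ S) (hC : Feas U T C) (h : Feas U T (S \ C)) :
    Feas U T S := by
  have := hC.union h Finset.disjoint_sdiff; rwa [Finset.union_sdiff_of_subset hCS] at this

theorem Feas.cluster_union {S : Finset ℕ} {c : ℕ → ℕ} (p : ℕ → Prop) [DecidablePred p]
    (h : ∀ i, p i → (S.filter (c · = i)).Nonempty →
      U.r ≤ (S.filter (c · = i)).card ∧ ClusterOk U T (S.filter (c · = i))) :
    Feas U T (S.filter (fun u => p (c u))) := by
  refine ⟨c, fun i hi => ?_⟩; obtain ⟨u, hu⟩ := hi; simp at hu; have hp : p i := hu.2 ▸ hu.1.2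
  have e : (S.filter (fun u => p (c u))).filter (c · = i) = S.filter (c · = i) := by grind
  rw [e]; exact h i hp ⟨u, Finset.mem_filter.2 ⟨hu.1.1, hu.2⟩⟩

/-- On one leg, some initial segment can be taken as a cluster. -/
theorem Feas.exists_initial_cluster {S : Finset ℕ} {l : ℕ} (h : Feas U T S)
    (hl : ∀ u ∈ S, U.leg u = l) (hne : S.Nonempty) :
    ∃ C ⊆ S, U.r ≤ C.card ∧ (∀ u ∈ C, ∀ v ∈ S, v ∉ C → u < v) ∧ ClusterOk U T C ∧
      Feas U T (S \ C) := by
  classical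
  obtain ⟨c, hc⟩ := h; set x := S.min' hne with hx
  have hxS : x ∈ S := Finset.min'_mem _ _; set M := S.filter (c · = c x) with hM
  have hMS : M ⊆ S := by grind
  have hxM : x ∈ M := by simp [hM, hxS]
  obtain ⟨hrM, hokM⟩ := hc (c x) ⟨x, hxM⟩
  -- The cluster `M` of the first user is replaced by equally many users from the beginning of the
  -- leg; the displaced users are exchanged into the other clusters.
  obtain ⟨C, hCS, hCcard, hClt⟩ := exists_initial S M.card (Finset.card_le_card hMS)
  -- every member of `C` is at most the largest member of `M`
  have hCle : ∀ u ∈ C, ∃ v ∈ M, u ≤ v := by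
    intro u hu; by_contra hcon
    push Not at hcon
    have hsub : M ⊆ C.erase u := by grind
    have := Finset.card_le_card hsub; grind
  have hokC : ClusterOk U T C := hokM.convex (fun u hu => hl u (hMS hu)) (fun u hu => hl u (hCS hu))
    (fun u hu => ⟨x, hxM, Finset.min'_le _ _ (hCS hu)⟩) hCle
  obtain ⟨c', hc'0, hc'⟩ := exists_exchange S c (c x) C hCS hCcard
  refine ⟨C, hCS, hCcard ▸ hrM, hClt, hokC, ?_⟩
  have := Feas.cluster_union (U := U) (T := T) (S := S) (c := c') (fun i => i ≠ c x) (by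
    intro i hi hne'; obtain ⟨h1, h2, h3⟩ := hc' i hi; set E := S.filter (c · = i) with hE
    set E' := S.filter (c' · = i) with hE'
    have hEne : E.Nonempty := by rw [← Finset.card_pos, ← h1]; exact Finset.card_pos.2 hne'
    obtain ⟨hrE, hokE⟩ := hc i hEne; refine ⟨h1 ▸ hrE, ?_⟩; have hES : E ⊆ S := by grind
    have hE'S : E' ⊆ S := by grind
    -- `E'` gains only users of `M`. If none of its members lies beyond `E`, it stays in the hull of
    -- `E`, since every gain is compensated by a loss to `C`, which lies below. Otherwise its
    -- largest member comes from `M`, and `E'` lies in the hull of `M`.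
    by_cases hbig : ∀ u ∈ E', ∃ v ∈ E, u ≤ v
    · refine hokE.convex (fun u hu => hl u (hES hu)) (fun u hu => hl u (hE'S hu)) ?_ hbig
      intro u hu; by_cases huE : u ∈ E
      · grind
      · -- `u` was gained, so something in `C` was lost
        have : ∃ v ∈ E, v ∉ E' := by
          by_contra hcon; have hss : E ⊂ E' := by grind
          have := Finset.card_lt_card hss; omega
        obtain ⟨v, hvE, hvE'⟩ := this; grind
    · push Not at hbig
      obtain ⟨w, hw, hwE⟩ := hbig
      refine hokM.convex (fun u hu => hl u (hMS hu)) (fun u hu => hl u (hE'S hu))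
        (fun u hu => ⟨x, hxM, Finset.min'_le _ _ (hE'S hu)⟩) ?_
      intro u hu; rcases Finset.mem_union.1 (h3 hu) with h | h
      · grind
      · exact ⟨u, (Finset.mem_sdiff.1 h).1, le_rfl⟩)
  convert this using 1; grind

end

/-! ### Minimal configurations of central clusters -/

section
variable {U : Users} {T : Threshold}

/-- The users `V ⊆ X` are partitioned by `c` into clusters labelled by `L` that lie in balls around
admissible centers, and on each leg the other users of `X` can be clustered separately. -/
structure Config (U : Users) (T : Threshold) (X L V : Finset ℕ) (c : ℕ → ℕ) (bl : ℕ → ℕ)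
    (by' : ℕ → ℝ) : Prop where
  sub : V ⊆ X
  label : ∀ u ∈ V, c u ∈ L
  size : ∀ i ∈ L, U.r ≤ (V.filter (c · = i)).card
  cent : ∀ i ∈ L, T.cent (bl i) (by' i)
  ball : ∀ i ∈ L, InBall U T (bl i) (by' i) (V.filter (c · = i))
  rest : ∀ l, Feas U T ((X.filter (U.leg · = l)) \ V)

/-- Call central those clusters that fit into an admissible ball. All the others lie on one leg, so
they remain whole when the remaining users are sorted by legs. -/
theorem Config.exists_of_feas {X : Finset ℕ} (h : Feas U T X) :
    ∃ L V c bl by', Config U T X L V c bl by' := by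
  classical
  obtain ⟨c, hc⟩ := h
  let p : ℕ → Prop := fun i => ∃ b y, T.cent b y ∧ InBall U T b y (X.filter (c · = i))
  have hp : ∀ i, ∃ b y, p i → T.cent b y ∧ InBall U T b y (X.filter (c · = i)) := fun i => by
    by_cases h : p i
    · obtain ⟨b, y, h'⟩ := h; exact ⟨b, y, fun _ => h'⟩
    · exact ⟨0, 0, fun h' => (h h').elim⟩
  choose bl by' hb using hp
  have hfib : ∀ u ∈ X.filter (fun u => p (c u)),
      (X.filter (fun u => p (c u))).filter (c · = c u) = X.filter (c · = c u) := by
    intro u hu; ext v; simp_all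
  refine ⟨(X.filter (fun u => p (c u))).image c, X.filter (fun u => p (c u)), c, bl, by',
    Finset.filter_subset _ _, fun u hu => Finset.mem_image_of_mem _ hu, ?_, ?_, ?_, ?_⟩
  · intro i hi; obtain ⟨u, hu, rfl⟩ := Finset.mem_image.1 hi; rw [hfib u hu]
    exact (hc (c u) ⟨u, Finset.mem_filter.2 ⟨(Finset.mem_filter.1 hu).1, rfl⟩⟩).1
  · intro i hi; obtain ⟨u, hu, rfl⟩ := Finset.mem_image.1 hi; grind
  · intro i hi; obtain ⟨u, hu, rfl⟩ := Finset.mem_image.1 hi; grind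
  · intro l; refine ⟨c, fun i hi => ?_⟩; obtain ⟨u, hu⟩ := hi; simp at hu
    obtain ⟨⟨⟨huX, hul⟩, hup⟩, rfl⟩ := hu; have hnp := hup huX
    obtain ⟨h1, h2⟩ := hc (c u) ⟨u, Finset.mem_filter.2 ⟨huX, rfl⟩⟩
    rcases h2 with h2 | ⟨i, j, h3, h4, h5⟩
    · grind
    · have e : ((X.filter (U.leg · = l)) \ X.filter (fun u => p (c u))).filter (c · = c u)
          = X.filter (c · = c u) := by
        ext v; simp_all
      rw [e]; exact ⟨h1, Or.inr ⟨i, j, h3, h4, h5⟩⟩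

/-- A lexicographic minimum of two potentials: `Config.drop` and `Config.merge` would lower the
number of central clusters, and the swap in `Config.prefix` would lower the sum of their users. -/
theorem Config.exists_minimal {X : Finset ℕ} (h : Feas U T X) :
    ∃ L V c bl by', Config U T X L V c bl by' ∧ ∀ L' V' c' bl' by'', Config U T X L' V' c' bl' by'' →
      L.card ≤ L'.card ∧ (L'.card = L.card → ∑ u ∈ V, u ≤ ∑ u ∈ V', u) := by
  classical
  have h1 : ∃ a, ∃ L V c bl by', Config U T X L V c bl by' ∧ L.card = a := by
    obtain ⟨L, V, c, bl, by', h⟩ := Config.exists_of_feas h; grind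
  have h2 : ∃ s, ∃ L V c bl by', Config U T X L V c bl by' ∧ L.card = Nat.find h1 ∧
      ∑ u ∈ V, u = s := by
    grind
  obtain ⟨L, V, c, bl, by', hC, h3, h4⟩ := Nat.find_spec h2
  refine ⟨L, V, c, bl, by', hC, fun L' V' c' bl' by'' hC' => ⟨?_, fun he => ?_⟩⟩
  · rw [h3]; exact Nat.find_min' h1 ⟨L', V', c', bl', by'', hC', rfl⟩
  · rw [h4]; exact Nat.find_min' h2 ⟨L', V', c', bl', by'', hC', he.trans h3, rfl⟩

/-- In a minimal configuration the users in central clusters come first on each leg. -/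
theorem Config.prefix {X L V : Finset ℕ} {c bl : ℕ → ℕ} {by' : ℕ → ℝ}
    (hC : Config U T X L V c bl by')
    (hmin : ∀ V' c' bl' by'', Config U T X L V' c' bl' by'' → ∑ u ∈ V, u ≤ ∑ u ∈ V', u)
    {y s : ℕ} (hy : y ∈ V) (hs : s ∈ X) (hsV : s ∉ V) (hl : U.leg s = U.leg y) : y < s := by
  classical
  by_contra hlt; have hne : s ≠ y := by grind
  have hsy : s < y := by omega
  -- Swap `y` with the nearer user `s`: the central cluster of `y` takes `s`, and the leg cluster of
  -- `s` takes `y`. The labels are kept and the sum decreases.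
  set V' := insert s (V.erase y) with hV'; have hyX := hC.sub hy
  have memV' : ∀ u, u ∈ V' ↔ u = s ∨ (u ≠ y ∧ u ∈ V) := by grind
  have hsum : ∑ u ∈ V', u + y = ∑ u ∈ V, u + s := by
    rw [hV', Finset.sum_insert (by simp [hsV]), ← Finset.sum_erase_add V _ hy]; ring
  have hfib : ∀ i, i ≠ c y → V'.filter (Function.update c s (c y) · = i) = V.filter (c · = i) := by
    grind
  have hfib' : V'.filter (Function.update c s (c y) · = c y)
      = insert s ((V.filter (c · = c y)).erase y) := by
    grind
  have hcfg : Config U T X L V' (Function.update c s (c y)) bl by' := by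
    refine ⟨?_, ?_, ?_, hC.cent, ?_, ?_⟩
    · intro u hu; rcases (memV' u).1 hu with rfl | h
      · exact hs
      · exact hC.sub h.2
    · intro u hu; by_cases h : u = s
      · subst h; simpa using hC.label y hy
      · rw [Function.update_of_ne h]; rcases (memV' u).1 hu with h' | h'
        · omega
        · exact hC.label u h'.2
    · intro i hi; by_cases h : i = c y
      · rw [h, hfib', Finset.card_insert_of_notMem (by simp [hsV]), Finset.card_erase_of_mem (by simp [hy])]
        have := hC.size i hi; rw [h] at *; omega
      · rw [hfib i h]; exact hC.size i hi
    · intro i hi; by_cases h : i = c y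
      · rw [h, hfib']; intro u hu; have hb := hC.ball (c y) (hC.label y hy)
        rcases Finset.mem_insert.1 hu with rfl | hu
        · rw [hl]; exact (U.mono hsy.le).trans (hb y (by simp [hy]))
        · exact hb u (Finset.mem_of_mem_erase hu)
      · rw [hfib i h]; exact hC.ball i hi
    · intro l; by_cases hll : l = U.leg y
      · subst hll; obtain ⟨e, he⟩ := hC.rest (U.leg y)
        set R := (X.filter (U.leg · = U.leg y)) \ V with hR
        have hsR : s ∈ R := by simp [hR, hs, hl, hsV]
        have hyR : y ∉ R := by simp [hR, hy]
        have hR' : (X.filter (U.leg · = U.leg y)) \ V' = insert y (R.erase s) := by grind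
        rw [hR']; refine ⟨Function.update e y (e s), fun i hi => ?_⟩; by_cases h : i = e s
        · subst h
          have hf : (insert y (R.erase s)).filter (Function.update e y (e s) · = e s)
              = insert y ((R.filter (e · = e s)).erase s) := by
            grind
          rw [hf]; obtain ⟨h1, h2⟩ := he (e s) ⟨s, by simp [hsR]⟩; constructor
          · rw [Finset.card_insert_of_notMem (by simp [hyR]),
              Finset.card_erase_of_mem (by simp [hsR])]
            omega
          · have hlR : ∀ u ∈ R, U.leg u = U.leg y := fun u hu => by grind
            -- If the cluster that receives `y` has a member beyond `y`, its hull is not enlarged.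
            -- Otherwise `y` is its outermost member, and the whole cluster fits into the ball that
            -- contained `y` before.
            by_cases hbig : ∃ v ∈ R.filter (e · = e s), y ≤ v
            · refine h2.convex (l := U.leg y) (fun u hu => hlR u (Finset.mem_filter.1 hu).1) ?_ ?_ ?_
              · intro u hu; rcases Finset.mem_insert.1 hu with rfl | hu
                · rfl
                · grind
              · intro u hu; rcases Finset.mem_insert.1 hu with rfl | hu
                · exact ⟨s, by simp [hsR], hsy.le⟩
                · grind
              all_goals grind
            · push Not at hbig
              refine Or.inl ⟨bl (c y), by' (c y), hC.cent _ (hC.label y hy), fun u hu => ?_⟩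
              have hb := hC.ball (c y) (hC.label y hy) y (by simp [hy])
              rcases Finset.mem_insert.1 hu with rfl | hu
              · exact hb
              · have hu' := Finset.mem_of_mem_erase hu; rw [hlR u (Finset.mem_filter.1 hu').1]
                exact (U.mono (hbig u hu').le).trans hb
        · have hf : (insert y (R.erase s)).filter (Function.update e y (e s) · = i)
              = R.filter (e · = i) := by
            grind
          rw [hf] at hi ⊢; exact he i hi
      · have : (X.filter (U.leg · = l)) \ V' = (X.filter (U.leg · = l)) \ V := by grind
        rw [this]; exact hC.rest l
  have := hmin _ _ _ _ hcfg; omega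

/-- The users up to `w` on leg `a` fit together with all users up to `z` on the other legs. -/
def MultiOk (U : Users) (T : Threshold) (a w z : ℕ) : Prop :=
  ∃ b y, T.cent b y ∧ ((b = a ∧ U.pos w ≤ T.rad + y ∧ U.pos z ≤ T.rad - y) ∨
    (U.pos w ≤ T.rad - y ∧ U.pos z ≤ T.rad - y))

theorem MultiOk.clusterOk {a w z : ℕ} (h : MultiOk U T a w z) {C : Finset ℕ}
    (hC : ∀ u ∈ C, (U.leg u = a ∧ u ≤ w) ∨ (U.leg u ≠ a ∧ u ≤ z)) : ClusterOk U T C := by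
  obtain ⟨b, y, hc, h⟩ := h; have hy := T.cent_nonneg hc; refine Or.inl ⟨b, y, hc, fun u hu => ?_⟩
  rcases hC u hu with ⟨h1, h2⟩ | ⟨h1, h2⟩ <;> have h3 := U.mono h2
  all_goals grind

end

/-! ### Choosing the first central cluster -/

section
variable {U : Users} {T : Threshold}

/-- A cluster inside one leg can be moved to the part that is clustered leg by leg. -/
theorem Config.drop {X L V : Finset ℕ} {c bl : ℕ → ℕ} {by' : ℕ → ℝ}
    (hC : Config U T X L V c bl by') {i₀ b : ℕ} (hi₀ : i₀ ∈ L)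
    (hb : ∀ u ∈ V.filter (c · = i₀), U.leg u = b) :
    Config U T X (L.erase i₀) (V.filter (c · ≠ i₀)) c bl by' := by
  classical
  have hf : ∀ i, i ≠ i₀ → (V.filter (c · ≠ i₀)).filter (c · = i) = V.filter (c · = i) := by grind
  refine ⟨(Finset.filter_subset _ _).trans hC.sub, ?_, ?_, fun i hi => hC.cent i (Finset.mem_of_mem_erase hi), ?_, ?_⟩
  · intro u hu; rw [Finset.mem_filter] at hu; exact Finset.mem_erase.2 ⟨hu.2, hC.label u hu.1⟩
  · intro i hi; rw [hf i (Finset.ne_of_mem_erase hi)]; exact hC.size i (Finset.mem_of_mem_erase hi)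
  · intro i hi; rw [hf i (Finset.ne_of_mem_erase hi)]; exact hC.ball i (Finset.mem_of_mem_erase hi)
  · intro l; by_cases hl : l = b
    · subst hl
      have hsub : V.filter (c · = i₀) ⊆ (X.filter (U.leg · = l)) \ V.filter (c · ≠ i₀) := by
        intro u hu; have h1 := hb u hu; rw [Finset.mem_filter] at hu
        simp only [Finset.mem_sdiff, Finset.mem_filter]
        exact ⟨⟨hC.sub hu.1, h1⟩, fun h => h.2 hu.2⟩
      refine Feas.split hsub (Feas.single (hC.size i₀ hi₀)
        (Or.inl ⟨_, _, hC.cent i₀ hi₀, hC.ball i₀ hi₀⟩)) ?_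
      convert hC.rest l using 1; grind
    · convert hC.rest l using 1; grind

/-- A cluster that fits into the ball of another central cluster can join it, because sizes are only
bounded from below. A minimal configuration therefore has no such pair. -/
theorem Config.merge {X L V : Finset ℕ} {c bl : ℕ → ℕ} {by' : ℕ → ℝ}
    (hC : Config U T X L V c bl by') {i₀ i₁ : ℕ} (hi₁ : i₁ ∈ L) (hne : i₁ ≠ i₀)
    (hb : InBall U T (bl i₁) (by' i₁) (V.filter (c · = i₀))) :
    Config U T X (L.erase i₀) V (fun u => if c u = i₀ then i₁ else c u) bl by' := by
  classical
  refine ⟨hC.sub, ?_, ?_, fun i hi => hC.cent i (Finset.mem_of_mem_erase hi), ?_, hC.rest⟩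
  · intro u hu
    split_ifs with h
    · grind
    · exact Finset.mem_erase.2 ⟨h, hC.label u hu⟩
  · intro i hi; refine (hC.size i (Finset.mem_of_mem_erase hi)).trans (Finset.card_le_card ?_)
    grind
  · intro i hi u hu; rw [Finset.mem_filter] at hu; by_cases h : c u = i₀
    · simp only [h, if_true] at hu; rw [← hu.2]; exact hb u (Finset.mem_filter.2 ⟨hu.1, h⟩)
    · simp only [h, if_false] at hu
      exact hC.ball i (Finset.mem_of_mem_erase hi) u (Finset.mem_filter.2 hu)

/-- There is no control over which central cluster receives an expelled user; hence the assumption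
that the expelled users fit into every ball. -/
theorem Config.exchange {X L V : Finset ℕ} {c bl : ℕ → ℕ} {by' : ℕ → ℝ}
    (hC : Config U T X L V c bl by') {i₀ : ℕ} {M' : Finset ℕ} (hi₀ : i₀ ∈ L) (hM' : M' ⊆ V)
    (hcard : M'.card = (V.filter (c · = i₀)).card)
    (hb : InBall U T (bl i₀) (by' i₀) M')
    (hb' : ∀ i ∈ L, InBall U T (bl i) (by' i) (V.filter (c · = i₀) \ M')) :
    ∃ c', Config U T X L V c' bl by' ∧ V.filter (c' · = i₀) = M' := by
  classical
  obtain ⟨c', h0, h1⟩ := exists_exchange V c i₀ M' hM' hcard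
  refine ⟨c', ⟨hC.sub, ?_, ?_, hC.cent, ?_, hC.rest⟩, h0⟩
  · intro u hu; by_cases h : c' u = i₀
    · rw [h]; exact hi₀
    · obtain ⟨h2, -, -⟩ := h1 (c' u) h
      have : 0 < (V.filter (c' · = c' u)).card := Finset.card_pos.2 ⟨u, by simp [hu]⟩
      rw [h2] at this; obtain ⟨v, hv⟩ := Finset.card_pos.1 this; rw [Finset.mem_filter] at hv
      rw [← hv.2]; exact hC.label v hv.1
  · intro i hi; by_cases h : i = i₀
    · rw [h, h0, hcard]; exact hC.size i₀ hi₀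
    · rw [(h1 i h).1]; exact hC.size i hi
  · intro i hi; by_cases h : i = i₀
    · rw [h, h0]; exact hb
    · intro u hu; rcases Finset.mem_union.1 ((h1 i h).2.2 hu) with h' | h'
      · exact hC.ball i hi u h'
      · exact hb' i hi u h'

theorem Config.feas_others {X L V : Finset ℕ} {c bl : ℕ → ℕ} {by' : ℕ → ℝ}
    (hC : Config U T X L V c bl by') (i₀ : ℕ) : Feas U T (V \ V.filter (c · = i₀)) := by
  have := Feas.cluster_union (U := U) (T := T) (S := V) (c := c) (fun i => i ≠ i₀) (by
    intro i _ hne; obtain ⟨u, hu⟩ := hne; rw [Finset.mem_filter] at hu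
    have hi : i ∈ L := hu.2 ▸ hC.label u hu.1
    exact ⟨hC.size i hi, Or.inl ⟨_, _, hC.cent i hi, hC.ball i hi⟩⟩)
  convert this using 1; grind

/-- Either every leg can be clustered by itself, or one cluster can be assumed to consist of all the
users `A` of one leg that are in a certain set `V` and of the first users `Q` of the others in `V`. -/
theorem Feas.exists_first_cluster {X : Finset ℕ} (h : Feas U T X) :
    (∀ l, Feas U T (X.filter (U.leg · = l))) ∨
    ∃ (V Q : Finset ℕ) (a : ℕ), V ⊆ X ∧ (∀ y ∈ V, ∀ s ∈ X, s ∉ V → U.leg s = U.leg y → y < s) ∧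
      (∀ l, Feas U T ((X.filter (U.leg · = l)) \ V)) ∧
      (V.filter (U.leg · = a)).Nonempty ∧ Q.Nonempty ∧ Q ⊆ V ∧ (∀ q ∈ Q, U.leg q ≠ a) ∧
      (∀ q ∈ Q, ∀ u ∈ V, U.leg u ≠ a → u ∉ Q → q < u) ∧
      U.r ≤ (V.filter (U.leg · = a)).card + Q.card ∧
      (∀ w ∈ V.filter (U.leg · = a), ∀ z ∈ Q, MultiOk U T a w z) ∧
      Feas U T (V \ (V.filter (U.leg · = a) ∪ Q)) := by
  classical
  obtain ⟨L, V, c, bl, by', hC, hmin⟩ := Config.exists_minimal h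
  have hpre : ∀ y ∈ V, ∀ s ∈ X, s ∉ V → U.leg s = U.leg y → y < s := fun y hy s hs hsV hl =>
    hC.prefix (fun V' c' bl' by'' h' => (hmin _ _ _ _ _ h').2 rfl) hy hs hsV hl
  have hcontra : ∀ i₀ ∈ L, ∀ V' c' bl' by'', ¬ Config U T X (L.erase i₀) V' c' bl' by'' := by grind
  rcases L.eq_empty_or_nonempty with hL | hL
  · left; intro l
    have hV : V = ∅ := by
      rw [Finset.eq_empty_iff_forall_notMem]; intro u hu; have := hC.label u hu; simp [hL] at this
    have := hC.rest l; rwa [hV, Finset.sdiff_empty] at this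
  -- The ball whose center is farthest out is the most restrictive one on foreign legs, so what it
  -- admits there fits into every ball; and on its own leg it admits every central user.
  right; obtain ⟨i₀, hi₀, hmax⟩ := L.exists_max_image by' hL; set b := bl i₀ with hb
  set y := by' i₀ with hy; have hcen := hC.cent i₀ hi₀; have hy0 : 0 ≤ y := T.cent_nonneg hcen
  set M := V.filter (c · = i₀) with hM
  have hMpos : 0 < M.card := lt_of_lt_of_le U.hr (hC.size i₀ hi₀)
  set A := V.filter (U.leg · = b) with hA
  -- a user at distance at most `rad - y` fits into every cluster
  have huniv : ∀ u, U.pos u ≤ T.rad - y → ∀ i ∈ L, U.pos u ≤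
      if U.leg u = bl i then T.rad + by' i else T.rad - by' i := by
    intro u hu i hi; have h1 := hmax i hi; have h2 := T.cent_nonneg (hC.cent i hi)
    split_ifs <;> linarith
  have hMoff : ∀ u ∈ M, U.leg u ≠ b → U.pos u ≤ T.rad - y := by
    intro u hu hub; have := hC.ball i₀ hi₀ u hu; rwa [if_neg hub] at this
  have hAle : ∀ u ∈ A, U.pos u ≤ T.rad + y := by
    intro u hu; rw [hA, Finset.mem_filter] at hu; have hi := hC.label u hu.1
    have h1 := hC.ball _ hi u (by simp [hu.1]); have h2 := hmax _ hi
    have h3 := T.cent_nonneg (hC.cent _ hi)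
    split_ifs at h1 <;> linarith
  rcases A.eq_empty_or_nonempty with hAe | hAne
  -- Without central users on leg `b`, the chosen cluster fits into every ball and is therefore the
  -- only central one. Any leg that it meets can then play the part of its own leg.
  · have hMle : ∀ u ∈ M, U.pos u ≤ T.rad - y := fun u hu => hMoff u hu fun h' => by grind
    have hone : ∀ i ∈ L, i = i₀ := by
      intro i hi; by_contra hne
      exact hcontra i₀ hi₀ _ _ _ _ (hC.merge hi hne fun u hu => huniv u (hMle u hu) i hi)
    have hMV' : V = M := by
      ext u; simp only [hM, Finset.mem_filter, iff_self_and]; exact fun hu => hone _ (hC.label u hu)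
    have hne : V.Nonempty := by rw [hMV']; exact Finset.card_pos.1 hMpos
    obtain ⟨v, hv⟩ := hne
    have hcov : V.filter (U.leg · = U.leg v) ∪ V.filter (U.leg · ≠ U.leg v) = V := by grind
    refine ⟨V, V.filter (U.leg · ≠ U.leg v), U.leg v, hC.sub, hpre, hC.rest, ⟨v, by simp [hv]⟩, ?_,
      Finset.filter_subset _ _, fun q hq => (Finset.mem_filter.1 hq).2, ?_, ?_, ?_, ?_⟩
    · by_contra hQ; refine hcontra i₀ hi₀ _ _ _ _ (hC.drop hi₀ (b := U.leg v) fun u hu => ?_)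
      by_contra hu'; grind
    · intro q _ u hu hul huQ; grind
    · rw [← Finset.card_union_of_disjoint (Finset.disjoint_filter_filter_not _ _ _), hcov, hMV']
      exact hC.size i₀ hi₀
    · intro w hw z hz; refine ⟨b, y, hcen, Or.inr ⟨hMle w ?_, hMle z ?_⟩⟩
      · rw [← hMV']; exact (Finset.mem_filter.1 hw).1
      · rw [← hMV']; exact (Finset.mem_filter.1 hz).1
    · rw [hcov, Finset.sdiff_self]; exact Feas.empty
  · have hAV : A ⊆ V := by grind
    have hMA : ∀ u ∈ M \ A, U.pos u ≤ T.rad - y := fun u hu => by grind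
    by_cases hcase : M.card ≤ A.card
    -- If leg `b` has enough central users, the cluster can be moved onto this leg entirely and then
    -- dropped, against minimality.
    · exfalso
      obtain ⟨M', h1, h2, h3⟩ := Finset.exists_subsuperset_card_eq
        (s := M ∩ A) (t := A) (n := M.card) Finset.inter_subset_right
        (Finset.card_le_card Finset.inter_subset_left) hcase
      obtain ⟨c', hC', hf⟩ := hC.exchange hi₀ (h2.trans hAV) h3
        (fun u hu => by rw [if_pos (Finset.mem_filter.1 (h2 hu)).2]; exact hAle u (h2 hu))
        (fun i hi u hu => huniv u (hMA u (by
          rw [Finset.mem_sdiff] at hu ⊢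
          exact ⟨hu.1, fun h' => hu.2 (h1 (Finset.mem_inter.2 ⟨hu.1, h'⟩))⟩)) i hi)
      refine hcontra i₀ hi₀ _ _ _ _ (hC'.drop hi₀ (b := b) fun u hu => ?_); grind
    -- Otherwise the cluster takes all of `A` and fills up with the first central users of the other
    -- legs. None of them is farther out than the outermost foreign member before the exchange, so
    -- they still fit.
    · have hle : M.card - A.card ≤ (V \ A).card := by grind
      obtain ⟨Q, hQ, hQc, hQlt⟩ := exists_initial (V \ A) _ hle; have hQV : Q ⊆ V := by grind
      have hQA : Disjoint A Q := Finset.disjoint_left.2 fun u hu hu' =>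
        (Finset.mem_sdiff.1 (hQ hu')).2 hu
      have hnotA : ∀ u ∈ V, (u ∉ A ↔ U.leg u ≠ b) := by grind
      have hQle : ∀ q ∈ Q, ∃ u ∈ M \ A, q ≤ u := by
        intro q hq; by_contra hcon
        push Not at hcon
        have hsub : M \ A ⊆ Q.erase q := by grind
        have := Finset.card_le_card hsub; grind
      have hQpos : ∀ q ∈ Q, U.pos q ≤ T.rad - y := fun q hq => by
        obtain ⟨u, hu, hqu⟩ := hQle q hq; exact (U.mono hqu).trans (hMA u hu)
      have hcard : (A ∪ Q).card = M.card := by rw [Finset.card_union_of_disjoint hQA]; omega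
      obtain ⟨c', hC', hf⟩ := hC.exchange hi₀ (Finset.union_subset hAV hQV) hcard
        (fun u hu => by
          by_cases huA : u ∈ A
          · rw [if_pos (Finset.mem_filter.1 huA).2]; exact hAle u huA
          · have huQ : u ∈ Q := by grind
            rw [if_neg ((hnotA u (hQV huQ)).1 huA)]
            exact hQpos u huQ)
        (fun i hi u hu => huniv u (hMA u (by
          simp only [Finset.mem_sdiff, Finset.mem_union, not_or] at hu ⊢
          exact ⟨hu.1, hu.2.1⟩)) i hi)
      refine ⟨V, Q, b, hC.sub, hpre, hC.rest, hAne, ?_, hQV, ?_, ?_, ?_, ?_, ?_⟩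
      · rw [← Finset.card_pos]; omega
      · grind
      · exact fun q hq u hu hul huQ => hQlt q hq u (Finset.mem_sdiff.2 ⟨hu, (hnotA u hu).2 hul⟩) huQ
      · rw [← hA, ← Finset.card_union_of_disjoint hQA, hcard]; exact hC.size i₀ hi₀
      · exact fun w hw z hz => ⟨b, y, hcen, Or.inl ⟨rfl, hAle w hw, hQpos z hz⟩⟩
      · have := hC'.feas_others i₀; rwa [hf] at this

/-- What the dynamic program has to guess about one cluster with users on several legs. -/
structure FirstCluster (U : Users) (T : Threshold) (X A Q : Finset ℕ) (a w z : ℕ)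
    (Z : Finset ℕ) : Prop where
  subA : A ⊆ X
  legA : ∀ u ∈ A, U.leg u = a
  memA : w ∈ A
  leA : ∀ u ∈ A, u ≤ w
  initialA : ∀ u ∈ X, U.leg u = a → u ≤ w → u ∈ A
  cardA : A.card ≤ 2 * U.r
  subQ : Q ⊆ X
  legQ : ∀ u ∈ Q, U.leg u ≠ a
  memQ : z ∈ Q
  leQ : ∀ u ∈ Q, u ≤ z
  cardQ : Q.card ≤ 2 * U.r
  size : U.r ≤ A.card + Q.card
  ok : MultiOk U T a w z
  restA : Feas U T ((X.filter (U.leg · = a)) \ A)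
  opened : ∀ u ∈ X, U.leg u ≠ a → U.leg u ∉ Z → u ≤ z → u ∈ Q
  closed : ∀ l ∈ Z, Feas U T ((X.filter (U.leg · = l)) \ Q)
  initialQ : ∀ u ∈ X, U.leg u ∈ Z → u ∉ Q → ∀ v ∈ Q, U.leg v = U.leg u → v < u
  -- Needed for all subsets: a leg of `Z` is closed only if the scan meets a user outside `Q` on it
  -- before `z`. The legs of `Z` not met in this way stay open.
  rest : ∀ Z' ⊆ Z, Feas U T ((X.filter (fun u => U.leg u ≠ a ∧ U.leg u ∉ Z')) \ Q)

/-- A cluster that is too large is split into its first `r` users and the others. -/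
theorem exists_short {S : Finset ℕ} (hne : S.Nonempty) (h : ∀ C ⊆ S, ClusterOk U T C) :
    ∃ A ⊆ S, A.card ≤ 2 * U.r ∧ (∀ t ∈ A, ∀ s ∈ S, s ∉ A → t < s) ∧ A.Nonempty ∧
      (A = S ∨ U.r ≤ A.card) ∧ Feas U T (S \ A) := by
  have hr := U.hr; by_cases hc : S.card ≤ 2 * U.r
  · exact ⟨S, subset_rfl, hc, by grind, hne, Or.inl rfl, by simpa using Feas.empty⟩
  · obtain ⟨A, h1, h2, h3⟩ := exists_initial S U.r (by omega)
    exact ⟨A, h1, by omega, h3, Finset.card_pos.1 (by omega), Or.inr h2.ge,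
      Feas.single (by grind) (h _ Finset.sdiff_subset)⟩

theorem Feas.exists_firstCluster {X : Finset ℕ} (h : Feas U T X) :
    (∀ l, Feas U T (X.filter (U.leg · = l))) ∨ ∃ A Q a w z Z, FirstCluster U T X A Q a w z Z := by
  classical
  rcases h.exists_first_cluster with h | ⟨V, Q₀, a, hVX, hpre, hrest, hAne, hQne, hQV, hQa, hQlt, hsz, hok, hf⟩
  · exact Or.inl h
  right; set A₀ := V.filter (U.leg · = a) with hA₀; have hA₀V : A₀ ⊆ V := by grind
  have hlegA₀ : ∀ u ∈ A₀, U.leg u = a := by grind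
  have hr := U.hr
  have hA₀Q : Disjoint A₀ Q₀ := Finset.disjoint_left.2 fun u hu hu' => hQa u hu' (hlegA₀ u hu)
  obtain ⟨A, hAA, hAcard, hAlt, hAne', hAsz, hAr⟩ := exists_short hAne fun C hC => by
    obtain ⟨q, hq⟩ := hQne
    exact (hok _ (A₀.max'_mem hAne) q hq).clusterOk fun u hu =>
      Or.inl ⟨hlegA₀ u (hC hu), A₀.le_max' u (hC hu)⟩
  obtain ⟨Q, hQQ, hQcard, hQlt', hQne', hQsz, hQr⟩ := exists_short hQne fun C hC => by
    obtain ⟨w, hw⟩ := hAne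
    exact (hok w hw _ (Q₀.max'_mem hQne)).clusterOk fun u hu =>
      Or.inr ⟨hQa u (hC hu), Q₀.le_max' u (hC hu)⟩
  have hfV : Feas U T (V \ (A₀ ∪ Q)) := by
    refine Feas.split (C := Q₀ \ Q) ?_ hQr ?_
    · intro u hu; simp at hu ⊢; grind
    · convert hf using 1; grind
  have hnotV : ∀ l, l ≠ a → (∀ u ∈ V, U.leg u = l → u ∈ Q) →
      (X.filter (U.leg · = l)) \ Q = (X.filter (U.leg · = l)) \ V := by
    grind
  -- The legs whose central users all belong to `Q`. What is left there can be clustered within the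
  -- leg, so these legs may be closed together with this cluster.
  let Z := (X.image U.leg).filter fun l => l ≠ a ∧ ∀ u ∈ V, U.leg u = l → u ∈ Q
  have memZ : ∀ l ∈ Z, l ≠ a ∧ ∀ u ∈ V, U.leg u = l → u ∈ Q := fun l hl =>
    (Finset.mem_filter.1 hl).2
  have hclosed : ∀ l ∈ Z, Feas U T ((X.filter (U.leg · = l)) \ Q) := fun l hl => by
    rw [hnotV l (memZ l hl).1 (memZ l hl).2]; exact hrest l
  have hlegs : ∀ W : Finset ℕ, Feas U T ((X \ V).filter (fun u => U.leg u ∈ W)) := by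
    intro W
    induction W using Finset.induction_on with
    | empty => simpa using Feas.empty
    | insert l W hl ih =>
      have := (hrest l).union ih (by
        refine Finset.disjoint_left.2 fun u hu hu' => hl ?_; simp at hu hu'
        rw [← hu.1.2]; exact hu'.2)
      convert this using 1; ext u; simp; tauto
  refine ⟨A, Q, a, A.max' hAne', Q.max' hQne', Z, ?_⟩
  refine ⟨hAA.trans (hA₀V.trans hVX), fun u hu => hlegA₀ u (hAA hu), A.max'_mem _,
    fun u hu => A.le_max' u hu, ?_, hAcard, hQQ.trans (hQV.trans hVX), fun u hu => hQa u (hQQ hu),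
    Q.max'_mem _, fun u hu => Q.le_max' u hu, hQcard, ?_,
    hok _ (hAA (A.max'_mem _)) _ (hQQ (Q.max'_mem _)), ?_, ?_, hclosed,
    ?_, ?_⟩
  · intro u hu hua huw; by_contra hn; have hw := A.max'_mem hAne'; grind
  · rcases hAsz with rfl | h1
    · rcases hQsz with rfl | h2 <;> omega
    · omega
  · refine Feas.split (C := A₀ \ A) ?_ hAr ?_
    · intro u hu; simp at hu ⊢; grind
    · convert hrest a using 1; grind
  · intro u hu hua huZ huz; by_contra hn; have hz := Q.max'_mem hQne'
    have : ¬ (U.leg u ≠ a ∧ ∀ v ∈ V, U.leg v = U.leg u → v ∈ Q) := fun h' =>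
      huZ (Finset.mem_filter.2 ⟨Finset.mem_image_of_mem _ hu, h'⟩)
    push Not at this
    grind
  · intro u hu huZ huQ v hv hvu; by_cases huV : u ∈ V
    · grind
    · grind
  -- The legs of `Z'` have no central users outside `Q`. So the rest consists of the other central
  -- users and of the non-central ones on the legs that are kept.
  · intro Z' hZ'; have h1 := hlegs ((X.image U.leg).filter fun l => l ≠ a ∧ l ∉ Z')
    have h2 := hfV.union h1 (Finset.disjoint_left.2 fun u hu hu' => by
      simp at hu hu'
      exact hu'.1.2 hu.1)
    convert h2 using 1; ext u; grind

end

/-! ### Numbering of the users, and the recursion of the dynamic program -/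

section
theorem exists_count_eq {p : ℕ → Prop} [DecidablePred p] {n i : ℕ} (h : i < Nat.count p n) :
    ∃ u, u < n ∧ p u ∧ Nat.count p u = i := by
  induction n with
  | zero => simp at h
  | succ n ih =>
    rw [Nat.count_succ] at h; by_cases hp : p n
    · rw [if_pos hp] at h; rcases Nat.lt_succ_iff_lt_or_eq.1 h with h | h
      · obtain ⟨u, hu, h'⟩ := ih h; exact ⟨u, by omega, h'⟩
      · grind
    · rw [if_neg hp] at h; obtain ⟨u, hu, h'⟩ := ih (by omega); exact ⟨u, by omega, h'⟩

/-- There is no carry at an unset bit, so addition inserts a leg into the bit mask of the closed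
legs. -/
theorem testBit_add_two_pow (m l j : ℕ) (h : m.testBit l = false) :
    (m + 2 ^ l).testBit j = (m.testBit j || decide (j = l)) := by
  induction l generalizing m j with
  | zero =>
    have h0 : m % 2 = 0 := by simpa [Nat.testBit_zero] using h
    cases j with
    | zero => simp [Nat.testBit_zero]; omega
    | succ j => rw [Nat.testBit_succ, Nat.testBit_succ, show (m + 2 ^ 0) / 2 = m / 2 by omega]; simp
  | succ l ih =>
    have e : (m + 2 ^ (l + 1)) / 2 = m / 2 + 2 ^ l := by rw [pow_succ]; omega
    cases j with
    | zero =>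
      rw [Nat.testBit_zero, Nat.testBit_zero, show (m + 2 ^ (l + 1)) % 2 = m % 2 by rw [pow_succ]; omega]
      simp
    | succ j => rw [Nat.testBit_succ, Nat.testBit_succ, e, ih _ _ (by grind)]; simp

theorem add_two_pow_lt {m l d : ℕ} (hm : m < 2 ^ d) (hl : l < d) (h : m.testBit l = false) :
    m + 2 ^ l < 2 ^ d := by
  refine Nat.lt_pow_two_of_testBit _ fun i hi => ?_
  rw [testBit_add_two_pow _ _ _ h, Nat.testBit_lt_two_pow (hm.trans_le (Nat.pow_le_pow_right (by norm_num) hi))]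
  grind

section Listing

variable (U : Users)

/-- The number of a user on its leg. -/
def Users.idx (u : ℕ) : ℕ := Nat.count (fun v => U.leg v = U.leg u) u

/-- The number of users on a leg. -/
def Users.cnt (l : ℕ) : ℕ := Nat.count (fun v => U.leg v = l) U.n

/-- The user with a given number on a leg. -/
noncomputable def Users.usr (l i : ℕ) : ℕ := Nat.nth (fun v => U.leg v = l) i

/-- The users numbered `i` or higher on leg `l`. -/
def Users.suf (l i : ℕ) : Finset ℕ := (Finset.range U.n).filter fun u => U.leg u = l ∧ i ≤ U.idx u

variable (K : ℕ)

/-- The `g`-th among the users with number below `K` on their leg. -/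
noncomputable def Users.tl (g : ℕ) : ℕ := Nat.nth (fun u => U.idx u < K) g

/-- `U.size K U.n` is the length of the list of the first `K` users of every leg, and `U.size K u`
is the position of a listed user `u` in it. -/
def Users.size (n : ℕ) : ℕ := Nat.count (fun u => U.idx u < K) n

/-- The number of users on leg `l` among the first `g` users with number below `K`. -/
noncomputable def Users.posn (g l : ℕ) : ℕ := Nat.count (fun h => U.leg (U.tl K h) = l) g

/-- The users not yet dealt with. -/
noncomputable def Users.left (g mask : ℕ) : Finset ℕ :=
  (Finset.range U.n).filter fun u => mask.testBit (U.leg u) = false ∧ U.posn K g (U.leg u) ≤ U.idx u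

variable {U K}

theorem Users.mem_suf {l i u : ℕ} : u ∈ U.suf l i ↔ u < U.n ∧ U.leg u = l ∧ i ≤ U.idx u := by
  simp [Users.suf]

theorem Users.mem_left {g mask u : ℕ} : u ∈ U.left K g mask ↔
    u < U.n ∧ mask.testBit (U.leg u) = false ∧ U.posn K g (U.leg u) ≤ U.idx u := by
  simp [Users.left]

theorem Users.idx_lt_cnt {u : ℕ} (hu : u < U.n) : U.idx u < U.cnt (U.leg u) := by
  have := Nat.count_strict_mono (p := fun v => U.leg v = U.leg u) (rfl : U.leg u = U.leg u) hu
  exact this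

theorem Users.usr_idx (u : ℕ) : U.usr (U.leg u) (U.idx u) = u :=
  Nat.nth_count (p := fun v => U.leg v = U.leg u) rfl

theorem Users.usr_spec {l i : ℕ} (h : i < U.cnt l) :
    U.usr l i < U.n ∧ U.leg (U.usr l i) = l ∧ U.idx (U.usr l i) = i := by
  obtain ⟨u, hu, rfl, rfl⟩ := exists_count_eq h
  have : U.usr (U.leg u) (Nat.count (fun v => U.leg v = U.leg u) u) = u := U.usr_idx u; rw [this]
  exact ⟨hu, rfl, rfl⟩

theorem Users.idx_lt_idx {u v : ℕ} (h : U.leg u = U.leg v) : U.idx u < U.idx v ↔ u < v := by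
  constructor
  · intro h'; by_contra hn; have := Nat.count_monotone (fun w => U.leg w = U.leg u) (not_lt.1 hn)
    unfold Users.idx at h'; rw [← h] at h'; omega
  · intro h'; have := Nat.count_strict_mono (p := fun w => U.leg w = U.leg u) rfl h'
    unfold Users.idx; rwa [← h]

theorem Users.idx_le_idx {u v : ℕ} (h : U.leg u = U.leg v) : U.idx u ≤ U.idx v ↔ u ≤ v := by
  have := U.idx_lt_idx h.symm; omega

theorem Users.exists_idx {u i : ℕ} (h : i ≤ U.idx u) :
    ∃ v, v ≤ u ∧ U.leg v = U.leg u ∧ U.idx v = i := by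
  rcases h.lt_or_eq with h | rfl
  · obtain ⟨v, hv, hl, hi⟩ := exists_count_eq h; refine ⟨v, hv.le, hl, ?_⟩; rw [← hi, Users.idx, hl]
  · exact ⟨u, le_rfl, rfl, rfl⟩

theorem Users.size_le : U.size K U.n ≤ U.n := Nat.count_le _

theorem Users.tl_spec {g : ℕ} (h : g < U.size K U.n) :
    U.tl K g < U.n ∧ U.idx (U.tl K g) < K ∧ U.size K (U.tl K g) = g := by
  obtain ⟨u, hu, hi, rfl⟩ := exists_count_eq h
  have : U.tl K (Nat.count (fun u => U.idx u < K) u) = u :=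
    Nat.nth_count (p := fun v => U.idx v < K) hi
  rw [this]; exact ⟨hu, hi, rfl⟩

theorem Users.tl_size {u : ℕ} (h : U.idx u < K) : U.tl K (U.size K u) = u :=
  Nat.nth_count (p := fun v => U.idx v < K) h

theorem Users.size_lt {u v : ℕ} (h : U.idx u < K) (huv : u < v) : U.size K u < U.size K v :=
  Nat.count_strict_mono (p := fun v => U.idx v < K) h huv

theorem Users.size_mono {u v : ℕ} (huv : u ≤ v) : U.size K u ≤ U.size K v :=
  Nat.count_monotone _ huv

theorem Users.tl_lt_tl {g h : ℕ} (hg : g < U.size K U.n) (hh : h < U.size K U.n) :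
    U.tl K g < U.tl K h ↔ g < h := by
  have h1 := U.tl_spec hg; have h2 := U.tl_spec hh; constructor
  · intro h3; have := U.size_lt h1.2.1 h3; omega
  · intro h3; by_contra hn; have := U.size_mono (K := K) (not_lt.1 hn); omega

/-- Translates positions in the truncated list into counts of users: the list contains exactly the
first `K` users of each leg. -/
theorem Users.posn_size (l v : ℕ) :
    U.posn K (U.size K v) l = min (Nat.count (fun w => U.leg w = l) v) K := by
  induction v with
  | zero => simp [Users.size, Users.posn]
  | succ v ih =>
    have hs : U.size K (v + 1) = U.size K v + if U.idx v < K then 1 else 0 := Nat.count_succ ..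
    rw [hs, Nat.count_succ]; by_cases h : U.idx v < K
    · rw [if_pos h, Users.posn, Nat.count_succ, ← Users.posn, ih, U.tl_size h]
      by_cases hl : U.leg v = l
      · have : Nat.count (fun w => U.leg w = l) v < K := by subst hl; exact h
        simp only [hl, if_true]; omega
      · simp [hl]
    · rw [if_neg h, add_zero, ih]; by_cases hl : U.leg v = l
      · have : ¬ Nat.count (fun w => U.leg w = l) v < K := by subst hl; exact h
        simp only [hl, if_true]; omega
      · simp [hl]

theorem Users.posn_succ (g l : ℕ) :
    U.posn K (g + 1) l = U.posn K g l + if U.leg (U.tl K g) = l then 1 else 0 := Nat.count_succ ..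

theorem Users.posn_mono {g h : ℕ} (hgh : g ≤ h) (l : ℕ) : U.posn K g l ≤ U.posn K h l :=
  Nat.count_monotone _ hgh

theorem Users.exists_size_eq {g : ℕ} (hg : g ≤ U.size K U.n) : ∃ v ≤ U.n, U.size K v = g := by
  rcases hg.lt_or_eq with h | h
  · exact ⟨_, (U.tl_spec h).1.le, (U.tl_spec h).2.2⟩
  · grind

theorem Users.posn_le_cnt {g : ℕ} (hg : g ≤ U.size K U.n) (l : ℕ) : U.posn K g l ≤ U.cnt l := by
  obtain ⟨v, hv, rfl⟩ := U.exists_size_eq hg; rw [U.posn_size]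
  exact (min_le_left _ _).trans (Nat.count_monotone _ hv)

theorem Users.idx_tl {g : ℕ} (hg : g < U.size K U.n) :
    U.idx (U.tl K g) = U.posn K g (U.leg (U.tl K g)) := by
  obtain ⟨-, h2, h3⟩ := U.tl_spec hg
  conv_rhs => rw [← h3]
  rw [U.tl_size h2, U.posn_size]; exact (min_eq_left h2.le).symm

theorem Users.exists_tl {u : ℕ} (hu : u < U.n) (h : U.idx u < K) :
    ∃ g < U.size K U.n, U.tl K g = u := ⟨_, U.size_lt h hu, U.tl_size h⟩

theorem Users.exists_tl_of_lt_posn {u g : ℕ} (hg : g ≤ U.size K U.n)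
    (h : U.idx u < U.posn K g (U.leg u)) : ∃ h < g, U.tl K h = u := by
  obtain ⟨v, hv, rfl⟩ := U.exists_size_eq hg; rw [U.posn_size, lt_min_iff] at h
  have huv : u < v := by
    by_contra hn; have := Nat.count_monotone (fun w => U.leg w = U.leg u) (not_lt.1 hn)
    have h1 := h.1; unfold Users.idx at h1; omega
  exact ⟨_, U.size_lt h.2 huv, U.tl_size h.2⟩

theorem Users.idx_tl_lt_posn {h g : ℕ} (hhg : h < g) (hh : h < U.size K U.n) :
    U.idx (U.tl K h) < U.posn K g (U.leg (U.tl K h)) := by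
  have h1 := U.posn_succ (K := K) h (U.leg (U.tl K h)); rw [if_pos rfl, ← U.idx_tl hh] at h1
  have := U.posn_mono (K := K) (show h + 1 ≤ g from hhg) (U.leg (U.tl K h)); omega

theorem Users.left_filter {g mask l : ℕ} (hl : mask.testBit l = false) :
    (U.left K g mask).filter (U.leg · = l) = U.suf l (U.posn K g l) := by
  ext u; rw [Finset.mem_filter, U.mem_left, U.mem_suf]; grind

end Listing

/-! ### The dynamic program -/

section Costs

variable (U : Users) (K : ℕ) (R mc : ℕ → ℕ → WithTop ℝ)

/-- The case without further central clusters. `R l i` stands for the least cost of clustering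
`Users.suf l i` within the leg. -/
noncomputable def finishCost (mask g : ℕ) : ℕ → WithTop ℝ
  | 0 => 0
  | l + 1 => max (finishCost mask g l) (if mask.testBit l then 0 else R l (U.posn K g l))

/-- The cost of opening a cluster whose outermost user on its own leg is the `w`-th one. -/
noncomputable def optionCost (I : ℕ → ℕ → ℕ → WithTop ℝ) (mask g w : ℕ) : WithTop ℝ :=
  if g ≤ w ∧ mask.testBit (U.leg (U.tl K w)) = false then
    max (R (U.leg (U.tl K w)) (U.idx (U.tl K w) + 1))
      (I (mask + 2 ^ U.leg (U.tl K w)) w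
        (U.r - (U.idx (U.tl K w) + 1 - U.posn K g (U.leg (U.tl K w)))))
  else ⊤

noncomputable def startCost (I : ℕ → ℕ → ℕ → WithTop ℝ) (mask g : ℕ) : ℕ → WithTop ℝ
  | 0 => finishCost U K R mask g U.d
  | w + 1 => min (startCost I mask g w) (optionCost U K R I mask g w)

/-- The cost of completing a cluster that still needs `need` users from other legs, and of all
later clusters, where `k` users with number below `K` remain. -/
noncomputable def segCost : ℕ → ℕ → ℕ → ℕ → WithTop ℝ
  | 0 => fun _ _ _ => ⊤
  | k + 1 => fun mask w need =>
    let g := U.size K U.n - (k + 1)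
    let l := U.leg (U.tl K g)
    -- On an open leg the next user `g` offers three choices: close the leg just before `g`, take
    -- `g`, or take `g` as the last foreign user. Only in the last case both extreme users are known
    -- and `mc w g` is charged; `need ≤ 1` because `g` itself counts.
    if mask.testBit l then segCost k mask w need else
      min (min (max (R l (U.idx (U.tl K g))) (segCost k (mask + 2 ^ l) w need))
        (segCost k mask w (need - 1)))
        (if need ≤ 1 then max (mc w g)
          (startCost U K R (segCost k) mask (U.size K U.n - k) (U.size K U.n)) else ⊤)

/-- The cost of clustering the remaining users on the legs outside `mask`. -/
noncomputable def bestCost (k mask : ℕ) : WithTop ℝ :=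
  startCost U K R (segCost U K R mc k) mask (U.size K U.n - k) (U.size K U.n)

variable {U K R mc}

theorem finishCost_le {mask g l : ℕ} {D : ℝ} (hD : 0 ≤ D)
    (h : ∀ l' < l, mask.testBit l' = false → R l' (U.posn K g l') ≤ (D : WithTop ℝ)) :
    finishCost U K R mask g l ≤ (D : WithTop ℝ) := by
  have h0 : (0 : WithTop ℝ) ≤ D := by exact_mod_cast hD
  induction l with
  | zero => exact h0
  | succ l ih =>
    rw [finishCost]; refine max_le (ih fun l' hl' => h l' (by omega)) ?_
    split_ifs with hb
    · exact h0
    · grind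

theorem startCost_anti {I : ℕ → ℕ → ℕ → WithTop ℝ} {mask g w w' : ℕ} (h : w ≤ w') :
    startCost U K R I mask g w' ≤ startCost U K R I mask g w := by
  induction w', h using Nat.le_induction with
  | base => exact le_rfl
  | succ w' _ ih => exact (min_le_left _ _).trans ih

theorem startCost_le_option {I : ℕ → ℕ → ℕ → WithTop ℝ} {mask g w w' : ℕ} (h : w < w') :
    startCost U K R I mask g w' ≤ optionCost U K R I mask g w :=
  (startCost_anti (show w + 1 ≤ w' from h)).trans (min_le_right _ _)

end Costs

/-! ### Completeness: the computed value is at most every feasible threshold -/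

section Completeness

variable {U : Users} {T : Threshold} {K : ℕ} {R mc : ℕ → ℕ → WithTop ℝ} {D : ℝ}

def closedLegs (d mask : ℕ) : Finset ℕ := (Finset.range d).filter fun l => mask.testBit l

variable (hD : 0 ≤ D)
  (hR : ∀ l < U.d, ∀ i ≤ U.cnt l, Feas U T (U.suf l i) → R l i ≤ (D : WithTop ℝ))
  (hmc : ∀ w z, w < U.size K U.n → z < U.size K U.n →
    MultiOk U T (U.leg (U.tl K w)) (U.tl K w) (U.tl K z) → mc w z ≤ (D : WithTop ℝ))

-- Replays a cluster as in `FirstCluster` against the recursion, by induction on the distance `j` to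
-- its last foreign user `z`. Before position `h`, all scanned users on open legs belong to `Q`, and
-- each leg of `Z'` has been closed at its first user outside `Q`. At `z` the cluster is completed,
-- and `ih` takes over.
include hR hmc in
theorem segCost_le {g mask a w z wi zi : ℕ} {A Q Z : Finset ℕ} (hg : g ≤ U.size K U.n)
    (hF : FirstCluster U T (U.left K g mask) A Q a w z Z)
    (hwi : wi < U.size K U.n) (hw : U.tl K wi = w) (hzi : zi < U.size K U.n) (hz : U.tl K zi = z)
    (hgz : g ≤ zi)
    (hQ : ∀ q ∈ Q, U.idx q < K)
    (ih : ∀ m, m.testBit a → (∀ l, mask.testBit l → m.testBit l) →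
      Feas U T (U.left K (zi + 1) m) → m < 2 ^ U.d →
      (∀ l, m.testBit l = false → U.posn K (zi + 1) l ≤ U.posn K g l + Q.card) →
      bestCost U K R mc (U.size K U.n - (zi + 1)) m ≤ (D : WithTop ℝ)) :
    ∀ j h m need (Z' : Finset ℕ), h + j = zi → g ≤ h → Z' ⊆ Z → m < 2 ^ U.d →
      (∀ l, m.testBit l = true ↔ mask.testBit l = true ∨ l = a ∨ l ∈ Z') →
      (∀ h', g ≤ h' → h' < h → m.testBit (U.leg (U.tl K h')) = false → U.tl K h' ∈ Q) →
      (∀ q ∈ Q, U.leg q ∈ Z' → q < U.tl K h) →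
      need ≤ (Q.filter (U.tl K h ≤ ·)).card →
      segCost U K R mc (U.size K U.n - h) m wi need ≤ (D : WithTop ℝ) := by
  classical
  have hQn : ∀ q ∈ Q, q < U.n ∧ mask.testBit (U.leg q) = false ∧
      U.posn K g (U.leg q) ≤ U.idx q := fun q hq => U.mem_left.1 (hF.subQ hq)
  have hlea : U.leg w = a := hF.legA w hF.memA; intro j
  induction j with
  | zero =>
    intro h m need Z' hj hgh hZ' hm hbits hopen hclosed hneed; have hh : h = zi := by omega
    subst hh; have hstep : U.size K U.n - h = (U.size K U.n - (h + 1)) + 1 := by omega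
    have hzopen : m.testBit (U.leg (U.tl K h)) = false := by
      rw [← Bool.not_eq_true, hbits, hz]; rintro (h1 | h1 | h1)
      · have := (hQn z hF.memQ).2.1; rw [h1] at this; cases this
      · exact hF.legQ z hF.memQ h1
      · have := hclosed z hF.memQ h1; rw [hz] at this; omega
    have hneed1 : need ≤ 1 := by
      refine hneed.trans (Finset.card_le_one.2 ?_); intro x hx y hy
      rw [Finset.mem_filter, hz] at hx hy; have := hF.leQ x hx.1; have := hF.leQ y hy.1; omega
    rw [hstep, segCost]; have hgg : U.size K U.n - (U.size K U.n - (h + 1) + 1) = h := by omega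
    simp only [hgg, hzopen, Bool.false_eq_true, if_false, hneed1, if_true]
    refine (min_le_right _ _).trans (max_le (hmc wi h hwi hzi ?_) ?_)
    · rw [hw, hz, hlea]; exact hF.ok
    · refine ih m ((hbits a).2 (Or.inr (Or.inl rfl))) (fun l hl => (hbits l).2 (Or.inl hl)) ?_ hm ?_
      -- After `z`, the users still to be dealt with are exactly those in `FirstCluster.rest` for
      -- the legs `Z'` that were closed on the way.
      · have hrest := hF.rest Z' hZ'; convert hrest using 1; ext u
        rw [U.mem_left, Finset.mem_sdiff, Finset.mem_filter, U.mem_left]; constructor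
        · rintro ⟨h1, h2, h3⟩; rw [← Bool.not_eq_true, hbits, not_or, not_or] at h2
          refine ⟨⟨⟨h1, by simpa using h2.1, (U.posn_mono (by omega) _).trans h3⟩, h2.2⟩, ?_⟩
          intro huQ; obtain ⟨hu, hhu, rfl⟩ := U.exists_tl h1 (hQ u huQ); have h5 := hF.leQ _ huQ
          have : hu < h + 1 := by
            by_contra hn; have := (U.tl_lt_tl hzi hhu).2 (show h < hu by omega); omega
          have := U.idx_tl_lt_posn this hhu; omega
        · rintro ⟨⟨⟨h1, h2, h3⟩, h4, h5⟩, h6⟩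
          have hmo : m.testBit (U.leg u) = false := by
            rw [← Bool.not_eq_true, hbits]; simp [h2, h4, h5]
          refine ⟨h1, hmo, ?_⟩; by_contra hn
          obtain ⟨h', hh', rfl⟩ := U.exists_tl_of_lt_posn (show h + 1 ≤ _ from hzi) (not_le.1 hn)
          rcases Nat.lt_succ_iff_lt_or_eq.1 hh' with hlt | rfl
          · refine h6 (hopen h' ?_ hlt hmo); by_contra hgn
            have := U.idx_tl_lt_posn (K := K) (not_le.1 hgn) (by omega); omega
          · exact h6 (hz ▸ hF.memQ)
      · intro l hl
        -- A leg that is still open has advanced over users of `Q` only, hence by at most `Q.card`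
        -- positions.
        have hsub : ((Finset.Ico g (h + 1)).filter (fun h' => U.leg (U.tl K h') = l)).image (U.tl K)
            ⊆ Q := by
          intro u hu; obtain ⟨h', hh', rfl⟩ := Finset.mem_image.1 hu
          simp only [Finset.mem_filter, Finset.mem_Ico] at hh'
          rcases Nat.lt_succ_iff_lt_or_eq.1 hh'.1.2 with hlt | rfl
          · exact hopen h' hh'.1.1 hlt (by grind)
          · exact hz ▸ hF.memQ
        have h1 := Finset.card_le_card hsub
        rw [Finset.card_image_of_injOn (by
          intro x hx y hy hxy
          simp only [Finset.coe_filter, Finset.mem_Ico, Set.mem_ofPred_eq] at hx hy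
          have h2 := U.tl_lt_tl (K := K) (g := x) (h := y) (by omega) (by omega)
          have h3 := U.tl_lt_tl (K := K) (g := y) (h := x) (by omega) (by omega)
          omega)] at h1
        have h2 : U.posn K (h + 1) l = U.posn K g l +
            ((Finset.Ico g (h + 1)).filter (fun h' => U.leg (U.tl K h') = l)).card := by
          rw [Users.posn, Users.posn, Nat.count_eq_card_filter_range, Nat.count_eq_card_filter_range,
            ← Finset.card_union_of_disjoint]
          · congr 1
            ext x; simp; constructor
            · rintro ⟨h1, h2⟩; rcases lt_or_ge x g with h3 | h3
              · omega
              · omega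
            · rintro (⟨h1, h2⟩ | ⟨⟨h1, h3⟩, h2⟩)
              · omega
              · omega
          · refine Finset.disjoint_left.2 fun x hx hx' => ?_
            simp only [Finset.mem_filter, Finset.mem_range, Finset.mem_Ico] at hx hx'; omega
        omega
  | succ j ihj =>
    intro h m need Z' hj hgh hZ' hm hbits hopen hclosed hneed
    have hhG : h < U.size K U.n := by omega
    have hstep : U.size K U.n - h = (U.size K U.n - (h + 1)) + 1 := by omega
    have hgg : U.size K U.n - (U.size K U.n - (h + 1) + 1) = h := by omega
    rw [hstep, segCost]; simp only [hgg]
    have htl := (U.tl_lt_tl (K := K) (g := h) (h := h + 1) hhG (by omega)).2 (by omega)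
    have hvz : U.tl K h < z := by rw [← hz, U.tl_lt_tl hhG hzi]; omega
    -- the members of `Q` from the next position on
    have hfil : ∀ q ∈ Q, U.tl K h < q → U.tl K (h + 1) ≤ q := by
      intro q hq hlt; obtain ⟨hq', hqG, rfl⟩ := U.exists_tl (hQn q hq).1 (hQ q hq)
      rw [U.tl_lt_tl hhG hqG] at hlt; by_contra hn; rw [not_le, U.tl_lt_tl hqG (by omega)] at hn
      omega
    by_cases hb : m.testBit (U.leg (U.tl K h)) = true
    · rw [if_pos hb]
      have hvQ : U.tl K h ∉ Q := by
        intro hq; rcases (hbits _).1 hb with h1 | h1 | h1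
        · have := (hQn _ hq).2.1; rw [h1] at this; cases this
        · exact hF.legQ _ hq h1
        · grind
      refine ihj (h + 1) m need Z' (by omega) (by omega) hZ' hm hbits ?_ ?_ ?_
      · intro h' hgh' hlt ho; rcases Nat.lt_succ_iff_lt_or_eq.1 hlt with hlt | rfl
        · grind
        · rw [hb] at ho; cases ho
      · grind
      · refine hneed.trans (Finset.card_le_card fun q hq => ?_); rw [Finset.mem_filter] at hq ⊢
        refine ⟨hq.1, hfil q hq.1 (lt_of_le_of_ne hq.2 ?_)⟩; rintro rfl; exact hvQ hq.1
    · have hb' : m.testBit (U.leg (U.tl K h)) = false := by simpa using hb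
      rw [if_neg hb]; refine (min_le_left _ _).trans ?_; by_cases hvQ : U.tl K h ∈ Q
      · refine (min_le_right _ _).trans (ihj (h + 1) m (need - 1) Z' (by omega) (by omega) hZ' hm hbits ?_ ?_ ?_)
        · intro h' hgh' hlt ho; rcases Nat.lt_succ_iff_lt_or_eq.1 hlt with hlt | rfl
          · grind
          · exact hvQ
        · grind
        · have : (Q.filter (U.tl K h ≤ ·)) ⊆ insert (U.tl K h) (Q.filter (U.tl K (h + 1) ≤ ·)) := by
            intro q hq; rw [Finset.mem_filter] at hq; rw [Finset.mem_insert, Finset.mem_filter]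
            rcases eq_or_lt_of_le hq.2 with h1 | h1
            · omega
            · grind
          have := (Finset.card_le_card this).trans (Finset.card_insert_le _ _); omega
      -- A user before `z` on an open foreign leg that is not in `Q` must lie on a leg of `Z`, by
      -- `opened`. This leg is closed here.
      · refine (min_le_left _ _).trans ?_; set v := U.tl K h with hv; have hvspec := U.tl_spec hhG
        have hvX : v ∈ U.left K g mask := by
          refine U.mem_left.2 ⟨hvspec.1, ?_, ?_⟩
          · rw [← Bool.not_eq_true]; exact fun h1 => hb ((hbits _).2 (Or.inl h1))
          · rw [U.idx_tl hhG]; exact U.posn_mono hgh _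
        have hva : U.leg v ≠ a := by grind
        have hvZ : U.leg v ∈ Z := by by_contra hn; exact hvQ (hF.opened v hvX hva hn hvz.le)
        have hvmask : mask.testBit (U.leg v) = false := by grind
        refine max_le (hR _ (U.leg_lt v hvspec.1) _ (U.idx_lt_cnt hvspec.1).le ?_) ?_
        · have := hF.closed _ hvZ; rw [U.left_filter hvmask] at this; convert this using 1; ext u
          rw [Finset.mem_sdiff, U.mem_suf, U.mem_suf]; constructor
          · rintro ⟨h1, h2, h3⟩; have hvu : v ≤ u := (U.idx_le_idx h2.symm).1 h3
            have h4 : U.posn K g (U.leg v) ≤ U.idx v := (U.mem_left.1 hvX).2.2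
            refine ⟨⟨h1, h2, h4.trans h3⟩, fun huQ => ?_⟩
            have := hF.initialQ v hvX hvZ hvQ u huQ h2; omega
          · rintro ⟨⟨h1, h2, h3⟩, h4⟩; refine ⟨h1, h2, ?_⟩; by_contra hn; rw [not_le] at hn
            have h5 : U.idx u < U.posn K h (U.leg u) := by rw [h2, ← U.idx_tl hhG]; exact hn
            obtain ⟨h', hh', rfl⟩ := U.exists_tl_of_lt_posn hhG.le h5
            refine h4 (hopen h' ?_ hh' (by grind)); by_contra hgn
            have := U.idx_tl_lt_posn (K := K) (not_le.1 hgn) (by omega); rw [h2] at this; omega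
        · refine ihj (h + 1) _ need (insert (U.leg v) Z') (by omega) (by omega) ?_
            (add_two_pow_lt hm (U.leg_lt v hvspec.1) hb') ?_ ?_ ?_ ?_
          · grind
          · intro l
            rw [testBit_add_two_pow _ _ _ hb', Bool.or_eq_true, hbits, decide_eq_true_iff,
              Finset.mem_insert]
            tauto
          · intro h' hgh' hlt ho; rw [testBit_add_two_pow _ _ _ hb', Bool.or_eq_false_iff] at ho
            rcases Nat.lt_succ_iff_lt_or_eq.1 hlt with hlt | rfl
            · grind
            · simp [hv] at ho
          · intro q hq hl; rcases Finset.mem_insert.1 hl with h1 | h1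
            · exact (hF.initialQ v hvX hvZ hvQ q hq h1).trans htl
            · grind
          · refine hneed.trans (Finset.card_le_card fun q hq => ?_); rw [Finset.mem_filter] at hq ⊢
            refine ⟨hq.1, hfil q hq.1 (lt_of_le_of_ne hq.2 ?_)⟩; rintro rfl; exact hvQ hq.1

-- Induction on the number of listed users that remain. Every central cluster closes one leg and
-- advances each open leg by at most `2 * r` users. So with `c` closed legs no open leg has advanced
-- beyond `2 * r * c`, and `2 * r * d` listed users per leg are enough.
include hD hR hmc in
theorem bestCost_le (hK : 2 * U.r * U.d ≤ K) : ∀ k mask, k ≤ U.size K U.n → mask < 2 ^ U.d →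
    Feas U T (U.left K (U.size K U.n - k) mask) →
    (∀ l < U.d, mask.testBit l = false →
      U.posn K (U.size K U.n - k) l ≤ 2 * U.r * (closedLegs U.d mask).card) →
    bestCost U K R mc k mask ≤ (D : WithTop ℝ) := by
  classical
  intro k
  induction k using Nat.strong_induction_on with
  | _ k IH =>
  intro mask hk hmask hfeas hpos; set g := U.size K U.n - k with hg
  have hgG : g ≤ U.size K U.n := Nat.sub_le _ _
  rcases hfeas.exists_firstCluster with hall | ⟨A, Q, a, w, z, Z, hF⟩
  · refine (startCost_anti (Nat.zero_le _)).trans (finishCost_le hD fun l hl hb => ?_)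
    refine hR l hl _ (U.posn_le_cnt hgG l) ?_; rw [← U.left_filter hb]; exact hall l
  · have hwX := U.mem_left.1 (hF.subA hF.memA); have hwa : U.leg w = a := hF.legA w hF.memA
    rw [hwa] at hwX; have had : a < U.d := hwa ▸ U.leg_lt w hwX.1
    have hclosed : (closedLegs U.d mask).card + 1 ≤ U.d := by
      have : insert a (closedLegs U.d mask) ⊆ Finset.range U.d := by
        intro l hl; rcases Finset.mem_insert.1 hl with rfl | hl
        · grind
        · exact (Finset.mem_filter.1 hl).1
      have h1 := Finset.card_le_card this
      rwa [Finset.card_insert_of_notMem (by simp [closedLegs, hwX.2.1]), Finset.card_range] at h1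
    have hmul : 2 * U.r * ((closedLegs U.d mask).card + 1) ≤ K :=
      (Nat.mul_le_mul_left _ hclosed).trans hK
    rw [Nat.mul_add, mul_one] at hmul
    -- `A` consists of consecutive users
    have hA : A = (U.suf a (U.posn K g a)).filter (· ≤ w) := by
      ext u; rw [Finset.mem_filter, ← U.left_filter hwX.2.1, Finset.mem_filter]; constructor
      · intro hu; exact ⟨⟨hF.subA hu, hF.legA u hu⟩, hF.leA u hu⟩
      · rintro ⟨⟨h1, h2⟩, h3⟩; exact hF.initialA u h1 h2 h3
    have hAcard : A.card = U.idx w + 1 - U.posn K g a := by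
      rw [← Nat.card_Icc]; refine Finset.card_bij (fun u _ => U.idx u) ?_ ?_ ?_
      · intro u hu; rw [hA, Finset.mem_filter, U.mem_suf] at hu; rw [Finset.mem_Icc]
        exact ⟨hu.1.2.2, (U.idx_le_idx (by rw [hu.1.2.1, hwa])).2 hu.2⟩
      · intro u hu v hv huv; have h1 : U.leg u = U.leg v := by rw [hF.legA u hu, hF.legA v hv]
        have h2 := U.idx_lt_idx h1; have h3 := U.idx_lt_idx h1.symm; omega
      · intro i hi; rw [Finset.mem_Icc] at hi; obtain ⟨v, hv1, hv2, hv3⟩ := U.exists_idx hi.2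
        refine ⟨v, ?_, hv3⟩; rw [hA, Finset.mem_filter, U.mem_suf]; omega
    have hwK : U.idx w < K := by have := hF.cardA; grind
    have hQK : ∀ q ∈ Q, U.idx q < K := by
      intro q hq; have hqX := U.mem_left.1 (hF.subQ hq)
      -- On the leg of `q`, all users from the current position up to `q` belong to `Q`, so `q` is
      -- at most `2 * r` positions ahead.
      have hsub : (Finset.Icc (U.posn K g (U.leg q)) (U.idx q)) ⊆
          (Q.filter (U.leg · = U.leg q)).image U.idx := by
        intro i hi; rw [Finset.mem_Icc] at hi; obtain ⟨v, hv1, hv2, hv3⟩ := U.exists_idx hi.2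
        have hvX : v ∈ U.left K g mask := U.mem_left.2 ⟨by omega, by rw [hv2]; exact hqX.2.1, by
          rw [hv2]; omega⟩
        refine Finset.mem_image.2 ⟨v, Finset.mem_filter.2 ⟨?_, hv2⟩, hv3⟩; by_contra hvQ
        by_cases hZ : U.leg v ∈ Z
        · have := hF.initialQ v hvX hZ hvQ q hq hv2.symm; omega
        · exact hvQ (hF.opened v hvX (by rw [hv2]; exact hF.legQ q hq) hZ
            (hv1.trans (hF.leQ q hq)))
      have h1 := Finset.card_le_card hsub; rw [Nat.card_Icc] at h1
      have h2 := h1.trans (Finset.card_image_le.trans (Finset.card_filter_le _ _)); have := hF.cardQ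
      have := hpos _ (U.leg_lt q hqX.1) hqX.2.1; omega
    obtain ⟨wi, hwi, hw⟩ := U.exists_tl hwX.1 hwK; have hzX := U.mem_left.1 (hF.subQ hF.memQ)
    obtain ⟨zi, hzi, hz⟩ := U.exists_tl hzX.1 (hQK z hF.memQ)
    have hgw : g ≤ wi := by
      by_contra hn; have := U.idx_tl_lt_posn (not_le.1 hn) hwi; rw [hw, hwa] at this; omega
    have hgz : g ≤ zi := by
      by_contra hn; have := U.idx_tl_lt_posn (not_le.1 hn) hzi; rw [hz] at this; omega
    refine (startCost_le_option hwi).trans ?_; have hlw : U.leg (U.tl K wi) = a := by rw [hw, hwa]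
    rw [optionCost, hlw, if_pos ⟨hgw, hwX.2.1⟩, hw, ← hAcard]
    refine max_le (hR a had _ (by have := U.idx_lt_cnt hwX.1; rw [hwa] at this; omega) ?_) ?_
    · convert hF.restA using 1; ext u
      rw [U.left_filter hwX.2.1, Finset.mem_sdiff, hA, Finset.mem_filter, U.mem_suf, U.mem_suf]
      constructor
      · rintro ⟨h1, h2, h3⟩; have : w < u := (U.idx_lt_idx (by rw [h2, hwa])).1 (by omega); omega
      · rintro ⟨⟨h1, h2, h3⟩, h4⟩; refine ⟨h1, h2, ?_⟩; have : w < u := by omega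
        exact (U.idx_lt_idx (by rw [h2, hwa])).2 this
    · have hgk : k = U.size K U.n - g := by omega
      rw [hgk]
      refine segCost_le hR hmc hgG hF hwi hw hzi hz hgz hQK ?_ (zi - g) g (mask + 2 ^ a) _ ∅
        (by omega) le_rfl (Finset.empty_subset _) (add_two_pow_lt hmask had hwX.2.1) ?_ ?_ ?_ ?_
      · intro m hma hmm hfeas' hm hpos'
        have e : U.size K U.n - (U.size K U.n - (zi + 1)) = zi + 1 := by omega
        refine IH (U.size K U.n - (zi + 1)) (by omega) m (Nat.sub_le _ _) hm (by rwa [e]) ?_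
        intro l hl hml; rw [e]
        have hmaskl : mask.testBit l = false := by
          rw [← Bool.not_eq_true]; intro h1; rw [hmm l h1] at hml; cases hml
        have h1 := hpos' l hml; have h2 := hpos l hl hmaskl; have h3 := hF.cardQ
        have h4 : (closedLegs U.d mask).card + 1 ≤ (closedLegs U.d m).card := by
          have : insert a (closedLegs U.d mask) ⊆ closedLegs U.d m := by
            intro l hl; rcases Finset.mem_insert.1 hl with rfl | hl
            · exact Finset.mem_filter.2 ⟨Finset.mem_range.2 had, hma⟩
            · rw [closedLegs, Finset.mem_filter] at hl ⊢; grind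
          have h1 := Finset.card_le_card this
          rwa [Finset.card_insert_of_notMem (by simp [closedLegs, hwX.2.1])] at h1
        have h5 := Nat.mul_le_mul_left (2 * U.r) h4; rw [Nat.mul_add, mul_one] at h5; omega
      · intro l; rw [testBit_add_two_pow _ _ _ hwX.2.1]; simp
      · intro h' h1 h2; omega
      · simp
      · have : Q.filter (U.tl K g ≤ ·) = Q := by
          refine Finset.filter_true_of_mem fun q hq => ?_; have hqX := U.mem_left.1 (hF.subQ hq)
          obtain ⟨qi, hqi, rfl⟩ := U.exists_tl hqX.1 (hQK q hq); by_contra hn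
          have hlt : qi < g := (U.tl_lt_tl hqi (by omega)).1 (not_le.1 hn)
          have := U.idx_tl_lt_posn hlt hqi; omega
        rw [this]; have := hF.size; omega

include hD hR hmc in
theorem bestCost_le_of_feas (hK : 2 * U.r * U.d ≤ K) (h : Feas U T (Finset.range U.n)) :
    bestCost U K R mc (U.size K U.n) 0 ≤ (D : WithTop ℝ) := by
  refine bestCost_le hD hR hmc hK _ 0 le_rfl (by positivity) ?_ ?_
  · convert h using 1; ext u; rw [U.mem_left]; simp [Users.posn]
  · intro l _ _; simp [Users.posn]

end Completeness

end

/-! ### The machine: total semantics, triples with time, and a program calculus -/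

section
/-! ### A total semantics with a bound on stored integers -/

/-- Evaluation without a word bound; it agrees with `IExp.eval` as soon as words are long enough
(`IExp.eval_eq`). -/
def IExp.val (s : Store) : IExp → ℕ
  | .const c => c
  | .read a i => s.ints a (i.val s)
  | .add e₁ e₂ => e₁.val s + e₂.val s
  | .sub e₁ e₂ => e₁.val s - e₂.val s
  | .mul e₁ e₂ => e₁.val s * e₂.val s
  | .div e₁ e₂ => e₁.val s / e₂.val s

noncomputable def RExp.val (s : Store) : RExp → ℝ
  | .zero => 0
  | .read a i => s.reals a (i.val s)
  | .add x₁ x₂ => x₁.val s + x₂.val s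
  | .sub x₁ x₂ => x₁.val s - x₂.val s

def Test.Holds (s : Store) : Test → Prop
  | .intLe e₁ e₂ => e₁.val s ≤ e₂.val s
  | .realLe x₁ x₂ => x₁.val s ≤ x₂.val s

/-- The exponent in the bound `N ^ size` for values when all stored integers are below `N`: both
sums and products of numbers below `N ^ a` and `N ^ b` are below `N ^ (a + b)`. A constant `c`
contributes `c + 1`, as `c < 2 ^ c ≤ N ^ c`. -/
def IExp.size : IExp → ℕ
  | .const c => c + 1
  | .read _ i => i.size + 1
  | .add e₁ e₂ => e₁.size + e₂.size
  | .sub e₁ e₂ => e₁.size + e₂.size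
  | .mul e₁ e₂ => e₁.size + e₂.size
  | .div e₁ e₂ => e₁.size + e₂.size

def RExp.size : RExp → ℕ
  | .zero => 0
  | .read _ i => i.size
  | .add x₁ x₂ => x₁.size + x₂.size
  | .sub x₁ x₂ => x₁.size + x₂.size

def Test.size : Test → ℕ
  | .intLe e₁ e₂ => e₁.size + e₂.size
  | .realLe x₁ x₂ => x₁.size + x₂.size

def Program.size : Program → ℕ
  | .skip => 0
  | .setInt _ i e => i.size + e.size
  | .setReal _ i x => i.size + x.size
  | .seq p q => p.size + q.size
  | .ite b p q => b.size + p.size + q.size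
  | .loop b p => b.size + p.size

theorem IExp.size_pos (e : IExp) : 1 ≤ e.size := by
  induction e <;> simp only [IExp.size] <;> omega

variable {N W : ℕ}

theorem IExp.eval_eq {s : Store} (hN : 2 ≤ N) (hs : ∀ a i, s.ints a i < N) (e : IExp)
    (hW : N ^ e.size ≤ W) : e.eval W s = some (e.val s) ∧ e.val s < N ^ e.size := by
  have mono : ∀ {a b : ℕ}, a ≤ b → N ^ a ≤ N ^ b := fun h => Nat.pow_le_pow_right (by omega) h
  have two : ∀ e : IExp, 2 ≤ N ^ e.size := fun e => hN.trans (by simpa using mono e.size_pos)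
  have bin : ∀ {e₁ e₂ : IExp}, N ^ (e₁.size + e₂.size) ≤ W → N ^ e₁.size ≤ W ∧ N ^ e₂.size ≤ W :=
    fun h => ⟨(mono (Nat.le_add_right _ _)).trans h, (mono (Nat.le_add_left _ _)).trans h⟩
  have fin : ∀ {e : IExp} {v : ℕ}, v < N ^ e.size → N ^ e.size ≤ W → word W v = some v :=
    fun h h' => if_pos (h.trans_le h')
  induction e with
  | const c =>
    have h : c < N ^ (IExp.const c).size := by
      have h1 : c < 2 ^ c := Nat.lt_two_pow_self
      have h2 : 2 ^ c ≤ N ^ c := Nat.pow_le_pow_left hN c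
      exact h1.trans_le (h2.trans (mono (Nat.le_succ _)))
    exact ⟨fin h hW, h⟩
  | read a i ih =>
    have h1 := ih ((mono (Nat.le_succ _)).trans hW)
    have h : s.ints a (i.val s) < N ^ (IExp.read a i).size :=
      (hs a _).trans_le (by simpa using mono (IExp.read a i).size_pos)
    exact ⟨by rw [IExp.eval, h1.1]; exact fin h hW, h⟩
  | add e₁ e₂ ih₁ ih₂ =>
    have h1 := ih₁ (bin hW).1; have h2 := ih₂ (bin hW).2
    have h : e₁.val s + e₂.val s < N ^ (IExp.add e₁ e₂).size := by
      rw [IExp.size, pow_add]; have := two e₁; have := two e₂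
      have h3 : N ^ e₁.size + N ^ e₂.size ≤ N ^ e₁.size * N ^ e₂.size := by nlinarith
      omega
    exact ⟨by rw [IExp.eval, h1.1, h2.1]; exact fin h hW, h⟩
  | sub e₁ e₂ ih₁ ih₂ =>
    have h1 := ih₁ (bin hW).1; have h2 := ih₂ (bin hW).2
    have h : e₁.val s - e₂.val s < N ^ (IExp.sub e₁ e₂).size :=
      (Nat.sub_le _ _).trans_lt (h1.2.trans_le (mono (Nat.le_add_right _ _)))
    exact ⟨by rw [IExp.eval, h1.1, h2.1]; exact fin h hW, h⟩
  | mul e₁ e₂ ih₁ ih₂ =>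
    have h1 := ih₁ (bin hW).1; have h2 := ih₂ (bin hW).2
    have h : e₁.val s * e₂.val s < N ^ (IExp.mul e₁ e₂).size := by
      rw [IExp.size, pow_add]; exact Nat.mul_lt_mul'' h1.2 h2.2
    exact ⟨by rw [IExp.eval, h1.1, h2.1]; exact fin h hW, h⟩
  | div e₁ e₂ ih₁ ih₂ =>
    have h1 := ih₁ (bin hW).1; have h2 := ih₂ (bin hW).2
    have h : e₁.val s / e₂.val s < N ^ (IExp.div e₁ e₂).size :=
      (Nat.div_le_self _ _).trans_lt (h1.2.trans_le (mono (Nat.le_add_right _ _)))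
    exact ⟨by rw [IExp.eval, h1.1, h2.1]; exact fin h hW, h⟩

theorem pow_le_of_add {N W a b : ℕ} (hN : 2 ≤ N) (h : N ^ (a + b) ≤ W) : N ^ a ≤ W ∧ N ^ b ≤ W :=
  ⟨(Nat.pow_le_pow_right (by omega) (Nat.le_add_right _ _)).trans h,
    (Nat.pow_le_pow_right (by omega) (Nat.le_add_left _ _)).trans h⟩

theorem RExp.eval_eq {s : Store} (hN : 2 ≤ N) (hs : ∀ a i, s.ints a i < N) (x : RExp)
    (hW : N ^ x.size ≤ W) : x.eval W s = some (x.val s) := by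
  induction x with
  | zero => rfl
  | read a i => rw [RExp.eval, (IExp.eval_eq hN hs i hW).1]; rfl
  | add x₁ x₂ ih₁ ih₂ => have h := pow_le_of_add hN hW; rw [RExp.eval, ih₁ h.1, ih₂ h.2]; rfl
  | sub x₁ x₂ ih₁ ih₂ => have h := pow_le_of_add hN hW; rw [RExp.eval, ih₁ h.1, ih₂ h.2]; rfl

open Classical in
theorem Test.eval_eq {s : Store} (hN : 2 ≤ N) (hs : ∀ a i, s.ints a i < N) (b : Test)
    (hW : N ^ b.size ≤ W) : b.eval W s = some (decide (b.Holds s)) := by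
  cases b with
  | intLe e₁ e₂ =>
    have h := pow_le_of_add hN hW
    simp [Test.eval, (IExp.eval_eq hN hs e₁ h.1).1, (IExp.eval_eq hN hs e₂ h.2).1, Test.Holds]
    congr
  | realLe x₁ x₂ =>
    have h := pow_le_of_add hN hW
    simp [Test.eval, RExp.eval_eq hN hs x₁ h.1, RExp.eval_eq hN hs x₂ h.2, Test.Holds]
    congr

/-- Execution in which every stored integer is below `N`. -/
inductive Ex (N : ℕ) : Program → Store → Store → ℕ → Prop
  | skip (s : Store) : Ex N .skip s s 1
  | setInt {s : Store} {a : ℕ} {i e : IExp} (h : e.val s < N) :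
      Ex N (.setInt a i e) s (s.setInt a (i.val s) (e.val s)) (i.cost + e.cost + 1)
  | setReal {s : Store} {a : ℕ} {i : IExp} {e : RExp} :
      Ex N (.setReal a i e) s (s.setReal a (i.val s) (e.val s)) (i.cost + e.cost + 1)
  | seq {p q : Program} {s s₁ s₂ : Store} {t₁ t₂ : ℕ}
      (hp : Ex N p s s₁ t₁) (hq : Ex N q s₁ s₂ t₂) : Ex N (.seq p q) s s₂ (t₁ + t₂)
  | iteTrue {b : Test} {p q : Program} {s s₁ : Store} {t : ℕ}
      (hb : b.Holds s) (hp : Ex N p s s₁ t) : Ex N (.ite b p q) s s₁ (b.cost + t)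
  | iteFalse {b : Test} {p q : Program} {s s₁ : Store} {t : ℕ}
      (hb : ¬ b.Holds s) (hq : Ex N q s s₁ t) : Ex N (.ite b p q) s s₁ (b.cost + t)
  | loopTrue {b : Test} {p : Program} {s s₁ s₂ : Store} {t₁ t₂ : ℕ}
      (hb : b.Holds s) (hp : Ex N p s s₁ t₁) (hl : Ex N (.loop b p) s₁ s₂ t₂) :
      Ex N (.loop b p) s s₂ (b.cost + t₁ + t₂)
  | loopFalse {b : Test} {p : Program} {s : Store} (hb : ¬ b.Holds s) :
      Ex N (.loop b p) s s b.cost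

/-- Only stored integers must be controlled dynamically. Intermediate results are bounded through
the program text, so a fixed power of `N` serves as the word bound whatever the running time is. -/
theorem Ex.run {p : Program} {s s' : Store} {t : ℕ} (h : Ex N p s s' t) (hN : 2 ≤ N)
    (hs : ∀ a i, s.ints a i < N) (hW : N ^ p.size ≤ W) :
    Run W p s s' t ∧ ∀ a i, s'.ints a i < N := by
  classical
  induction h with
  | skip s => exact ⟨.skip s, hs⟩
  | setInt h =>
    have hw := pow_le_of_add hN hW
    refine ⟨.setInt (IExp.eval_eq hN hs _ hw.1).1 (IExp.eval_eq hN hs _ hw.2).1, fun a i => ?_⟩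
    simp only [Store.setInt]
    split_ifs
    · exact h
    · exact hs a i
  | setReal =>
    have hw := pow_le_of_add hN hW
    exact ⟨.setReal (IExp.eval_eq hN hs _ hw.1).1 (RExp.eval_eq hN hs _ hw.2), hs⟩
  | seq _ _ ih₁ ih₂ =>
    have hw := pow_le_of_add hN hW; have h1 := ih₁ hs hw.1; have h2 := ih₂ h1.2 hw.2
    exact ⟨.seq h1.1 h2.1, h2.2⟩
  | iteTrue hb _ ih =>
    have hw := pow_le_of_add hN hW; have hw' := pow_le_of_add hN hw.1; have h1 := ih hs hw'.2
    exact ⟨.iteTrue (by rw [Test.eval_eq hN hs _ hw'.1]; simpa using hb) h1.1, h1.2⟩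
  | iteFalse hb _ ih =>
    have hw := pow_le_of_add hN hW; have hw' := pow_le_of_add hN hw.1; have h1 := ih hs hw.2
    exact ⟨.iteFalse (by rw [Test.eval_eq hN hs _ hw'.1]; simpa using hb) h1.1, h1.2⟩
  | loopTrue hb _ _ ih₁ ih₂ =>
    have hw := pow_le_of_add hN hW; have h1 := ih₁ hs hw.2; have h2 := ih₂ h1.2 hW
    exact ⟨.loopTrue (by rw [Test.eval_eq hN hs _ hw.1]; simpa using hb) h1.1 h2.1, h2.2⟩
  | loopFalse hb =>
    have hw := pow_le_of_add hN hW
    exact ⟨.loopFalse (by rw [Test.eval_eq hN hs _ hw.1]; simpa using hb), hs⟩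

/-! ### Correctness triples with time -/

/-- The arrays of integers, and of reals, that a program may modify. -/
def Program.im : Program → List ℕ
  | .skip => []
  | .setInt a _ _ => [a]
  | .setReal _ _ _ => []
  | .seq p q => p.im ++ q.im
  | .ite _ p q => p.im ++ q.im
  | .loop _ p => p.im

def Program.rm : Program → List ℕ
  | .skip => []
  | .setInt _ _ _ => []
  | .setReal a _ _ => [a]
  | .seq p q => p.rm ++ q.rm
  | .ite _ p q => p.rm ++ q.rm
  | .loop _ p => p.rm

/-- A syntactic frame rule: arrays that the text of `p` does not assign keep their contents. That an
array is not assigned can be decided, which transports the facts about all other tables. -/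
def Frame (p : Program) (s s' : Store) : Prop :=
  (∀ a, a ∉ p.im → s'.ints a = s.ints a) ∧ ∀ a, a ∉ p.rm → s'.reals a = s.reals a

theorem Frame.refl (p : Program) (s : Store) : Frame p s s := ⟨fun _ _ => rfl, fun _ _ => rfl⟩

theorem Frame.trans {p : Program} {s s' s'' : Store} (h : Frame p s s') (h' : Frame p s' s'') :
    Frame p s s'' :=
  ⟨fun a ha => (h'.1 a ha).trans (h.1 a ha), fun a ha => (h'.2 a ha).trans (h.2 a ha)⟩

theorem Frame.weaken {p q : Program} {s s' : Store} (h : Frame p s s') (hi : p.im ⊆ q.im)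
    (hr : p.rm ⊆ q.rm) : Frame q s s' :=
  ⟨fun a ha => h.1 a fun h' => ha (hi h'), fun a ha => h.2 a fun h' => ha (hr h')⟩

theorem Ex.frame {p : Program} {s s' : Store} {t : ℕ} (h : Ex N p s s' t) : Frame p s s' := by
  induction h with
  | skip s => exact Frame.refl _ _
  | setInt h =>
    refine ⟨fun a ha => ?_, fun _ _ => rfl⟩; simp only [Program.im, List.mem_singleton] at ha
    simp [Store.setInt, ha]
  | setReal =>
    refine ⟨fun _ _ => rfl, fun a ha => ?_⟩; simp only [Program.rm, List.mem_singleton] at ha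
    simp [Store.setReal, ha]
  | seq _ _ ih₁ ih₂ =>
    exact (ih₁.weaken (List.subset_append_left _ _) (List.subset_append_left _ _)).trans
      (ih₂.weaken (List.subset_append_right _ _) (List.subset_append_right _ _))
  | iteTrue _ _ ih => exact ih.weaken (List.subset_append_left _ _) (List.subset_append_left _ _)
  | iteFalse _ _ ih => exact ih.weaken (List.subset_append_right _ _) (List.subset_append_right _ _)
  | loopTrue _ _ _ ih₁ ih₂ => exact (ih₁.weaken (List.Subset.refl _) (List.Subset.refl _)).trans ih₂
  | loopFalse _ => exact Frame.refl _ _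

/-- `p` started in `s` terminates in some `s'` after `t` steps with `Q s' t`. -/
def Tm (N : ℕ) (p : Program) (s : Store) (Q : Store → ℕ → Prop) : Prop :=
  ∃ s' t, Ex N p s s' t ∧ Q s' t

/-- `p` started in `s` terminates after at most `t` steps in some `s'` with `Q s'`. -/
def Tr (N : ℕ) (p : Program) (s : Store) (t : ℕ) (Q : Store → Prop) : Prop :=
  Tm N p s fun s' t' => t' ≤ t ∧ Q s'

theorem Tm.mono {p : Program} {s : Store} {Q Q' : Store → ℕ → Prop} (h : Tm N p s Q)
    (hQ : ∀ s' t, Frame p s s' → Q s' t → Q' s' t) : Tm N p s Q' := by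
  obtain ⟨s', t, h1, h2⟩ := h; exact ⟨s', t, h1, hQ s' t h1.frame h2⟩

theorem Tr.mono {p : Program} {s : Store} {t t' : ℕ} {Q Q' : Store → Prop} (h : Tr N p s t Q)
    (ht : t ≤ t') (hQ : ∀ s', Frame p s s' → Q s' → Q' s') : Tr N p s t' Q' :=
  Tm.mono h fun s' _ hf h' => ⟨h'.1.trans ht, hQ s' hf h'.2⟩

theorem Tm.seq {p q : Program} {s : Store} {Q : Store → ℕ → Prop}
    (h : Tm N p s fun s₁ t₁ => Tm N q s₁ fun s₂ t₂ => Q s₂ (t₁ + t₂)) : Tm N (.seq p q) s Q := by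
  obtain ⟨s₁, t₁, h1, s₂, t₂, h2, h3⟩ := h; exact ⟨s₂, _, h1.seq h2, h3⟩

theorem Tr.seq {p q : Program} {s : Store} {t₁ t₂ : ℕ} {R Q : Store → Prop}
    (h : Tr N p s t₁ R) (h' : ∀ s₁, Frame p s s₁ → R s₁ → Tr N q s₁ t₂ Q) :
    Tr N (.seq p q) s (t₁ + t₂) Q := by
  obtain ⟨s₁, t, h1, h2, h3⟩ := h; obtain ⟨s₂, t', h4, h5, h6⟩ := h' s₁ h1.frame h3
  exact ⟨s₂, _, h1.seq h4, by omega, h6⟩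

theorem Tr.ite {b : Test} {p q : Program} {s : Store} {t : ℕ} {Q : Store → Prop}
    (h : b.Holds s → Tr N p s t Q) (h' : ¬ b.Holds s → Tr N q s t Q) :
    Tr N (.ite b p q) s (b.cost + t) Q := by
  by_cases hb : b.Holds s
  · obtain ⟨s₁, t', h1, h2, h3⟩ := h hb; exact ⟨s₁, _, .iteTrue hb h1, by omega, h3⟩
  · obtain ⟨s₁, t', h1, h2, h3⟩ := h' hb; exact ⟨s₁, _, .iteFalse hb h1, by omega, h3⟩

theorem Test.cost_pos (b : Test) : 1 ≤ b.cost := by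
  cases b <;> simp only [Test.cost] <;> omega

/-- The rule for loops with a potential. -/
theorem Tm.loop {b : Test} {p : Program} (I : Store → Prop) (Φ : Store → ℕ) {s : Store} (hI : I s)
    (h : ∀ s', Frame (.loop b p) s s' → I s' → b.Holds s' →
      Tm N p s' fun s'' t => I s'' ∧ t + b.cost + Φ s'' ≤ Φ s') :
    Tm N (.loop b p) s fun s' t => I s' ∧ ¬ b.Holds s' ∧ t + Φ s' ≤ Φ s + b.cost := by
  suffices ∀ m s', Φ s' ≤ m → Frame (.loop b p) s s' → I s' →
      Tm N (.loop b p) s' fun s'' t => I s'' ∧ ¬ b.Holds s'' ∧ t + Φ s'' ≤ Φ s' + b.cost from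
    this _ s le_rfl (Frame.refl _ _) hI
  intro m
  induction m with
  | zero =>
    intro s' hm hf hI'; by_cases hb : b.Holds s'
    · obtain ⟨s₁, t₁, h1, h2, h3⟩ := h s' hf hI' hb; have := b.cost_pos; omega
    · exact ⟨s', _, .loopFalse hb, hI', hb, by omega⟩
  | succ m ih =>
    intro s' hm hf hI'; by_cases hb : b.Holds s'
    · obtain ⟨s₁, t₁, h1, h2, h3⟩ := h s' hf hI' hb; have := b.cost_pos
      obtain ⟨s₂, t₂, h4, h5, h6, h7⟩ := ih s₁ (by omega)
        (hf.trans (h1.frame.weaken (List.Subset.refl _) (List.Subset.refl _))) h2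
      exact ⟨s₂, _, .loopTrue hb h1 h4, h5, h6, by omega⟩
    · exact ⟨s', _, .loopFalse hb, hI', hb, by omega⟩

/-! ### Notation for programs -/

instance : Add IExp := ⟨.add⟩
instance : Sub IExp := ⟨.sub⟩
instance : Mul IExp := ⟨.mul⟩
instance : Div IExp := ⟨.div⟩
instance (n : ℕ) : OfNat IExp n := ⟨.const n⟩
instance : Add RExp := ⟨.add⟩
instance : Sub RExp := ⟨.sub⟩

/-- Cell `0` of an integer array, used as a variable. -/
def iv (a : ℕ) : IExp := .read a 0

infixr:60 " ;; " => Program.seq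

theorem IExp.val_add (s : Store) (e f : IExp) : (e + f).val s = e.val s + f.val s := rfl
theorem IExp.val_sub (s : Store) (e f : IExp) : (e - f).val s = e.val s - f.val s := rfl
theorem IExp.val_mul (s : Store) (e f : IExp) : (e * f).val s = e.val s * f.val s := rfl
theorem IExp.val_div (s : Store) (e f : IExp) : (e / f).val s = e.val s / f.val s := rfl
theorem IExp.val_zero (s : Store) : IExp.val s 0 = 0 := rfl
theorem IExp.val_one (s : Store) : IExp.val s 1 = 1 := rfl
theorem IExp.val_two (s : Store) : IExp.val s 2 = 2 := rfl
theorem IExp.val_three (s : Store) : IExp.val s 3 = 3 := rfl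
theorem IExp.val_read (s : Store) (a : ℕ) (i : IExp) : (IExp.read a i).val s = s.ints a (i.val s) :=
  rfl
theorem IExp.val_iv (s : Store) (a : ℕ) : (iv a).val s = s.ints a 0 := rfl
theorem RExp.val_add (s : Store) (e f : RExp) : (e + f).val s = e.val s + f.val s := rfl
theorem RExp.val_sub (s : Store) (e f : RExp) : (e - f).val s = e.val s - f.val s := rfl
theorem RExp.val_read (s : Store) (a : ℕ) (i : IExp) : (RExp.read a i).val s = s.reals a (i.val s) :=
  rfl
theorem RExp.val_zero (s : Store) : RExp.zero.val s = 0 := rfl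
theorem Test.holds_intLe (s : Store) (e f : IExp) : (Test.intLe e f).Holds s ↔ e.val s ≤ f.val s :=
  Iff.rfl
theorem Test.holds_realLe (s : Store) (e f : RExp) :
    (Test.realLe e f).Holds s ↔ e.val s ≤ f.val s := Iff.rfl

theorem Store.ints_setInt (s : Store) (a i v a' i' : ℕ) :
    (s.setInt a i v).ints a' i' = if a' = a ∧ i' = i then v else s.ints a' i' := rfl
theorem Store.reals_setInt (s : Store) (a i v : ℕ) : (s.setInt a i v).reals = s.reals := rfl
theorem Store.reals_setReal (s : Store) (a i a' i' : ℕ) (v : ℝ) :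
    (s.setReal a i v).reals a' i' = if a' = a ∧ i' = i then v else s.reals a' i' := rfl
theorem Store.ints_setReal (s : Store) (a i : ℕ) (v : ℝ) : (s.setReal a i v).ints = s.ints := rfl
theorem Store.ints_setInt_ne (s : Store) {a a' : ℕ} (i v : ℕ) (h : a' ≠ a) :
    (s.setInt a i v).ints a' = s.ints a' := by
  funext j; rw [Store.ints_setInt, if_neg fun h' => h h'.1]
theorem Store.reals_setReal_ne (s : Store) {a a' : ℕ} (i : ℕ) (v : ℝ) (h : a' ≠ a) :
    (s.setReal a i v).reals a' = s.reals a' := by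
  funext j; rw [Store.reals_setReal, if_neg fun h' => h h'.1]

attribute [simp] IExp.val_add IExp.val_sub IExp.val_mul IExp.val_div IExp.val_zero IExp.val_one
  IExp.val_two IExp.val_three IExp.val_read
  IExp.val_iv RExp.val_add RExp.val_sub RExp.val_read RExp.val_zero Test.holds_intLe
  Test.holds_realLe Store.ints_setInt Store.reals_setInt Store.reals_setReal Store.ints_setReal
  Store.ints_setInt_ne Store.reals_setReal_ne

/-! ### Programs without loops -/

/-- Weakest preconditions for straight-line code. Loops get `False`, since they are handled by
`Tm.loop` and `Tm.forUp`. -/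
def wp (N : ℕ) : Program → (Store → Prop) → Store → Prop
  | .skip, Q, s => Q s
  | .setInt a i e, Q, s => e.val s < N ∧ Q (s.setInt a (i.val s) (e.val s))
  | .setReal a i x, Q, s => Q (s.setReal a (i.val s) (x.val s))
  | .seq p q, Q, s => wp N p (wp N q Q) s
  | .ite b p q, Q, s => (b.Holds s → wp N p Q s) ∧ (¬ b.Holds s → wp N q Q s)
  | .loop _ _, _, _ => False

/-- An upper bound on the running time of a program without loops. -/
def Program.cst : Program → ℕ
  | .skip => 1
  | .setInt _ i e => i.cost + e.cost + 1
  | .setReal _ i x => i.cost + x.cost + 1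
  | .seq p q => p.cst + q.cst
  | .ite b p q => b.cost + (p.cst + q.cst)
  | .loop _ _ => 0

theorem Tr.of_wp {p : Program} {s : Store} {Q : Store → Prop} (h : wp N p Q s) :
    Tr N p s p.cst Q := by
  induction p generalizing s Q with
  | skip => exact ⟨s, _, .skip s, le_rfl, h⟩
  | setInt a i e => exact ⟨_, _, .setInt h.1, le_rfl, h.2⟩
  | setReal a i x => exact ⟨_, _, .setReal, le_rfl, h⟩
  | seq p q ihp ihq => exact Tr.seq (ihp h) fun s' _ h' => ihq h'
  | ite b p q ihp ihq =>
    exact Tr.ite (fun hb => (ihp (h.1 hb)).mono (Nat.le_add_right _ _) fun _ _ h => h)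
      (fun hb => (ihq (h.2 hb)).mono (Nat.le_add_left _ _) fun _ _ h => h)
  | loop b p => exact h.elim

theorem Tr.of_wp_le {p : Program} {s : Store} {Q : Store → Prop} {t : ℕ} (h : wp N p Q s)
    (ht : p.cst ≤ t := by decide) : Tr N p s t Q := (Tr.of_wp h).mono ht fun _ _ h => h

/-! ### Counting loops -/

def Program.forUp (v : ℕ) (hi : IExp) (body : Program) : Program :=
  .setInt v 0 0 ;; .loop (.intLe (iv v + 1) hi) (body ;; .setInt v 0 (iv v + 1))

/-- The bounds `T k` may vary with the round, and the potential `Φ` carries savings from one round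
to another. The bound `hi` is evaluated again in every round, whence `hhi`. The constant `20` covers
the test and the update of the counter. -/
theorem Tm.forUp {v : ℕ} {hi : IExp} {body : Program} {s : Store} {m : ℕ} (T : ℕ → ℕ)
    (Φ : Store → ℕ) (Inv : ℕ → Store → Prop) (hm : m < N) (hv : v ∉ body.im)
    (h0 : Inv 0 (s.setInt v 0 0))
    (hhi : ∀ k ≤ m, ∀ s', Frame (.forUp v hi body) s s' → s'.ints v 0 = k → Inv k s' →
      hi.val s' = m)
    (hb : ∀ k < m, ∀ s', Frame (.forUp v hi body) s s' → s'.ints v 0 = k → Inv k s' →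
      Tm N body s' fun s'' t => Inv (k + 1) (s''.setInt v 0 (k + 1)) ∧
        t + Φ (s''.setInt v 0 (k + 1)) ≤ T k + Φ s') :
    Tm N (.forUp v hi body) s fun s' t => Inv m s' ∧
      t + Φ s' ≤ (∑ k ∈ Finset.range m, (T k + hi.cost + 20)) + hi.cost + 20 + Φ (s.setInt v 0 0) := by
  have hN : 0 < N := by omega
  have key : ∀ j k s', k + j = m → Frame (.forUp v hi body) s s' → s'.ints v 0 = k → Inv k s' →
      Tm N (.loop (.intLe (iv v + 1) hi) (body ;; .setInt v 0 (iv v + 1))) s' fun s'' t =>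
        Inv m s'' ∧ t + Φ s'' ≤ (∑ i ∈ Finset.Ico k m, (T i + hi.cost + 20)) + hi.cost + 10 + Φ s' := by
    intro j
    have hcost : (Test.intLe (iv v + 1) hi).cost = hi.cost + 5 := by
      show (1 + 1 + 1 + 1) + hi.cost + 1 = _; omega
    induction j with
    | zero =>
      intro k s' hk hf hkv hI; obtain rfl : k = m := by omega
      refine ⟨s', _, .loopFalse ?_, hI, ?_⟩
      · simp [hkv, hhi k le_rfl s' hf hkv hI]
      · rw [hcost]; omega
    | succ j ih =>
      intro k s' hk hf hkv hI; obtain ⟨s₁, t₁, h1, h2, h3⟩ := hb k (by omega) s' hf hkv hI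
      have hkv₁ : s₁.ints v 0 = k := by rw [h1.frame.1 v hv, hkv]
      have e2 : Ex N (.setInt v 0 (iv v + 1)) s₁ (s₁.setInt v 0 (k + 1)) 6 := by
        have := Ex.setInt (N := N) (s := s₁) (a := v) (i := 0) (e := iv v + 1) (by simp [hkv₁]; omega)
        simp only [hkv₁, IExp.val_zero, IExp.val_add, IExp.val_iv, IExp.val_one] at this; exact this
      have hf2 : Frame (.forUp v hi body) s (s₁.setInt v 0 (k + 1)) := by
        refine hf.trans ((h1.seq e2).frame.weaken ?_ ?_)
        · exact List.subset_append_right _ _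
        · exact List.subset_append_right _ _
      obtain ⟨s₂, t₂, h4, h5, h6⟩ := ih (k + 1) _ (by omega) hf2 (by simp) h2
      refine ⟨s₂, _, .loopTrue ?_ (h1.seq e2) h4, h5, ?_⟩
      · simp [hkv, hhi k (by omega) s' hf hkv hI]; omega
      · rw [hcost, Finset.sum_eq_sum_Ico_succ_bot (show k < m by omega)]; omega
  have e1 : Ex N (.setInt v 0 0) s (s.setInt v 0 0) 3 :=
    Ex.setInt (N := N) (s := s) (a := v) (i := 0) (e := 0) (by simpa using hN)
  obtain ⟨s', t, h1, h2, h3⟩ := key m 0 (s.setInt v 0 0) (by omega)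
    (e1.frame.weaken (List.subset_append_left _ _) (List.subset_append_left _ _)) (by simp) h0
  refine ⟨s', _, e1.seq h1, h2, ?_⟩; rw [Finset.range_eq_Ico]; omega

theorem Tr.forUp {v : ℕ} {hi : IExp} {body : Program} {s : Store} {m : ℕ} (T : ℕ)
    (Inv : ℕ → Store → Prop) (hm : m < N) (hv : v ∉ body.im)
    (h0 : Inv 0 (s.setInt v 0 0))
    (hhi : ∀ k ≤ m, ∀ s', Frame (.forUp v hi body) s s' → s'.ints v 0 = k → Inv k s' →
      hi.val s' = m)
    (hb : ∀ k < m, ∀ s', Frame (.forUp v hi body) s s' → s'.ints v 0 = k → Inv k s' →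
      Tr N body s' T fun s'' => Inv (k + 1) (s''.setInt v 0 (k + 1))) :
    Tr N (.forUp v hi body) s ((m + 1) * (T + hi.cost + 20)) (Inv m) := by
  refine (Tm.forUp (fun _ => T) (fun _ => 0) Inv hm hv h0 hhi fun k hk s' hf hkv hI =>
    Tm.mono (hb k hk s' hf hkv hI) fun s'' t _ h => ⟨h.2, by simpa using h.1⟩).mono
    fun s' t _ h => ⟨?_, h.1⟩
  have h2 := h.2; rw [Finset.sum_const, Finset.card_range, smul_eq_mul] at h2; nlinarith

/-! ### Costs that may be infinite -/

/-- Cell `i` of array `a` as a cost: the integer cell tells whether it is finite. -/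
noncomputable def Store.ext (s : Store) (a i : ℕ) : WithTop ℝ :=
  if s.ints a i = 0 then ⊤ else (s.reals a i : ℝ)

noncomputable def Store.setExt (s : Store) (a i : ℕ) (x : ℝ) : Store := (s.setReal a i x).setInt a i 1

@[simp] theorem Store.ext_setExt (s : Store) (a i : ℕ) (x : ℝ) (a' i' : ℕ) :
    (s.setExt a i x).ext a' i' = if a' = a ∧ i' = i then (x : WithTop ℝ) else s.ext a' i' := by
  unfold Store.ext Store.setExt; by_cases h : a' = a ∧ i' = i
  · simp [h]
  · simp [h]

@[simp] theorem Store.ext_setInt (s : Store) {a a' : ℕ} (i v : ℕ) (i' : ℕ) (h : a' ≠ a) :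
    (s.setInt a i v).ext a' i' = s.ext a' i' := by
  simp [Store.ext, h]

@[simp] theorem Store.ints_setExt_ne (s : Store) {a a' : ℕ} (i : ℕ) (x : ℝ) (h : a' ≠ a) :
    (s.setExt a i x).ints a' = s.ints a' := by
  simp [Store.setExt, h]

@[simp] theorem Store.reals_setExt_ne (s : Store) {a a' : ℕ} (i : ℕ) (x : ℝ) (h : a' ≠ a) :
    (s.setExt a i x).reals a' = s.reals a' := by
  simp [Store.setExt, h]

theorem Store.ext_congr {s s' : Store} {a : ℕ} (h : s'.ints a = s.ints a)
    (h' : s'.reals a = s.reals a) (i : ℕ) : s'.ext a i = s.ext a i := by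
  simp [Store.ext, h, h']

theorem Frame.int {p : Program} {s s' : Store} (h : Frame p s s') (a : ℕ)
    (ha : a ∉ p.im := by decide) : s'.ints a = s.ints a := h.1 a ha

theorem Frame.real {p : Program} {s s' : Store} (h : Frame p s s') (a : ℕ)
    (ha : a ∉ p.rm := by decide) : s'.reals a = s.reals a := h.2 a ha

theorem Frame.ext {p : Program} {s s' : Store} (h : Frame p s s') {a i : ℕ}
    (hi : a ∉ p.im := by decide) (hr : a ∉ p.rm := by decide) : s'.ext a i = s.ext a i :=
  Store.ext_congr (h.1 a hi) (h.2 a hr) i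

theorem IExp.val_setReal (s : Store) (a i : ℕ) (x : ℝ) (e : IExp) :
    e.val (s.setReal a i x) = e.val s := by
  induction e with
  | const c => rfl
  | read b j ih => simp [ih]
  | add e f h1 h2 => simp only [IExp.val, h1, h2]
  | sub e f h1 h2 => simp only [IExp.val, h1, h2]
  | mul e f h1 h2 => simp only [IExp.val, h1, h2]
  | div e f h1 h2 => simp only [IExp.val, h1, h2]

/-- `a[i] := min (a[i], max (b[j], c[k]))`, followed by `p` if this changes `a[i]`. -/
def Program.relax (a : ℕ) (i : IExp) (b : ℕ) (j : IExp) (c : ℕ) (k : IExp) (p : Program) : Program :=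
  let set (x : RExp) : Program := .setReal a i x ;; .setInt a i 1 ;; p
  let upd (x : RExp) : Program :=
    .ite (.intLe (.read a i) 0) (set x) (.ite (.realLe (.read a i) x) .skip (set x))
  .ite (.intLe 1 (.read b j)) (.ite (.intLe 1 (.read c k))
    (.ite (.realLe (.read b j) (.read c k)) (upd (.read c k)) (upd (.read b j))) .skip) .skip

/-- Integer cells decide finiteness before any reals are compared, so the comparison of costs in
`WithTop ℝ` becomes a few tests. -/
theorem wp_relax {a b c : ℕ} {i j k : IExp} {p : Program} {Q : Store → Prop} {s : Store}
    (hN : 1 < N)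
    (h1 : ∀ x : ℝ, max (s.ext b (j.val s)) (s.ext c (k.val s)) = (x : WithTop ℝ) →
      (x : WithTop ℝ) < s.ext a (i.val s) → wp N p Q (s.setExt a (i.val s) x))
    (h2 : s.ext a (i.val s) ≤ max (s.ext b (j.val s)) (s.ext c (k.val s)) → Q s) :
    wp N (.relax a i b j c k p) Q s := by
  unfold Program.relax
  simp only [wp, Test.holds_intLe, IExp.val_zero, IExp.val_one, IExp.val_read, Test.holds_realLe, RExp.val_read,
    IExp.val_setReal, hN, true_and]
  have upd : ∀ x : ℝ, max (s.ext b (j.val s)) (s.ext c (k.val s)) = (x : WithTop ℝ) →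
      (s.ints a (i.val s) ≤ 0 → wp N p Q ((s.setReal a (i.val s) x).setInt a (i.val s) 1)) ∧
      (¬ s.ints a (i.val s) ≤ 0 → (s.reals a (i.val s) ≤ x → Q s) ∧
        (¬ s.reals a (i.val s) ≤ x → wp N p Q ((s.setReal a (i.val s) x).setInt a (i.val s) 1))) := by
    intro x hx; refine ⟨fun h => h1 x hx ?_, fun h => ⟨fun h' => h2 ?_, fun h' => h1 x hx ?_⟩⟩
    · rw [Store.ext, if_pos (by omega)]; exact WithTop.coe_lt_top x
    · rw [hx, Store.ext, if_neg (by omega)]; exact_mod_cast h'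
    · rw [Store.ext, if_neg (by omega)]; exact_mod_cast not_le.1 h'
  refine ⟨fun hb => ⟨fun hc => ⟨fun h => upd _ ?_, fun h => upd _ ?_⟩, fun hc => h2 ?_⟩,
    fun hb => h2 ?_⟩
  · rw [Store.ext, if_neg (by omega), Store.ext, if_neg (by omega)]
    exact max_eq_right (by exact_mod_cast h)
  · rw [Store.ext, if_neg (by omega), Store.ext, if_neg (by omega)]
    exact max_eq_left (by exact_mod_cast (not_le.1 h).le)
  · have : s.ext c (k.val s) = ⊤ := by rw [Store.ext, if_pos (by omega)]
    simp [this]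
  · have : s.ext b (j.val s) = ⊤ := by rw [Store.ext, if_pos (by omega)]
    simp [this]

end

/-! ### Preprocessing: bucket sort by legs, powers of two, positions -/

section
-- Tables indexed by a leg and a number on it have rows of `n + 1` cells, because the number may
-- equal the count of the leg (the empty suffix).
theorem addr_inj {n l i l' i' : ℕ} (hi : i ≤ n) (hi' : i' ≤ n) :
    l * (n + 1) + i = l' * (n + 1) + i' ↔ l = l' ∧ i = i' := by
  constructor
  · intro h
    have h1 : (l * (n + 1) + i) / (n + 1) = l := by
      rw [mul_comm, Nat.mul_add_div (by omega), Nat.div_eq_of_lt (by omega), add_zero]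
    have h2 : (l' * (n + 1) + i') / (n + 1) = l' := by
      rw [mul_comm, Nat.mul_add_div (by omega), Nat.div_eq_of_lt (by omega), add_zero]
    grind
  · rintro ⟨rfl, rfl⟩; rfl

/-! ### Sorting by legs

The points given by integer array `1 + k` and real array `k` are sorted by legs. -/

/-- `k` is `0` for the users and `1` for the facilities. Array `50 + k` holds the counts of the
legs, `52 + k` the numbers on the legs, `54 + k` and `56 + k` the truncated list and its length, `58
+ k` the points sorted by legs. Variable `30` is the current point, `31` its leg, `32` its number
there. -/
def Program.bucketBody (k : ℕ) : Program := .setInt 31 0 (.read (1 + k) (iv 30)) ;;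
  .setInt 32 0 (.read (50 + k) (iv 31)) ;;
  .setInt (58 + k) (iv 31 * (.read 0 (.const (2 + k)) + 1) + iv 32) (iv 30) ;;
  .setReal (58 + k) (iv 31 * (.read 0 (.const (2 + k)) + 1) + iv 32) (.read k (iv 30)) ;;
  .setInt (52 + k) (iv 30) (iv 32) ;;
  .setInt (50 + k) (iv 31) (iv 32 + 1) ;;
  .ite (.intLe (iv 32 + 1) (iv 16))
    (.setInt (54 + k) (iv (56 + k)) (iv 30) ;; .setInt (56 + k) 0 (iv (56 + k) + 1)) .skip

def Program.bucket (k : ℕ) : Program := .forUp 30 (.read 0 (.const (2 + k))) (.bucketBody k)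

/-- The state after the first `j` points have been sorted. -/
structure Bucketed (U : Users) (K k j : ℕ) (s : Store) : Prop where
  cnt : ∀ l, s.ints (50 + k) l = Nat.count (fun v => U.leg v = l) j
  idx : ∀ u < j, s.ints (52 + k) u = U.idx u
  size : s.ints (56 + k) 0 = U.size K j
  tl : ∀ g < U.size K j, s.ints (54 + k) g = U.tl K g
  usr : ∀ u < j, s.ints (58 + k) (U.leg u * (U.n + 1) + U.idx u) = u
  pos : ∀ u < j, s.reals (58 + k) (U.leg u * (U.n + 1) + U.idx u) = U.pos u

theorem IExp.val_const (s : Store) (c : ℕ) : (IExp.const c).val s = c := rfl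

variable {N : ℕ}

theorem bucket_spec {U : Users} {K k : ℕ} {s : Store} (hk : k = 0 ∨ k = 1)
    (hn : s.ints 0 (2 + k) = U.n) (hK : s.ints 16 0 = K)
    (hleg : ∀ u < U.n, s.ints (1 + k) u = U.leg u) (hpos : ∀ u < U.n, s.reals k u = U.pos u)
    (hcnt : ∀ l, s.ints (50 + k) l = 0) (hG : s.ints (56 + k) 0 = 0)
    (hN : U.n + 1 < N) (hNd : U.d < N) :
    Tr N (.bucket k) s ((U.n + 1) * ((Program.bucketBody k).cst + 30))
      (Bucketed U K k U.n) := by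
  have hmain : Tr N (.bucket k) s ((U.n + 1) * ((Program.bucketBody k).cst +
      (IExp.read 0 (.const (2 + k))).cost + 20)) (Bucketed U K k U.n) := by
    refine Tr.forUp _ (Bucketed U K k) (by omega) ?_ ?_ ?_ ?_
    · rcases hk with rfl | rfl <;> decide
    · rcases hk with rfl | rfl <;> constructor <;> simp [hcnt, hG, Users.size]
    · intro j _ s' hf _ _
      have : s'.ints 0 = s.ints 0 := hf.1 0 (by rcases hk with rfl | rfl <;> decide)
      simp [this, hn, IExp.val_const]
    · intro j hj s' hf hjv hI
      have h0 : s'.ints 0 = s.ints 0 := hf.1 0 (by rcases hk with rfl | rfl <;> decide)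
      have h1 : s'.ints (1 + k) = s.ints (1 + k) := hf.1 _ (by rcases hk with rfl | rfl <;> decide)
      have h16 : s'.ints 16 = s.ints 16 := hf.1 _ (by rcases hk with rfl | rfl <;> decide)
      have hr0 : s'.reals k = s.reals k := hf.2 _ (by rcases hk with rfl | rfl <;> decide)
      have hl := hleg j hj; have hp := hpos j hj; have hld := U.leg_lt j hj
      have hidx : Nat.count (fun v => U.leg v = U.leg j) j = U.idx j := rfl
      have hidxj : U.idx j ≤ j := Nat.count_le _; have hsz : U.size K j ≤ j := Nat.count_le _
      have hsucc : U.size K (j + 1) = U.size K j + if U.idx j < K then 1 else 0 := Nat.count_succ ..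
      have hix : ∀ u < j, U.idx u ≤ U.n := fun u hu => (Nat.count_le _ : U.idx u ≤ u).trans (by omega)
      have hne : ∀ u < j, ¬ (U.leg u * (U.n + 1) + U.idx u = U.leg j * (U.n + 1) + U.idx j) := by
        intro u hu h; rw [addr_inj (hix u hu) (by omega)] at h; have := (U.idx_lt_idx h.1).2 hu
        omega
      have key : ∀ s'' : Store,
          s''.ints (50 + k) = (fun l => if l = U.leg j then U.idx j + 1 else s'.ints (50 + k) l) →
          s''.ints (52 + k) = (fun u => if u = j then U.idx j else s'.ints (52 + k) u) →
          s''.ints (58 + k) = (fun a => if a = U.leg j * (U.n + 1) + U.idx j then j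
            else s'.ints (58 + k) a) →
          s''.reals (58 + k) = (fun a => if a = U.leg j * (U.n + 1) + U.idx j then U.pos j
            else s'.reals (58 + k) a) →
          s''.ints (56 + k) 0 = U.size K (j + 1) →
          (∀ g < U.size K (j + 1), s''.ints (54 + k) g = U.tl K g) → Bucketed U K k (j + 1) s'' := by
        intro s'' e50 e52 e58 e58' e56 e54
        refine ⟨fun l => ?_, fun u hu => ?_, e56, e54, fun u hu => ?_, fun u hu => ?_⟩
        · rw [e50, Nat.count_succ]; by_cases h : l = U.leg j
          · subst h; simp [hidx]
          · simp [h, Ne.symm h, hI.cnt]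
        · rw [e52]; rcases Nat.lt_succ_iff_lt_or_eq.1 hu with h | rfl
          · simp only [if_neg h.ne, hI.idx u h]
          · simp
        · rw [e58]; rcases Nat.lt_succ_iff_lt_or_eq.1 hu with h | rfl
          · simp only [if_neg (hne u h), hI.usr u h]
          · simp
        · rw [e58']; rcases Nat.lt_succ_iff_lt_or_eq.1 hu with h | rfl
          · simp only [if_neg (hne u h), hI.pos u h]
          · simp
      have htl : ∀ g, ¬ g = U.size K j → g < U.size K j + 1 → s'.ints (54 + k) g = U.tl K g :=
        fun g h1 h2 => hI.tl g (by omega)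
      have hc := hI.cnt (U.leg j); have hs' := hI.size; refine Tr.of_wp ?_; rcases hk with rfl | rfl
      all_goals
        simp [Program.bucketBody, wp, IExp.val_const, h0, h1, h16, hr0, hjv, hl, hp, hn, hK, hc, hidx, hs']
        refine ⟨by omega, by omega, by omega, by omega, by omega, ?_, ?_⟩
        · intro hle; refine ⟨by omega, by omega, ?_⟩; have hlt : U.idx j < K := hle
          rw [if_pos hlt] at hsucc; apply key
          · funext l; simp
          · funext l; simp
          · funext l; simp
          · funext l; simp
          · simp [hsucc]
          · intro g hg; rw [hsucc] at hg; by_cases h : g = U.size K j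
            · subst h; simp [U.tl_size hlt]
            · simp [h, htl g h hg]
        · intro hle; rw [if_neg (by omega), add_zero] at hsucc; apply key
          · funext l; simp
          · funext l; simp
          · funext l; simp
          · funext l; simp
          · simp [hsucc, hs']
          · intro g hg; rw [hsucc] at hg; simpa using hI.tl g hg
  refine hmain.mono (Nat.mul_le_mul_left _ ?_) fun s' _ h => h
  have : (IExp.read 0 (.const (2 + k))).cost = 2 := rfl; omega

end

section
variable {N : ℕ}

theorem pair_inj {b l i l' i' : ℕ} (hi : i < b) (hi' : i' < b) :
    l * b + i = l' * b + i' ↔ l = l' ∧ i = i' := by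
  obtain ⟨b, rfl⟩ : ∃ c, b = c + 1 := ⟨b - 1, by omega⟩; exact addr_inj (by omega) (by omega)

/-- Powers of two. -/
def Program.powers : Program := .setInt 10 0 1 ;;
  .forUp 30 (.read 0 0) (.setInt 10 (iv 30 + 1) (.read 10 (iv 30) * 2)) ;;
  .setInt 17 0 (.read 10 (.read 0 0))

theorem powers_spec : ∃ c, ∀ (N d : ℕ) (s : Store), s.ints 0 0 = d → 2 ^ d < N →
    Tr N .powers s (c * (d + 1)) fun s' =>
      (∀ l ≤ d, s'.ints 10 l = 2 ^ l) ∧ s'.ints 17 0 = 2 ^ d := by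
  refine ⟨60, fun N d s hd hN => ?_⟩; have hdN : d < 2 ^ d := Nat.lt_two_pow_self
  refine Tr.mono (Tr.seq (Tr.of_wp (Q := fun s' => s'.ints 10 0 = 1) ?_) fun s₁ hf₁ h₁ =>
    Tr.seq (Tr.forUp 20 (m := d) (fun k s => ∀ l ≤ k, s.ints 10 l = 2 ^ l) (by omega)
      (by decide) ?_ ?_ ?_) fun s₂ hf₂ h₂ => Tr.of_wp (p := .setInt 17 0 (.read 10 (.read 0 0)))
      (Q := fun s' => (∀ l ≤ d, s'.ints 10 l = 2 ^ l) ∧ s'.ints 17 0 = 2 ^ d) ?_) ?_ fun _ _ h => h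
  · simp [wp]; omega
  · intro l hl; simp [h₁, show l = 0 by omega]
  · intro k _ s' hf _ _; have : s'.ints 0 = s.ints 0 := (hf.int 0).trans (hf₁.int 0)
    simp [this, hd]
  · intro k hk s' hf hk' h; refine Tr.of_wp_le ?_
    have h2 : 2 ^ (k + 1) ≤ 2 ^ d := Nat.pow_le_pow_right (by norm_num) hk
    simp only [wp, IExp.val_add, IExp.val_iv, hk', IExp.val_one, IExp.val_mul, IExp.val_read,
      h k le_rfl, IExp.val_two]
    rw [← pow_succ]; refine ⟨by omega, fun l hl => ?_⟩; rcases eq_or_ne l (k + 1) with rfl | hne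
    · simp
    · simp [hne, h l (by omega)]
  · have h0 : s₂.ints 0 = s.ints 0 := (hf₂.int 0).trans (hf₁.int 0); simp [wp, h0, hd]
    rw [h₂ d le_rfl]; grind
  · have e1 : (Program.setInt 10 0 1).cst = 3 := rfl
    have e2 : (Program.setInt 17 0 (.read 10 (.read 0 0))).cst = 5 := rfl
    have e3 : (IExp.read 0 0).cost = 2 := rfl; rw [e1, e2, e3]; omega

/-- The table of the functions `Users.posn`. -/
def Program.posTable : Program :=
  .forUp 30 (iv 56)
    -- Row `g + 1` is a copy of row `g` in which the entry for the leg of the `g`-th listed user is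
    -- raised by one.
    (.forUp 31 (.read 0 0)
      (.setInt 9 ((iv 30 + 1) * .read 0 0 + iv 31) (.read 9 (iv 30 * .read 0 0 + iv 31))) ;;
      .setInt 31 0 ((iv 30 + 1) * .read 0 0 + .read 1 (.read 54 (iv 30))) ;;
      .setInt 9 (iv 31) (.read 9 (iv 31) + 1))

theorem posTable_spec : ∃ c, ∀ (N K : ℕ) (U : Users) (s : Store), s.ints 0 0 = U.d →
    s.ints 56 0 = U.size K U.n → (∀ g < U.size K U.n, s.ints 54 g = U.tl K g) →
    (∀ u < U.n, s.ints 1 u = U.leg u) → (∀ l, s.ints 9 l = 0) →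
    U.n + 1 < N → (U.size K U.n + 1) * U.d < N →
    Tr N .posTable s (c * ((U.size K U.n + 1) * (U.d + 1))) fun s' =>
      ∀ g ≤ U.size K U.n, ∀ l < U.d, s'.ints 9 (g * U.d + l) = U.posn K g l := by
  refine ⟨200, fun N K U s hd hG htl hleg h9 hN hGN => ?_⟩; have hdN : U.d < N := by nlinarith
  refine Tr.mono (Tr.forUp (m := U.size K U.n) (100 * (U.d + 1)) (fun k s =>
    ∀ g ≤ k, ∀ l < U.d, s.ints 9 (g * U.d + l) = U.posn K g l) (by have := U.size_le (K := K); omega)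
      (by decide) ?_ ?_ ?_) ?_ fun _ _ h => h
  · intro g hg l hl; simp [h9, Users.posn, show g = 0 by omega]
  · intro k _ s' hf _ _; have : s'.ints 56 = s.ints 56 := hf.int _; simp [this, hG]
  · intro g hg s' hf hgv h; have e0 : s'.ints 0 = s.ints 0 := hf.int _
    have e1 : s'.ints 1 = s.ints 1 := hf.int _; have e54 : s'.ints 54 = s.ints 54 := hf.int _
    have hspec := U.tl_spec hg; have hlt := U.leg_lt _ hspec.1
    have hbnd : ∀ l < U.d, U.posn K g l ≤ U.n := fun l hl =>
      (U.posn_le_cnt hg.le l).trans (Nat.count_le _)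
    refine Tr.mono (Tr.seq (Tr.forUp 20 (m := U.d) (fun j s => (∀ g' ≤ g, ∀ l < U.d,
      s.ints 9 (g' * U.d + l) = U.posn K g' l) ∧ ∀ l < j, s.ints 9 ((g + 1) * U.d + l) = U.posn K g l)
      hdN (by decide) ?_ ?_ ?_) fun s₁ hf₁ h₁ => Tr.of_wp ?_) ?_ fun _ _ h => h
    · refine ⟨fun g' hg' l hl => ?_, fun l hl => by omega⟩; simpa using h g' hg' l hl
    · intro k _ s'' hf' _ _; have : s''.ints 0 = s'.ints 0 := hf'.int _; simp [this, e0, hd]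
    · intro l hl s'' hf' hlv h'; have e0' : s''.ints 0 = s'.ints 0 := hf'.int _
      have hgv' : s''.ints 30 0 = g := by rw [hf'.int _, hgv]
      refine Tr.of_wp_le ?_; simp [wp, hgv', hlv, e0', e0, hd, h'.1 g le_rfl l hl]
      refine ⟨by have := hbnd l hl; omega, ?_, ?_⟩
      · intro g' hg' l' hl'; rw [if_neg]
        · grind
        · rw [pair_inj hl' hl]; omega
      · intro l' hl'
        split_ifs with hc
        · rw [hc]
        · grind
    · have hgv₁ : s₁.ints 30 0 = g := by rw [hf₁.int _, hgv]
      have e0' : s₁.ints 0 = s.ints 0 := (hf₁.int _).trans e0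
      have e1' : s₁.ints 1 = s.ints 1 := (hf₁.int _).trans e1
      have e54' : s₁.ints 54 = s.ints 54 := (hf₁.int _).trans e54
      have hlt' : s.ints 1 (s.ints 54 g) = U.leg (U.tl K g) := by rw [htl g hg, hleg _ hspec.1]
      have hltN : (g + 1) * U.d + U.leg (U.tl K g) < N := by
        have : (g + 1) * U.d + U.d ≤ (U.size K U.n + 1) * U.d := by nlinarith
        omega
      simp [wp, hgv₁, e0', e1', e54', hd, hlt']; rw [h₁.2 _ hlt]
      refine ⟨hltN, by have := hbnd _ hlt; omega, ?_⟩; intro g' hg' l hl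
      rcases Nat.lt_or_ge g g' with hc | hc
      · obtain rfl : g' = g + 1 := by omega
        rw [U.posn_succ]
        split_ifs with c1 c2 c2
        · rw [c2]
        · omega
        · omega
        · grind
      · rw [if_neg, h₁.1 g' hc l hl]; rw [pair_inj hl hlt]; omega
    · have e1 : ((Program.setInt 31 0 ((iv 30 + 1) * .read 0 0 + .read 1 (.read 54 (iv 30)))) ;;
        Program.setInt 9 (iv 31) (.read 9 (iv 31) + 1)).cst ≤ 50 := by decide
      have e3 : (IExp.read 0 0).cost = 2 := rfl; rw [e3]; omega
  · have e3 : (iv 56).cost = 2 := rfl; rw [e3]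
    have : 100 * (U.d + 1) + 2 + 20 ≤ 200 * (U.d + 1) := by omega
    calc _ ≤ (U.size K U.n + 1) * (200 * (U.d + 1)) := Nat.mul_le_mul_left _ this
      _ = _ := by ring

end

/-! ### Clusters within one leg: a monotone queue -/

section
/-! ### Candidates for the end of the next cluster on a leg -/

section Deque

variable (lc : ℕ → ℕ → ℝ) (R : ℕ → WithTop ℝ)

/-- The cost of a suffix from `i` on if its first cluster ends before `j`. -/
noncomputable def cutCost (i j : ℕ) : WithTop ℝ := max (lc i j : WithTop ℝ) (R j)

/-- The candidates `st bt, …, st (tp - 1)` for starting points `i < i0`. -/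
structure Deque (cnt : ℕ) (st : ℕ → ℕ) (bt tp jn i0 : ℕ) : Prop where
  le : bt ≤ tp
  mem : ∀ x, bt ≤ x → x < tp → jn < st x ∧ st x ≤ cnt ∧ R (st x) ≠ ⊤
  -- Along the queue the ends move towards the center while `R` increases. An end that is nearer to
  -- the center and has no larger `R` would make the other one superfluous.
  anti : ∀ x y, bt ≤ x → x < y → y < tp → st y < st x ∧ R (st x) < R (st y)
  dom : ∀ j, jn < j → j ≤ cnt → R j ≠ ⊤ → ∀ i < i0, ∃ x, bt ≤ x ∧ x < tp ∧
    cutCost lc R i (st x) ≤ cutCost lc R i j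

variable {lc R} {cnt bt tp j i0 : ℕ} {st : ℕ → ℕ}
  (hlc : ∀ i i' j j', i' ≤ i → j ≤ j' → i < j → j' ≤ cnt → lc i j ≤ lc i' j')

theorem Deque.congr {R' : ℕ → WithTop ℝ} (h : Deque lc R cnt st bt tp j i0)
    (hR : ∀ j', j < j' → j' ≤ cnt → R' j' = R j') : Deque lc R' cnt st bt tp j i0 := by
  have hm : ∀ x, bt ≤ x → x < tp → R' (st x) = R (st x) := fun x h1 h2 =>
    hR _ (h.mem x h1 h2).1 (h.mem x h1 h2).2.1
  refine ⟨h.le, fun x h1 h2 => ?_, fun x y h1 h2 h3 => ?_, fun j' h1 h2 h3 i hi => ?_⟩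
  · rw [hm x h1 h2]; exact h.mem x h1 h2
  · rw [hm x h1 (h2.trans h3), hm y (h1.trans h2.le) h3]; exact h.anti x y h1 h2 h3
  · rw [hR j' h1 h2] at h3; obtain ⟨x, h4, h5, h6⟩ := h.dom j' h1 h2 h3 i hi
    exact ⟨x, h4, h5, by rw [cutCost, cutCost, hm x h4 h5, hR j' h1 h2]; exact h6⟩

theorem Deque.skip (h : Deque lc R cnt st bt tp j i0) (hj : R j = ⊤) :
    Deque lc R cnt st bt tp (j - 1) i0 := by
  refine ⟨h.le, fun x h1 h2 => ?_, h.anti, fun j' h1 h2 h3 i hi => ?_⟩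
  · have := h.mem x h1 h2; grind
  · refine h.dom j' ?_ h2 h3 i hi; rcases lt_or_eq_of_le (show j ≤ j' by omega) with h4 | rfl
    · exact h4
    · grind

theorem Deque.anti_i {i0' : ℕ} (h : Deque lc R cnt st bt tp j i0) (hi : i0' ≤ i0) :
    Deque lc R cnt st bt tp j i0' :=
  ⟨h.le, h.mem, h.anti, fun j' h1 h2 h3 i hi' => h.dom j' h1 h2 h3 i (by omega)⟩

-- The new end `j` gives shorter first clusters than all earlier ends, so an old candidate with `R`
-- at least `R j` is dominated for every later start and can be removed from the back.
include hlc in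
theorem Deque.push {tp' : ℕ} (h : Deque lc R cnt st bt tp j i0) (hj : R j ≠ ⊤) (hjc : j ≤ cnt)
    (hi0 : i0 ≤ j) (hj1 : 1 ≤ j) (h1 : bt ≤ tp') (h2 : tp' ≤ tp)
    (h3 : ∀ x, tp' ≤ x → x < tp → R j ≤ R (st x))
    (h4 : bt < tp' → R (st (tp' - 1)) < R j) :
    Deque lc R cnt (fun x => if x = tp' then j else st x) bt (tp' + 1) (j - 1) i0 := by
  refine ⟨by omega, fun x hx hx' => ?_, fun x y hx hxy hy => ?_, fun j' hj' hjc' hne i hi => ?_⟩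
  · by_cases hxt : x = tp'
    · simp only [hxt, if_true]; exact ⟨by omega, hjc, hj⟩
    · simp only [hxt, if_false]; have := h.mem x hx (by omega); grind
  · have hx' : x ≠ tp' := by omega
    by_cases hyt : y = tp'
    · subst hyt; simp only [hx', if_true, if_false]; refine ⟨(h.mem x hx (by omega)).1, ?_⟩
      rcases lt_or_eq_of_le (show x ≤ y - 1 by omega) with h5 | h5
      · exact (h.anti x (y - 1) hx h5 (by omega)).2.trans (h4 (by omega))
      · rw [h5]; exact h4 (by omega)
    · simp only [hx', hyt, if_false]; exact h.anti x y hx hxy (by omega)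
  · rcases lt_or_eq_of_le (show j ≤ j' by omega) with h5 | rfl
    · obtain ⟨x, hx, hx', hV⟩ := h.dom j' h5 hjc' hne i hi; by_cases hxt : x < tp'
      · grind
      · refine ⟨tp', h1, by omega, le_trans ?_ hV⟩; rw [if_pos rfl]; have hm := h.mem x hx hx'
        refine max_le_max ?_ (h3 x (by omega) hx')
        exact_mod_cast hlc i i j (st x) le_rfl hm.1.le (by omega) hm.2.1
    · exact ⟨tp', h1, by omega, by rw [if_pos rfl]⟩

-- If the next candidate is already as good as the front one, its larger `R` must be at most `lc` of
-- the front. The latter only grows as the start moves towards the center, so the front never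
-- recovers.
include hlc in
theorem Deque.step_anti {x i i' : ℕ} (h : Deque lc R cnt st bt tp j i0) (hx : bt ≤ x)
    (hx' : x + 1 < tp) (hij : i ≤ j) (hi : i' ≤ i)
    (hV : cutCost lc R i (st (x + 1)) ≤ cutCost lc R i (st x)) :
    cutCost lc R i' (st (x + 1)) ≤ cutCost lc R i' (st x) := by
  have ha := h.anti x (x + 1) hx (by omega) hx'; have hm := h.mem x hx (by omega)
  have hm' := h.mem (x + 1) (by omega) hx'
  have h1 : (lc i' (st (x + 1)) : WithTop ℝ) ≤ lc i' (st x) := by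
    exact_mod_cast hlc i' i' _ _ le_rfl ha.1.le (by omega) hm.2.1
  have h2 : R (st (x + 1)) ≤ lc i (st x) := by
    have h3 : R (st (x + 1)) ≤ cutCost lc R i (st x) := (le_max_right _ _).trans hV
    rcases le_max_iff.1 h3 with h4 | h4
    · exact h4
    · grind
  have h3 : (lc i (st x) : WithTop ℝ) ≤ lc i' (st x) := by
    exact_mod_cast hlc i i' _ _ hi le_rfl (by omega) hm.2.1
  exact (max_le h1 (h2.trans h3)).trans (le_max_left _ _)

include hlc in
theorem Deque.advance {bt' i : ℕ} (h : Deque lc R cnt st bt tp j i0) (hb : bt ≤ bt')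
    (hb' : bt' < tp) (hij : i ≤ j) (hi : i0 ≤ i + 1)
    (hV : ∀ x, bt ≤ x → x < bt' → cutCost lc R i (st (x + 1)) ≤ cutCost lc R i (st x)) :
    Deque lc R cnt st bt' tp j i0 := by
  refine ⟨hb'.le, fun x h1 h2 => h.mem x (by omega) h2,
    fun x y h1 h2 h3 => h.anti x y (by omega) h2 h3, fun j' h1 h2 h3 i' hi' => ?_⟩
  obtain ⟨x, h4, h5, h6⟩ := h.dom j' h1 h2 h3 i' hi'; by_cases hx : bt' ≤ x
  · grind
  · refine ⟨bt', le_rfl, hb', le_trans ?_ h6⟩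
    have : ∀ k y, y + k = bt' → bt ≤ y → cutCost lc R i' (st bt') ≤ cutCost lc R i' (st y) := by
      intro k
      induction k with
      | zero => rintro y rfl _; exact le_rfl
      | succ k ih =>
        intro y hy hby
        exact (ih (y + 1) (by omega) (by omega)).trans
          (h.step_anti hlc hby (by omega) hij (by omega) (hV y hby (by omega)))
    exact this (bt' - x) x (by omega) h4

-- The second candidate has the smaller `lc`, so it can lose strictly to the front only because of
-- its `R`. As `R` increases further along the queue, the front then beats all candidates.
include hlc in
theorem Deque.optimal {i : ℕ} (h : Deque lc R cnt st bt tp j i0) (hb : bt < tp) (hij : i ≤ j)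
    (hi : i < i0) (hV : bt + 1 < tp → cutCost lc R i (st bt) < cutCost lc R i (st (bt + 1)))
    {j' : ℕ} (h1 : j < j') (h2 : j' ≤ cnt) : cutCost lc R i (st bt) ≤ cutCost lc R i j' := by
  by_cases h3 : R j' = ⊤
  · rw [cutCost, cutCost, h3]; simp
  obtain ⟨x, h4, h5, h6⟩ := h.dom j' h1 h2 h3 i hi; refine le_trans ?_ h6
  rcases h4.eq_or_lt with rfl | h4
  · exact le_rfl
  have hV' := hV (by omega); have ha := h.anti bt (bt + 1) le_rfl (by omega) (by omega)
  have hm := h.mem bt le_rfl hb; have hm' := h.mem (bt + 1) (by omega) (by omega)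
  have hlt : cutCost lc R i (st bt) < R (st (bt + 1)) := by
    rcases lt_max_iff.1 hV' with h7 | h7
    · refine absurd h7 (not_lt.2 (le_trans ?_ (le_max_left _ _)))
      exact_mod_cast hlc i i _ _ le_rfl ha.1.le (by omega) hm.2.1
    · exact h7
  refine hlt.le.trans (le_trans ?_ (le_max_right _ _))
  rcases (show bt + 1 ≤ x by omega).eq_or_lt with rfl | h7
  · exact le_rfl
  · exact (h.anti _ _ (by omega) h7 h5).2.le

end Deque

/-! ### The program for one leg -/

/-- The queue is array `41` between variables `34` and `35`. Variable `32` is the base address of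
the leg, `38` the new end, and `40` the flag of the loop. -/
def Program.pop : Program := .setInt 40 0 1 ;;
  .loop (.intLe 1 (iv 40))
    (.ite (.intLe (iv 34 + 1) (iv 35))
      (.ite (.realLe (.read 20 (iv 32 + iv 38)) (.read 20 (iv 32 + .read 41 (iv 35 - 1))))
        (.setInt 35 0 (iv 35 - 1)) (.setInt 40 0 0))
      (.setInt 40 0 0))

variable {N : ℕ}

theorem pop_spec {s : Store} {b : ℕ} (hN : 1 < N) (h32 : s.ints 32 0 = b)
    (hle : s.ints 34 0 ≤ s.ints 35 0) (htp : s.ints 35 0 < N) :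
    Tm N .pop s fun s' t => s'.ints 34 0 ≤ s'.ints 35 0 ∧ s'.ints 35 0 ≤ s.ints 35 0 ∧
      (∀ x, s'.ints 35 0 ≤ x → x < s.ints 35 0 →
        s.reals 20 (b + s.ints 38 0) ≤ s.reals 20 (b + s.ints 41 x)) ∧
      (s.ints 34 0 < s'.ints 35 0 →
        s.reals 20 (b + s.ints 41 (s'.ints 35 0 - 1)) < s.reals 20 (b + s.ints 38 0)) ∧
      t + 50 * s'.ints 35 0 ≤ 100 + 50 * s.ints 35 0 := by
  refine Tm.seq (Tm.mono (Tr.of_wp (Q := fun s₁ => s₁ = s.setInt 40 0 1) ?_) ?_)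
  · simp [wp, hN]
  rintro s₁ t₁ - ⟨ht₁, rfl⟩
  refine Tm.mono (Tm.loop (fun s' => s'.ints 34 0 ≤ s'.ints 35 0 ∧ s'.ints 35 0 ≤ s.ints 35 0 ∧
      (∀ x, s'.ints 35 0 ≤ x → x < s.ints 35 0 →
        s.reals 20 (b + s.ints 38 0) ≤ s.reals 20 (b + s.ints 41 x)) ∧
      (s'.ints 40 0 = 0 → s.ints 34 0 < s'.ints 35 0 →
        s.reals 20 (b + s.ints 41 (s'.ints 35 0 - 1)) < s.reals 20 (b + s.ints 38 0)) ∧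
      s'.ints 40 0 ≤ 1)
    (fun s' => 50 * s'.ints 35 0 + 50 * s'.ints 40 0) ?_ ?_) ?_
  · refine ⟨by simpa using hle, by simp, fun x h1 h2 => ?_, by simp, by simp⟩; simp at h1; omega
  · rintro s' hf ⟨h1, h2, h3, h4, h5⟩ hb
    have e32 : s'.ints 32 0 = b := by rw [hf.int 32]; simpa using h32
    have e34 : s'.ints 34 0 = s.ints 34 0 := by rw [hf.int 34]; simp
    have e38 : s'.ints 38 0 = s.ints 38 0 := by rw [hf.int 38]; simp
    have e41 : s'.ints 41 = s.ints 41 := by rw [hf.int 41]; simp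
    have e20 : s'.reals 20 = s.reals 20 := by rw [hf.real 20]; simp
    have hfl : s'.ints 40 0 = 1 := by simp at hb; omega
    refine Tm.mono (Tr.of_wp (Q := fun s'' => (s''.ints 34 0 ≤ s''.ints 35 0 ∧
      s''.ints 35 0 ≤ s.ints 35 0 ∧
      (∀ x, s''.ints 35 0 ≤ x → x < s.ints 35 0 →
        s.reals 20 (b + s.ints 38 0) ≤ s.reals 20 (b + s.ints 41 x)) ∧
      (s''.ints 40 0 = 0 → s.ints 34 0 < s''.ints 35 0 →
        s.reals 20 (b + s.ints 41 (s''.ints 35 0 - 1)) < s.reals 20 (b + s.ints 38 0)) ∧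
      s''.ints 40 0 ≤ 1) ∧ s''.ints 35 0 + s''.ints 40 0 + 1 ≤ s'.ints 35 0 + 1) ?_) ?_
    · simp only [wp, Test.holds_intLe, IExp.val_add, IExp.val_iv, IExp.val_one, Test.holds_realLe,
        RExp.val_read, IExp.val_read, IExp.val_sub, IExp.val_zero, e32, e34, e38, e41, e20]
      refine ⟨fun hlt => ⟨fun hle' => ⟨by omega, ?_⟩, fun hnle => ⟨by omega, ?_⟩⟩,
        fun hnlt => ⟨by omega, ?_⟩⟩
      · simp [e34, hfl]; refine ⟨⟨by omega, by omega, fun x hx hx' => ?_⟩, by omega⟩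
        rcases (show s'.ints 35 0 - 1 ≤ x by omega).eq_or_lt with h6 | h6
        · rw [← h6]; exact hle'
        · grind
      · simp [e34]; refine ⟨?_, h2, h3, fun _ => not_le.1 hnle⟩; omega
      · simp [e34]; refine ⟨?_, h2, h3, fun h6 => by omega⟩; omega
    · rintro s'' t hf' ⟨ht, h6, h7⟩; refine ⟨h6, ?_⟩
      have hc : ((Test.intLe (iv 34 + 1) (iv 35)).cost ≤ 50) := by decide
      have hcst : t ≤ 40 := ht.trans (by decide); have : (Test.intLe 1 (iv 40)).cost = 4 := rfl
      rw [this]; omega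
  · rintro s' t hf ⟨⟨h1, h2, h3, h4, h5⟩, h6, h7⟩; have : (Test.intLe 1 (iv 40)).cost = 4 := rfl
    simp at h6 h7; have hcst : t₁ ≤ 4 := ht₁.trans (by decide); grind

end

section
variable {N : ℕ}

theorem Ex.assoc {p q r : Program} {s s' : Store} {t : ℕ} (h : Ex N ((p ;; q) ;; r) s s' t) :
    Ex N (p ;; q ;; r) s s' t := by
  cases h with
  | seq h1 h2 =>
    cases h1 with
    | seq h3 h4 => have := h3.seq (h4.seq h2); rwa [← add_assoc] at this

/-- A program that evaluates the cost of a cluster on a leg, from its first user (integer variable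
`39`) to the user before the one in integer variable `43`.  Search pointers are in the first two
cells of integer array `36`; the one to be used is given by integer variable `42`. -/
structure LinePhi (N C : ℕ) (phi : Program) (G : Store → Prop) (cnt : ℕ) (lc : ℕ → ℕ → ℝ)
    (Lab : ℕ → ℕ → ℕ → Prop) (Pt : ℕ → ℕ → ℕ → Prop) : Prop where
  spec : ∀ s, G s → ∀ i j e, s.ints 39 0 = i → s.ints 43 0 = j → s.ints 42 0 = e → i < j → j ≤ cnt →
    Pt (s.ints 36 e) i j → Tm N phi s fun s' t => s'.reals 42 0 = lc i j ∧ Lab i j (s'.ints 44 0) ∧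
      s'.ints 44 0 < N ∧ Pt (s'.ints 36 e) i j ∧ (∀ e', e' ≠ e → s'.ints 36 e' = s.ints 36 e') ∧
      t + C * s'.ints 36 e ≤ C + C * s.ints 36 e
  im : ∀ a ∈ phi.im, a ∈ [36, 44, 46, 47]
  rm : ∀ a ∈ phi.rm, a ∈ [42, 44]
  stable : ∀ s s', G s → (∀ a, a ∉ [11, 12, 20, 34, 35, 36, 37, 38, 39, 40, 41, 42, 43, 44, 45, 46, 47] →
      s'.ints a = s.ints a) → (∀ a, a ∉ [20, 42, 43, 44] → s'.reals a = s.reals a) → G s'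
  -- A pointer that is valid for `i` and `j` remains valid when both decrease. The queries made with
  -- one pointer cell do not increase, so pointers are never reset, and their moves are paid by the
  -- fall of their value.
  anti : ∀ p i i' j j', i' ≤ i → j' ≤ j → Pt p i j → Pt p i' j'
  mono : ∀ i i' j j', i' ≤ i → j ≤ j' → i < j → j' ≤ cnt → lc i j ≤ lc i' j'

theorem notMem_mono {a : ℕ} {L L' : List ℕ} (h : a ∉ L) (h' : ∀ x ∈ L', x ∈ L := by decide) :
    a ∉ L' := fun h1 => h (h' a h1)

theorem Store.ints_setInt_of_mem {s : Store} {a b i v : ℕ} {L : List ℕ} (h : b ∈ L)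
    (ha : a ∉ L := by decide) : (s.setInt a i v).ints b = s.ints b :=
  Store.ints_setInt_ne _ _ _ (by grind)

theorem Frame.ints_eq {p : Program} {s s' : Store} (h : Frame p s s') {L : List ℕ}
    (hp : ∀ a ∈ p.im, a ∈ L) {a : ℕ} (ha : a ∉ L := by decide) : s'.ints a = s.ints a :=
  h.1 a fun h' => ha (hp a h')

theorem Frame.reals_eq {p : Program} {s s' : Store} (h : Frame p s s') {L : List ℕ}
    (hp : ∀ a ∈ p.rm, a ∈ L) {a : ℕ} (ha : a ∉ L := by decide) : s'.reals a = s.reals a :=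
  h.2 a fun h' => ha (hp a h')

/-- Replace the value computed by the evaluation program by the maximum with an entry of the table. -/
def Program.maxTable : Program :=
  .ite (.realLe (.read 42 0) (.read 20 (iv 32 + iv 43)))
    (.setReal 42 0 (.read 20 (iv 32 + iv 43))) .skip

/-- Later candidates are evaluated with pointer cell `1`, the front candidate with cell `0`. With a
single cell, the search for a nearer end would move the pointer past what the front candidate still
needs for the next start. -/
def Program.advance (phi : Program) : Program := .setInt 40 0 1 ;;
  .loop (.intLe 1 (iv 40))
    (.ite (.intLe (iv 34 + 2) (iv 35))
      (.setInt 42 0 1 ;; .setInt 43 0 (.read 41 (iv 34 + 1)) ;; phi ;; .maxTable ;;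
        .ite (.realLe (.read 42 0) (.read 43 0))
          (.setInt 34 0 (iv 34 + 1) ;; .setReal 43 0 (.read 42 0) ;; .setInt 45 0 (iv 44))
          (.setInt 40 0 0))
      (.setInt 40 0 0))

theorem LinePhi.im_advance {C : ℕ} {phi : Program} {G : Store → Prop} {cnt : ℕ} {lc : ℕ → ℕ → ℝ}
    {Lab Pt : ℕ → ℕ → ℕ → Prop} (h : LinePhi N C phi G cnt lc Lab Pt) :
    (∀ a ∈ (Program.advance phi).im, a ∈ [34, 36, 40, 42, 43, 44, 45, 46, 47]) ∧
    ∀ a ∈ (Program.advance phi).rm, a ∈ [42, 43, 44] := by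
  constructor <;> intro a ha
  · have := h.im a; simp [Program.advance, Program.maxTable, Program.im] at ha this ⊢; tauto
  · have := h.rm a; simp [Program.advance, Program.maxTable, Program.rm] at ha this ⊢; tauto

theorem Store.ext_eq_coe {s : Store} {a i : ℕ} (h : s.ext a i ≠ ⊤) :
    s.ext a i = (s.reals a i : ℝ) := by
  unfold Store.ext at h ⊢
  split_ifs at h ⊢
  · grind
  · rfl

theorem advance_spec {C : ℕ} {phi : Program} {G : Store → Prop} {cnt : ℕ} {lc : ℕ → ℕ → ℝ}
    {Lab Pt : ℕ → ℕ → ℕ → Prop} (h : LinePhi N C phi G cnt lc Lab Pt) {s : Store} {b i : ℕ}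
    (hN : cnt + 2 < N) (hG : G s) (h32 : s.ints 32 0 = b) (h39 : s.ints 39 0 = i)
    (hlt : s.ints 34 0 < s.ints 35 0) (hleN : s.ints 35 0 < N)
    (hmem : ∀ x, s.ints 34 0 ≤ x → x < s.ints 35 0 → i < s.ints 41 x ∧ s.ints 41 x ≤ cnt ∧
      s.ext 20 (b + s.ints 41 x) ≠ ⊤)
    (hanti : ∀ x y, s.ints 34 0 ≤ x → x ≤ y → y < s.ints 35 0 → s.ints 41 y ≤ s.ints 41 x)
    (hval : (s.reals 43 0 : WithTop ℝ) =
      cutCost lc (fun j => s.ext 20 (b + j)) i (s.ints 41 (s.ints 34 0)))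
    (hlab : Lab i (s.ints 41 (s.ints 34 0)) (s.ints 45 0)) (hlabN : s.ints 45 0 < N)
    (hPt : ∀ x, s.ints 34 0 < x → x < s.ints 35 0 → Pt (s.ints 36 1) i (s.ints 41 x)) :
    Tm N (.advance phi) s fun s' t => s.ints 34 0 ≤ s'.ints 34 0 ∧ s'.ints 34 0 < s.ints 35 0 ∧
      (∀ x, s.ints 34 0 ≤ x → x < s'.ints 34 0 →
        cutCost lc (fun j => s.ext 20 (b + j)) i (s.ints 41 (x + 1)) ≤
          cutCost lc (fun j => s.ext 20 (b + j)) i (s.ints 41 x)) ∧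
      (s'.ints 34 0 + 1 < s.ints 35 0 →
        cutCost lc (fun j => s.ext 20 (b + j)) i (s.ints 41 (s'.ints 34 0)) <
          cutCost lc (fun j => s.ext 20 (b + j)) i (s.ints 41 (s'.ints 34 0 + 1))) ∧
      (s'.reals 43 0 : WithTop ℝ) =
        cutCost lc (fun j => s.ext 20 (b + j)) i (s.ints 41 (s'.ints 34 0)) ∧
      Lab i (s.ints 41 (s'.ints 34 0)) (s'.ints 45 0) ∧ s'.ints 45 0 < N ∧
      (∀ x, s'.ints 34 0 < x → x < s.ints 35 0 → Pt (s'.ints 36 1) i (s.ints 41 x)) ∧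
      (∀ j, (∀ x, s.ints 34 0 ≤ x → x < s.ints 35 0 → j ≤ s.ints 41 x) → 
        Pt (s.ints 36 1) i j → Pt (s'.ints 36 1) i j) ∧
      s'.ints 36 0 = s.ints 36 0 ∧
      t + C * s'.ints 36 1 + (C + 200) * (s.ints 35 0 - s'.ints 34 0) ≤
        C * s.ints 36 1 + (C + 200) * (s.ints 35 0 - s.ints 34 0) + (C + 300) := by
  set R : ℕ → WithTop ℝ := fun j => s.ext 20 (b + j) with hR; set st := s.ints 41 with hst
  refine Tm.seq (Tm.mono (Tr.of_wp (Q := fun s₁ => s₁ = s.setInt 40 0 1) ?_) ?_)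
  · simp [wp]; omega
  rintro s₁ t₁ - ⟨ht₁, rfl⟩; have ht₁' : t₁ ≤ 4 := ht₁.trans (by decide)
  refine Tm.mono (Tm.loop (fun s' => s.ints 34 0 ≤ s'.ints 34 0 ∧ s'.ints 34 0 < s.ints 35 0 ∧
      (∀ x, s.ints 34 0 ≤ x → x < s'.ints 34 0 →
        cutCost lc R i (st (x + 1)) ≤ cutCost lc R i (st x)) ∧
      (s'.ints 40 0 = 0 → s'.ints 34 0 + 1 < s.ints 35 0 →
        cutCost lc R i (st (s'.ints 34 0)) < cutCost lc R i (st (s'.ints 34 0 + 1))) ∧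
      (s'.reals 43 0 : WithTop ℝ) = cutCost lc R i (st (s'.ints 34 0)) ∧
      Lab i (st (s'.ints 34 0)) (s'.ints 45 0) ∧ s'.ints 45 0 < N ∧
      (∀ x, s'.ints 34 0 < x → x < s.ints 35 0 → Pt (s'.ints 36 1) i (st x)) ∧
      (∀ j, (∀ x, s.ints 34 0 ≤ x → x < s.ints 35 0 → j ≤ st x) →
        Pt (s.ints 36 1) i j → Pt (s'.ints 36 1) i j) ∧
      s'.ints 36 0 = s.ints 36 0 ∧ s'.ints 40 0 ≤ 1)
    -- The potential counts the moves left to the pointer and the candidates left in the queue. The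
    -- flag pays for the last, unsuccessful comparison.
    (fun s' => C * s'.ints 36 1 + (C + 200) * (s.ints 35 0 - s'.ints 34 0) +
      (C + 200) * s'.ints 40 0) ?_ ?_) ?_
  · simp only [Store.ints_setInt, Store.reals_setInt]; simp; grind
  · rintro s' hf ⟨h1, h2, h3, h4, h5, h6, h7, h8, h9, h10, h11⟩ hb
    have hfl : s'.ints 40 0 = 1 := by simp at hb; omega
    have him := h.im_advance
    have hF : Frame (.advance phi) s s' := by
      refine Frame.trans (s' := s.setInt 40 0 1) ⟨fun a ha => ?_, fun a ha => rfl⟩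
        (hf.weaken (List.subset_append_right _ _) (List.subset_append_right _ _))
      have : a ≠ 40 := by rintro rfl; exact ha (by simp [Program.advance, Program.im])
      simp [this]
    have e32 : s'.ints 32 0 = b := by rw [hF.ints_eq him.1]; exact h32
    have e35 : s'.ints 35 = s.ints 35 := hF.ints_eq him.1
    have e39 : s'.ints 39 0 = i := by rw [hF.ints_eq him.1]; exact h39
    have e41 : s'.ints 41 = st := hF.ints_eq him.1
    have e20 : s'.reals 20 = s.reals 20 := hF.reals_eq him.2
    have hcc : (Test.intLe 1 (iv 40)).cost = 4 := rfl; rw [hcc]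
    have hci : (Test.intLe (iv 34 + 2) (iv 35)).cost = 7 := rfl
    by_cases hlast : s'.ints 34 0 + 2 ≤ s.ints 35 0
    swap
    · have hw : Tr N (.setInt 40 0 0) s' 3 fun s'' => s'' = s'.setInt 40 0 0 :=
        Tr.of_wp (by simp [wp]; omega)
      obtain ⟨s'', t, hex, ht, rfl⟩ := hw
      refine ⟨_, _, .iteFalse (by simpa [e35] using hlast) hex, ?_⟩
      simp only [Store.ints_setInt, Store.reals_setInt]; simp
      refine ⟨⟨h1, h2, h3, fun h => by omega, h5, h6, h7, h8, h9, h10⟩, ?_⟩; rw [hfl, hci]; omega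
    obtain ⟨m1, m2, m3⟩ := hmem (s'.ints 34 0 + 1) (by omega) (by omega)
    have hw : Tr N (.setInt 42 0 1 ;; .setInt 43 0 (.read 41 (iv 34 + 1))) s' 20 fun s'' =>
        s'' = (s'.setInt 42 0 1).setInt 43 0 (st (s'.ints 34 0 + 1)) :=
      (Tr.of_wp (Q := fun s'' => s'' = (s'.setInt 42 0 1).setInt 43 0 (st (s'.ints 34 0 + 1)))
        (by simp [wp, e41]; omega)).mono (by decide) fun _ _ h => h
    obtain ⟨s₂, t₂, hex₂, ht₂, rfl⟩ := hw
    obtain ⟨s₃, t₃, hex₃, p1, p2, p2', p3, p4, p5⟩ := h.spec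
      ((s'.setInt 42 0 1).setInt 43 0 (st (s'.ints 34 0 + 1)))
      (h.stable s _ hG (fun a ha => by
          simp only [List.mem_cons, List.not_mem_nil, or_false, not_or] at ha
          rw [Store.ints_setInt_ne _ _ _ (by omega), Store.ints_setInt_ne _ _ _ (by omega)]
          exact hF.ints_eq him.1 (by simp; omega))
        (fun a ha => hF.reals_eq him.2 (notMem_mono ha))) i (st (s'.ints 34 0 + 1)) 1
      (by simpa using e39) (by simp) (by simp) m1 m2
      (by simpa using h8 (s'.ints 34 0 + 1) (by omega) (by omega))
    simp only [ne_eq, Store.ints_setInt_ne, not_false_eq_true, Nat.reduceEqDiff] at p4 p5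
    have hF₃ := hex₃.frame; have f32 : s₃.ints 32 0 = b := by rw [hF₃.ints_eq h.im]; simpa using e32
    have f34 : s₃.ints 34 0 = s'.ints 34 0 := by rw [hF₃.ints_eq h.im]; simp
    have f40 : s₃.ints 40 0 = 1 := by rw [hF₃.ints_eq h.im]; simpa using hfl
    have f43 : s₃.ints 43 0 = st (s'.ints 34 0 + 1) := by rw [hF₃.ints_eq h.im]; simp
    have f45 : s₃.ints 45 0 = s'.ints 45 0 := by rw [hF₃.ints_eq h.im]; simp
    have g20 : s₃.reals 20 = s.reals 20 := by rw [hF₃.reals_eq h.rm]; simpa using e20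
    have g43 : s₃.reals 43 0 = s'.reals 43 0 := by rw [hF₃.reals_eq h.rm]; simp
    have hval' : cutCost lc R i (st (s'.ints 34 0 + 1)) =
        (max (s₃.reals 42 0) (s₃.reals 20 (b + st (s'.ints 34 0 + 1))) : ℝ) := by
      rw [cutCost, hR]; simp only []; rw [Store.ext_eq_coe m3, p1, g20]
      rfl
    have hPt' : ∀ j, (∀ x, s.ints 34 0 ≤ x → x < s.ints 35 0 → j ≤ st x) →
        Pt (s.ints 36 1) i j → Pt (s₃.ints 36 1) i j := fun j hj _ =>
      h.anti _ i i _ _ le_rfl (hj _ (by omega) (by omega)) p3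
    have hw : Tr N (.maxTable ;; .ite (.realLe (.read 42 0) (.read 43 0))
          (.setInt 34 0 (iv 34 + 1) ;; .setReal 43 0 (.read 42 0) ;; .setInt 45 0 (iv 44))
          (.setInt 40 0 0)) s₃ 100 fun s'' =>
        (s''.ints 34 0 = s'.ints 34 0 + 1 ∧
          cutCost lc R i (st (s'.ints 34 0 + 1)) ≤ cutCost lc R i (st (s'.ints 34 0)) ∧
          (s''.reals 43 0 : WithTop ℝ) = cutCost lc R i (st (s'.ints 34 0 + 1)) ∧
          s''.ints 45 0 = s₃.ints 44 0 ∧ s''.ints 40 0 = 1 ∨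
        s''.ints 34 0 = s'.ints 34 0 ∧
          cutCost lc R i (st (s'.ints 34 0)) < cutCost lc R i (st (s'.ints 34 0 + 1)) ∧
          s''.reals 43 0 = s'.reals 43 0 ∧
          s''.ints 45 0 = s'.ints 45 0 ∧ s''.ints 40 0 = 0) ∧ s''.ints 36 = s₃.ints 36 := by
      refine Tr.of_wp_le ?_; rw [hval', ← h5, ← g43]
      simp only [wp, Program.maxTable, Test.holds_realLe, RExp.val_read, IExp.val_zero, IExp.val_add,
        IExp.val_iv, f32, f43]
      refine ⟨fun hm => ⟨fun hle => ?_, fun hle => ?_⟩, fun hm => ⟨fun hle => ?_, fun hle => ?_⟩⟩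
      all_goals simp at hm hle
      · simp [f34, f40, hm, hle]; omega
      · simp [f34, hm, hle, f45]; omega
      · simp [f34, f40, hm.le, hle]; omega
      · simp [f34, hm.le, hle, f45]; omega
    obtain ⟨s₄, t₄, hex₄, ht₄, hout, h36⟩ := hw
    refine ⟨s₄, _, .iteTrue (by simpa [e35] using hlast)
      (hex₂.seq (hex₃.seq hex₄)).assoc, ?_⟩
    beta_reduce
    rw [hci, h36, hfl]; have h360 : s₃.ints 36 0 = s.ints 36 0 := by rw [p4 0 (by decide), h10]
    rcases hout with ⟨q1, q2, q3, q4, q5⟩ | ⟨q1, q2, q3, q4, q5⟩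
    · rw [q1, q3, q4, q5]
      refine ⟨⟨by omega, by omega, fun x hx hx' => ?_, fun h => absurd h (by omega), rfl, p2, p2',
        fun x hx hx' => ?_, hPt', h360, le_rfl⟩, ?_⟩
      · rcases (show x ≤ s'.ints 34 0 by omega).eq_or_lt with rfl | hlt
        · exact q2
        · grind
      · exact h.anti _ i i _ _ le_rfl (hanti _ x (by omega) (by omega) hx') p3
      · obtain ⟨k, hk⟩ : ∃ k, s.ints 35 0 - s'.ints 34 0 = k + 1 := ⟨s.ints 35 0 - s'.ints 34 0 - 1, by omega⟩
        rw [hk, show s.ints 35 0 - (s'.ints 34 0 + 1) = k by omega]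
        clear * - ht₂ p5 ht₄
        nlinarith
    · rw [q1, q3, q4, q5]
      refine ⟨⟨h1, h2, h3, fun _ _ => q2, h5, h6, h7, fun x hx hx' => ?_, hPt', h360, by omega⟩, ?_⟩
      · exact h.anti _ i i _ _ le_rfl (hanti _ x (by omega) (by omega) hx') p3
      · clear * - ht₂ p5 ht₄
        nlinarith
  · rintro s' t hf ⟨⟨h1, h2, h3, h4, h5, h6, h7, h8, h9, h10, h11⟩, h12, h13⟩
    have hcc : (Test.intLe 1 (iv 40)).cost = 4 := rfl; rw [hcc] at h13
    have h40 : s'.ints 40 0 = 0 := by simp at h12; omega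
    refine ⟨h1, h2, h3, h4 h40, h5, h6, h7, h8, h9, h10, ?_⟩; simp [h40] at h13; omega

end

section
variable {N : ℕ}

/-- Ends at which the remaining suffix cannot be clustered have cost `⊤` and never enter the queue.
-/
def Program.pushStep : Program :=
  .ite (.intLe 1 (.read 20 (iv 32 + iv 38)))
    (.pop ;; .setInt 41 (iv 35) (iv 38) ;; .setInt 35 0 (iv 35 + 1)) .skip

theorem Store.ext_ne_top {s : Store} {a i : ℕ} : s.ext a i ≠ ⊤ ↔ 1 ≤ s.ints a i := by
  unfold Store.ext
  split_ifs with h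
  · simp [h]
  · simp; omega

theorem pushStep_spec {lc : ℕ → ℕ → ℝ} {cnt b j i0 : ℕ} {s : Store}
    (hlc : ∀ i i' j j', i' ≤ i → j ≤ j' → i < j → j' ≤ cnt → lc i j ≤ lc i' j')
    (h32 : s.ints 32 0 = b) (h38 : s.ints 38 0 = j) (hjc : j ≤ cnt) (hi0 : i0 ≤ j) (hj : 1 ≤ j)
    (hD : Deque lc (fun j => s.ext 20 (b + j)) cnt (s.ints 41) (s.ints 34 0) (s.ints 35 0) j i0)
    (hne : s.ints 34 0 < s.ints 35 0 ∨ s.ext 20 (b + j) ≠ ⊤)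
    (hN : s.ints 35 0 + 1 < N) (hjN : j < N) :
    Tm N .pushStep s fun s' t =>
      Deque lc (fun j => s.ext 20 (b + j)) cnt (s'.ints 41) (s.ints 34 0) (s'.ints 35 0) (j - 1) i0 ∧
      s.ints 34 0 < s'.ints 35 0 ∧ s'.ints 35 0 ≤ s.ints 35 0 + 1 ∧
      (∀ x, s.ints 34 0 ≤ x → x < s'.ints 35 0 →
        s'.ints 41 x = j ∨ (x < s.ints 35 0 ∧ s'.ints 41 x = s.ints 41 x)) ∧
      t + 50 * (s'.ints 35 0 - s.ints 34 0) ≤ 300 + 50 * (s.ints 35 0 - s.ints 34 0) := by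
  have hcc : (Test.intLe 1 (.read 20 (iv 32 + iv 38))).cost = 8 := rfl
  by_cases hfin : s.ext 20 (b + j) = ⊤
  · have h0 : ¬ 1 ≤ s.ints 20 (b + j) := fun h => Store.ext_ne_top.2 h hfin
    refine ⟨s, _, .iteFalse (by simpa [h32, h38] using h0) (.skip s), hD.skip hfin, ?_, by omega,
      fun x h1 h2 => Or.inr ⟨h2, rfl⟩, ?_⟩
    · rcases hne with h | h
      · exact h
      · grind
    · rw [hcc]; omega
  have h0 : 1 ≤ s.ints 20 (b + j) := Store.ext_ne_top.1 hfin
  obtain ⟨s₁, t₁, hex, h1, h2, h3, h4, h5⟩ := pop_spec (N := N) (by omega) h32 hD.le (by omega)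
  rw [h38] at h3 h4; have e34 : s₁.ints 34 = s.ints 34 := hex.frame.int _
  have e38 : s₁.ints 38 = s.ints 38 := hex.frame.int _
  have e41 : s₁.ints 41 = s.ints 41 := hex.frame.int _
  have hw : Tr N (.setInt 41 (iv 35) (iv 38) ;; .setInt 35 0 (iv 35 + 1)) s₁ 20 fun s'' =>
      s''.ints 35 0 = s₁.ints 35 0 + 1 ∧
        s''.ints 41 = fun x => if x = s₁.ints 35 0 then j else s.ints 41 x := by
    refine Tr.of_wp_le ?_; simp [wp, e38, h38]; refine ⟨hjN, by omega, ?_⟩; funext x; simp [e41]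
  obtain ⟨s₂, t₂, hex₂, ht₂, h35, h41⟩ := hw
  refine ⟨s₂, _, .iteTrue (by simpa [h32, h38] using h0) (hex.seq hex₂), ?_⟩
  beta_reduce
  rw [h35, h41]
  have hco : ∀ {x}, s.ext 20 (b + x) ≠ ⊤ → s.ext 20 (b + x) = (s.reals 20 (b + x) : ℝ) :=
    fun h => Store.ext_eq_coe h
  rw [e34] at h1
  refine ⟨hD.push hlc hfin hjc hi0 hj h1 h2 (fun x hx hx' => ?_) (fun hlt => ?_), by omega, by omega,
    fun x hx hx' => ?_, ?_⟩
  · rw [hco hfin, hco (hD.mem x (by omega) hx').2.2]; exact_mod_cast h3 x hx hx'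
  · rw [hco hfin, hco (hD.mem _ (by omega) (by omega)).2.2]; exact_mod_cast h4 hlt
  · by_cases hxt : x = s₁.ints 35 0
    · simp [hxt]
    · right; simp only [hxt, if_false, and_true]; omega
  · rw [hcc]; omega

def Program.firstValue (phi : Program) : Program :=
  .setInt 42 0 0 ;; .setInt 43 0 (.read 41 (iv 34)) ;; phi ;;
    .maxTable ;; .setReal 43 0 (.read 42 0) ;; .setInt 45 0 (iv 44)

variable {C : ℕ} {phi : Program} {G : Store → Prop} {cnt : ℕ} {lc : ℕ → ℕ → ℝ}
    {Lab Pt : ℕ → ℕ → ℕ → Prop}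

theorem firstValue_spec (h : LinePhi N C phi G cnt lc Lab Pt) {s : Store} {b i : ℕ}
    (hN : cnt + 2 < N) (hG : G s) (h32 : s.ints 32 0 = b) (h39 : s.ints 39 0 = i)
    (hmem : i < s.ints 41 (s.ints 34 0) ∧ s.ints 41 (s.ints 34 0) ≤ cnt ∧
      s.ext 20 (b + s.ints 41 (s.ints 34 0)) ≠ ⊤)
    (hPt : Pt (s.ints 36 0) i (s.ints 41 (s.ints 34 0))) :
    Tm N (.firstValue phi) s fun s' t =>
      (s'.reals 43 0 : WithTop ℝ) =
        cutCost lc (fun j => s.ext 20 (b + j)) i (s.ints 41 (s.ints 34 0)) ∧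
      Lab i (s.ints 41 (s.ints 34 0)) (s'.ints 45 0) ∧ s'.ints 45 0 < N ∧
      Pt (s'.ints 36 0) i (s.ints 41 (s.ints 34 0)) ∧ s'.ints 36 1 = s.ints 36 1 ∧
      t + C * s'.ints 36 0 ≤ C * s.ints 36 0 + (C + 200) := by
  obtain ⟨m1, m2, m3⟩ := hmem; set j := s.ints 41 (s.ints 34 0) with hj
  have hw : Tr N (.setInt 42 0 0 ;; .setInt 43 0 (.read 41 (iv 34))) s 20 fun s'' =>
      s'' = (s.setInt 42 0 0).setInt 43 0 j :=
    (Tr.of_wp (Q := fun s'' => s'' = (s.setInt 42 0 0).setInt 43 0 j)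
      (by simp [wp, ← hj]; omega)).mono (by decide) fun _ _ h => h
  obtain ⟨s₂, t₂, hex₂, ht₂, rfl⟩ := hw
  obtain ⟨s₃, t₃, hex₃, p1, p2, p2', p3, p4, p5⟩ := h.spec ((s.setInt 42 0 0).setInt 43 0 j)
    (h.stable s _ hG (fun a ha => by
        simp only [List.mem_cons, List.not_mem_nil, or_false, not_or] at ha
        rw [Store.ints_setInt_ne _ _ _ (by omega), Store.ints_setInt_ne _ _ _ (by omega)])
      (fun a ha => rfl)) i j 0
    (by simpa using h39) (by simp) (by simp) m1 m2 (by simpa using hPt)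
  simp only [ne_eq, Store.ints_setInt_ne, not_false_eq_true, Nat.reduceEqDiff] at p4 p5
  have hF₃ := hex₃.frame; have f32 : s₃.ints 32 0 = b := by rw [hF₃.ints_eq h.im]; simpa using h32
  have f43 : s₃.ints 43 0 = j := by rw [hF₃.ints_eq h.im]; simp
  have g20 : s₃.reals 20 = s.reals 20 := by rw [hF₃.reals_eq h.rm]; simp
  have hval' : cutCost lc (fun j => s.ext 20 (b + j)) i j =
      (max (s₃.reals 42 0) (s₃.reals 20 (b + j)) : ℝ) := by
    rw [cutCost, Store.ext_eq_coe m3, p1, g20]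
    rfl
  have hw : Tr N (.maxTable ;; .setReal 43 0 (.read 42 0) ;; .setInt 45 0 (iv 44)) s₃ 100 fun s'' =>
      s''.reals 43 0 = max (s₃.reals 42 0) (s₃.reals 20 (b + j)) ∧
      s''.ints 45 0 = s₃.ints 44 0 ∧ s''.ints 36 = s₃.ints 36 := by
    refine Tr.of_wp_le ?_
    simp only [wp, Program.maxTable, Test.holds_realLe, RExp.val_read, IExp.val_zero, IExp.val_add,
      IExp.val_iv, f32, f43]
    refine ⟨fun hm => ?_, fun hm => ?_⟩
    · simp [hm, p2']
    · simp [(not_le.1 hm).le, p2']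
  obtain ⟨s₄, t₄, hex₄, ht₄, q1, q2, q3⟩ := hw; refine ⟨s₄, _, (hex₂.seq (hex₃.seq hex₄)).assoc, ?_⟩
  beta_reduce
  rw [hval', q1, q2, q3]; grind

/-! ### The table for one leg -/

/-- Cell `i` of the table for a leg with `cnt` users. -/
structure LineCell (lc : ℕ → ℕ → ℝ) (Lab : ℕ → ℕ → ℕ → Prop) (R : ℕ → WithTop ℝ) (cnt r i : ℕ)
    (nxt lab : ℕ) : Prop where
  last : i = cnt → R i = 0
  short : i < cnt → cnt < i + r → R i = ⊤
  next_ge : i + r ≤ cnt → i + r ≤ nxt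
  next_le : i + r ≤ cnt → nxt ≤ cnt
  eq : i + r ≤ cnt → R i = cutCost lc R i nxt
  lab : i + r ≤ cnt → Lab i nxt lab
  le : i + r ≤ cnt → ∀ j, i + r ≤ j → j ≤ cnt → R i ≤ cutCost lc R i j

theorem LineCell.congr {R R' : ℕ → WithTop ℝ} {r i nxt lab : ℕ} (hr : 1 ≤ r)
    (h : LineCell lc Lab R cnt r i nxt lab) (hR : ∀ j, i ≤ j → j ≤ cnt → R' j = R j) (hi : i ≤ cnt) :
    LineCell lc Lab R' cnt r i nxt lab where
  last h' := by rw [hR i le_rfl hi]; exact h.last h'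
  short h1 h2 := by rw [hR i le_rfl hi]; exact h.short h1 h2
  next_ge := h.next_ge
  next_le := h.next_le
  eq h' := by
    rw [hR i le_rfl hi, h.eq h', cutCost, cutCost, hR _ (by have := h.next_ge h'; omega) (h.next_le h')]
  lab := h.lab
  le h' j h1 h2 := by rw [hR i le_rfl hi, cutCost, hR j (by omega) h2]; exact h.le h' j h1 h2

/-- The invariant when the last `q` possible ends of clusters have been dealt with. -/
structure LineInv (lc : ℕ → ℕ → ℝ) (Lab Pt : ℕ → ℕ → ℕ → Prop) (cnt r b q : ℕ) (s₀ s : Store) :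
    Prop where
  deque : Deque lc (fun j => s.ext 20 (b + j)) cnt (s.ints 41) (s.ints 34 0) (s.ints 35 0) (cnt - q)
    (cnt + 1 - r - q)
  tp_le : s.ints 35 0 ≤ q
  nonempty : 0 < q → s.ints 34 0 < s.ints 35 0
  -- Cell `e` is valid for all queries to come: for the ends not yet entered, and for the queue from
  -- the front on (`e = 0`) or from behind the front on (`e = 1`).
  pt : ∀ e < 2, ∀ j, (j ≤ cnt - q ∨ ∃ x, s.ints 34 0 + e ≤ x ∧ x < s.ints 35 0 ∧ j = s.ints 41 x) →
    Pt (s.ints 36 e) (cnt - r - q) j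
  cell : ∀ i ≤ cnt, cnt + 1 - r - q ≤ i →
    LineCell lc Lab (fun j => s.ext 20 (b + j)) cnt r i (s.ints 11 (b + i)) (s.ints 12 (b + i))
  others : ∀ a, a < b ∨ b + cnt < a → s.ext 20 a = s₀.ext 20 a ∧ s.ints 11 a = s₀.ints 11 a ∧
    s.ints 12 a = s₀.ints 12 a

/-- Enters the end `cnt - q` and then settles the start `cnt - q - r`, for which this end is the
nearest one that leaves at least `r` users. -/
def Program.lineStep (phi : Program) : Program :=
  (.setInt 38 0 (iv 33 - iv 37) ;; .setInt 39 0 (iv 38 - .read 0 1)) ;; .pushStep ;;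
  .firstValue phi ;; .advance phi ;;
  .setInt 20 (iv 32 + iv 39) 1 ;; .setReal 20 (iv 32 + iv 39) (.read 43 0) ;;
  .setInt 11 (iv 32 + iv 39) (.read 41 (iv 34)) ;; .setInt 12 (iv 32 + iv 39) (iv 45)

/-- Pays for the moves of both pointers and for the removal of candidates at either end of the
queue; a step adds at most one candidate. -/
noncomputable def linePotential (C : ℕ) (s : Store) : ℕ :=
  C * (s.ints 36 0 + s.ints 36 1) + (C + 250) * (s.ints 35 0 - s.ints 34 0)

theorem LinePhi.im_firstValue (h : LinePhi N C phi G cnt lc Lab Pt) :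
    (∀ a ∈ (Program.firstValue phi).im, a ∈ [36, 42, 43, 44, 45, 46, 47]) ∧
    ∀ a ∈ (Program.firstValue phi).rm, a ∈ [42, 43, 44] := by
  constructor <;> intro a ha
  · have := h.im a; simp [Program.firstValue, Program.maxTable, Program.im] at ha this ⊢; tauto
  · have := h.rm a; simp [Program.firstValue, Program.maxTable, Program.rm] at ha this ⊢; tauto

theorem lineStep_time {C t₁ t₂ t₃ t₄ t₅ x y z p₀ p₁ p₀' p₁' : ℕ} (h₁ : t₁ ≤ 30)
    (h₂ : t₂ + 50 * x ≤ 300 + 50 * z) (h₃ : t₃ + C * p₀' ≤ C * p₀ + (C + 200))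
    (h₄ : t₄ + C * p₁' + (C + 200) * y ≤ C * p₁ + (C + 200) * x + (C + 300)) (h₅ : t₅ ≤ 60)
    (hx : x ≤ z + 1) (hy : y ≤ x) :
    t₁ + (t₂ + (t₃ + (t₄ + t₅))) + (C * (p₀' + p₁') + (C + 250) * y) ≤
      5 * C + 2000 + (C * (p₀ + p₁) + (C + 250) * z) := by
  have := Nat.mul_le_mul_left C hx; linarith

set_option maxHeartbeats 1000000 in
theorem lineStep_spec (h : LinePhi N C phi G cnt lc Lab Pt) {s₀ s : Store} {b r q : ℕ} (hr : 1 ≤ r)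
    (hN : cnt + 2 < N) (hG : G s) (h32 : s.ints 32 0 = b) (h33 : s.ints 33 0 = cnt)
    (h01 : s.ints 0 1 = r) (h37 : s.ints 37 0 = q) (hq : q + r ≤ cnt)
    (hI : LineInv lc Lab Pt cnt r b q s₀ s) :
    Tm N (.lineStep phi) s fun s' t => LineInv lc Lab Pt cnt r b (q + 1) s₀ s' ∧
      t + linePotential C s' ≤ 5 * C + 2000 + linePotential C s := by
  set j := cnt - q with hj; set i := j - r with hi; have hiq : cnt - r - q = i := by omega
  have hi0 : cnt + 1 - r - q = i + 1 := by omega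
  have hi0' : cnt + 1 - r - (q + 1) = i := by omega
  have hij : i < j := by omega
  have hjc : j ≤ cnt := by omega
  have htpq := hI.tp_le; have hble := hI.deque.le; have hD := hI.deque; rw [hi0] at hD
  set R : ℕ → WithTop ℝ := fun j => s.ext 20 (b + j) with hR; have ima := h.im_advance
  have imf := h.im_firstValue
  -- the indices
  have hA : Tr N (.setInt 38 0 (iv 33 - iv 37) ;; .setInt 39 0 (iv 38 - .read 0 1)) s 30 fun s₁ =>
      s₁.ints 38 0 = j ∧ s₁.ints 39 0 = i := by
    refine Tr.of_wp_le ?_; simp [wp, h33, h37, h01]; omega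
  obtain ⟨s₁, t₁, hex₁, ht₁, a38, a39⟩ := hA; have hF₁ := hex₁.frame
  have a32 : s₁.ints 32 0 = b := by rw [hF₁.int _]; exact h32
  have a34 : s₁.ints 34 = s.ints 34 := hF₁.int _; have a35 : s₁.ints 35 = s.ints 35 := hF₁.int _
  have a36 : s₁.ints 36 = s.ints 36 := hF₁.int _; have a41 : s₁.ints 41 = s.ints 41 := hF₁.int _
  have aR : ∀ x, s₁.ext 20 x = s.ext 20 x := fun _ => hF₁.ext
  have aR' : (fun j => s₁.ext 20 (b + j)) = R := by grind
  have hG₁ : G s₁ := by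
    exact h.stable s s₁ hG (fun a ha => hF₁.int _ (notMem_mono ha)) fun a _ => hF₁.real _ (by simp [Program.rm])
  -- the new candidate
  obtain ⟨s₂, t₂, hex₂, b1, b2, b3, b4, b5⟩ := pushStep_spec (N := N) (s := s₁) h.mono a32 a38 hjc
    (i0 := i + 1) hij (by omega) (by grind)
    (by
      rw [a34, a35, aR]; rcases Nat.eq_zero_or_pos q with h0 | h0
      · right; have := (hI.cell cnt le_rfl (by omega)).last rfl; rw [show j = cnt by omega, this]
        simp
      · exact Or.inl (hI.nonempty h0)) (by rw [a35]; omega) (by omega)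
  have hF₂ := hex₂.frame; rw [aR', a34] at b1; rw [a34] at b2 b4 b5; rw [a35] at b3 b4 b5
  rw [a41] at b4; have c32 : s₂.ints 32 0 = b := by rw [hF₂.int _]; exact a32
  have c34 : s₂.ints 34 = s.ints 34 := (hF₂.int _).trans a34
  have c36 : s₂.ints 36 = s.ints 36 := (hF₂.int _).trans a36
  have c39 : s₂.ints 39 0 = i := by rw [hF₂.int _]; exact a39
  have cR : ∀ x, s₂.ext 20 x = s.ext 20 x := fun x => (hF₂.ext).trans (aR x)
  have cR' : (fun j => s₂.ext 20 (b + j)) = R := by grind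
  have hG₂ : G s₂ := by
    exact h.stable s₁ s₂ hG₁ (fun a ha => hF₂.int _ (notMem_mono ha)) fun a ha => hF₂.real _ (notMem_mono ha)
  set bt := s.ints 34 0 with hbt
  have hmem₂ : ∀ x, bt ≤ x → x < s₂.ints 35 0 → i < s₂.ints 41 x ∧ s₂.ints 41 x ≤ cnt ∧
      R (s₂.ints 41 x) ≠ ⊤ := fun x h1 h2 => by
    have := b1.mem x h1 h2; grind
  have hpt₂ : ∀ e < 2, ∀ j', (j' ≤ j - 1 ∨ ∃ x, bt + e ≤ x ∧ x < s₂.ints 35 0 ∧ j' = s₂.ints 41 x) →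
      Pt (s.ints 36 e) i j' := by
    intro e he j' hj'; have hpt := hI.pt e he; rw [hiq] at hpt
    rcases hj' with h1 | ⟨x, h1, h2, rfl⟩
    · grind
    · rcases b4 x (by omega) h2 with h3 | ⟨h3, h4⟩
      · grind
      · grind
  -- the first candidate
  obtain ⟨s₃, t₃, hex₃, d1, d2, d3, d4, d5, d6⟩ := firstValue_spec h hN hG₂ c32 c39
    (by grind)
    (by rw [c34, c36]; exact hpt₂ 0 (by omega) _ (Or.inr ⟨bt, le_rfl, b2, rfl⟩))
  rw [cR', c34, ← hbt] at d1; rw [c34, ← hbt] at d2 d4; rw [c36] at d5 d6; have hF₃ := hex₃.frame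
  have e32 : s₃.ints 32 0 = b := by rw [hF₃.ints_eq imf.1]; exact c32
  have e34 : s₃.ints 34 0 = bt := by rw [hF₃.ints_eq imf.1, c34]
  have e35 : s₃.ints 35 = s₂.ints 35 := hF₃.ints_eq imf.1
  have e39 : s₃.ints 39 0 = i := by rw [hF₃.ints_eq imf.1]; exact c39
  have e41 : s₃.ints 41 = s₂.ints 41 := hF₃.ints_eq imf.1
  have eR : ∀ x, s₃.ext 20 x = s.ext 20 x := fun x =>
    (Store.ext_congr (hF₃.ints_eq imf.1) (hF₃.reals_eq imf.2) x).trans (cR x)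
  have eR' : (fun j => s₃.ext 20 (b + j)) = R := by grind
  have hG₃ : G s₃ := by
    exact h.stable s₂ s₃ hG₂ (fun a ha => hF₃.ints_eq imf.1 (notMem_mono ha)) fun a ha =>
      hF₃.reals_eq imf.2 (notMem_mono ha)
  -- the best candidate
  obtain ⟨s₄, t₄, hex₄, f1, f2, f3, f4, f5, f6, f7, f8, f9, f10, f11⟩ := advance_spec h hN hG₃ e32 e39
    (by grind) (by rw [e35]; omega)
    (by grind)
    (by
      rw [e34, e35, e41]; intro x y h1 h2 h3; rcases h2.eq_or_lt with rfl | h2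
      · exact le_rfl
      · exact (b1.anti x y h1 h2 h3).1.le)
    (by grind) (by grind) d3
    (by
      rw [e34, e35, e41, d5]; intro x h1 h2
      exact hpt₂ 1 (by omega) _ (Or.inr ⟨x, h1, h2, rfl⟩))
  rw [eR', e34, e41] at f3; rw [eR', e35, e41] at f4; rw [eR', e41] at f5; rw [e41] at f6
  rw [e35, e41] at f8; rw [e34, e35, e41, d5] at f9; rw [e34] at f1; rw [e35] at f2
  rw [e34, e35, d5] at f11; have hF₄ := hex₄.frame
  have g32 : s₄.ints 32 0 = b := by rw [hF₄.ints_eq ima.1]; exact e32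
  have g35 : s₄.ints 35 = s₂.ints 35 := (hF₄.ints_eq ima.1).trans e35
  have g39 : s₄.ints 39 0 = i := by rw [hF₄.ints_eq ima.1]; exact e39
  have g41 : s₄.ints 41 = s₂.ints 41 := (hF₄.ints_eq ima.1).trans e41
  have gR : ∀ x, s₄.ext 20 x = s.ext 20 x := fun x =>
    (Store.ext_congr (hF₄.ints_eq ima.1) (hF₄.reals_eq ima.2) x).trans (eR x)
  have g11 : s₄.ints 11 = s.ints 11 := by
    rw [hF₄.ints_eq ima.1, hF₃.ints_eq imf.1, hF₂.int _, hF₁.int _]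
  have g12 : s₄.ints 12 = s.ints 12 := by
    rw [hF₄.ints_eq ima.1, hF₃.ints_eq imf.1, hF₂.int _, hF₁.int _]
  set bt' := s₄.ints 34 0 with hbt'; have hm' := hmem₂ bt' f1 f2
  -- the new entry
  have hE : Tr N (.setInt 20 (iv 32 + iv 39) 1 ;; .setReal 20 (iv 32 + iv 39) (.read 43 0) ;;
      .setInt 11 (iv 32 + iv 39) (.read 41 (iv 34)) ;; .setInt 12 (iv 32 + iv 39) (iv 45)) s₄ 60
      fun s₅ => (∀ x, s₅.ext 20 x = if x = b + i then (s₄.reals 43 0 : WithTop ℝ) else s.ext 20 x) ∧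
        (∀ x, s₅.ints 11 x = if x = b + i then s₂.ints 41 bt' else s.ints 11 x) ∧
        (∀ x, s₅.ints 12 x = if x = b + i then s₄.ints 45 0 else s.ints 12 x) ∧
        s₅.ints 34 = s₄.ints 34 ∧ s₅.ints 35 = s₄.ints 35 ∧ s₅.ints 36 = s₄.ints 36 ∧
        s₅.ints 41 = s₄.ints 41 := by
    refine Tr.of_wp_le ?_; simp [wp, g32, g39, g41, ← hbt']
    refine ⟨by omega, by omega, f7, fun x => ?_, fun x => ?_, fun x => ?_⟩
    · have hg := gR x; unfold Store.ext at hg ⊢; by_cases hx : x = b + i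
      · simp [hx]
      · simpa [hx] using hg
    · simp [g11]
    · simp [g12]
  obtain ⟨s₅, t₅, hex₅, ht₅, k1, k2, k3, k4, k5, k6, k7⟩ := hE
  refine ⟨s₅, _, hex₁.seq (hex₂.seq (hex₃.seq (hex₄.seq hex₅))), ?_, ?_⟩
  · set R' : ℕ → WithTop ℝ := fun j => s₅.ext 20 (b + j) with hR'
    have hRR : ∀ x, x ≠ i → R' x = R x := fun x hx => by
      simp only [hR', hR]; rw [k1, if_neg (by omega)]
    have hRi : R' i = cutCost lc R i (s₂.ints 41 bt') := by simp only [hR']; rw [k1, if_pos rfl, f5]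
    have hdq : Deque lc R cnt (s₂.ints 41) bt' (s₂.ints 35 0) (j - 1) (i + 1) :=
      b1.advance h.mono f1 f2 (by omega) le_rfl f3
    refine ⟨?_, ?_, fun _ => ?_, ?_, ?_, ?_⟩
    · rw [k4, k5, k7, g35, g41, hi0']; rw [show cnt - (q + 1) = j - 1 by omega]
      exact (hdq.anti_i (by omega)).congr fun x h1 h2 => hRR x (by omega)
    · rw [k5, g35]; omega
    · rw [k4, k5, g35]; exact f2
    · rw [k4, k5, k6, k7, g35, g41]
      have hall : ∀ e < 2, ∀ j', (j' ≤ j - 1 ∨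
          ∃ x, bt' + e ≤ x ∧ x < s₂.ints 35 0 ∧ j' = s₂.ints 41 x) → Pt (s₄.ints 36 e) i j' := by
        intro e he j' hj'; obtain rfl | rfl : e = 0 ∨ e = 1 := by omega
        · rw [f10]; refine h.anti _ i i _ _ le_rfl ?_ d4; rcases hj' with h1 | ⟨x, h1, h2, rfl⟩
          · have := (b1.mem bt le_rfl b2).1; omega
          · rcases (show bt ≤ x by omega).eq_or_lt with rfl | h3
            · exact le_rfl
            · exact (b1.anti bt x le_rfl h3 h2).1.le
        · rcases hj' with h1 | ⟨x, h1, h2, rfl⟩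
          · refine f9 j' (fun x h2 h3 => ?_) (hpt₂ 1 (by omega) _ (Or.inl h1))
            have := (b1.mem x h2 h3).1; omega
          · grind
      intro e he j' hj'; refine h.anti _ i _ _ _ (by omega) le_rfl (hall e he j' ?_)
      rcases hj' with h1 | h1
      · omega
      · exact Or.inr h1
    · intro i' hi' hle; rw [hi0'] at hle; rcases hle.eq_or_lt with rfl | hlt
      · rw [k2, k3, if_pos rfl, if_pos rfl]; have hm := b1.mem bt' f1 f2
        have hcut : ∀ x, i < x → cutCost lc R' i x = cutCost lc R i x := fun x hx => by
          rw [cutCost, cutCost, hRR x (by omega)]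
        refine ⟨fun hh => by omega, fun h1 h2 => by omega, fun _ => by omega, fun _ => hm.2.1,
          fun _ => ?_, fun _ => f6, fun _ x h1 h2 => ?_⟩
        · show R' i = cutCost lc R' i _; rw [hRi, hcut _ hm'.1]
        · show R' i ≤ cutCost lc R' i x; rw [hRi, hcut _ (by omega)]
          exact hdq.optimal h.mono f2 (by omega) (by omega) f4 (by omega) h2
      · rw [k2, k3, if_neg (by omega), if_neg (by omega)]
        exact (hI.cell i' hi' (by omega)).congr hr (fun x h1 h2 => hRR x (by omega)) hi'
    · intro a ha; rw [k1, k2, k3, if_neg (by omega), if_neg (by omega), if_neg (by omega)]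
      exact hI.others a ha
  · unfold linePotential; rw [k4, k5, k6, g35, f10, ← hbt', ← hbt]
    exact lineStep_time ht₁ b5 d6 f11 ht₅ (by omega) (by omega)

end

/-! ### The suffix costs of all legs -/

section
variable {N : ℕ}

/-- `e` gives the initial value of both pointers, and the empty suffix gets cost `0`. Subtraction is
truncated, so there is no round for a leg with fewer than `r` users. -/
def Program.lineLeg (phi : Program) (e : IExp) : Program :=
  (.setInt 32 0 (iv 31 * (.read 0 2 + 1)) ;; .setInt 33 0 (.read 50 (iv 31)) ;;
    .setInt 34 0 0 ;; .setInt 35 0 0 ;; .setInt 36 0 e ;; .setInt 36 1 e ;;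
    .setInt 20 (iv 32 + iv 33) 1 ;; .setReal 20 (iv 32 + iv 33) .zero) ;;
  .forUp 37 (iv 33 + 1 - .read 0 1) (.lineStep phi)

/-- The table of the optimal costs of the sets `Users.suf l i`. -/
def Program.lineTable (phi : Program) (e : IExp) : Program := .forUp 31 (.read 0 0) (.lineLeg phi e)

structure LineTable (U : Users) (lc : ℕ → ℕ → ℕ → ℝ) (Lab : ℕ → ℕ → ℕ → ℕ → Prop) (l : ℕ) (s : Store) :
    Prop where
  cell : ∀ i ≤ U.cnt l, LineCell (lc l) (Lab l) (fun j => s.ext 20 (l * (U.n + 1) + j)) (U.cnt l) U.r i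
    (s.ints 11 (l * (U.n + 1) + i)) (s.ints 12 (l * (U.n + 1) + i))

theorem Users.cnt_le (U : Users) (l : ℕ) : U.cnt l ≤ U.n := Nat.count_le _

theorem Users.sum_cnt (U : Users) : ∑ l ∈ Finset.range U.d, U.cnt l = U.n := by
  have h := Finset.card_eq_sum_card_fiberwise (s := Finset.range U.n) (t := Finset.range U.d) (f := U.leg)
    (fun u hu => by
      have := U.leg_lt u (by simpa using hu)
      simpa using this)
  rw [Finset.card_range] at h; rw [h]
  exact Finset.sum_congr rfl fun l _ => Nat.count_eq_card_filter_range ..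

theorem mem_trans {l L L' : List ℕ} (h : ∀ a ∈ l, a ∈ L) (h' : ∀ a ∈ L, a ∈ L' := by decide) : ∀ a ∈ l, a ∈ L' :=
  fun a ha => h' a (h a ha)

theorem LinePhi.im_lineStep {C cnt : ℕ} {phi : Program} {G : Store → Prop} {lc : ℕ → ℕ → ℝ}
    {Lab Pt : ℕ → ℕ → ℕ → Prop} (h : LinePhi N C phi G cnt lc Lab Pt) :
    (∀ a ∈ (Program.lineStep phi).im,
      a ∈ [11, 12, 20, 34, 35, 36, 38, 39, 40, 41, 42, 43, 44, 45, 46, 47]) ∧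
    ∀ a ∈ (Program.lineStep phi).rm, a ∈ [20, 42, 43, 44] := by
  constructor
  · exact List.forall_mem_append.2 ⟨by decide, List.forall_mem_append.2 ⟨by decide,
      List.forall_mem_append.2 ⟨mem_trans h.im_firstValue.1,
      List.forall_mem_append.2 ⟨mem_trans h.im_advance.1, by decide⟩⟩⟩⟩
  · exact List.forall_mem_append.2 ⟨by decide, List.forall_mem_append.2 ⟨by decide,
      List.forall_mem_append.2 ⟨mem_trans h.im_firstValue.2,
      List.forall_mem_append.2 ⟨mem_trans h.im_advance.2, by decide⟩⟩⟩⟩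

theorem lineLeg_spec {U : Users} {C F l : ℕ} {phi : Program} {e : IExp} {G : Store → Prop}
    {lc : ℕ → ℕ → ℝ} {Lab Pt : ℕ → ℕ → ℕ → Prop} (h : LinePhi N C phi G (U.cnt l) lc Lab Pt)
    {s : Store} (hN : U.n + 2 < N) (hdN : U.d < N) (hl : l < U.d) (h0 : s.ints 0 0 = U.d) (h1 : s.ints 0 1 = U.r)
    (h2 : s.ints 0 2 = U.n) (h31 : s.ints 31 0 = l) (h50 : s.ints 50 l = U.cnt l)
    (hlN : (U.n + 1) * U.d < N)
    (hG : ∀ s', (∀ a, a ∉ [11, 12, 20, 32, 33, 34, 35, 36, 37, 38, 39, 40, 41, 42, 43, 44, 45, 46, 47] →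
      s'.ints a = s.ints a) → (∀ a, a ∉ [20, 42, 43, 44] → s'.reals a = s.reals a) →
      s'.ints 31 0 = l → s'.ints 32 0 = l * (U.n + 1) → s'.ints 33 0 = U.cnt l → G s' ∧ e.val s' = F)
    (hF : F < N) (hPt : ∀ i j, j ≤ U.cnt l → Pt F i j)
    (hfresh : ∀ i ≤ U.n, s.ext 20 (l * (U.n + 1) + i) = ⊤) :
    Tr N (.lineLeg phi e) s ((5 * C + 3000) * (U.cnt l + 1) + 2 * e.cost + 2 * C * F) fun s' =>
      (∀ i ≤ U.cnt l, LineCell lc Lab (fun j => s'.ext 20 (l * (U.n + 1) + j)) (U.cnt l) U.r i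
        (s'.ints 11 (l * (U.n + 1) + i)) (s'.ints 12 (l * (U.n + 1) + i))) ∧
      ∀ a, a < l * (U.n + 1) ∨ l * (U.n + 1) + U.cnt l < a → s'.ext 20 a = s.ext 20 a ∧
        s'.ints 11 a = s.ints 11 a ∧ s'.ints 12 a = s.ints 12 a := by
  have hcn := U.cnt_le l; have hr := U.hr; set b := l * (U.n + 1) with hb
  set cnt := U.cnt l with hcnt
  have hbN : b + cnt < N := by
    have : b + (U.n + 1) ≤ (U.n + 1) * U.d := by
      rw [hb, mul_comm]
      calc (U.n + 1) * l + (U.n + 1) = (U.n + 1) * (l + 1) := by ring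
        _ ≤ _ := Nat.mul_le_mul_left _ hl
    omega
  have hA : Tr N (.setInt 32 0 (iv 31 * (.read 0 2 + 1)) ;; .setInt 33 0 (.read 50 (iv 31)) ;;
      .setInt 34 0 0 ;; .setInt 35 0 0 ;; .setInt 36 0 e ;; .setInt 36 1 e ;;
      .setInt 20 (iv 32 + iv 33) 1 ;; .setReal 20 (iv 32 + iv 33) .zero) s (100 + 2 * e.cost) fun s₁ =>
      s₁.ints 31 0 = l ∧ s₁.ints 32 0 = b ∧ s₁.ints 33 0 = cnt ∧ s₁.ints 34 0 = 0 ∧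
      s₁.ints 35 0 = 0 ∧ s₁.ints 36 0 = F ∧ s₁.ints 36 1 = F ∧
      (∀ a, s₁.ext 20 a = if a = b + cnt then 0 else s.ext 20 a) := by
    refine (Tr.of_wp ?_).mono (t := Program.cst _) ?_ fun _ _ h => h
    · have e1 := (hG ((((s.setInt 32 0 b).setInt 33 0 cnt).setInt 34 0 0).setInt 35 0 0)
        (fun a ha => by simp at ha; simp [ha])
        (fun a _ => rfl) (by simpa using h31) (by simp) (by simp)).2
      have e2 := (hG (((((s.setInt 32 0 b).setInt 33 0 cnt).setInt 34 0 0).setInt 35 0 0).setInt 36 0 F)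
        (fun a ha => by simp at ha; simp [ha])
        (fun a _ => rfl) (by simpa using h31) (by simp) (by simp)).2
      simp only [wp, IExp.val_zero, IExp.val_mul, IExp.val_add, IExp.val_iv, IExp.val_read,
        IExp.val_one, IExp.val_two, h31, h2]
      rw [← hb]
      simp only [ne_eq, Nat.reduceEqDiff, not_false_eq_true,
        Store.ints_setInt_ne, h31, h50, e1, e2]
      simp [h31]; refine ⟨by omega, by omega, by omega, hF, by omega, fun a => ?_⟩; unfold Store.ext
      by_cases ha : a = b + cnt
      <;> simp [ha]
    · simp only [Program.cst, iv]; have : ∀ c, (IExp.const c).cost = 1 := fun _ => rfl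
      have e0 : (0 : IExp).cost = 1 := rfl; have e1 : (1 : IExp).cost = 1 := rfl
      have hadd : ∀ e f : IExp, (e + f).cost = e.cost + f.cost + 1 := fun _ _ => rfl
      have hmul : ∀ e f : IExp, (e * f).cost = e.cost + f.cost + 1 := fun _ _ => rfl
      have e2 : (2 : IExp).cost = 1 := rfl; simp only [IExp.cost, RExp.cost]
      omega
  obtain ⟨s₁, t₁, hex₁, ht₁, a31, a32, a33, a34, a35, a36, a36', aR⟩ := hA; have hF₁ := hex₁.frame
  have im₁ : ∀ a, a ∉ [20, 32, 33, 34, 35, 36] → s₁.ints a = s.ints a := fun a ha =>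
    hF₁.1 a (by simp at ha; simp [Program.im]; omega)
  have rm₁ : ∀ a, a ∉ [20] → s₁.reals a = s.reals a := fun a ha =>
    hF₁.2 a (by simp at ha; simp [Program.rm]; omega)
  have ims := h.im_lineStep
  have imf : ∀ a ∈ (Program.forUp 37 (iv 33 + 1 - .read 0 1) (.lineStep phi)).im,
      a ∈ [11, 12, 20, 34, 35, 36, 37, 38, 39, 40, 41, 42, 43, 44, 45, 46, 47] := by
    exact List.forall_mem_append.2 ⟨by decide, List.forall_mem_append.2
      ⟨mem_trans ims.1, by decide⟩⟩
  have rmf : ∀ a ∈ (Program.forUp 37 (iv 33 + 1 - .read 0 1) (.lineStep phi)).rm,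
      a ∈ [20, 42, 43, 44] := by
    exact List.forall_mem_append.2 ⟨by decide, List.forall_mem_append.2
      ⟨mem_trans ims.2, by decide⟩⟩
  have hsame : ∀ s' : Store, Frame (.forUp 37 (iv 33 + 1 - .read 0 1) (.lineStep phi)) s₁ s' →
      G s' ∧ s'.ints 32 0 = b ∧ s'.ints 33 0 = cnt ∧ s'.ints 0 1 = U.r := by
    intro s' hf; have b31 : s'.ints 31 0 = l := by rw [hf.ints_eq imf]; exact a31
    have b32 : s'.ints 32 0 = b := by rw [hf.ints_eq imf]; exact a32
    have b33 : s'.ints 33 0 = cnt := by rw [hf.ints_eq imf]; exact a33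
    refine ⟨(hG s' (fun a ha => ?_) (fun a ha => ?_) b31 b32 b33).1, b32, b33, ?_⟩
    · rw [hf.ints_eq imf (by grind), im₁ _ (by grind)]
    · rw [hf.reals_eq rmf (by grind), rm₁ _ (by grind)]
    · rw [hf.ints_eq imf, im₁ 0 (by decide), h1]
  have hnot37 : 37 ∉ (Program.lineStep phi).im := fun hh => absurd (ims.1 _ hh) (by decide)
  have congr37 : ∀ q v (s' : Store), LineInv lc Lab Pt cnt U.r b q s₁ s' →
      LineInv lc Lab Pt cnt U.r b q s₁ (s'.setInt 37 0 v) := by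
    intro q v s' hI
    refine ⟨by simpa using hI.deque, by simpa using hI.tp_le, by simpa using hI.nonempty,
      fun e he j hj => ?_, by simpa using hI.cell, by simpa using hI.others⟩
    simpa using hI.pt e he j (by simpa using hj)
  obtain ⟨s₂, t₂, hex₂, hI, ht₂⟩ := Tm.forUp (N := N) (v := 37) (hi := iv 33 + 1 - .read 0 1)
    (body := .lineStep phi) (s := s₁) (m := cnt + 1 - U.r) (fun _ => 5 * C + 2000) (linePotential C)
    (LineInv lc Lab Pt cnt U.r b · s₁) (by omega) hnot37
    (by
      apply congr37
      refine ⟨?_, by omega, fun h => absurd h (by omega), fun e' he' j hj => ?_, fun i hi hle => ?_,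
        fun a _ => ⟨rfl, rfl, rfl⟩⟩
      · rw [a34, a35]
        exact ⟨le_rfl, fun x _ h2 => absurd h2 (by omega), fun x y _ _ h2 => absurd h2 (by omega),
          fun j h1 h2 => absurd h2 (by omega)⟩
      · have hj' : j ≤ cnt := by
          rcases hj with h3 | ⟨x, h3, h4, -⟩
          · omega
          · omega
        obtain rfl | rfl : e' = 0 ∨ e' = 1 := by omega
        · rw [a36]; exact hPt _ _ hj'
        · rw [a36']; exact hPt _ _ hj'
      · refine ⟨fun hh => ?_, fun h3 _ => ?_, fun h3 => by omega, fun h3 => by omega,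
          fun h3 => by omega, fun h3 => by omega, fun h3 => by omega⟩
        · beta_reduce
          rw [aR, if_pos (by omega)]
        · beta_reduce
          rw [aR, if_neg (by omega)]
          exact hfresh i (by omega))
    (by
      intro k _ s' hf _ _; have := hsame s' hf
      simp [this.2.2.1, this.2.2.2])
    (by
      intro k hk s' hf hk' hI; have := hsame s' hf
      refine Tm.mono (lineStep_spec h hr (by omega) this.1 this.2.1 this.2.2.1 this.2.2.2 hk' (by omega) hI)
        fun s'' t _ hh => ⟨congr37 _ _ _ hh.1, ?_⟩
      have e1 : linePotential C (s''.setInt 37 0 (k + 1)) = linePotential C s'' := by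
        simp [linePotential]
      rw [e1]; exact hh.2)
  refine ⟨s₂, _, hex₁.seq hex₂, ?_, fun i hi => ?_, fun a ha => ?_⟩
  · have e1 : linePotential C (s₁.setInt 37 0 0) = C * (F + F) := by
      simp [linePotential, a34, a35, a36, a36']
    have e2 : (iv 33 + 1 - .read 0 1).cost = 7 := rfl
    rw [e1, e2, Finset.sum_const, Finset.card_range, smul_eq_mul] at ht₂
    have h3 : (cnt + 1 - U.r) * (5 * C + 2000 + 7 + 20) ≤ cnt * (5 * C + 2000 + 7 + 20) :=
      Nat.mul_le_mul_right _ (by omega)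
    have h4 : (5 * C + 3000) * (cnt + 1) = cnt * (5 * C + 2000 + 7 + 20) + 973 * cnt + (5 * C + 3000) := by
      ring
    have h5 : C * (F + F) = 2 * C * F := by ring
    omega
  · exact hI.cell i hi (by omega)
  · have h3 := hI.others a ha
    rw [h3.1, h3.2.1, h3.2.2, im₁ 11 (by decide), im₁ 12 (by decide), aR, if_neg (by omega)]; grind


theorem LinePhi.im_lineLeg {C cnt : ℕ} {phi : Program} {G : Store → Prop} {lc : ℕ → ℕ → ℝ}
    {Lab Pt : ℕ → ℕ → ℕ → Prop} (h : LinePhi N C phi G cnt lc Lab Pt) (e : IExp) :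
    (∀ a ∈ (Program.lineLeg phi e).im,
      a ∈ [11, 12, 20, 32, 33, 34, 35, 36, 37, 38, 39, 40, 41, 42, 43, 44, 45, 46, 47]) ∧
    ∀ a ∈ (Program.lineLeg phi e).rm, a ∈ [20, 42, 43, 44] := by
  have ims := h.im_lineStep; constructor
  · exact List.forall_mem_append.2 ⟨by intro a ha; simp [Program.im] at ha ⊢; omega, List.forall_mem_append.2 ⟨by decide,
      List.forall_mem_append.2 ⟨mem_trans ims.1, by decide⟩⟩⟩
  · exact List.forall_mem_append.2 ⟨by intro a ha; simp [Program.rm] at ha ⊢; omega, List.forall_mem_append.2 ⟨by decide,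
      List.forall_mem_append.2 ⟨mem_trans ims.2, by decide⟩⟩⟩

/-- On each leg the amortized time is linear in the number of its users and in the initial pointer.
The former add up to `n`, which makes the whole table linear. -/
theorem lineTable_spec {U : Users} {C : ℕ} {F : ℕ → ℕ} {phi : Program} {e : IExp}
    {G : ℕ → Store → Prop} {lc : ℕ → ℕ → ℕ → ℝ} {Lab Pt : ℕ → ℕ → ℕ → ℕ → Prop}
    (h : ∀ l < U.d, LinePhi N C phi (G l) (U.cnt l) (lc l) (Lab l) (Pt l))
    {s : Store} (hd : 1 ≤ U.d) (hN : U.n + 2 < N) (hdN : U.d < N) (h0 : s.ints 0 0 = U.d)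
    (h1 : s.ints 0 1 = U.r)
    (h2 : s.ints 0 2 = U.n) (h50 : ∀ l < U.d, s.ints 50 l = U.cnt l) (hlN : (U.n + 1) * U.d < N)
    (hG : ∀ l < U.d, ∀ s', (∀ a, a ∉ [11, 12, 20, 31, 32, 33, 34, 35, 36, 37, 38, 39, 40, 41, 42, 43,
      44, 45, 46, 47] → s'.ints a = s.ints a) → (∀ a, a ∉ [20, 42, 43, 44] → s'.reals a = s.reals a) →
      s'.ints 31 0 = l → s'.ints 32 0 = l * (U.n + 1) → s'.ints 33 0 = U.cnt l →
      G l s' ∧ e.val s' = F l)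
    (hF : ∀ l < U.d, F l < N) (hPt : ∀ l < U.d, ∀ i j, j ≤ U.cnt l → Pt l (F l) i j)
    (hfresh : ∀ a, s.ext 20 a = ⊤) :
    Tr N (.lineTable phi e) s ((7 * C + 4000 + 2 * e.cost) *
        (U.n + U.d + ∑ l ∈ Finset.range U.d, F l + 1)) fun s' =>
      ∀ l < U.d, LineTable U lc Lab l s' := by
  have iml := (h 0 hd).im_lineLeg e
  have imt : ∀ a ∈ (Program.forUp 31 (.read 0 0) (.lineLeg phi e)).im,
      a ∈ [11, 12, 20, 31, 32, 33, 34, 35, 36, 37, 38, 39, 40, 41, 42, 43, 44, 45, 46, 47] :=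
    List.forall_mem_append.2 ⟨by decide, List.forall_mem_append.2
      ⟨mem_trans iml.1, by decide⟩⟩
  have rmt : ∀ a ∈ (Program.forUp 31 (.read 0 0) (.lineLeg phi e)).rm, a ∈ [20, 42, 43, 44] :=
    List.forall_mem_append.2 ⟨by decide, List.forall_mem_append.2
      ⟨mem_trans iml.2, by decide⟩⟩
  have hsame : ∀ l k (s' : Store), LineTable U lc Lab l s' → LineTable U lc Lab l (s'.setInt 31 0 k) :=
    fun l k s' hh => ⟨by simpa using hh.cell⟩
  refine Tm.mono (Tm.forUp (N := N) (v := 31) (hi := .read 0 0) (body := .lineLeg phi e) (s := s)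
    (m := U.d) (fun l => (5 * C + 3000) * (U.cnt l + 1) + 2 * e.cost + 2 * C * F l) (fun _ => 0)
    (fun k s' => (∀ l < k, LineTable U lc Lab l s') ∧ ∀ a, k * (U.n + 1) ≤ a → s'.ext 20 a = ⊤) hdN
    (fun hh => absurd (iml.1 _ hh) (by decide)) ⟨fun l hl => by omega, fun a _ => by simpa using hfresh a⟩
    ?_ ?_) ?_
  · intro k _ s' hf _ _; have : s'.ints 0 = s.ints 0 := hf.ints_eq imt; simp [this, h0]
  · intro l hl s' hf hk hI; have e0 : s'.ints 0 = s.ints 0 := hf.ints_eq imt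
    have e50 : s'.ints 50 = s.ints 50 := hf.ints_eq imt
    refine Tm.mono (lineLeg_spec (F := F l) (h l hl) hN hdN hl (by rw [e0, h0]) (by rw [e0, h1]) (by rw [e0, h2])
      hk (by grind) hlN ?_ (hF l hl) (hPt l hl) fun i _ => hI.2 _ (by omega)) ?_
    · intro s'' ha hb h31 h32 h33
      refine hG l hl s'' (fun a ha' => ?_) (fun a ha' => ?_) h31 h32 h33
      · rw [ha a (fun hh => ha' ((by decide : ∀ x ∈ [11, 12, 20, 32, 33, 34, 35, 36, 37, 38, 39, 40, 41, 42, 43, 44, 45, 46, 47],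
          x ∈ [11, 12, 20, 31, 32, 33, 34, 35, 36, 37, 38, 39, 40, 41, 42, 43, 44, 45, 46, 47]) a hh)), hf.ints_eq imt ha']
      · rw [hb a ha', hf.reals_eq rmt ha']
    · rintro s'' t hf' ⟨ht, hc, ho⟩
      refine ⟨⟨fun l' hl' => hsame _ _ _ ?_, fun a ha => ?_⟩, by simpa using ht⟩
      · rcases Nat.lt_succ_iff_lt_or_eq.1 hl' with h3 | rfl
        · have hb : ∀ i ≤ U.n, l' * (U.n + 1) + i < l * (U.n + 1) := by
            intro i hi
            calc l' * (U.n + 1) + i < l' * (U.n + 1) + (U.n + 1) := by omega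
              _ = (l' + 1) * (U.n + 1) := by ring
              _ ≤ _ := Nat.mul_le_mul_right _ h3
          refine ⟨fun i hi => ?_⟩; have hcn := U.cnt_le l'
          have h4 := ho _ (Or.inl (hb i (by omega))); rw [h4.2.1, h4.2.2]
          exact ((hI.1 l' h3).cell i hi).congr U.hr
            (fun j _ hj => (ho _ (Or.inl (hb j (by omega)))).1) hi
        · exact ⟨hc⟩
      · have hcn := U.cnt_le l; have h3 : (l + 1) * (U.n + 1) = l * (U.n + 1) + (U.n + 1) := by ring
        rw [Store.ext_setInt _ _ _ _ (by decide), (ho a (Or.inr (by omega))).1]; grind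
  · rintro s' t hf ⟨hI, ht⟩; refine ⟨?_, hI.1⟩; have e1 : (IExp.read 0 0).cost = 2 := rfl
    rw [e1] at ht
    simp only [Finset.sum_add_distrib, ← Finset.mul_sum, Finset.sum_const, Finset.card_range,
      smul_eq_mul, U.sum_cnt, mul_one, mul_add] at ht
    set S := ∑ l ∈ Finset.range U.d, F l
    clear_value S
    clear * - ht
    have h1 : 0 ≤ e.cost * U.n := Nat.zero_le _; have h2 : 0 ≤ e.cost * S := Nat.zero_le _
    have h3 : 0 ≤ C * S := Nat.zero_le _; have h4 : 0 ≤ C * U.n := Nat.zero_le _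
    have h5 : 0 ≤ C * U.d := Nat.zero_le _; linarith

end

section
-- Induction along the leg. By `Feas.exists_initial_cluster` a feasible suffix has a clustering that
-- starts with an initial interval, and its end is one of those over which the table minimizes. Its
-- cost is controlled by its two extreme users.
theorem LineTable.le_of_feas {U : Users} {T : Threshold} {lc : ℕ → ℕ → ℕ → ℝ}
    {Lab : ℕ → ℕ → ℕ → ℕ → Prop} {l : ℕ} {s : Store} (h : LineTable U lc Lab l s) {D : ℝ} (hD : 0 ≤ D)
    (hlc : ∀ i j, i < j → j ≤ U.cnt l → ClusterOk U T {U.usr l i, U.usr l (j - 1)} → lc l i j ≤ D) :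
    ∀ i ≤ U.cnt l, Feas U T (U.suf l i) → s.ext 20 (l * (U.n + 1) + i) ≤ (D : WithTop ℝ) := by
  have main : ∀ k i, i + k = U.cnt l → Feas U T (U.suf l i) →
      s.ext 20 (l * (U.n + 1) + i) ≤ (D : WithTop ℝ) := by
    intro k
    induction k using Nat.strong_induction_on with
    | _ k ih =>
    intro i hi hf; rcases Nat.eq_zero_or_pos k with rfl | hk
    · have := (h.cell i (by omega)).last (by omega)
      rw [show s.ext 20 (l * (U.n + 1) + i) = 0 from this]; exact_mod_cast hD
    have hsp := U.usr_spec (show i < U.cnt l by omega)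
    have hiS : U.usr l i ∈ U.suf l i := U.mem_suf.2 ⟨hsp.1, hsp.2.1, hsp.2.2.ge⟩
    obtain ⟨C, hCS, hr, hini, hok, hrest⟩ := hf.exists_initial_cluster
      (fun u hu => (U.mem_suf.1 hu).2.1) ⟨_, hiS⟩
    have hCne : C.Nonempty := Finset.card_pos.1 (by have := U.hr; omega)
    obtain ⟨w, hwC, hwmax⟩ : ∃ w ∈ C, ∀ u ∈ C, u ≤ w :=
      ⟨C.max' hCne, C.max'_mem hCne, fun u hu => C.le_max' u hu⟩
    have hwS := U.mem_suf.1 (hCS hwC)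
    have hmem : ∀ u, u ∈ C ↔ u ∈ U.suf l i ∧ U.idx u ≤ U.idx w := by
      intro u; constructor
      · intro hu; have := U.mem_suf.1 (hCS hu)
        exact ⟨hCS hu, (U.idx_le_idx (by rw [this.2.1, hwS.2.1])).2 (hwmax u hu)⟩
      · rintro ⟨hu, hle⟩; by_contra hn; have h1 := hini w hwC u hu hn; have h2 := U.mem_suf.1 hu
        have := (U.idx_lt_idx (by omega)).2 h1; omega
    have hidx : U.idx w < U.cnt l := by have := U.idx_lt_cnt hwS.1; rwa [hwS.2.1] at this
    have hcard : C.card ≤ U.idx w + 1 - i := by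
      rw [← Nat.card_Ico]
      refine Finset.card_le_card_of_injOn U.idx (fun u hu => ?_) (fun u hu v hv huv => ?_)
      · have h1 := (hmem u).1 hu; have h2 := U.mem_suf.1 h1.1
        simp only [Finset.coe_Ico, Set.mem_Ico]; omega
      · have h1 := U.mem_suf.1 (hCS hu); have h2 := U.mem_suf.1 (hCS hv)
        have h3 := U.idx_lt_idx (show U.leg u = U.leg v by rw [h1.2.1, h2.2.1])
        have h4 := U.idx_lt_idx (show U.leg v = U.leg u by rw [h1.2.1, h2.2.1]); omega
    have hrest' : Feas U T (U.suf l (U.idx w + 1)) := by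
      convert hrest using 1; ext u; rw [Finset.mem_sdiff, hmem, U.mem_suf, U.mem_suf]; constructor
      · rintro ⟨h1, h2, h3⟩; exact ⟨⟨h1, h2, by omega⟩, fun h4 => by omega⟩
      · rintro ⟨⟨h1, h2, h3⟩, h4⟩; refine ⟨h1, h2, ?_⟩; by_contra hn; omega
    have hr1 := U.hr; have hcell := h.cell i (by omega)
    have h1 := hcell.le (by omega) (U.idx w + 1) (by omega) (by omega)
    refine h1.trans (max_le ?_ (ih (U.cnt l - (U.idx w + 1)) (by omega) _ (by omega) hrest'))
    have h2 : U.usr l (U.idx w) = w := by have := U.usr_idx w; rwa [hwS.2.1] at this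
    have h3 := hlc i (U.idx w + 1) (by omega) (by omega) (hok.mono (by
      intro u hu; simp only [Nat.add_sub_cancel, h2, Finset.mem_insert, Finset.mem_singleton] at hu
      rcases hu with rfl | rfl
      · grind
      · exact hwC))
    exact_mod_cast h3
  exact fun i hi hf => main (U.cnt l - i) i (by omega) hf

/-! ### Minimization with a record of the choice -/

def Program.relaxSet (a : ℕ) (i : IExp) (b : ℕ) (j : IExp) (c : ℕ) (k : IExp) (ch : ℕ) (v : IExp) :
    Program := .relax a i b j c k (.setInt ch i v)

structure Relaxed (a i ch v : ℕ) (x : WithTop ℝ) (s s' : Store) : Prop where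
  val : ∀ i', s'.ext a i' = if i' = i then min (s.ext a i) x else s.ext a i'
  choice : s'.ints ch i = if x < s.ext a i then v else s.ints ch i
  other : ∀ i', i' ≠ i → s'.ints ch i' = s.ints ch i'
  pos : ∀ i', i' ≠ i → s'.ints a i' = s.ints a i'
  ints : ∀ a', a' ≠ a → a' ≠ ch → s'.ints a' = s.ints a'
  reals : ∀ a', a' ≠ a → s'.reals a' = s.reals a'

theorem Relaxed.ext {a i ch v : ℕ} {x : WithTop ℝ} {s s' : Store} (h : Relaxed a i ch v x s s')
    {a' : ℕ} (h1 : a' ≠ a) (h2 : a' ≠ ch) (i' : ℕ) : s'.ext a' i' = s.ext a' i' :=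
  Store.ext_congr (h.ints a' h1 h2) (h.reals a' h1) i'

theorem IExp.val_setExt_of {s : Store} {a i x : ℕ} {y : ℝ} (e : IExp) (he : e.val s = x)
    (h : ∀ v, e.val (s.setInt a i v) = e.val s) : e.val (s.setExt a i y) = x := by
  rw [← he, ← h 1, Store.setExt]
  have : (s.setReal a i y).setInt a i 1 = (s.setInt a i 1).setReal a i y := rfl
  rw [this, IExp.val_setReal]

theorem wp_relaxSet {N : ℕ} {a b c ch : ℕ} {i j k v : IExp} {Q : Store → Prop} {s : Store}
    (hN : 1 < N) (hch : ch ≠ a) (hv : v.val s < N)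
    (hi : ∀ x, i.val (s.setInt a (i.val s) x) = i.val s)
    (hv' : ∀ x, v.val (s.setInt a (i.val s) x) = v.val s)
    (h : ∀ s', Relaxed a (i.val s) ch (v.val s) (max (s.ext b (j.val s)) (s.ext c (k.val s))) s s' →
      Q s') : wp N (.relaxSet a i b j c k ch v) Q s := by
  refine wp_relax hN (fun x hx hlt => ?_) fun hle => ?_
  · have e1 : i.val (s.setExt a (i.val s) x) = i.val s := IExp.val_setExt_of i rfl hi
    have e2 : v.val (s.setExt a (i.val s) x) = v.val s := IExp.val_setExt_of v rfl hv'
    simp only [wp, e1, e2]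
    refine ⟨hv, h _ ⟨fun i' => ?_, ?_, fun i' hi' => ?_, fun i' hi' => ?_, fun a' h1 h2 => ?_, fun a' h1 => ?_⟩⟩
    · rw [Store.ext_setInt _ _ _ _ hch.symm, Store.ext_setExt, hx, min_eq_right hlt.le]; simp
    · rw [hx, if_pos hlt]; simp
    · simp [hi', Store.ints_setExt_ne, hch]
    · simp [hch.symm, Store.setExt, hi']
    · rw [Store.ints_setInt_ne _ _ _ h2, Store.ints_setExt_ne _ _ _ h1]
    · rw [Store.reals_setInt, Store.reals_setExt_ne _ _ _ h1]
  · refine h s ⟨fun i' => ?_, ?_, fun _ _ => rfl, fun _ _ => rfl, fun _ _ _ => rfl, fun _ _ => rfl⟩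
    · rw [min_eq_left hle]
      split_ifs with h'
      · rw [h']
      · rfl
    · rw [if_neg (not_lt.2 hle)]

end

/-! ### Filling the tables of the dynamic program -/

section
theorem Relaxed.cases {a i ch v : ℕ} {x : WithTop ℝ} {s s' : Store} (h : Relaxed a i ch v x s s') :
    (s'.ints ch i = v ∧ s'.ext a i = x) ∨ (s'.ints ch i = s.ints ch i ∧ s'.ext a i = s.ext a i) := by
  rw [h.val, h.choice, if_pos rfl]; by_cases hx : x < s.ext a i
  · simp [hx, hx.le]
  · simp [hx, not_lt.1 hx]

section

variable (U : Users) (K : ℕ) (R mc : ℕ → ℕ → WithTop ℝ)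

/-- Input of the dynamic program. -/
structure DpIn (s : Store) : Prop where
  d : s.ints 0 0 = U.d
  r : s.ints 0 1 = U.r
  n : s.ints 0 2 = U.n
  leg : ∀ u < U.n, s.ints 1 u = U.leg u
  posn : ∀ g ≤ U.size K U.n, ∀ l < U.d, s.ints 9 (g * U.d + l) = U.posn K g l
  pow : ∀ l ≤ U.d, s.ints 10 l = 2 ^ l
  masks : s.ints 17 0 = 2 ^ U.d
  idx : ∀ u < U.n, s.ints 52 u = U.idx u
  tl : ∀ g < U.size K U.n, s.ints 54 g = U.tl K g
  size : s.ints 56 0 = U.size K U.n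
  line : ∀ l i, s.ext 20 (l * (U.n + 1) + i) = R l i
  multi : ∀ w z, s.ext 21 (w * U.size K U.n + z) = mc w z

/-- The address of an entry of the table of `segCost`. -/
def iaddr (k mask w need : ℕ) : ℕ := ((k * 2 ^ U.d + mask) * U.size K U.n + w) * (U.r + 1) + need

/-- The codes record what happens to the next user: `0` it is skipped on a closed leg, `1` its leg
is closed, `2` it is taken, `3` it is taken and completes the cluster. -/
def ChoiceI (k mask w need : ℕ) (c : ℕ) : Prop := let g := U.size K U.n - k
  let l := U.leg (U.tl K g)
  (c = 0 ∧ mask.testBit l = true ∧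
    segCost U K R mc k mask w need = segCost U K R mc (k - 1) mask w need) ∨
  (c = 1 ∧ mask.testBit l = false ∧ segCost U K R mc k mask w need =
    max (R l (U.idx (U.tl K g))) (segCost U K R mc (k - 1) (mask + 2 ^ l) w need)) ∨
  (c = 2 ∧ mask.testBit l = false ∧
    segCost U K R mc k mask w need = segCost U K R mc (k - 1) mask w (need - 1)) ∨
  (c = 3 ∧ mask.testBit l = false ∧ need ≤ 1 ∧
    segCost U K R mc k mask w need = max (mc w g) (bestCost U K R mc (k - 1) mask))

structure ICell (k mask w need : ℕ) (s : Store) : Prop where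
  val : s.ext 22 (iaddr U K k mask w need) = segCost U K R mc k mask w need
  choice : segCost U K R mc k mask w need ≠ ⊤ →
    ChoiceI U K R mc k mask w need (s.ints 14 (iaddr U K k mask w need))

/-- Code `0` clusters the open legs separately; code `w + 1` opens the cluster whose outermost
own-leg user is the `w`-th listed one. -/
def ChoiceV (k mask : ℕ) (c : ℕ) : Prop := let g := U.size K U.n - k
  (c = 0 ∧ bestCost U K R mc k mask = finishCost U K R mask g U.d) ∨
  ∃ w < U.size K U.n, c = w + 1 ∧
    bestCost U K R mc k mask = optionCost U K R (segCost U K R mc k) mask g w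

structure VCell (k mask : ℕ) (s : Store) : Prop where
  val : s.ext 23 (k * 2 ^ U.d + mask) = bestCost U K R mc k mask
  choice : bestCost U K R mc k mask ≠ ⊤ → ChoiceV U K R mc k mask (s.ints 15 (k * 2 ^ U.d + mask))

end

variable {N : ℕ} {U : Users} {K : ℕ} {R mc : ℕ → ℕ → WithTop ℝ}

theorem DpIn.congr {s s' : Store} (h : DpIn U K R mc s)
    (hi : ∀ a ∈ [0, 1, 9, 10, 17, 20, 21, 52, 54, 56], s'.ints a = s.ints a)
    (hr : ∀ a ∈ [20, 21], s'.reals a = s.reals a) : DpIn U K R mc s' where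
  d := by rw [hi _ (by decide)]; exact h.d
  r := by rw [hi _ (by decide)]; exact h.r
  n := by rw [hi _ (by decide)]; exact h.n
  leg := by rw [hi _ (by decide)]; exact h.leg
  posn := by rw [hi _ (by decide)]; exact h.posn
  pow := by rw [hi _ (by decide)]; exact h.pow
  masks := by rw [hi _ (by decide)]; exact h.masks
  idx := by rw [hi _ (by decide)]; exact h.idx
  tl := by rw [hi _ (by decide)]; exact h.tl
  size := by rw [hi _ (by decide)]; exact h.size
  line l i := by rw [Store.ext_congr (hi _ (by decide)) (hr _ (by decide))]; exact h.line l i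
  multi w z := by rw [Store.ext_congr (hi _ (by decide)) (hr _ (by decide))]; exact h.multi w z

theorem DpIn.frame {s s' : Store} (h : DpIn U K R mc s) {p : Program} (hf : Frame p s s')
    (hi : ∀ a ∈ [0, 1, 9, 10, 17, 20, 21, 52, 54, 56], a ∉ p.im := by decide)
    (hr : ∀ a ∈ [20, 21], a ∉ p.rm := by decide) : DpIn U K R mc s' :=
  h.congr (fun a ha => hf.1 a (hi a ha)) fun a ha => hf.2 a (hr a ha)

theorem iaddr_eq (k mask w need : ℕ) : iaddr U K k mask w need =
    k * (2 ^ U.d * U.size K U.n * (U.r + 1)) + ((mask * U.size K U.n + w) * (U.r + 1) + need) := by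
  unfold iaddr; ring

theorem triple_lt {M G r mask w need : ℕ} (hm : mask < M) (hw : w < G) (hn : need ≤ r) :
    (mask * G + w) * (r + 1) + need < M * G * (r + 1) := by
  have h1 : mask * G + w + 1 ≤ M * G := by
    calc mask * G + w + 1 ≤ mask * G + G := by omega
      _ = (mask + 1) * G := by ring
      _ ≤ _ := Nat.mul_le_mul_right _ hm
  calc (mask * G + w) * (r + 1) + need < (mask * G + w) * (r + 1) + (r + 1) := by omega
    _ = (mask * G + w + 1) * (r + 1) := by ring
    _ ≤ _ := Nat.mul_le_mul_right _ h1

/-- Mixed-radix decoding in the form in which the machine can do it: it divides, and remainders are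
differences. -/
theorem exists_triple {M G r t : ℕ} (ht : t < M * G * (r + 1)) :
    t / (r + 1) / G < M ∧ t / (r + 1) - t / (r + 1) / G * G < G ∧ t - t / (r + 1) * (r + 1) ≤ r ∧
      t = (t / (r + 1) / G * G + (t / (r + 1) - t / (r + 1) / G * G)) * (r + 1) +
        (t - t / (r + 1) * (r + 1)) := by
  have h1 : t / (r + 1) < M * G := Nat.div_lt_of_lt_mul (by rwa [mul_comm] at ht)
  have hG : 0 < G := by
    rcases Nat.eq_zero_or_pos G with rfl | h
    · simp at h1
    · exact h
  have h2 := Nat.div_add_mod t (r + 1); have h3 := Nat.mod_lt t (show 0 < r + 1 by omega)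
  have h4 := Nat.div_add_mod (t / (r + 1)) G; have h5 := Nat.mod_lt (t / (r + 1)) hG
  rw [mul_comm] at h2 h4; refine ⟨Nat.div_lt_of_lt_mul (by grind), by omega, by omega, ?_⟩
  rw [show t / (r + 1) / G * G + (t / (r + 1) - t / (r + 1) / G * G) = t / (r + 1) by omega]; omega

/-! ### One entry of the table of `segCost` -/

/-- Bit `e` of `m`. -/
def IExp.bit (m e : IExp) : IExp := m / .read 10 e - m / .read 10 e / 2 * 2

theorem bit_eq (m l : ℕ) : m / 2 ^ l - m / 2 ^ l / 2 * 2 = if m.testBit l then 1 else 0 := by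
  rw [Nat.testBit_eq_decide_div_mod_eq]
  split_ifs with h
  · simp at h; omega
  · simp at h; omega

/-- Variable `60` runs through one layer and encodes the mask (`66`), the outermost own-leg user
(`67`) and the need (`62`). Variables `64` and `65` are the address of the entry and that of the
entry with need `0` in the previous layer; `70` is the bit of leg `68` in the mask. -/
def Program.segDecode : Program := .setInt 61 0 (iv 60 / (.read 0 1 + 1)) ;;
  .setInt 62 0 (iv 60 - iv 61 * (.read 0 1 + 1)) ;;
  .setInt 66 0 (iv 61 / iv 56) ;;
  .setInt 67 0 (iv 61 - iv 66 * iv 56) ;;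
  .setInt 64 0 (iv 48 * (iv 17 * iv 56 * (.read 0 1 + 1)) + iv 60) ;;
  .setInt 65 0 ((((iv 48 - 1) * iv 17 + iv 66) * iv 56 + iv 67) * (.read 0 1 + 1)) ;;
  .setInt 70 0 (.bit (iv 66) (iv 68))

/-- The entry starts at `⊤`, and every alternative of the recursion is one relaxation. A single
value is entered as the maximum of itself with itself. -/
def Program.segFill : Program :=
  .ite (.intLe 1 (iv 70))
    (.relaxSet 22 (iv 64) 22 (iv 65 + iv 62) 22 (iv 65 + iv 62) 14 0)
    (.relaxSet 22 (iv 64) 20 (iv 68 * (.read 0 2 + 1) + iv 69)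
        22 (iv 65 + .read 10 (iv 68) * (iv 56 * (.read 0 1 + 1)) + iv 62) 14 1 ;;
      .relaxSet 22 (iv 64) 22 (iv 65 + (iv 62 - 1)) 22 (iv 65 + (iv 62 - 1)) 14 2 ;;
      .ite (.intLe (iv 62) 1)
        (.relaxSet 22 (iv 64) 21 (iv 67 * iv 56 + iv 63) 23 ((iv 48 - 1) * iv 17 + iv 66) 14 3) .skip)

theorem segFill_spec {s : Store} {k mask w need a g : ℕ} (hN : 3 < N) (h : DpIn U K R mc s)
    (hk : 1 ≤ k) (hkG : k ≤ U.size K U.n) (hg : g = U.size K U.n - k) (ha : a = U.leg (U.tl K g))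
    (hm : mask < 2 ^ U.d) (hw : w < U.size K U.n) (hn : need ≤ U.r)
    (h48 : s.ints 48 0 = k) (h63 : s.ints 63 0 = g) (h68 : s.ints 68 0 = a)
    (h69 : s.ints 69 0 = U.idx (U.tl K g)) (h62 : s.ints 62 0 = need) (h66 : s.ints 66 0 = mask)
    (h67 : s.ints 67 0 = w) (h64 : s.ints 64 0 = iaddr U K k mask w need)
    (h65 : s.ints 65 0 = iaddr U K (k - 1) mask w 0)
    (h70 : s.ints 70 0 = if mask.testBit a then 1 else 0)
    (hfresh : s.ext 22 (iaddr U K k mask w need) = ⊤)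
    (hI : ∀ mask < 2 ^ U.d, ∀ w < U.size K U.n, ∀ need ≤ U.r, ICell U K R mc (k - 1) mask w need s)
    (hV : ∀ mask < 2 ^ U.d, VCell U K R mc (k - 1) mask s) :
    wp N .segFill (fun s' => ICell U K R mc k mask w need s' ∧
      ∀ x, x ≠ iaddr U K k mask w need → s'.ext 22 x = s.ext 22 x ∧ s'.ints 14 x = s.ints 14 x ∧
        s'.ints 22 x = s.ints 22 x) s := by
  obtain ⟨k', rfl⟩ : ∃ k', k = k' + 1 := ⟨k - 1, by omega⟩
  simp only [Nat.add_sub_cancel] at h65 hI hV; set A := iaddr U K (k' + 1) mask w need with hA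
  have hgG : g < U.size K U.n := by omega
  have had : a < U.d := ha ▸ U.leg_lt _ (U.tl_spec hgG).1
  -- The relaxations write into layer `k' + 1` and read from layer `k'` of the same array; the
  -- addresses are distinct.
  have hprev : ∀ m < 2 ^ U.d, ∀ need' ≤ U.r, iaddr U K k' m w need' ≠ A := by
    intro m hm' need' hn'; rw [hA, iaddr_eq, iaddr_eq]; have := triple_lt hm' hw hn'
    have e : (k' + 1) * (2 ^ U.d * U.size K U.n * (U.r + 1)) =
      k' * (2 ^ U.d * U.size K U.n * (U.r + 1)) + 2 ^ U.d * U.size K U.n * (U.r + 1) := by ring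
    omega
  have hbase : ∀ need', iaddr U K k' mask w 0 + need' = iaddr U K k' mask w need' := fun need' => rfl
  have hsegdef : ∀ b, mask.testBit a = b → segCost U K R mc (k' + 1) mask w need =
      if b then segCost U K R mc k' mask w need else
      min (min (max (R a (U.idx (U.tl K g))) (segCost U K R mc k' (mask + 2 ^ a) w need))
        (segCost U K R mc k' mask w (need - 1)))
        (if need ≤ 1 then max (mc w g) (bestCost U K R mc k' mask) else ⊤) := by
    intro b hb; rw [segCost, ← hg]; simp only [← ha, hb]
    rfl
  unfold Program.segFill; simp only [wp, Test.holds_intLe, IExp.val_one, IExp.val_iv, h70]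
  have hval : (iv 64).val s = A := h64; refine ⟨fun hb => ?_, fun hb => ?_⟩
  · have hbit : mask.testBit a = true := by by_contra hn; rw [if_neg hn] at hb; omega
    refine wp_relaxSet (by omega) (by decide) (by simp; omega) (fun x => by simp) (fun x => rfl) fun s' h1 => ?_
    have e1 : (iv 65 + iv 62).val s = iaddr U K k' mask w need := by
      simp only [IExp.val_add, IExp.val_iv, h65, h62]; exact hbase need
    rw [hval, e1, max_self, (hI mask hm w hw need hn).val] at h1; have hv := hsegdef true hbit
    rw [if_pos rfl] at hv
    refine ⟨⟨?_, fun hne => ?_⟩, fun x hx => ⟨?_, h1.other x hx, h1.pos x hx⟩⟩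
    · rw [h1.val, if_pos rfl, hfresh, hv]; simp
    · rcases h1.cases with ⟨h2, -⟩ | ⟨-, h3⟩
      · rw [ChoiceI, ← hg, ← ha, h2]; exact Or.inl ⟨rfl, hbit, hv⟩
      · rw [hfresh, h1.val, if_pos rfl, hfresh, min_eq_right le_top] at h3; grind
    · rw [h1.val, if_neg hx]
  · have hbit : mask.testBit a = false := by
      rw [← Bool.not_eq_true]; intro hn; rw [if_pos hn] at hb; omega
    have hm' := add_two_pow_lt hm had hbit; have hv := hsegdef false hbit
    simp only [Bool.false_eq_true, if_false] at hv
    refine wp_relaxSet (by omega) (by decide) (by simp; omega) (fun x => by simp) (fun x => rfl) fun s₁ h1 => ?_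
    have e1 : (iv 68 * (.read 0 2 + 1) + iv 69).val s = a * (U.n + 1) + U.idx (U.tl K g) := by
      simp [h68, h69, h.n]
    have e2 : (iv 65 + .read 10 (iv 68) * (iv 56 * (.read 0 1 + 1)) + iv 62).val s =
        iaddr U K k' (mask + 2 ^ a) w need := by
      simp only [IExp.val_add, IExp.val_iv, IExp.val_mul, IExp.val_read, IExp.val_one,
        h65, h62, h68, h.size, h.r, h.pow a had.le, iaddr]
      ring
    rw [hval, e1, e2, h.line, (hI _ hm' w hw need hn).val] at h1
    have i1 : ∀ b, b ≠ 22 → b ≠ 14 → s₁.ints b = s.ints b := h1.ints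
    refine wp_relaxSet (by omega) (by decide) (by simp; omega) (fun x => by simp) (fun x => rfl) fun s₂ h2 => ?_
    have e3 : (iv 65 + (iv 62 - 1)).val s₁ = iaddr U K k' mask w (need - 1) := by
      simp only [IExp.val_add, IExp.val_sub, IExp.val_iv, IExp.val_one, i1 65 (by decide) (by decide),
        i1 62 (by decide) (by decide), h65, h62]
      exact hbase _
    have e4 : (iv 64).val s₁ = A := by rw [IExp.val_iv, i1 64 (by decide) (by decide)]; exact h64
    rw [e3, e4, max_self, h1.val, if_neg (hprev _ hm _ (by omega)),
      (hI mask hm w hw (need - 1) (by omega)).val] at h2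
    have i2 : ∀ b, b ≠ 22 → b ≠ 14 → s₂.ints b = s.ints b := fun b h3 h4 =>
      (h2.ints b h3 h4).trans (i1 b h3 h4)
    have v2 : s₂.ext 22 A = min (max (R a (U.idx (U.tl K g))) (segCost U K R mc k' (mask + 2 ^ a) w need))
        (segCost U K R mc k' mask w (need - 1)) := by
      rw [h2.val, if_pos rfl, h1.val, if_pos rfl, hfresh, min_eq_right le_top]
    have c2 : s₂.ext 22 A ≠ ⊤ →
        (s₂.ints 14 A = 1 ∧ s₂.ext 22 A =
          max (R a (U.idx (U.tl K g))) (segCost U K R mc k' (mask + 2 ^ a) w need)) ∨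
        (s₂.ints 14 A = 2 ∧ s₂.ext 22 A = segCost U K R mc k' mask w (need - 1)) := by
      intro hne; rcases h2.cases with ⟨h3, h4⟩ | ⟨h3, h4⟩
      · exact Or.inr ⟨h3, h4⟩
      · rcases h1.cases with ⟨h5, h6⟩ | ⟨h5, h6⟩
        · exact Or.inl ⟨h3.trans h5, h4.trans h6⟩
        · grind
    have o2 : ∀ x, x ≠ A → s₂.ext 22 x = s.ext 22 x ∧ s₂.ints 14 x = s.ints 14 x ∧
        s₂.ints 22 x = s.ints 22 x := fun x hx =>
      ⟨by rw [h2.val, if_neg hx, h1.val, if_neg hx], (h2.other x hx).trans (h1.other x hx),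
        (h2.pos x hx).trans (h1.pos x hx)⟩
    simp only [i2 62 (by decide) (by decide), h62]
    refine ⟨fun hn1 => ?_, fun hn1 => ?_⟩
    · refine wp_relaxSet (by omega) (by decide) (by simp; omega) (fun x => by simp) (fun x => rfl) fun s₃ h3 => ?_
      have e5 : (iv 67 * iv 56 + iv 63).val s₂ = w * U.size K U.n + g := by
        simp only [IExp.val_add, IExp.val_mul, IExp.val_iv, i2 67 (by decide) (by decide),
          i2 56 (by decide) (by decide), i2 63 (by decide) (by decide), h67, h63, h.size]
      have e6 : ((iv 48 - 1) * iv 17 + iv 66).val s₂ = k' * 2 ^ U.d + mask := by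
        simp only [IExp.val_add, IExp.val_mul, IExp.val_iv, IExp.val_sub, IExp.val_one,
          i2 48 (by decide) (by decide), i2 17 (by decide) (by decide), i2 66 (by decide) (by decide),
          h48, h66, h.masks, Nat.add_sub_cancel]
      have e7 : (iv 64).val s₂ = A := by rw [IExp.val_iv, i2 64 (by decide) (by decide)]; exact h64
      rw [e5, e6, e7, h2.ext (by decide) (by decide), h1.ext (by decide) (by decide), h.multi,
        h2.ext (by decide) (by decide), h1.ext (by decide) (by decide), (hV mask hm).val] at h3
      rw [if_pos hn1, ← v2] at hv
      have v3 : s₃.ext 22 A = segCost U K R mc (k' + 1) mask w need := by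
        rw [h3.val, if_pos rfl, hv]
      refine ⟨⟨v3, fun hne => ?_⟩, fun x hx => ⟨?_, ?_, ?_⟩⟩
      · rw [ChoiceI, ← hg, ← ha, ← v3]; rcases h3.cases with ⟨h4, h5⟩ | ⟨h4, h5⟩
        · exact Or.inr (Or.inr (Or.inr ⟨h4, hbit, hn1, h5⟩))
        · rw [← v3, h5] at hne; rw [h4, h5]; rcases c2 hne with h6 | h6
          · grind
          · grind
      · rw [h3.val, if_neg hx]; exact (o2 x hx).1
      · rw [h3.other x hx]; exact (o2 x hx).2.1
      · rw [h3.pos x hx]; exact (o2 x hx).2.2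
    · rw [if_neg hn1, min_eq_left le_top, ← v2] at hv; refine ⟨⟨hv.symm, fun hne => ?_⟩, o2⟩
      rw [ChoiceI, ← hg, ← ha, hv]; rw [hv] at hne; rcases c2 hne with h6 | h6
      · grind
      · grind

end

section
variable {N : ℕ} {U : Users} {K : ℕ} {R mc : ℕ → ℕ → WithTop ℝ}

/-- The entries with addresses below `A` and `B` of the two tables have been computed. -/
structure DpTab (U : Users) (K : ℕ) (R mc : ℕ → ℕ → WithTop ℝ) (A B : ℕ) (s : Store) : Prop where
  seg : ∀ k ≤ U.size K U.n, ∀ mask < 2 ^ U.d, ∀ w < U.size K U.n, ∀ need ≤ U.r,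
    iaddr U K k mask w need < A → ICell U K R mc k mask w need s
  segFresh : ∀ a, A ≤ a → s.ints 22 a = 0
  best : ∀ k ≤ U.size K U.n, ∀ mask < 2 ^ U.d, k * 2 ^ U.d + mask < B → VCell U K R mc k mask s
  bestFresh : ∀ a, B ≤ a → s.ints 23 a = 0

theorem DpTab.congr {A B : ℕ} {s s' : Store} (h : DpTab U K R mc A B s)
    (hi : ∀ a ∈ [14, 15, 22, 23], s'.ints a = s.ints a) (hr : ∀ a ∈ [22, 23], s'.reals a = s.reals a) :
    DpTab U K R mc A B s' := by
  have e22 := Store.ext_congr (hi 22 (by decide)) (hr 22 (by decide))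
  have e23 := Store.ext_congr (hi 23 (by decide)) (hr 23 (by decide))
  refine ⟨fun k hk m hm w hw n hn ha => ⟨?_, ?_⟩, ?_, fun k hk m hm ha => ⟨?_, ?_⟩, ?_⟩
  · rw [e22]; exact (h.seg k hk m hm w hw n hn ha).val
  · rw [hi 14 (by decide)]; exact (h.seg k hk m hm w hw n hn ha).choice
  · rw [hi 22 (by decide)]; exact h.segFresh
  · rw [e23]; exact (h.best k hk m hm ha).val
  · rw [hi 15 (by decide)]; exact (h.best k hk m hm ha).choice
  · rw [hi 23 (by decide)]; exact h.bestFresh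

def Program.segLayer : Program :=
  .forUp 60 (iv 17 * iv 56 * (.read 0 1 + 1)) (.segDecode ;; .segFill)

/-- The size of a layer of the table of `segCost`. -/
def segLen (U : Users) (K : ℕ) : ℕ := 2 ^ U.d * U.size K U.n * (U.r + 1)

theorem segLayer_spec : ∃ c, ∀ (N : ℕ) (U : Users) (K : ℕ) (R mc : ℕ → ℕ → WithTop ℝ) (s : Store)
    (k g a : ℕ), 3 < N → U.n < N → (U.size K U.n + 1) * segLen U K < N → DpIn U K R mc s → 1 ≤ k → k ≤ U.size K U.n →
    g = U.size K U.n - k → a = U.leg (U.tl K g) → s.ints 48 0 = k → s.ints 63 0 = g →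
    s.ints 68 0 = a → s.ints 69 0 = U.idx (U.tl K g) →
    DpTab U K R mc (k * segLen U K) (k * 2 ^ U.d) s →
    Tr N .segLayer s (c * (segLen U K + 1))
      (DpTab U K R mc ((k + 1) * segLen U K) (k * 2 ^ U.d)) := by
  refine ⟨(Program.segDecode ;; Program.segFill).cst + 30,
    fun N U K R mc s k g a hN hnN hL h hk hkG hg ha h48 h63 h68 h69 hT => ?_⟩
  set L := segLen U K with hLdef
  have hLk : (k + 1) * L ≤ (U.size K U.n + 1) * L := Nat.mul_le_mul_right _ (by omega)
  have hk1 : (k + 1) * L = k * L + L := by ring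
  refine Tr.mono (Tr.forUp (m := L) (Program.segDecode ;; Program.segFill).cst
    (fun t => DpTab U K R mc (k * L + t) (k * 2 ^ U.d)) (by nlinarith) (by decide) ?_ ?_ ?_) ?_
    fun s' _ hh => by rw [hk1]; exact hh
  · rw [add_zero]
    exact hT.congr (fun b hb => Store.ints_setInt_of_mem hb)
      fun b _ => rfl
  · intro t _ s' hf _ _; have h' := h.frame hf
    simp only [IExp.val_mul, IExp.val_add, IExp.val_iv, IExp.val_read, IExp.val_one,
      h'.masks, h'.size, h'.r]
    rfl
  · intro t ht s' hf htv hI; have h' := h.frame hf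
    have e48 : s'.ints 48 0 = k := by rw [hf.int _]; exact h48
    have e63 : s'.ints 63 0 = g := by rw [hf.int _]; exact h63
    have e68 : s'.ints 68 0 = a := by rw [hf.int _]; exact h68
    have e69 : s'.ints 69 0 = U.idx (U.tl K g) := by rw [hf.int _]; exact h69
    obtain ⟨d1, d2, d3, d4⟩ := exists_triple (M := 2 ^ U.d) (G := U.size K U.n) (r := U.r) ht
    set q := t / (U.r + 1) with hq; set need := t - q * (U.r + 1) with hneed
    set mask := q / U.size K U.n with hmask; set w := q - mask * U.size K U.n with hw
    have hA : k * L + t = iaddr U K k mask w need := by rw [iaddr_eq, ← d4]; rfl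
    have hgG : g < U.size K U.n := by omega
    have had : a < U.d := ha ▸ U.leg_lt _ (U.tl_spec hgG).1; have hqt : q ≤ t := Nat.div_le_self _ _
    have hmq : mask ≤ q := Nat.div_le_self _ _
    have hprevaddr : ∀ m < 2 ^ U.d, ∀ w < U.size K U.n, ∀ n' ≤ U.r, iaddr U K (k - 1) m w n' < k * L := by
      intro m hm w hw n' hn'; rw [iaddr_eq]; have := triple_lt hm hw hn'
      have e : k * L = (k - 1) * L + L := by
        obtain ⟨k', rfl⟩ : ∃ k', k = k' + 1 := ⟨k - 1, by omega⟩; rw [Nat.add_sub_cancel]; ring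
      rw [e, hLdef]; exact Nat.add_lt_add_left this _
    have hdec : Tr N .segDecode s' Program.segDecode.cst fun s₁ => s₁.ints 62 0 = need ∧
        s₁.ints 66 0 = mask ∧ s₁.ints 67 0 = w ∧ s₁.ints 64 0 = iaddr U K k mask w need ∧
        s₁.ints 65 0 = iaddr U K (k - 1) mask w 0 ∧
        s₁.ints 70 0 = if mask.testBit a then 1 else 0 := by
      refine Tr.of_wp ?_; have hpa := hprevaddr mask d1 w d2 0 (by omega)
      have e1 : k * (2 ^ U.d * U.size K U.n * (U.r + 1)) + t = iaddr U K k mask w need := by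
        rw [← hA]; rfl
      have e2 : (((k - 1) * 2 ^ U.d + mask) * U.size K U.n + w) * (U.r + 1) =
        iaddr U K (k - 1) mask w 0 := rfl
      have e3 := bit_eq mask a; have e0 := h'.r; have e17 := h'.masks; have e56 := h'.size
      have ep := h'.pow a had.le
      simp [Program.segDecode, wp, IExp.bit, htv, e0, e17, e56, e48, e68, ep, ← hq, ← hneed, ← hmask, ← hw]
      rw [e1, e2, e3, ← hA]
      refine ⟨by omega, by omega, by omega, by omega, by omega, by omega, by split_ifs <;> omega, rfl, rfl, rfl⟩
    obtain ⟨s₁, t₁, hex₁, ht₁, f1, f2, f3, f4, f5, f6⟩ := hdec; have hf₁ := hex₁.frame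
    have hT₁ : DpTab U K R mc (k * L + t) (k * 2 ^ U.d) s₁ :=
      hI.congr (fun b hb => hf₁.1 b (by revert b; decide)) (fun b hb => hf₁.2 b (by revert b; decide))
    obtain ⟨s₂, t₂, hex₂, ht₂, hc, ho⟩ := Tr.of_wp
      (segFill_spec (R := R) (mc := mc) hN (h'.frame hf₁) hk hkG hg ha d1 d2 d3
        (by rw [hf₁.int _]; exact e48)
        (by rw [hf₁.int _]; exact e63) (by rw [hf₁.int _]; exact e68)
        (by rw [hf₁.int _]; exact e69) f1 f2 f3 f4 f5 f6
        (by rw [Store.ext, if_pos (hT₁.segFresh _ (by omega))])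
        (fun m hm w hw n' hn' => hT₁.seg _ (by omega) m hm w hw n' hn'
          (by have := hprevaddr m hm w hw n' hn'; omega))
        (fun m hm => hT₁.best _ (by omega) m hm (by
          obtain ⟨k', rfl⟩ : ∃ k', k = k' + 1 := ⟨k - 1, by omega⟩
          rw [Nat.add_sub_cancel, show (k' + 1) * 2 ^ U.d = k' * 2 ^ U.d + 2 ^ U.d by ring]
          omega)))
    have hf₂ := hex₂.frame; refine ⟨s₂, _, hex₁.seq hex₂, Nat.add_le_add ht₁ ht₂, ?_⟩
    refine DpTab.congr (s := s₂) ?_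
      (fun b hb => Store.ints_setInt_of_mem hb) fun b _ => rfl
    refine ⟨fun k' hk' m hm w' hw' n' hn' hlt => ?_, fun x hx => ?_, fun k' hk' m hm hlt => ?_, ?_⟩
    · by_cases heq : iaddr U K k' m w' n' = iaddr U K k mask w need
      · have h1 := (pair_inj (by omega) (by omega)).1 heq; have h2 := (pair_inj hw' d2).1 h1.1
        have h3 := (pair_inj hm d1).1 h2.1; rw [h3.1, h3.2, h2.2, h1.2]; exact hc
      · have h1 := hT₁.seg k' hk' m hm w' hw' n' hn' (by omega); have h2 := ho _ heq
        exact ⟨h2.1.trans h1.val, by rw [h2.2.1]; exact h1.choice⟩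
    · rw [(ho x (by omega)).2.2]; exact hT₁.segFresh x (by omega)
    · have h1 := hT₁.best k' hk' m hm hlt
      exact ⟨by rw [hf₂.ext]; exact h1.val, by rw [hf₂.int _]; exact h1.choice⟩
    · rw [hf₂.int _]; exact hT₁.bestFresh
  · have : (iv 17 * iv 56 * (.read 0 1 + 1)).cost = 10 := rfl; rw [this]; nlinarith

end

section
variable {N : ℕ} {U : Users} {K : ℕ} {R mc : ℕ → ℕ → WithTop ℝ}

theorem finishCost_nonneg (mask g l : ℕ) : 0 ≤ finishCost U K R mask g l := by
  induction l with
  | zero => exact le_rfl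
  | succ l ih => exact ih.trans (le_max_left _ _)

/-! ### One entry of the table of `bestCost` -/

/-- Cell `24` holds the running maximum; its integer part drops to `0` as soon as some open leg
cannot be finished. -/
def Program.finishStep : Program := .setInt 70 0 (.bit (iv 66) (iv 61)) ;;
  .setInt 62 0 (iv 61 * (.read 0 2 + 1) + .read 9 (iv 63 * .read 0 0 + iv 61)) ;;
  .ite (.intLe 1 (iv 70)) .skip
    (.ite (.intLe 1 (.read 20 (iv 62)))
      (.ite (.intLe 1 (iv 24))
        (.ite (.realLe (.read 24 0) (.read 20 (iv 62))) (.setReal 24 0 (.read 20 (iv 62))) .skip) .skip)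
      (.setInt 24 0 0))

theorem finishStep_spec {s : Store} {mask g l : ℕ} (hN : 1 < N) (h : DpIn U K R mc s)
    (hlN : (U.n + 1) * U.d < N) (hg : g ≤ U.size K U.n) (hl : l < U.d)
    (h66 : s.ints 66 0 = mask) (h61 : s.ints 61 0 = l) (h63 : s.ints 63 0 = g)
    (hv : s.ext 24 0 = finishCost U K R mask g l) :
    wp N .finishStep (fun s' => s'.ext 24 0 = finishCost U K R mask g (l + 1)) s := by
  have e0 := h.d; have e2 := h.n; have e9 := h.posn g hg l hl; have ep := h.pow l hl.le
  have eb := bit_eq mask l; have eR := h.line l (U.posn K g l)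
  have hpos := (U.posn_le_cnt hg l).trans (U.cnt_le l)
  have hadr : l * (U.n + 1) + U.posn K g l < N := by
    calc l * (U.n + 1) + U.posn K g l < l * (U.n + 1) + (U.n + 1) := by omega
      _ = (U.n + 1) * (l + 1) := by ring
      _ ≤ (U.n + 1) * U.d := Nat.mul_le_mul_left _ hl
      _ < N := hlN
  have hnn := finishCost_nonneg (U := U) (K := K) (R := R) mask g l
  simp [Program.finishStep, wp, IExp.bit, h66, h61, h63, e0, e2, e9, ep, eb]
  refine ⟨by split_ifs <;> omega, hadr, fun hb => ?_, fun hb => ⟨fun hr => ⟨fun ht => ⟨fun hle => ?_,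
    fun hlt => ?_⟩, fun ht => ?_⟩, fun hr => ⟨by omega, ?_⟩⟩⟩
  · have hbit : mask.testBit l = true := by by_contra hn; simp [hn] at hb
    rw [finishCost, if_pos hbit, max_eq_left hnn, ← hv]
  all_goals
    have hbit : ¬ mask.testBit l = true := by simp_all
    rw [finishCost, if_neg hbit, ← hv, ← eR]
  · have h24 : (s.ints 24 0 = 0) = False := by simp; omega
    have h20 : (s.ints 20 (l * (U.n + 1) + U.posn K g l) = 0) = False := by simp; omega
    simp only [Store.ext, h24, h20]; simp [h24, hle, hb]
  · have h24 : (s.ints 24 0 = 0) = False := by simp; omega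
    have h20 : (s.ints 20 (l * (U.n + 1) + U.posn K g l) = 0) = False := by simp; omega
    simp only [Store.ext, h24, h20]; simp [hlt.le]
  · simp [Store.ext, ht]
  · simp [Store.ext, hr, hb]

def Program.optionStep : Program :=
  .setInt 61 0 (.read 54 (iv 67)) ;; .setInt 68 0 (.read 1 (iv 61)) ;;
  .setInt 69 0 (.read 52 (iv 61) + 1) ;; .setInt 70 0 (.bit (iv 66) (iv 68)) ;;
  .ite (.intLe (iv 63) (iv 67))
    (.ite (.intLe 1 (iv 70)) .skip
      (.relaxSet 23 (iv 64) 20 (iv 68 * (.read 0 2 + 1) + iv 69)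
        22 (((iv 64 + .read 10 (iv 68)) * iv 56 + iv 67) * (.read 0 1 + 1) +
          (.read 0 1 - (iv 69 - .read 9 (iv 63 * .read 0 0 + iv 68)))) 15 (iv 67 + 1)))
    .skip

/-- The entry for `k` and `mask` after the first `w` options. -/
structure BestCell (U : Users) (K : ℕ) (R mc : ℕ → ℕ → WithTop ℝ) (k mask w : ℕ) (s : Store) : Prop where
  val : s.ext 23 (k * 2 ^ U.d + mask) =
    startCost U K R (segCost U K R mc k) mask (U.size K U.n - k) w
  choice : s.ext 23 (k * 2 ^ U.d + mask) ≠ ⊤ → (s.ints 15 (k * 2 ^ U.d + mask) = 0 ∧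
      s.ext 23 (k * 2 ^ U.d + mask) = finishCost U K R mask (U.size K U.n - k) U.d) ∨
    ∃ w' < U.size K U.n, s.ints 15 (k * 2 ^ U.d + mask) = w' + 1 ∧ s.ext 23 (k * 2 ^ U.d + mask) =
      optionCost U K R (segCost U K R mc k) mask (U.size K U.n - k) w'

theorem optionStep_spec {s : Store} {k mask g w : ℕ} (hN : 1 < N) (h : DpIn U K R mc s)
    (hnN : U.n < N) (hdN : U.d < N) (hg : g = U.size K U.n - k) (hkG : k ≤ U.size K U.n)
    (hm : mask < 2 ^ U.d) (hw : w < U.size K U.n)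
    (h66 : s.ints 66 0 = mask) (h67 : s.ints 67 0 = w) (h63 : s.ints 63 0 = g)
    (h64 : s.ints 64 0 = k * 2 ^ U.d + mask) 
    (hI : ∀ mask < 2 ^ U.d, ∀ w < U.size K U.n, ∀ need ≤ U.r, ICell U K R mc k mask w need s)
    (hV : BestCell U K R mc k mask w s) :
    wp N .optionStep (fun s' => BestCell U K R mc k mask (w + 1) s' ∧
      ∀ x, x ≠ k * 2 ^ U.d + mask → s'.ext 23 x = s.ext 23 x ∧ s'.ints 15 x = s.ints 15 x ∧
        s'.ints 23 x = s.ints 23 x) s := by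
  obtain ⟨hu, hi, -⟩ := U.tl_spec hw; have e54 := h.tl w hw; have e1 := h.leg _ hu
  have e52 := h.idx _ hu; have had := U.leg_lt _ hu; set u := U.tl K w with hudef
  set a := U.leg u with ha; have ep := h.pow a had.le; have eb := bit_eq mask a
  have hix : U.idx u < U.cnt a := U.idx_lt_cnt hu; have hcn := U.cnt_le a
  have hstart : startCost U K R (segCost U K R mc k) mask g (w + 1) =
    min (startCost U K R (segCost U K R mc k) mask g w)
      (optionCost U K R (segCost U K R mc k) mask g w) := rfl
  have hskip : ¬ (g ≤ w ∧ mask.testBit a = false) → ∀ s' : Store, s'.ints 15 = s.ints 15 →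
      s'.ints 23 = s.ints 23 → s'.reals 23 = s.reals 23 →
      BestCell U K R mc k mask (w + 1) s' := by
    intro hn s' h1 h2 h3
    have hopt : optionCost U K R (segCost U K R mc k) mask g w = ⊤ := by
      rw [optionCost, ← hudef, ← ha, if_neg hn]
    refine ⟨?_, ?_⟩
    · rw [Store.ext_congr h2 h3, hV.val, ← hg, hstart, hopt, min_eq_left le_top]
    · rw [Store.ext_congr h2 h3, h1]; exact hV.choice
  unfold Program.optionStep; simp [wp, IExp.bit, h66, h67, h63, e54, e1, e52, ep, eb]
  refine ⟨by omega, by omega, by omega, by split_ifs <;> omega, fun hgw => ⟨fun hb => ?_, fun hb => ?_⟩, fun hgw => ?_⟩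
  · have hbit : mask.testBit a = true := by by_contra hn; simp [hn] at hb
    exact hskip (by simp [hbit]) _ (by simp) (by simp) (by simp)
  · have hbit : mask.testBit a = false := by simp_all
    refine wp_relaxSet (by omega) (by decide) (by simp [h67]; have := U.size_le (K := K); omega) (fun x => by simp) (fun x => by simp)
      fun s' h1 => ?_
    have e0 := h.d; have er := h.r; have en := h.n; have eG := h.size
    have e9 := h.posn g (by omega) a had
    have eI := (hI _ (add_two_pow_lt hm had hbit) w hw (U.r - (U.idx u + 1 - U.posn K g a))
      (by omega)).val
    have eR := h.line a (U.idx u + 1)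
    have eadr : ((k * 2 ^ U.d + mask + 2 ^ a) * U.size K U.n + w) * (U.r + 1) +
      (U.r - (U.idx u + 1 - U.posn K g a)) =
        iaddr U K k (mask + 2 ^ a) w (U.r - (U.idx u + 1 - U.posn K g a)) := by
      unfold iaddr; ring
    simp [h64, h67, h63, e0, er, en, eG, e9, ep, eadr, eI, eR] at h1
    have hopt : optionCost U K R (segCost U K R mc k) mask g w = max (R a (U.idx u + 1))
      (segCost U K R mc k (mask + 2 ^ a) w (U.r - (U.idx u + 1 - U.posn K g a))) := by
      rw [optionCost, ← hudef, ← ha, if_pos ⟨hgw, hbit⟩]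
    rw [← hopt] at h1; have hc := h1.cases; have hv := h1.val (k * 2 ^ U.d + mask)
    rw [if_pos rfl] at hv; simp at hc hv; refine ⟨⟨?_, fun hne => ?_⟩, fun x hx => ⟨?_, ?_, ?_⟩⟩
    · rw [hv, hV.val, ← hg, hstart]
    · rcases hc with ⟨c1, c2⟩ | ⟨c1, c2⟩
      · exact Or.inr ⟨w, hw, c1, by rw [← hg]; exact c2⟩
      · rw [c2] at hne ⊢; rw [c1]; exact hV.choice hne
    · rw [h1.val, if_neg hx]; simp
    · rw [h1.other x hx]; simp
    · rw [h1.pos x hx]; simp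
  · exact hskip (by omega) _ (by simp) (by simp) (by simp)

end

section
variable {N : ℕ} {U : Users} {K : ℕ} {R mc : ℕ → ℕ → WithTop ℝ}

/-! ### The dynamic program -/

def Program.bestCell : Program :=
  (.setInt 64 0 (iv 48 * iv 17 + iv 66) ;; .setInt 24 0 1 ;; .setReal 24 0 .zero) ;;
  .forUp 61 (.read 0 0) .finishStep ;;
  .relaxSet 23 (iv 64) 24 0 24 0 15 0 ;;
  .forUp 67 (iv 56) .optionStep

theorem bestCell_spec : ∃ c, ∀ (N : ℕ) (U : Users) (K : ℕ) (R mc : ℕ → ℕ → WithTop ℝ) (s : Store)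
    (k g mask : ℕ), 3 < N → U.n < N → U.d < N → (U.n + 1) * U.d < N →
    (U.size K U.n + 1) * 2 ^ U.d < N → DpIn U K R mc s →
    k ≤ U.size K U.n → g = U.size K U.n - k → mask < 2 ^ U.d →
    s.ints 48 0 = k → s.ints 63 0 = g → s.ints 66 0 = mask →
    DpTab U K R mc ((k + 1) * segLen U K) (k * 2 ^ U.d + mask) s →
    Tr N .bestCell s (c * (U.size K U.n + U.d + 1))
      (DpTab U K R mc ((k + 1) * segLen U K) (k * 2 ^ U.d + (mask + 1))) := by
  refine ⟨Program.finishStep.cst + Program.optionStep.cst + 200 +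
    (Program.relaxSet 23 (iv 64) 24 0 24 0 15 0).cst,
    fun N U K R mc s k g mask hN hnN hdN hlN hM h hk hg hm h48 h63 h66 hT => ?_⟩
  have hGn : U.size K U.n ≤ U.n := U.size_le
  have hx : k * 2 ^ U.d + mask < N := by
    have : (k + 1) * 2 ^ U.d ≤ (U.size K U.n + 1) * 2 ^ U.d := Nat.mul_le_mul_right _ (by omega)
    rw [Nat.add_mul] at this; omega
  refine Tr.mono (Tr.seq (Tr.of_wp (Q := fun s₁ => s₁.ints 64 0 = k * 2 ^ U.d + mask ∧ s₁.ext 24 0 = 0) ?_)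
    fun s₁ f₁ ⟨h64, h24⟩ => Tr.seq (Tr.forUp (m := U.d) Program.finishStep.cst
      (fun l s' => s'.ext 24 0 = finishCost U K R mask g l) hdN (by decide) ?_ ?_ ?_)
    fun s₂ f₂ h24 => Tr.seq (Tr.of_wp (Q := fun s' => BestCell U K R mc k mask 0 s' ∧
      ∀ x, x ≠ k * 2 ^ U.d + mask → s'.ext 23 x = s.ext 23 x ∧ s'.ints 15 x = s.ints 15 x ∧
        s'.ints 23 x = s.ints 23 x) ?_)
    fun s₃ f₃ ⟨hB, ho⟩ => Tr.forUp (N := N) (v := 67) (hi := iv 56) (m := U.size K U.n) (body := .optionStep) Program.optionStep.cst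
      (fun w s' => BestCell U K R mc k mask w s' ∧
      ∀ x, x ≠ k * 2 ^ U.d + mask → s'.ext 23 x = s.ext 23 x ∧ s'.ints 15 x = s.ints 15 x ∧
        s'.ints 23 x = s.ints 23 x) (by omega) (by decide) ?_ ?_ ?_)
    (t := _) (t' := _) ?_ fun s' f hQ => ?_
  · have := h.masks; simp [wp, h48, h66, this, Store.ext]; omega
  · simpa [finishCost] using h24
  · intro l _ s' f _ _; simp only [IExp.val_read, IExp.val_zero]; rw [f.int _, f₁.int _, h.d]
  · intro l hl s' f hl' hv; have h' := (h.frame f₁).frame f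
    refine (Tr.of_wp (finishStep_spec (g := g) (mask := mask) (by omega) h' hlN (by omega) hl
      (by rw [f.int _, f₁.int _, h66]) hl'
      (by rw [f.int _, f₁.int _, h63]) hv)).mono le_rfl fun s'' _ h'' => ?_
    simpa using h''
  · have h64' : s₂.ints 64 0 = k * 2 ^ U.d + mask := by rw [f₂.int _, h64]
    refine wp_relaxSet (by omega) (by decide) (by simp; omega) (fun x => by simp) (fun x => by simp)
      fun s' hr => ?_
    have hfresh : s₂.ext 23 (k * 2 ^ U.d + mask) = ⊤ := by
      rw [f₂.ext, f₁.ext, Store.ext, if_pos (hT.bestFresh _ le_rfl)]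
    simp only [IExp.val_iv, IExp.val_zero, h64', h24, max_self] at hr
    have hv := hr.val (k * 2 ^ U.d + mask); rw [if_pos rfl, hfresh, min_eq_right le_top] at hv
    refine ⟨⟨by rw [hv, hg]; rfl, fun hne => Or.inl ?_⟩, fun x hx => ⟨?_, ?_, ?_⟩⟩
    · rw [hv] at hne ⊢; rw [hr.choice, hfresh, if_pos (lt_top_iff_ne_top.2 hne), hg]
      exact ⟨rfl, rfl⟩
    · rw [hr.val, if_neg hx, f₂.ext, f₁.ext]
    · rw [hr.other x hx, f₂.int _, f₁.int _]
    · rw [hr.pos x hx, f₂.int _, f₁.int _]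
  · refine ⟨⟨by simpa using hB.val, by simpa using hB.choice⟩, by simpa using ho⟩
  · intro w _ s' f _ _; simp only [IExp.val_iv]; rw [f.int _, f₃.int _, f₂.int _, f₁.int _, h.size]
  · intro w hw s' f hw' hI; have h' := (((h.frame f₁).frame f₂).frame f₃).frame f
    have e : ∀ a, a ∉ (Program.bestCell).im → s'.ints a = s.ints a := fun a ha => by
      rw [f.int a (notMem_mono ha), f₃.int a (notMem_mono ha), f₂.int a (notMem_mono ha),
        f₁.int a (notMem_mono ha)]
    refine (Tr.of_wp (optionStep_spec (by omega) h' hnN hdN hg hk hm hw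
      (by rw [e _ (by decide), h66]) hw' (by rw [e _ (by decide), h63])
      (by rw [f.int _, f₃.int _, f₂.int _, h64])
      (fun m hm w hw n hn => ?_) hI.1)).mono le_rfl fun s'' _ h'' => ?_
    · have h1 := hT.seg k hk m hm w hw n hn (by
        rw [iaddr_eq, show (k + 1) * segLen U K = k * segLen U K + segLen U K by ring]
        exact Nat.add_lt_add_left (triple_lt hm hw hn) _)
      refine ⟨?_, by rw [e _ (by decide)]; exact h1.choice⟩; rw [f.ext, f₃.ext, f₂.ext, f₁.ext]
      exact h1.val
    · refine ⟨⟨by simpa using h''.1.val, by simpa using h''.1.choice⟩, fun x hx => ?_⟩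
      have h1 := h''.2 x hx; have h2 := hI.2 x hx; simpa [h1.1, h1.2.1, h1.2.2] using h2
  · have e1 : (IExp.read 0 0).cost = 2 := rfl; have e2 : (iv 56).cost = 2 := rfl
    have e3 : (Program.setInt 64 0 (iv 48 * iv 17 + iv 66) ;; .setInt 24 0 1 ;; .setReal 24 0 .zero).cst
      = 16 := rfl
    rw [e1, e2, e3]; generalize (Program.relaxSet 23 (iv 64) 24 0 24 0 15 0).cst = A; nlinarith
  · obtain ⟨hB, eq⟩ := hQ
    refine ⟨fun k' hk' m hm' w hw n hn ha => ?_, ?_, fun k' hk' m hm' ha => ?_, fun a ha => ?_⟩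
    · have h1 := hT.seg k' hk' m hm' w hw n hn ha
      exact ⟨by rw [f.ext]; exact h1.val, by rw [f.int _]; exact h1.choice⟩
    · rw [f.int _]; exact hT.segFresh
    · by_cases heq : k' * 2 ^ U.d + m = k * 2 ^ U.d + mask
      · obtain ⟨rfl, rfl⟩ := (pair_inj hm' hm).1 heq
        exact ⟨hB.val, fun hne => hB.choice (by rw [hB.val]; exact hne) |>.imp
          (fun h => ⟨h.1, hB.val.symm.trans h.2⟩)
          fun ⟨w, hw, h1, h2⟩ => ⟨w, hw, h1, hB.val.symm.trans h2⟩⟩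
      · have h1 := hT.best k' hk' m hm' (by omega)
        exact ⟨by rw [(eq _ heq).1]; exact h1.val, by rw [(eq _ heq).2.1]; exact h1.choice⟩
    · rw [(eq a (by omega)).2.2]; exact hT.bestFresh a (by omega)

/-- Layer `k` of `segCost` refers to layer `k - 1` of both tables, and `bestCost` at `k` to layer
`k` of `segCost`. The two are therefore filled alternately. -/
def Program.dpStep : Program := .setInt 63 0 (iv 56 - iv 48) ;;
  .ite (.intLe 1 (iv 48))
    ((.setInt 61 0 (.read 54 (iv 63)) ;; .setInt 68 0 (.read 1 (iv 61)) ;;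
      .setInt 69 0 (.read 52 (iv 61))) ;; .segLayer) .skip ;;
  .forUp 66 (iv 17) .bestCell

def Program.dp : Program := .forUp 48 (iv 56 + 1) .dpStep

theorem dp_spec : ∃ c, ∀ (N : ℕ) (U : Users) (K : ℕ) (R mc : ℕ → ℕ → WithTop ℝ) (s : Store),
    3 < N → U.n + 1 < N → U.d < N → (U.n + 1) * U.d < N → (U.size K U.n + 1) * 2 ^ U.d < N →
    (U.size K U.n + 1) * segLen U K < N → DpIn U K R mc s →
    (∀ a, s.ints 22 a = 0) → (∀ a, s.ints 23 a = 0) →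
    Tr N .dp s (c * ((U.size K U.n + 1) * 2 ^ U.d * ((U.size K U.n + 1) * (U.r + 1) + U.d + 1)))
      fun s' => (∀ k ≤ U.size K U.n, ∀ mask < 2 ^ U.d, VCell U K R mc k mask s') ∧
        ∀ k ≤ U.size K U.n, ∀ mask < 2 ^ U.d, ∀ w < U.size K U.n, ∀ need ≤ U.r,
          ICell U K R mc k mask w need s' := by
  obtain ⟨c₁, hc₁⟩ := segLayer_spec; obtain ⟨c₂, hc₂⟩ := bestCell_spec
  refine ⟨4 * (c₁ + c₂) + 400, fun N U K R mc s hN hnN hdN hlN hM hL h hI0 hV0 => ?_⟩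
  set G := U.size K U.n with hG; set L := segLen U K with hLdef; set M := 2 ^ U.d with hMdef
  have hGn : G ≤ U.n := U.size_le; have hMpos : 1 ≤ M := Nat.one_le_two_pow
  have hMN : M < N := by nlinarith
  refine Tr.mono (Tr.forUp (m := G + 1) (c₁ * (L + 1) + (M + 1) * (c₂ * (G + U.d + 1) + 2 + 20) + 60)
    -- Layer `0` of `segCost` is `⊤` everywhere, which is the value of fresh cells, so it counts as
    -- computed from the start; hence `max k 1`.
    (fun k => DpTab U K R mc (max k 1 * L) (k * M)) (by omega) (by decide) ?_ ?_ ?_) ?_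
    fun s' f hQ => ⟨fun k hk mask hm => hQ.best k hk mask hm ?_,
      fun k hk m hm w hw n hn => hQ.seg k hk m hm w hw n hn ?_⟩
  · refine DpTab.congr (s := s) ⟨fun k hk m hm w hw n hn ha => ?_, fun a _ => hI0 a, fun k hk m hm ha => ?_,
      fun a _ => hV0 a⟩ (fun b hb => Store.ints_setInt_of_mem hb)
      fun b _ => rfl
    · rcases Nat.eq_zero_or_pos k with rfl | hk0
      · exact ⟨by rw [Store.ext, if_pos (hI0 _)]; rfl, fun hne => (hne rfl).elim⟩
      · rw [iaddr_eq] at ha; have : 1 * L ≤ k * L := Nat.mul_le_mul_right _ hk0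
        simp only [hLdef, segLen] at this ha; simp at this ha; omega
    · omega
  · intro k _ s' f _ _; simp only [IExp.val_add, IExp.val_iv, IExp.val_one]; rw [f.int _, h.size]
  · intro k hk s' f h48 hT; have h' := h.frame f; have hkG : k ≤ G := by omega
    refine Tr.mono (Tr.seq (Tr.of_wp (Q := fun s₁ => s₁.ints 63 0 = G - k) ?_) fun s₁ f₁ h63 =>
      Tr.seq (Q := fun s'' => DpTab U K R mc (max (k + 1) 1 * L) ((k + 1) * M) (s''.setInt 48 0 (k + 1)))
      (R := DpTab U K R mc ((k + 1) * L) (k * M))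
      (Tr.ite (t := 20 + c₁ * (L + 1)) (fun hb => ?_) fun hb => ?_) fun s₂ f₂ hT₂ => Tr.mono (Tr.forUp (m := M)
      (c₂ * (G + U.d + 1)) (fun m => DpTab U K R mc ((k + 1) * L) (k * M + m)) hMN (by decide) ?_ ?_ ?_) le_rfl
      fun s'' _ hQ => ?_) (t := _) (t' := _) ?_ fun s'' _ hQ => hQ
    · have := h'.size; simp [wp, this, h48]; omega
    · simp [f₁.int 48, h48] at hb; have h₁ := h'.frame f₁
      obtain ⟨hu, -, -⟩ := U.tl_spec (K := K) (show G - k < G by omega)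
      refine Tr.mono (Tr.seq (Tr.of_wp (Q := fun s₃ => s₃.ints 68 0 = U.leg (U.tl K (G - k)) ∧
        s₃.ints 69 0 = U.idx (U.tl K (G - k))) ?_) fun s₃ f₃ h₃ => hc₁ N U K R mc s₃ k (G - k) _ hN
          (by omega) hL (h₁.frame f₃) hb hkG rfl rfl
          (by rw [f₃.int _, f₁.int _, h48]) (by rw [f₃.int _, h63])
          h₃.1 h₃.2 ?_) (Nat.add_le_add_right (by decide) _) fun s'' _ hQ => hQ
      · have e1 := h₁.tl (G - k) (by omega); have e2 := h₁.leg _ hu; have e3 := h₁.idx _ hu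
        have e4 := U.leg_lt _ hu; have e5 := U.idx_lt_cnt hu
        have e6 := U.cnt_le (U.leg (U.tl K (G - k))); simp [wp, h63, e1, e2, e3]; omega
      · refine DpTab.congr (s := s') (by rwa [max_eq_left hb] at hT)
          (fun b hb => ?_) fun b hb => ?_
        · rw [f₃.1 b (by revert b; decide), f₁.1 b (by revert b; decide)]
        · rw [f₃.2 b (by revert b; decide), f₁.2 b (by revert b; decide)]
    · refine ⟨s₁, _, .skip _, by omega, ?_⟩; simp [f₁.int 48, h48] at hb; subst hb
      exact hT.congr (fun b hb => f₁.1 b (by revert b; decide)) fun b hb => f₁.2 b (by revert b; decide)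
    · exact hT₂.congr (fun b hb => Store.ints_setInt_of_mem hb)
        fun b _ => rfl
    · intro m _ s₃ f₃ _ _; simp only [IExp.val_iv]; rw [f₃.int _, f₂.int _, f₁.int _, h'.masks]
    · intro m hm s₃ f₃ h66 hQ; have h₃ := ((h'.frame f₁).frame f₂).frame f₃
      refine (hc₂ N U K R mc s₃ k _ m hN (by omega) hdN hlN hM h₃ hkG rfl hm
        (by rw [f₃.int _, f₂.int _, f₁.int _, h48])
        (by rw [f₃.int _, f₂.int _, h63]) h66 hQ).mono le_rfl fun s'' _ hQ => ?_
      exact hQ.congr (fun b hb => Store.ints_setInt_of_mem hb)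
        fun b _ => rfl
    · rw [max_eq_left (by omega), show (k + 1) * M = k * M + M by ring]
      exact hQ.congr (fun b hb => Store.ints_setInt_of_mem hb)
        fun b _ => rfl
    · have e1 : (Test.intLe 1 (iv 48)).cost = 4 := rfl; have e2 : (iv 17).cost = 2 := rfl
      have e3 : (Program.setInt 63 0 (iv 56 - iv 48)).cst = 7 := rfl; rw [e1, e2, e3]; omega
  · have e1 : (iv 56 + 1).cost = 4 := rfl; rw [e1]; have hLe : L = M * G * (U.r + 1) := rfl
    rw [hLe]; set X := (G + 1) * (U.r + 1) + U.d + 1 with hX; have hX1 : 1 ≤ X := by omega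
    have hX2 : G + 1 ≤ X := by nlinarith
    have hX3 : G + U.d + 1 ≤ X := by nlinarith
    have a1 : M * G * (U.r + 1) + 1 ≤ M * X := by nlinarith
    have a2 : (M + 1) * (c₂ * (G + U.d + 1) + 2 + 20) ≤ (2 * c₂ + 44) * (M * X) := by
      have : c₂ * (G + U.d + 1) + 2 + 20 ≤ (c₂ + 22) * X := by nlinarith
      calc _ ≤ (2 * M) * ((c₂ + 22) * X) := Nat.mul_le_mul (by omega) this
        _ = _ := by ring
    have a3 : 1 ≤ M * X := Nat.mul_pos hMpos hX1
    have a4 : c₁ * (M * G * (U.r + 1) + 1) ≤ c₁ * (M * X) := Nat.mul_le_mul_left _ a1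
    calc (G + 1 + 1) * (c₁ * (M * G * (U.r + 1) + 1) + (M + 1) * (c₂ * (G + U.d + 1) + 2 + 20) + 60 + 4 + 20)
        ≤ (2 * (G + 1)) * ((c₁ + 2 * c₂ + 128) * (M * X)) := by
          refine Nat.mul_le_mul (by omega) ?_; nlinarith
      _ = (2 * c₁ + 4 * c₂ + 256) * ((G + 1) * M * X) := by ring
      _ ≤ _ := Nat.mul_le_mul_right _ (by omega)
  · calc k * M + mask < k * M + M := by omega
      _ = (k + 1) * M := by ring
      _ ≤ _ := Nat.mul_le_mul_right _ (by omega)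
  · rw [iaddr_eq]
    calc k * L + ((m * G + w) * (U.r + 1) + n) < k * L + L := Nat.add_lt_add_left (triple_lt hm hw hn) _
      _ = (k + 1) * L := by ring
      _ ≤ _ := Nat.mul_le_mul_right _ (by omega)

end

/-! ### Reconstruction of a clustering from the recorded choices -/

section
/-! ### Partial clusterings met when the choices of the dynamic program are followed -/

/-- A state of the reconstruction: the first `g` users with small numbers have been dealt with,
and so have the legs in `mask`, on which the users from number `cl l` on form line clusters.
The earlier users `u` belong to the central cluster `tk u`, or `own (leg u)` if `tk u = 0`. -/
structure Partial where
  g : ℕ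
  mask : ℕ
  cl : ℕ → ℕ
  own : ℕ → ℕ
  tk : ℕ → ℕ

section

variable (U : Users) (K : ℕ) (R mc : ℕ → ℕ → WithTop ℝ) (V : ℝ) (Lab : ℕ → ℕ → ℕ → Prop)

/-- The users already put into central clusters. On a closed leg all users beyond them form line
clusters. -/
def Partial.Done (A : Partial) (u : ℕ) : Prop :=
  U.idx u < if A.mask.testBit (U.leg u) then A.cl (U.leg u) else U.posn K A.g (U.leg u)

/-- Central clusters are named after the list number `w` of their outermost own-leg user, stored as
`w + 1`, so that `0` means that nothing is recorded. -/
def Partial.cid (A : Partial) (u : ℕ) : ℕ := if 1 ≤ A.tk u then A.tk u else A.own (U.leg u)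

open Classical in
noncomputable def Partial.mem (A : Partial) (w : ℕ) : Finset ℕ :=
  (Finset.range U.n).filter fun u => A.Done U K u ∧ A.cid U u = w + 1

structure Partial.Ok (A : Partial) : Prop where
  g_le : A.g ≤ U.size K U.n
  mask_lt : A.mask < 2 ^ U.d
  closed : ∀ l < U.d, A.mask.testBit l = true → A.cl l ≤ U.cnt l ∧ R l (A.cl l) ≤ V
  taken : ∀ u < U.n, 1 ≤ A.tk u → A.Done U K u
  cid_pos : ∀ u < U.n, A.Done U K u → 1 ≤ A.cid U u
  open_tk : ∀ u < U.n, A.Done U K u → A.mask.testBit (U.leg u) = false → 1 ≤ A.tk u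
  used : ∀ w, (A.mem U K w).Nonempty → w < U.size K U.n ∧ A.mask.testBit (U.leg (U.tl K w)) = true

/-- `u` may belong to a cluster with outermost users `w` on the own leg and `z` elsewhere. -/
def Within (w z u : ℕ) : Prop := (U.leg u = U.leg (U.tl K w) ∧ u ≤ U.tl K w) ∨ u ≤ U.tl K z

def CentralOk (S : Finset ℕ) (w lab : ℕ) : Prop :=
  U.r ≤ S.card ∧ ∃ z < U.size K U.n, mc w z ≤ V ∧ Lab w z lab ∧ ∀ u ∈ S, Within U K w z u

structure Partial.Open (A : Partial) (w need : ℕ) : Prop where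
  lt : w < U.size K U.n
  bit : A.mask.testBit (U.leg (U.tl K w)) = true
  card : U.r ≤ (A.mem U K w).card + need
  need_le : need ≤ U.r
  within : ∀ u ∈ A.mem U K w, (U.leg u = U.leg (U.tl K w) ∧ u ≤ U.tl K w) ∨ ∃ g < A.g, u = U.tl K g

/-- The state between two clusters. In contrast, `InvI` describes the state while cluster `w` is
being filled and is not yet required to be large enough. -/
structure Partial.InvV (A : Partial) (lab : ℕ → ℕ) : Prop extends A.Ok U K R V where
  cluster : ∀ w, (A.mem U K w).Nonempty → CentralOk U K mc V Lab (A.mem U K w) w (lab w)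
  value : bestCost U K R mc (U.size K U.n - A.g) A.mask ≤ V

structure Partial.InvI (A : Partial) (lab : ℕ → ℕ) (w need : ℕ) : Prop extends A.Ok U K R V where
  current : A.Open U K w need
  cluster : ∀ w', w' ≠ w → (A.mem U K w').Nonempty →
    CentralOk U K mc V Lab (A.mem U K w') w' (lab w')
  value : segCost U K R mc (U.size K U.n - A.g) A.mask w need ≤ V

/-- The result of the reconstruction. -/
structure Traced (cl own tk lab : ℕ → ℕ) : Prop where
  line : ∀ l < U.d, cl l ≤ U.cnt l ∧ R l (cl l) ≤ V
  cid_pos : ∀ u < U.n, U.idx u < cl (U.leg u) → 1 ≤ if 1 ≤ tk u then tk u else own (U.leg u)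
  cluster : ∀ w, ∀ S ⊆ Finset.range U.n,
    (∀ u, u ∈ S ↔ u < U.n ∧ U.idx u < cl (U.leg u) ∧
      (if 1 ≤ tk u then tk u else own (U.leg u)) = w + 1) → S.Nonempty →
    w < U.size K U.n ∧ CentralOk U K mc V Lab S w (lab w)

end

variable {U : Users} {K : ℕ} {R mc : ℕ → ℕ → WithTop ℝ} {V : ℝ} {Lab : ℕ → ℕ → ℕ → Prop}
  {A B : Partial}

theorem Partial.mem_mem {w u : ℕ} : u ∈ A.mem U K w ↔ u < U.n ∧ A.Done U K u ∧ A.cid U u = w + 1 := by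
  simp [Partial.mem]

theorem testBit_or_of_ne {m l j : ℕ} (h : m.testBit l = false) :
    (m + 2 ^ l).testBit j = true ↔ m.testBit j = true ∨ j = l := by
  rw [testBit_add_two_pow _ _ _ h]; simp

/-- Closing the leg of the next user without starting a cluster there. -/
theorem Partial.mem_congr (h : ∀ u < U.n, (B.Done U K u ↔ A.Done U K u) ∧ B.cid U u = A.cid U u) (w : ℕ) :
    B.mem U K w = A.mem U K w := by
  ext u; rw [mem_mem, mem_mem]; grind

/-- Covers both choices in which the next user is not taken: its leg is already closed, or it is
closed just before this user. Central memberships do not change. -/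
theorem Partial.Ok.pass {mask : ℕ} {cl : ℕ → ℕ} (hA : A.Ok U K R V) (hg : A.g < U.size K U.n)
    (hm : mask < 2 ^ U.d) (hbit : mask.testBit (U.leg (U.tl K A.g)) = true)
    (hmask : ∀ j, A.mask.testBit j = true → mask.testBit j = true)
    (hmask' : ∀ j, mask.testBit j = true → A.mask.testBit j = true ∨ j = U.leg (U.tl K A.g))
    (hcl : ∀ j, A.mask.testBit j = true → cl j = A.cl j)
    (hnew : A.mask.testBit (U.leg (U.tl K A.g)) = false →
      cl (U.leg (U.tl K A.g)) = U.idx (U.tl K A.g) ∧ R (U.leg (U.tl K A.g)) (U.idx (U.tl K A.g)) ≤ V) :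
    let B : Partial := ⟨A.g + 1, mask, cl, A.own, A.tk⟩
    B.Ok U K R V ∧ ∀ w, B.mem U K w = A.mem U K w := by
  intro B
  have hdone : ∀ u, B.Done U K u ↔ A.Done U K u := by
    intro u; unfold Partial.Done; by_cases h : A.mask.testBit (U.leg u) = true
    · rw [if_pos h, if_pos (hmask _ h), show B.cl = cl from rfl, hcl _ h]
    · by_cases h' : mask.testBit (U.leg u) = true
      · rw [if_neg h, if_pos h']; have e := (hmask' _ h').resolve_left h; have h2 := hnew (by grind)
        rw [e, show B.cl = cl from rfl, h2.1, U.idx_tl hg]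
      · rw [if_neg h, if_neg h', U.posn_succ, if_neg, add_zero]; grind
  have hmem : ∀ w, B.mem U K w = A.mem U K w := fun w => mem_congr (fun u _ => ⟨hdone u, rfl⟩) w
  refine ⟨⟨hg, hm, fun l hl hb => ?_, fun u hu h => (hdone u).2 (hA.taken u hu h),
    fun u hu h => hA.cid_pos u hu ((hdone u).1 h), fun u hu h hb => hA.open_tk u hu ((hdone u).1 h) ?_,
    fun w hw => ?_⟩, hmem⟩
  · by_cases h : A.mask.testBit l = true
    · show cl l ≤ _ ∧ R l (cl l) ≤ _; rw [hcl l h]; exact hA.closed l hl h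
    · obtain rfl := (hmask' _ hb).resolve_left h; have h2 := hnew (by simpa using h)
      show cl _ ≤ _ ∧ R _ (cl _) ≤ _; rw [h2.1]; exact ⟨(U.idx_lt_cnt (U.tl_spec hg).1).le, h2.2⟩
  · rw [← Bool.not_eq_true] at hb ⊢; grind
  · rw [hmem] at hw; exact (hA.used w hw).imp_right (hmask _)

theorem Partial.Open.pass {w need : ℕ} (h : A.Open U K w need) (hmem : ∀ w, B.mem U K w = A.mem U K w)
    (hg : A.g ≤ B.g) (hmask : ∀ j, A.mask.testBit j = true → B.mask.testBit j = true) :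
    B.Open U K w need :=
  ⟨h.lt, hmask _ h.bit, by rw [hmem]; exact h.card, h.need_le, fun u hu => by
    rw [hmem] at hu
    exact (h.within u hu).imp_right fun ⟨g, h1, h2⟩ => ⟨g, h1.trans_le hg, h2⟩⟩

/-- Putting the next user into the current cluster. -/
theorem Partial.Ok.take {w need : ℕ} (hA : A.Ok U K R V) (hg : A.g < U.size K U.n)
    (hbit : A.mask.testBit (U.leg (U.tl K A.g)) = false) (hO : A.Open U K w need) :
    let B : Partial := ⟨A.g + 1, A.mask, A.cl, A.own, Function.update A.tk (U.tl K A.g) (w + 1)⟩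
    B.Ok U K R V ∧ B.Open U K w (need - 1) ∧ ∀ w', w' ≠ w → B.mem U K w' = A.mem U K w' := by
  intro B; obtain ⟨hu, hK, -⟩ := U.tl_spec hg; set v := U.tl K A.g with hv
  have hidx : U.idx v = U.posn K A.g (U.leg v) := U.idx_tl hg
  have hnd : ¬ A.Done U K v := by unfold Partial.Done; rw [hbit, hidx]; simp
  have htk0 : A.tk v = 0 := by by_contra h; exact hnd (hA.taken v hu (by omega))
  have hdone : ∀ u, B.Done U K u ↔ A.Done U K u ∨ u = v := by
    intro u; unfold Partial.Done
    show (U.idx u < if A.mask.testBit (U.leg u) = true then A.cl (U.leg u) else U.posn K (A.g + 1) (U.leg u)) ↔ _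
    by_cases h : A.mask.testBit (U.leg u) = true
    · rw [if_pos h, if_pos h, or_iff_left]; rintro rfl; rw [hbit] at h; simp at h
    · rw [if_neg h, if_neg h, U.posn_succ]
      split_ifs with hl
      · constructor
        · intro h1; by_cases h2 : u = v
          · exact Or.inr h2
          · left
            have h3 : U.idx u ≠ U.idx v := by
              intro h4; have e1 := U.usr_idx u; have e2 := U.usr_idx v; grind
            rw [hidx, hl] at h3; omega
        all_goals grind
      all_goals grind
  have htk : ∀ u, u ≠ v → B.tk u = A.tk u := by grind
  have htkv : B.tk v = w + 1 := by grind
  have hcid : ∀ u, u ≠ v → B.cid U u = A.cid U u := by intro u hne; rw [Partial.cid, htk u hne]; rfl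
  have hcv : B.cid U v = w + 1 := by simp [Partial.cid, htkv]
  have hmem : ∀ w' u, u ∈ B.mem U K w' ↔ u ∈ A.mem U K w' ∨ (w' = w ∧ u = v) := by
    intro w' u; rw [mem_mem, mem_mem, hdone]; grind
  have hbig : B.mem U K w = insert v (A.mem U K w) := by grind
  refine ⟨⟨hg, hA.mask_lt, hA.closed, fun u hu h => ?_, fun u hu h => ?_, fun u hu h hb => ?_,
    fun w' hw' => ?_⟩, ⟨hO.lt, hO.bit, ?_, by have := hO.need_le; omega, fun u hu => ?_⟩, fun w' hne => ?_⟩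
  · rw [hdone]; by_cases h' : u = v
    · exact Or.inr h'
    · refine Or.inl (hA.taken u hu ?_); rwa [← htk u h']
  · by_cases h' : u = v
    · rw [h', hcv]; omega
    · rw [hcid u h']; exact hA.cid_pos u hu (((hdone u).1 h).resolve_right h')
  · by_cases h' : u = v
    · rw [h', htkv]; omega
    · have := hA.open_tk u hu (((hdone u).1 h).resolve_right h') hb; rwa [htk u h']
  · obtain ⟨u, hu⟩ := hw'; rcases (hmem w' u).1 hu with h | ⟨rfl, -⟩
    · exact hA.used w' ⟨u, h⟩
    · exact ⟨hO.lt, hO.bit⟩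
  · rw [hbig, Finset.card_insert_of_notMem fun h => hnd (mem_mem.1 h).2.1]; have := hO.card; omega
  · rcases (hmem w u).1 hu with h | ⟨-, h⟩
    · exact (hO.within u h).imp_right fun ⟨g, h1, h2⟩ => ⟨g, h1.trans (Nat.lt_succ_self _), h2⟩
    · grind
  · ext u; rw [hmem]; simp [hne]

/-- Starting a cluster on an open leg. -/
theorem Partial.InvV.start {lab : ℕ → ℕ} {w : ℕ} (hA : A.InvV U K R mc V Lab lab)
    (hgw : A.g ≤ w) (hw : w < U.size K U.n) (hbit : A.mask.testBit (U.leg (U.tl K w)) = false)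
    (hV : optionCost U K R (segCost U K R mc (U.size K U.n - A.g)) A.mask A.g w ≤ V) :
    let a := U.leg (U.tl K w)
    let i := U.idx (U.tl K w) + 1
    let B : Partial := ⟨A.g, A.mask + 2 ^ a, Function.update A.cl a i, Function.update A.own a (w + 1), A.tk⟩
    B.InvI U K R mc V Lab lab w (U.r - (i - U.posn K A.g a)) := by
  intro a i B; obtain ⟨hu, hK, -⟩ := U.tl_spec hw; have had : a < U.d := U.leg_lt _ hu
  have hpi : U.posn K A.g a ≤ U.idx (U.tl K w) := by rw [U.idx_tl hw]; exact U.posn_mono hgw a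
  have hi : i ≤ U.cnt a := U.idx_lt_cnt hu; rw [optionCost, if_pos ⟨hgw, hbit⟩] at hV
  have hBbit : ∀ j, B.mask.testBit j = true ↔ A.mask.testBit j = true ∨ j = a := fun j =>
    testBit_or_of_ne hbit
  have hdone : ∀ u, B.Done U K u ↔ A.Done U K u ∨ (U.leg u = a ∧ U.posn K A.g a ≤ U.idx u ∧ U.idx u < i) := by
    intro u; unfold Partial.Done; grind
  have htk : ∀ u, u < U.n → ¬ A.Done U K u → A.tk u = 0 := fun u hu h => by
    by_contra h'; exact h (hA.taken u hu (by omega))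
  have hnd : ∀ u, U.leg u = a → U.posn K A.g a ≤ U.idx u → ¬ A.Done U K u := by
    intro u hl hp; unfold Partial.Done; rw [hl, if_neg (by rw [hbit]; simp)]; omega
  have hcid : ∀ u < U.n, A.Done U K u → B.cid U u = A.cid U u := by
    intro u hu h; unfold Partial.cid; by_cases hl : U.leg u = a
    · have := hA.open_tk u hu h (by grind); simp [B, this]
    · simp [B, Function.update_of_ne hl]
  have hcn : ∀ u < U.n, U.leg u = a → ¬ A.Done U K u → B.cid U u = w + 1 := by
    intro u hu hl h; simp [Partial.cid, B, htk u hu h, hl]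
  have hmem : ∀ w' u, u ∈ B.mem U K w' ↔ u ∈ A.mem U K w' ∨
      (w' = w ∧ u < U.n ∧ U.leg u = a ∧ U.posn K A.g a ≤ U.idx u ∧ U.idx u < i) := by
    intro w' u; rw [mem_mem, mem_mem, hdone]; grind
  -- The name `w` is new: clusters in use have closed their own legs, whereas the leg of `w` is
  -- still open.
  have hfresh : A.mem U K w = ∅ := by
    by_contra h; have := (hA.used w (Finset.nonempty_iff_ne_empty.2 h)).2
    rw [hbit] at this; simp at this
  refine ⟨⟨hA.g_le, add_two_pow_lt hA.mask_lt had hbit, fun l hl hb => ?_, fun u hu h => ?_, fun u hu h => ?_,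
    fun u hu h hb => ?_, fun w' hw' => ?_⟩, ⟨hw, (hBbit _).2 (Or.inr rfl), ?_, by omega, fun u hu => ?_⟩,
    fun w' hne hw' => ?_, (le_max_right _ _).trans hV⟩
  · by_cases h : l = a
    · subst h; simp only [B, Function.update_self]; grind
    · simp only [B, Function.update_of_ne h]
      exact hA.closed l hl (((hBbit l).1 hb).resolve_right h)
  · grind
  · by_cases h' : A.Done U K u
    · rw [hcid u hu h']; exact hA.cid_pos u hu h'
    all_goals grind
  · refine hA.open_tk u hu (((hdone u).1 h).resolve_right fun h' => ?_) ?_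
    all_goals grind
  · obtain ⟨u, hu⟩ := hw'; rcases (hmem w' u).1 hu with h | ⟨rfl, -⟩
    · exact (hA.used w' ⟨u, h⟩).imp_right fun h => (hBbit _).2 (Or.inl h)
    · grind
  · have : (Finset.Ico (U.posn K A.g a) i).card ≤ (B.mem U K w).card := by
      refine Finset.card_le_card_of_injOn (U.usr a) (fun j hj => ?_) fun j hj j' hj' h => ?_
      · rw [Finset.mem_coe, Finset.mem_Ico] at hj
        obtain ⟨h1, h2, h3⟩ := U.usr_spec (l := a) (i := j) (by omega); grind
      · rw [Finset.mem_coe, Finset.mem_Ico] at hj hj'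
        rw [← (U.usr_spec (l := a) (i := j) (by omega)).2.2, h, (U.usr_spec (l := a) (i := j') (by omega)).2.2]
    rw [Nat.card_Ico] at this; omega
  · rcases (hmem w u).1 hu with h | ⟨-, h1, h2, h3, h4⟩
    · rw [hfresh] at h; simp at h
    · exact Or.inl ⟨h2, (U.idx_le_idx h2).1 (by omega)⟩
  · have e : B.mem U K w' = A.mem U K w' := by ext u; rw [hmem]; simp [hne]
    rw [e] at hw' ⊢; exact hA.cluster w' hw'

/-- `finishCost` bounds `R` on every open leg at its current position, so all of them can be closed
there. -/
theorem Partial.InvV.finish {lab : ℕ → ℕ} {cl : ℕ → ℕ} (hA : A.InvV U K R mc V Lab lab)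
    (hcl : ∀ l < U.d, cl l = if A.mask.testBit l then A.cl l else U.posn K A.g l)
    (hV : finishCost U K R A.mask A.g U.d ≤ V) : Traced U K R mc V Lab cl A.own A.tk lab := by
  have hdone : ∀ u < U.n, (U.idx u < cl (U.leg u) ↔ A.Done U K u) := fun u hu => by
    rw [hcl _ (U.leg_lt u hu)]; rfl
  have hfin : ∀ m ≤ U.d, ∀ l < m, A.mask.testBit l = false →
      R l (U.posn K A.g l) ≤ finishCost U K R A.mask A.g m := by
    intro m
    induction m with
    | zero => intro _ l hl; omega
    | succ m ih =>
      intro hm l hl hb; rw [finishCost]; rcases Nat.lt_succ_iff_lt_or_eq.1 hl with h | rfl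
      · grind
      · rw [if_neg (by rw [hb]; simp)]; exact le_max_right _ _
  refine ⟨fun l hl => ?_, fun u hu h => hA.cid_pos u hu ((hdone u hu).1 h), fun w S _ hS hne => ?_⟩
  · rw [hcl l hl]
    split_ifs with h
    · exact hA.closed l hl h
    · exact ⟨U.posn_le_cnt hA.g_le l, (hfin U.d le_rfl l hl (by simpa using h)).trans hV⟩
  · have e : S = A.mem U K w := by
      ext u; rw [hS, mem_mem]; exact and_congr_right fun hu => and_congr_left fun _ => hdone u hu
    subst e; exact ⟨(hA.used w hne).1, hA.cluster w hne⟩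

theorem Partial.InvI.pass {lab : ℕ → ℕ} {w need mask : ℕ} {cl : ℕ → ℕ} (hA : A.InvI U K R mc V Lab lab w need)
    (hg : A.g < U.size K U.n) (hm : mask < 2 ^ U.d) (hbit : mask.testBit (U.leg (U.tl K A.g)) = true)
    (hmask : ∀ j, A.mask.testBit j = true → mask.testBit j = true)
    (hmask' : ∀ j, mask.testBit j = true → A.mask.testBit j = true ∨ j = U.leg (U.tl K A.g))
    (hcl : ∀ j, A.mask.testBit j = true → cl j = A.cl j)
    (hnew : A.mask.testBit (U.leg (U.tl K A.g)) = false →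
      cl (U.leg (U.tl K A.g)) = U.idx (U.tl K A.g) ∧ R (U.leg (U.tl K A.g)) (U.idx (U.tl K A.g)) ≤ V)
    (hV : segCost U K R mc (U.size K U.n - A.g - 1) mask w need ≤ V) :
    (⟨A.g + 1, mask, cl, A.own, A.tk⟩ : Partial).InvI U K R mc V Lab lab w need := by
  obtain ⟨h1, h2⟩ := hA.toOk.pass hg hm hbit hmask hmask' hcl hnew
  refine ⟨h1, hA.current.pass h2 (Nat.le_succ _) hmask, fun w' hne hw' => ?_, by rwa [← Nat.sub_add_eq] at hV⟩
  rw [h2] at hw' ⊢; exact hA.cluster w' hne hw'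

theorem Partial.InvI.take {lab : ℕ → ℕ} {w need : ℕ} (hA : A.InvI U K R mc V Lab lab w need)
    (hg : A.g < U.size K U.n) (hbit : A.mask.testBit (U.leg (U.tl K A.g)) = false)
    (hV : segCost U K R mc (U.size K U.n - A.g - 1) A.mask w (need - 1) ≤ V) :
    (⟨A.g + 1, A.mask, A.cl, A.own, Function.update A.tk (U.tl K A.g) (w + 1)⟩ : Partial).InvI
      U K R mc V Lab lab w (need - 1) := by
  obtain ⟨h1, h2, h3⟩ := hA.toOk.take hg hbit hA.current
  refine ⟨h1, h2, fun w' hne hw' => ?_, by rwa [← Nat.sub_add_eq] at hV⟩; rw [h3 w' hne] at hw' ⊢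
  exact hA.cluster w' hne hw'

/-- With `need ≤ 1` the next user completes the required size. It is the last listed user taken, so
it bounds all foreign users of the cluster. -/
theorem Partial.InvI.close {lab : ℕ → ℕ} {w need x : ℕ} (hA : A.InvI U K R mc V Lab lab w need)
    (hg : A.g < U.size K U.n) (hbit : A.mask.testBit (U.leg (U.tl K A.g)) = false) (hneed : need ≤ 1)
    (hmc : mc w A.g ≤ V) (hx : Lab w A.g x)
    (hV : bestCost U K R mc (U.size K U.n - A.g - 1) A.mask ≤ V) :
    (⟨A.g + 1, A.mask, A.cl, A.own, Function.update A.tk (U.tl K A.g) (w + 1)⟩ : Partial).InvV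
      U K R mc V Lab (Function.update lab w x) := by
  obtain ⟨h1, h2, h3⟩ := hA.toOk.take hg hbit hA.current
  refine ⟨h1, fun w' hw' => ?_, by rwa [← Nat.sub_add_eq] at hV⟩; by_cases hne : w' = w
  · subst hne; rw [Function.update_self]
    refine ⟨by have := h2.card; omega, A.g, hg, hmc, hx, fun u hu => (h2.within u hu).imp_right ?_⟩
    rintro ⟨g, hgg, rfl⟩; rcases (Nat.lt_succ_iff_lt_or_eq.1 hgg) with h | rfl
    · exact ((U.tl_lt_tl (by omega) hg).2 h).le
    · exact le_rfl
  · rw [h3 w' hne] at hw' ⊢; rw [Function.update_of_ne hne]; exact hA.cluster w' hne hw'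

end

section
variable {N : ℕ} {U : Users} {K : ℕ} {R mc : ℕ → ℕ → WithTop ℝ} {V : ℝ} {Lab : ℕ → ℕ → ℕ → Prop}

/-! ### Following the choices of the dynamic program -/

/-- The state of the reconstruction held in memory. -/
def Store.part (U : Users) (K : ℕ) (s : Store) : Partial :=
  ⟨U.size K U.n - s.ints 48 0, s.ints 66 0, s.ints 25, s.ints 26, s.ints 27⟩

theorem Store.ints_setInt_self (s : Store) (a i v : ℕ) :
    (s.setInt a i v).ints a = Function.update (s.ints a) i v := by
  funext j; simp [Function.update_apply]

/-- What the reconstruction uses of the tables. -/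
structure TraceIn (N : ℕ) (U : Users) (K : ℕ) (R mc : ℕ → ℕ → WithTop ℝ) (V : ℝ)
    (Lab : ℕ → ℕ → ℕ → Prop) (s : Store) : Prop where
  dp : DpIn U K R mc s
  best : ∀ k ≤ U.size K U.n, ∀ mask < 2 ^ U.d, VCell U K R mc k mask s
  seg : ∀ k ≤ U.size K U.n, ∀ mask < 2 ^ U.d, ∀ w < U.size K U.n, ∀ need ≤ U.r,
    ICell U K R mc k mask w need s
  label : ∀ w < U.size K U.n, ∀ z < U.size K U.n, mc w z ≤ V →
    Lab w z (s.ints 13 (w * U.size K U.n + z))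
  label_lt : ∀ a, s.ints 13 a < N

theorem TraceIn.congr {s s' : Store} (h : TraceIn N U K R mc V Lab s)
    (hi : ∀ a ∈ [0, 1, 9, 10, 13, 14, 15, 17, 20, 21, 22, 23, 52, 54, 56], s'.ints a = s.ints a)
    (hr : s'.reals = s.reals) : TraceIn N U K R mc V Lab s' := by
  have e22 := Store.ext_congr (hi 22 (by decide)) (congrFun hr 22)
  have e23 := Store.ext_congr (hi 23 (by decide)) (congrFun hr 23)
  refine ⟨h.dp.congr (fun a ha => hi a (by revert a; decide)) fun a _ => congrFun hr a,
    fun k hk m hm => ⟨?_, ?_⟩, fun k hk m hm w hw n hn => ⟨?_, ?_⟩, ?_, ?_⟩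
  · rw [e23]; exact (h.best k hk m hm).val
  · rw [hi 15 (by decide)]; exact (h.best k hk m hm).choice
  · rw [e22]; exact (h.seg k hk m hm w hw n hn).val
  · rw [hi 14 (by decide)]; exact (h.seg k hk m hm w hw n hn).choice
  · rw [hi 13 (by decide)]; exact h.label
  · rw [hi 13 (by decide)]; exact h.label_lt

/-- Variable `48` is the number of listed users left, `66` the mask, `67` and `62` are the name and
the need of the current cluster, and `71` tells whether a cluster is open. Arrays `25` to `28` hold
the fields `cl`, `own`, `tk` of `Partial` and the labels of the clusters. -/
def Program.traceSeg : Program := .setInt 63 0 (iv 56 - iv 48) ;; .setInt 61 0 (.read 54 (iv 63)) ;;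
  .setInt 68 0 (.read 1 (iv 61)) ;;
  .setInt 65 0 (((iv 48 * iv 17 + iv 66) * iv 56 + iv 67) * (.read 0 1 + 1) + iv 62) ;;
  .setInt 70 0 (.read 14 (iv 65)) ;; .setInt 48 0 (iv 48 - 1) ;;
  .ite (.intLe (iv 70) 0) .skip (.ite (.intLe (iv 70) 1)
    (.setInt 25 (iv 68) (.read 52 (iv 61)) ;; .setInt 66 0 (iv 66 + .read 10 (iv 68)))
    (.setInt 27 (iv 61) (iv 67 + 1) ;; .setInt 62 0 (iv 62 - 1) ;;
      .ite (.intLe (iv 70) 2) .skip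
        (.setInt 28 (iv 67) (.read 13 (iv 67 * iv 56 + iv 63)) ;; .setInt 71 0 0)))

theorem traceSeg_spec {s : Store} {k w need : ℕ} (hN : 3 < N) (hnN : U.n + 1 < N) (hdN : U.d < N)
    (hL : (U.size K U.n + 1) * segLen U K < N) (hM : 2 ^ U.d < N) (h : TraceIn N U K R mc V Lab s)
    (hk : k ≤ U.size K U.n) (h48 : s.ints 48 0 = k) (h67 : s.ints 67 0 = w) (h62 : s.ints 62 0 = need)
    (h71 : s.ints 71 0 = 1) (hI : (s.part U K).InvI U K R mc V Lab (s.ints 28) w need) :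
    1 ≤ k ∧ wp N .traceSeg (fun s' => s'.ints 48 0 = k - 1 ∧
      ((s'.ints 71 0 = 1 ∧ s'.ints 67 0 = w ∧
        (s'.part U K).InvI U K R mc V Lab (s'.ints 28) w (s'.ints 62 0)) ∨
      (s'.ints 71 0 = 0 ∧ (s'.part U K).InvV U K R mc V Lab (s'.ints 28)))) s := by
  set G := U.size K U.n with hG; have hGn : G ≤ U.n := U.size_le
  have eg : (s.part U K).g = G - k := by show G - s.ints 48 0 = _; rw [h48]
  have em : (s.part U K).mask = s.ints 66 0 := rfl; set mask := s.ints 66 0 with hmask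
  have hm : mask < 2 ^ U.d := hI.mask_lt; have hw : w < G := hI.current.lt
  have hn : need ≤ U.r := hI.current.need_le; have hval := hI.value
  rw [eg, em, show U.size K U.n - (G - k) = k by omega] at hval
  have hne : segCost U K R mc k mask w need ≠ ⊤ := fun h => by rw [h] at hval; simp at hval
  have hk1 : 1 ≤ k := by
    rcases Nat.eq_zero_or_pos k with rfl | h
    · exact (hne rfl).elim
    · exact h
  refine ⟨hk1, ?_⟩; have hch := (h.seg k hk mask hm w hw need hn).choice hne
  have hgG : G - k < G := by omega
  obtain ⟨hu, -, -⟩ := U.tl_spec (K := K) hgG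
  have hidx : U.idx (U.tl K (G - k)) < N := by
    have := U.idx_lt_cnt hu; have := U.cnt_le (U.leg (U.tl K (G - k))); omega
  have hadr : iaddr U K k mask w need < N := by
    rw [iaddr_eq]; have h1 := triple_lt hm hw hn
    have h2 : k * segLen U K + segLen U K ≤ (G + 1) * segLen U K := by
      rw [← Nat.succ_mul]; exact Nat.mul_le_mul_right _ (by omega)
    have h3 : segLen U K = 2 ^ U.d * G * (U.r + 1) := rfl; rw [← h3] at h1; rw [← hG, ← h3]; omega
  have had : U.leg (U.tl K (G - k)) < U.d := U.leg_lt _ hu; have e1 : s.ints 56 0 = G := h.dp.size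
  have e2 := h.dp.tl (G - k) hgG; have e3 := h.dp.leg _ hu; have e4 := h.dp.masks; have e5 := h.dp.r
  have e6 := h.dp.idx _ hu; have e7 := h.dp.pow _ had.le
  have eadr : ((k * 2 ^ U.d + mask) * G + w) * (U.r + 1) + need = iaddr U K k mask w need := rfl
  have hpow : 2 ^ U.leg (U.tl K (G - k)) < N :=
    (Nat.pow_le_pow_right (by norm_num) had.le).trans_lt hM
  have hlab := h.label_lt (w * G + (G - k)); have hGk : G - k + 1 = G - (k - 1) := by omega
  have hGG : U.size K U.n - (G - k) - 1 = k - 1 := by omega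
  unfold Program.traceSeg
  rcases hch with ⟨hc, hb, hv⟩ | ⟨hc, hb, hv⟩ | ⟨hc, hb, hv⟩ | ⟨hc, hb, hn1, hv⟩
  · simp [wp, h48, h67, h62, e1, e2, e3, e4, e5, ← hmask, eadr, hc, h71]
    refine ⟨by omega, by omega, by omega, hadr, by omega, by omega, ?_⟩
    have := hI.pass (mask := mask) (cl := s.ints 25) (by rw [eg]; exact hgG) hm (by rw [eg]; exact hb)
      (fun j hj => hj) (fun j hj => Or.inl hj) (fun _ _ => rfl)
      (fun h => by rw [eg, em] at h; rw [hb] at h; simp at h) (by rw [eg, hGG, ← hv]; exact hval)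
    rw [eg, hGk] at this; simpa [Store.part, h48, h62] using this
  · have hlt := add_two_pow_lt hm had hb
    simp [wp, h48, h67, h62, e1, e2, e3, e4, e5, e6, e7, ← hmask, eadr, hc, h71]
    refine ⟨by omega, by omega, by omega, hadr, by omega, by omega, by omega, by omega, ?_⟩
    rw [hv] at hval
    have := hI.pass (mask := mask + 2 ^ U.leg (U.tl K (G - k)))
      (cl := Function.update (s.ints 25) (U.leg (U.tl K (G - k))) (U.idx (U.tl K (G - k))))
      (by rw [eg]; exact hgG) hlt (by rw [eg, testBit_or_of_ne hb]; exact Or.inr rfl)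
      (fun j hj => (testBit_or_of_ne hb).2 (Or.inl hj)) (fun j hj => by rw [eg]; exact (testBit_or_of_ne hb).1 hj)
      (fun j hj => Function.update_of_ne (by rintro rfl; rw [em] at hj; exact absurd (hj.symm.trans hb) (by simp)) _ _)
      (fun _ => by
        rw [eg, Function.update_self]
        exact ⟨rfl, (le_max_left _ _).trans hval⟩)
      (by rw [eg, hGG]; exact (le_max_right _ _).trans hval)
    rw [eg, hGk] at this; simpa [Store.part, h48, h62, Store.ints_setInt_self] using this
  · simp [wp, h48, h67, h62, e1, e2, e3, e4, e5, e6, e7, ← hmask, eadr, hc, h71]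
    refine ⟨by omega, by omega, by omega, hadr, by omega, by omega, by omega, by omega, ?_⟩
    have := hI.take (by rw [eg]; exact hgG) (by rw [eg]; exact hb) (by rw [eg, hGG, em, ← hv]; exact hval)
    rw [eg, hGk] at this; simpa [Store.part, h48, h62, Store.ints_setInt_self] using this
  · simp [wp, h48, h67, h62, e1, e2, e3, e4, e5, e6, e7, ← hmask, eadr, hc, h71]
    refine ⟨by omega, by omega, by omega, hadr, by omega, by omega, by omega, by omega, hlab, by omega, ?_⟩
    rw [hv] at hval; have hmc := (le_max_left _ _).trans hval
    have := hI.close (by rw [eg]; exact hgG) (by rw [eg]; exact hb) hn1 (by rw [eg]; exact hmc)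
      (x := s.ints 13 (w * G + (G - k))) (by rw [eg]; exact h.label w hw _ hgG hmc)
      (by rw [eg, hGG, em]; exact (le_max_right _ _).trans hval)
    rw [eg, hGk] at this; simpa [Store.part, h48, h62, Store.ints_setInt_self] using this

def Program.traceStart : Program :=
  .setInt 67 0 (iv 70 - 1) ;; .setInt 61 0 (.read 54 (iv 67)) ;; .setInt 68 0 (.read 1 (iv 61)) ;;
  .setInt 69 0 (.read 52 (iv 61) + 1) ;; .setInt 25 (iv 68) (iv 69) ;;
  .setInt 26 (iv 68) (iv 67 + 1) ;;
  .setInt 62 0 (.read 0 1 - (iv 69 - .read 9 (iv 63 * .read 0 0 + iv 68))) ;;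
  .setInt 66 0 (iv 66 + .read 10 (iv 68)) ;; .setInt 71 0 1

theorem traceStart_spec {s : Store} {w : ℕ} (hN : 3 < N) (hnN : U.n + 1 < N) (hdN : U.d < N)
    (hM : 2 ^ U.d < N) (hrN : U.r < N) (h : TraceIn N U K R mc V Lab s)
    (hk : s.ints 48 0 ≤ U.size K U.n) (h63 : s.ints 63 0 = U.size K U.n - s.ints 48 0)
    (h70 : s.ints 70 0 = w + 1) (hw : w < U.size K U.n)
    (hI : (s.part U K).InvV U K R mc V Lab (s.ints 28))
    (hV : optionCost U K R (segCost U K R mc (s.ints 48 0)) (s.ints 66 0) (U.size K U.n - s.ints 48 0) w ≤ V) :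
    wp N .traceStart (fun s' => s'.ints 71 0 = 1 ∧
      (s'.part U K).InvI U K R mc V Lab (s'.ints 28) (s'.ints 67 0) (s'.ints 62 0)) s := by
  set G := U.size K U.n with hG; set k := s.ints 48 0 with hk'; have hGn : G ≤ U.n := U.size_le
  have hwb : G - k ≤ w ∧ (s.ints 66 0).testBit (U.leg (U.tl K w)) = false := by
    by_contra hn; rw [optionCost, if_neg hn] at hV; simp at hV
  obtain ⟨hgw, hb⟩ := hwb; have hm : s.ints 66 0 < 2 ^ U.d := hI.mask_lt
  obtain ⟨hu, -, -⟩ := U.tl_spec (K := K) hw; have had : U.leg (U.tl K w) < U.d := U.leg_lt _ hu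
  have hlt := add_two_pow_lt hm had hb; have h1 := U.idx_lt_cnt hu
  have h2 := U.cnt_le (U.leg (U.tl K w)); have e0 := h.dp.d; have e1 : s.ints 56 0 = G := h.dp.size
  have e2 := h.dp.tl w hw; have e3 := h.dp.leg _ hu; have e5 := h.dp.r; have e6 := h.dp.idx _ hu
  have e7 := h.dp.pow _ had.le; have e9 := h.dp.posn (G - k) (by omega) _ had
  simp [Program.traceStart, wp, h70, e0, e2, e3, e5, e6, e7, h63, e9]
  refine ⟨by omega, by omega, by omega, by omega, by omega, by omega, by omega, by omega, ?_⟩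
  have hgk : (s.part U K).g = G - k := rfl
  have := hI.start hgw hw hb (by
    rw [hgk, show U.size K U.n - (G - k) = k by omega]
    exact hV)
  rw [hgk] at this; simpa [Store.part, Store.ints_setInt_self] using this

def Program.traceEnd : Program :=
  .forUp 73 (.read 0 0) (.setInt 68 0 (.bit (iv 66) (iv 73)) ;;
    .ite (.intLe 1 (iv 68)) .skip (.setInt 25 (iv 73) (.read 9 (iv 63 * .read 0 0 + iv 73)))) ;;
  .setInt 72 0 0

theorem traceEnd_spec {s : Store} (hN : 3 < N) (hnN : U.n < N) (hdN : U.d < N)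
    (h : TraceIn N U K R mc V Lab s)
    (hk : s.ints 48 0 ≤ U.size K U.n) (h63 : s.ints 63 0 = U.size K U.n - s.ints 48 0)
    (hI : (s.part U K).InvV U K R mc V Lab (s.ints 28))
    (hV : finishCost U K R (s.ints 66 0) (U.size K U.n - s.ints 48 0) U.d ≤ V) :
    Tr N .traceEnd s (200 * (U.d + 1)) (fun s' => s'.ints 72 0 = 0 ∧
      Traced U K R mc V Lab (s'.ints 25) (s'.ints 26) (s'.ints 27) (s'.ints 28)) := by
  set g := U.size K U.n - s.ints 48 0 with hg
  refine Tr.mono (Tr.seq (Tr.forUp (m := U.d) 50 (fun m s' => ∀ l, s'.ints 25 l =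
      if l < m ∧ (s.ints 66 0).testBit l = false then U.posn K g l else s.ints 25 l) hdN (by decide) ?_ ?_ ?_)
    fun s₁ f₁ h₁ => Tr.of_wp (Q := fun s' => s'.ints 72 0 = 0 ∧
      Traced U K R mc V Lab (s'.ints 25) (s'.ints 26) (s'.ints 27) (s'.ints 28)) ?_) ?_ fun s' _ hQ => hQ
  · simp
  · intro m _ s' f _ _; simp only [IExp.val_read, IExp.val_zero]; rw [f.int _, h.dp.d]
  · intro m hm s' f hv hQ; have e0 : s'.ints 0 0 = U.d := by rw [f.int _, h.dp.d]
    have e9 : s'.ints 9 (g * U.d + m) = U.posn K g m := by rw [f.int _, h.dp.posn g (by omega) m hm]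
    have e10 : s'.ints 10 m = 2 ^ m := by rw [f.int _, h.dp.pow m hm.le]
    have e66 : s'.ints 66 0 = s.ints 66 0 := by rw [f.int _]
    have e63 : s'.ints 63 0 = g := by rw [f.int _, h63]
    have eb := bit_eq (s.ints 66 0) m
    have hp := U.posn_le_cnt (K := K) (show g ≤ U.size K U.n by omega) m; have hc := U.cnt_le m
    refine (Tr.of_wp (Q := fun s'' => ∀ l, s''.ints 25 l =
      if l < m + 1 ∧ (s.ints 66 0).testBit l = false then U.posn K g l else s.ints 25 l) ?_).mono
      (by decide) fun s'' _ hQ l => ?_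
    · simp [wp, IExp.bit, hv, e0, e9, e10, e66, e63, eb]
      refine ⟨by split_ifs <;> omega, fun hb => fun l => ?_, fun hb => ⟨by omega, fun l => ?_⟩⟩
      · have hbit : (s.ints 66 0).testBit m = true := by by_contra hn; simp [hn] at hb
        rw [hQ]; by_cases hl : l = m
        · subst hl; simp [hbit]
        · simp only [show l ≤ m ↔ l < m by omega]
      · by_cases hl : l = m
        · subst hl; simp [hb]
        · rw [if_neg hl, hQ]; simp only [show l ≤ m ↔ l < m by omega]
    · simpa using hQ l
  · simp [wp]; refine ⟨by omega, ?_⟩; rw [f₁.int 26, f₁.int 27, f₁.int 28]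
    refine hI.finish (fun l hl => ?_) hV; rw [h₁ l]
    cases hb : (s.ints 66 0).testBit l <;> simp [hl, hb, Store.part, hg]
  · have e1 : (IExp.read 0 0).cost = 2 := rfl; have e2 : (Program.setInt 72 0 0).cst = 3 := rfl
    rw [e1, e2]; omega

def Program.traceStep : Program :=
  .ite (.intLe 1 (iv 71)) .traceSeg
    ((.setInt 63 0 (iv 56 - iv 48) ;; .setInt 70 0 (.read 15 (iv 48 * iv 17 + iv 66))) ;;
      .ite (.intLe 1 (iv 70)) .traceStart .traceEnd)

def Program.trace : Program :=
  (.setInt 48 0 (iv 56) ;; .setInt 66 0 0 ;; .setInt 71 0 0 ;; .setInt 72 0 1) ;;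
  .loop (.intLe 1 (iv 72)) .traceStep

theorem trace_spec : ∃ c, ∀ (N : ℕ) (U : Users) (K : ℕ) (R mc : ℕ → ℕ → WithTop ℝ) (V : ℝ)
    (Lab : ℕ → ℕ → ℕ → Prop) (s : Store), 3 < N → U.n + 1 < N → U.d < N → U.r < N → (U.size K U.n + 1) * 2 ^ U.d < N →
    (U.size K U.n + 1) * segLen U K < N → TraceIn N U K R mc V Lab s →
    (∀ a ∈ [25, 26, 27], ∀ i, s.ints a i = 0) → bestCost U K R mc (U.size K U.n) 0 ≤ V →
    Tr N .trace s (c * ((U.size K U.n + 1) * (U.d + 1)))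
      fun s' => Traced U K R mc V Lab (s'.ints 25) (s'.ints 26) (s'.ints 27) (s'.ints 28) := by
  refine ⟨4 * (Program.traceSeg.cst + Program.traceStart.cst + 300), fun N U K R mc V Lab s hN hnN hdN hrN hM hL h hfresh hV => ?_⟩
  set G := U.size K U.n with hG; have hGn : G ≤ U.n := U.size_le
  have hM1 : 2 ^ U.d < N := by nlinarith
  set C := (Program.traceSeg.cst + Program.traceStart.cst + 250) * (U.d + 1) with hC
  have hCge : Program.traceSeg.cst + Program.traceStart.cst + 250 + 250 * U.d ≤ C := by rw [hC]; nlinarith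
  refine Tr.mono (t := 16 + (C * (2 * G + 1) + 4)) (Tr.seq (t₁ := 16) (R := fun s₁ => s₁.ints 48 0 = G ∧ s₁.ints 72 0 = 1 ∧
      s₁.ints 71 0 = 0 ∧ (s₁.part U K).InvV U K R mc V Lab (s₁.ints 28)) (Tr.of_wp_le ?_)
    fun s₁ f₁ ⟨g1, g2, g3, g4⟩ => Tm.mono (Tm.loop
      (fun s' => (s'.ints 72 0 = 1 ∧ s'.ints 48 0 ≤ G ∧
        ((s'.ints 71 0 = 1 ∧ (s'.part U K).InvI U K R mc V Lab (s'.ints 28) (s'.ints 67 0) (s'.ints 62 0)) ∨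
        (s'.ints 71 0 = 0 ∧ (s'.part U K).InvV U K R mc V Lab (s'.ints 28)))) ∨
        (s'.ints 72 0 = 0 ∧ Traced U K R mc V Lab (s'.ints 25) (s'.ints 26) (s'.ints 27) (s'.ints 28)))
      -- A round inside a cluster uses up a listed user. Opening a cluster uses none, but sets the
      -- flag `71`; counting users twice pays for both kinds of rounds.
      (fun s' => if s'.ints 72 0 = 0 then 0 else C * (2 * s'.ints 48 0 + if s'.ints 71 0 = 0 then 1 else 0))
      (Or.inl ⟨g2, g1.le, Or.inr ⟨g3, g4⟩⟩) ?_) fun s' t _ hQ => ?_) ?_ fun s' _ hQ => hQ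
  · have e56 := h.dp.size; simp [wp, e56]
    have hdone : ∀ u, ¬ (⟨0, 0, s.ints 25, s.ints 26, s.ints 27⟩ : Partial).Done U K u := by
      intro u; simp [Partial.Done, Users.posn]
    refine ⟨by omega, by omega, by omega, ?_⟩
    have hmem : ∀ w, (⟨0, 0, s.ints 25, s.ints 26, s.ints 27⟩ : Partial).mem U K w = ∅ := fun w => by
      ext u; simp [Partial.mem_mem, hdone]
    have : (⟨0, 0, s.ints 25, s.ints 26, s.ints 27⟩ : Partial).InvV U K R mc V Lab (s.ints 28) := by
      refine ⟨⟨Nat.zero_le _, Nat.two_pow_pos _, fun l _ hb => by simp at hb, fun u _ hu => ?_,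
        fun u _ hu => (hdone u hu).elim, fun u _ hu => (hdone u hu).elim, fun w hw => ?_⟩, fun w hw => ?_, hV⟩
      · have h27 : s.ints 27 u = 0 := hfresh 27 (by decide) u; simp only [h27] at hu; omega
      · rw [hmem] at hw; simp at hw
      · rw [hmem] at hw; simp at hw
    simpa [Store.part, hG] using this
  · intro s' f hI hb
    have h' : TraceIn N U K R mc V Lab s' := h.congr
      (fun a ha => by rw [f.1 a (by revert a; decide), f₁.1 a (by revert a; decide)])
      (by funext a; rw [f.real a nofun, f₁.real a nofun])
    have hcost : (Test.intLe 1 (iv 72)).cost = 4 := rfl; rcases hI with ⟨h72, h48, hI⟩ | ⟨h72, -⟩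
    swap
    · simp [h72] at hb
    rw [hcost, h72, if_neg one_ne_zero]; rcases hI with ⟨h71, hI⟩ | ⟨h71, hI⟩
    · obtain ⟨hk1, hwp⟩ := traceSeg_spec hN hnN hdN hL hM1 h' h48 rfl rfl rfl h71 hI
      refine Tm.mono (Tr.ite (t := Program.traceSeg.cst) (fun _ => (Tr.of_wp hwp).mono le_rfl
        fun s'' f'' hQ => And.intro (f''.int 72) hQ) fun hb => ?_) fun s'' t f' hQ => ?_
      · simp [h71] at hb
      · obtain ⟨ht, h72', q1, q2⟩ := hQ; have h72' : s''.ints 72 0 = 1 := by rw [h72', h72]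
        have hc2 : (Test.intLe 1 (iv 71)).cost = 4 := rfl; rw [hc2] at ht
        rw [h72', if_neg one_ne_zero, h71, if_neg one_ne_zero, q1]
        refine ⟨Or.inl ⟨rfl, by omega, ?_⟩, ?_⟩
        · rcases q2 with ⟨q3, q4, q5⟩ | q2
          · exact Or.inl ⟨q3, by rw [q4]; exact q5⟩
          · exact Or.inr q2
        · have e : C * (2 * s'.ints 48 0 + 0) = C * (2 * (s'.ints 48 0 - 1) + 1) + C := by
            obtain ⟨j, hj⟩ : ∃ j, s'.ints 48 0 = j + 1 := ⟨_, (Nat.sub_add_cancel hk1).symm⟩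
            rw [hj, Nat.add_sub_cancel]; ring
          have e2 : C * (2 * (s'.ints 48 0 - 1) + if s''.ints 71 0 = 0 then 1 else 0) ≤
            C * (2 * (s'.ints 48 0 - 1) + 1) := Nat.mul_le_mul_left _ (by split_ifs <;> omega)
          omega
    · set k := s'.ints 48 0 with hk; have hm : s'.ints 66 0 < 2 ^ U.d := hI.mask_lt
      have hval : bestCost U K R mc k (s'.ints 66 0) ≤ V := by
        have := hI.value; rwa [show (s'.part U K).g = G - k from rfl, Nat.sub_sub_self h48] at this
      have hch := (h'.best k h48 _ hm).choice (ne_of_lt (hval.trans_lt (WithTop.coe_lt_top V)))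
      have hadr : k * 2 ^ U.d + s'.ints 66 0 < N := by
        have : (k + 1) * 2 ^ U.d ≤ (G + 1) * 2 ^ U.d := Nat.mul_le_mul_right _ (by omega)
        rw [Nat.add_mul] at this; omega
      have hnext : ∀ s₂, Frame (.setInt 63 0 (iv 56 - iv 48) ;; .setInt 70 0 (.read 15 (iv 48 * iv 17 + iv 66))) s' s₂ →
          s₂.ints 63 0 = G - k ∧ s₂.ints 70 0 = s'.ints 15 (k * 2 ^ U.d + s'.ints 66 0) →
          Tr N (.ite (.intLe 1 (iv 70)) .traceStart .traceEnd) s₂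
            (4 + (Program.traceStart.cst + 200 * (U.d + 1)))
            (fun s'' => (s''.ints 72 0 = 1 ∧ s''.ints 48 0 = k ∧ s''.ints 71 0 = 1 ∧
            (s''.part U K).InvI U K R mc V Lab (s''.ints 28) (s''.ints 67 0) (s''.ints 62 0)) ∨
            (s''.ints 72 0 = 0 ∧ Traced U K R mc V Lab (s''.ints 25) (s''.ints 26) (s''.ints 27) (s''.ints 28))) := by
        rintro s₂ f₂ ⟨e63, e70⟩
        have h₂ : TraceIn N U K R mc V Lab s₂ := h'.congr (fun a ha => f₂.1 a (by revert a; decide))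
          (funext fun a => f₂.real a nofun)
        have e48 : s₂.ints 48 0 = k := by rw [f₂.int 48]
        have e66 : s₂.ints 66 0 = s'.ints 66 0 := by rw [f₂.int 66]
        have hp : s₂.part U K = s'.part U K := by
          simp only [Store.part, f₂.int 48, f₂.int 66, f₂.int 25, f₂.int 26, f₂.int 27]
        have hI₂ : (s₂.part U K).InvV U K R mc V Lab (s₂.ints 28) := by rw [hp, f₂.int 28]; exact hI
        refine Tr.ite (fun hb => ?_) fun hb => ?_
        · simp [e70] at hb
          obtain ⟨w, hw, hc, hv⟩ := hch.resolve_left fun h => by have := h.1; omega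
          refine (Tr.of_wp (traceStart_spec (w := w) hN hnN hdN hM1 hrN h₂ (by rw [e48]; exact h48)
            (by rw [e48, e63]) (by rw [e70, hc]) hw hI₂ (by rw [e48, e66]; rw [hv] at hval; exact hval))).mono
            (by omega) fun s'' f'' hQ => Or.inl ⟨?_, ?_, hQ⟩
          · rw [f''.int _, f₂.int _, h72]
          · rw [f''.int _, e48]
        · simp [e70] at hb; obtain ⟨hc, hv⟩ := hch.resolve_right fun ⟨w, _, h, _⟩ => by omega
          refine (traceEnd_spec hN (by omega) hdN h₂ (by rw [e48]; exact h48) (by rw [e48, e63]) hI₂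
            (by rw [e48, e66]; rw [hv] at hval; exact hval)).mono (by omega) fun s'' _ hQ => Or.inr hQ
      refine Tm.mono (Tr.ite (t := 30 + (4 + (Program.traceStart.cst + 200 * (U.d + 1))))
        (fun hb => ?_) fun _ => Tr.seq (t₁ := 30) (Tr.of_wp_le ?_) hnext)
        fun s'' t f' hQ => ?_
      · simp [h71] at hb
      · have e1 := h'.dp.size; have e2 := h'.dp.masks; simp [wp, e1, e2, ← hk, ← hG]
        refine ⟨by omega, ?_⟩; rcases hch with h | ⟨w, hw, h, -⟩
        · rw [h.1]; omega
        · rw [h]; omega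
      · obtain ⟨ht, hQ⟩ := hQ; have hc2 : (Test.intLe 1 (iv 71)).cost = 4 := rfl; rw [hc2] at ht
        rw [h71, if_pos rfl]; rcases hQ with ⟨q1, q2, q3, q4⟩ | ⟨q1, q2⟩
        · refine ⟨Or.inl ⟨q1, by omega, Or.inl ⟨q3, q4⟩⟩, ?_⟩
          rw [q1, if_neg one_ne_zero, q2, q3, if_neg one_ne_zero, show C * (2 * k + 1) = C * (2 * k + 0) + C by ring]
          omega
        · refine ⟨Or.inr ⟨q1, q2⟩, ?_⟩; rw [q1, if_pos rfl, Nat.mul_add C]; omega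
  · obtain ⟨q1, q2, q3⟩ := hQ; have hcost : (Test.intLe 1 (iv 72)).cost = 4 := rfl
    rw [hcost, g2, g3, g1, if_neg one_ne_zero, if_pos rfl] at q3; refine ⟨by omega, ?_⟩
    rcases q1 with ⟨q1, -⟩ | ⟨-, q1⟩
    · simp [q1] at q2
    · exact q1
  · rw [hC]; nlinarith

end

/-! ### Output: labels of the users -/

section
/-! ### Labelling the users -/

/-- The start of the line cluster that contains number `c + k`, if the line clusters begin at `c`
and `nxt` is the end of the cluster that starts at a given number. -/
def lineStart (nxt : ℕ → ℕ) (c : ℕ) : ℕ → ℕ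
  | 0 => c
  | k + 1 => if nxt (lineStart nxt c k) ≤ c + k + 1 then c + k + 1 else lineStart nxt c k

/-- `P` passes from the start of one line cluster to that of the next. It will say that the suffix
from this start has cost at most the value. -/
theorem lineStart_spec {nxt : ℕ → ℕ} {c cnt : ℕ} {P : ℕ → Prop} (hc : c < cnt → P c)
    (h : ∀ j < cnt, P j → j < nxt j ∧ (nxt j < cnt → P (nxt j))) {k : ℕ} (hk : c + k < cnt) :
    P (lineStart nxt c k) ∧ c ≤ lineStart nxt c k ∧ lineStart nxt c k ≤ c + k ∧
      c + k < nxt (lineStart nxt c k) ∧ lineStart nxt c (lineStart nxt c k - c) = lineStart nxt c k := by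
  induction k with
  | zero =>
    have h1 := hc (by omega)
    exact ⟨h1, le_rfl, le_rfl, by simpa [lineStart] using (h c (by omega) h1).1, by simp [lineStart]⟩
  | succ k ih =>
    obtain ⟨h1, h2, h3, h4, h5⟩ := ih (by omega)
    have e : lineStart nxt c (k + 1) =
      if nxt (lineStart nxt c k) ≤ c + k + 1 then c + k + 1 else lineStart nxt c k := rfl
    by_cases hn : nxt (lineStart nxt c k) ≤ c + k + 1
    · rw [if_pos hn] at e; have en : nxt (lineStart nxt c k) = c + k + 1 := by omega
      have hP : P (c + k + 1) := by have := (h _ (by omega) h1).2 (by omega); rwa [en] at this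
      rw [e]; refine ⟨hP, by omega, by omega, (h _ (by omega) hP).1, ?_⟩
      rw [show c + k + 1 - c = k + 1 by omega, e]
    · rw [if_neg hn] at e; rw [e]; grind

/-- Conversely, everything from the start of a cluster up to its end is assigned to that start. This
yields the size of line clusters. -/
theorem lineStart_const {nxt : ℕ → ℕ} {c j k : ℕ} (hj : lineStart nxt c (j - c) = j) (hcj : c ≤ j)
    (h1 : j ≤ c + k) (h2 : c + k < nxt j) : lineStart nxt c k = j := by
  induction k with
  | zero => rwa [show j - c = 0 by omega] at hj
  | succ k ih =>
    by_cases h : j = c + k + 1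
    · rwa [show j - c = k + 1 by omega] at hj
    · rw [lineStart, ih (by omega) (by omega), if_neg (by omega)]

section

variable (U : Users) (K : ℕ) (mc : ℕ → ℕ → WithTop ℝ) (lc : ℕ → ℕ → ℕ → ℝ) (V : ℝ)
  (LabM : ℕ → ℕ → ℕ → Prop) (Lab : ℕ → ℕ → ℕ → ℕ → Prop)

/-- Clusters `κ` with labels `lam` that witness the value `V`. -/
def Solution (κ lam : ℕ → ℕ) : Prop := ∀ u < U.n,
  U.r ≤ ((Finset.range U.n).filter (κ · = κ u)).card ∧
    ((∃ w < U.size K U.n, ∃ z < U.size K U.n, mc w z ≤ V ∧ LabM w z (lam u) ∧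
      ∀ v < U.n, κ v = κ u → lam v = lam u ∧ Within U K w z v) ∨
    ∃ l < U.d, ∃ i j, i < j ∧ j ≤ U.cnt l ∧ lc l i j ≤ V ∧ Lab l i j (lam u) ∧
      ∀ v < U.n, κ v = κ u → lam v = lam u ∧ U.leg v = l ∧ i ≤ U.idx v ∧ U.idx v < j)

/-- The cluster (or its label, if `b` is false) computed for `u` from the tables. -/
def outLabel (cl own tk lab nxt labs : ℕ → ℕ) (b : Bool) (u : ℕ) : ℕ :=
  if U.idx u < cl (U.leg u) then
    let w := (if 1 ≤ tk u then tk u else own (U.leg u)) - 1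
    if b then w else lab w
  else
    let a := U.leg u * (U.n + 1) +
      lineStart (fun i => nxt (U.leg u * (U.n + 1) + i)) (cl (U.leg u)) (U.idx u - cl (U.leg u))
    -- The shift by `n` separates the names of line clusters from those of central clusters, which
    -- are below `n`.
    if b then U.n + a else labs a

end

variable {N : ℕ} {U : Users} {K : ℕ} {R mc : ℕ → ℕ → WithTop ℝ} {V : ℝ} {LabM : ℕ → ℕ → ℕ → Prop}
  {lc : ℕ → ℕ → ℕ → ℝ} {Lab : ℕ → ℕ → ℕ → ℕ → Prop} {cl own tk lab nxt labs : ℕ → ℕ}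

theorem LineCell.start (hr : 1 ≤ U.r) {l c : ℕ} (hc : c ≤ U.cnt l) (hR : R l c ≤ V)
    (hcell : ∀ i ≤ U.cnt l, LineCell (lc l) (Lab l) (R l) (U.cnt l) U.r i
      (nxt (l * (U.n + 1) + i)) (labs (l * (U.n + 1) + i))) {k : ℕ} (hk : c + k < U.cnt l) :
    let f := fun i => nxt (l * (U.n + 1) + i)
    let j := lineStart f c k
    c ≤ j ∧ j ≤ c + k ∧ c + k < f j ∧ lineStart f c (j - c) = j ∧ j + U.r ≤ f j ∧ f j ≤ U.cnt l ∧
      lc l j (f j) ≤ V ∧ Lab l j (f j) (labs (l * (U.n + 1) + j)) := by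
  intro f j
  have hval : ∀ j < U.cnt l, R l j ≤ V → j + U.r ≤ U.cnt l := fun j hj h => by
    by_contra hn; rw [(hcell j hj.le).short hj (by omega)] at h; simp at h
  have hcut : ∀ j < U.cnt l, R l j ≤ V → (lc l j (f j) : WithTop ℝ) ≤ V ∧ R l (f j) ≤ V := fun j hj h => by
    rw [(hcell j hj.le).eq (hval j hj h), cutCost] at h; grind
  obtain ⟨h1, h2, h3, h4, h5⟩ := lineStart_spec (nxt := f) (P := fun j => R l j ≤ V) (fun _ => hR)
    (fun j hj h => by
      have h1 := (hcell j hj.le).next_ge (hval j hj h)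
      exact ⟨by simp only [f]; omega, fun _ => (hcut j hj h).2⟩) hk
  have hj : j < U.cnt l := by omega
  have h6 := hval j hj h1
  exact ⟨h2, h3, h4, h5, (hcell j hj.le).next_ge h6, (hcell j hj.le).next_le h6,
    by exact_mod_cast (hcut j hj h1).1, (hcell j hj.le).lab h6⟩

/-- Central clusters are good by `Traced.cluster`. A line cluster contains all users of its leg from
its start to the recorded end, which are at least `r` by the table. -/
theorem Traced.solution (hr : 1 ≤ U.r) (h : Traced U K R mc V LabM cl own tk lab)
    (hcell : ∀ l < U.d, ∀ i ≤ U.cnt l, LineCell (lc l) (Lab l) (R l) (U.cnt l) U.r i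
      (nxt (l * (U.n + 1) + i)) (labs (l * (U.n + 1) + i))) :
    Solution U K mc lc V LabM Lab (outLabel U cl own tk lab nxt labs true)
      (outLabel U cl own tk lab nxt labs false) := by
  classical
  set κ := outLabel U cl own tk lab nxt labs true with hκ
  have hG : U.size K U.n ≤ U.n := U.size_le
  set cid : ℕ → ℕ := fun u => if 1 ≤ tk u then tk u else own (U.leg u) with hcid
  have cen : ∀ u, U.idx u < cl (U.leg u) → κ u = cid u - 1 ∧
      outLabel U cl own tk lab nxt labs false u = lab (cid u - 1) := fun u hu => by
    simp [hκ, outLabel, hu, hcid]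
  set st : ℕ → ℕ := fun u => lineStart (fun i => nxt (U.leg u * (U.n + 1) + i)) (cl (U.leg u))
    (U.idx u - cl (U.leg u)) with hst
  have lin : ∀ u, ¬ U.idx u < cl (U.leg u) → κ u = U.n + (U.leg u * (U.n + 1) + st u) ∧
      outLabel U cl own tk lab nxt labs false u = labs (U.leg u * (U.n + 1) + st u) := fun u hu => by
    simp [hκ, outLabel, hu, hst]
  have small : ∀ u < U.n, U.idx u < cl (U.leg u) → κ u < U.n := fun u hu h1 => by
    have h2 := h.cid_pos u hu h1
    have := (h.cluster (cid u - 1) ((Finset.range U.n).filter fun v => U.idx v < cl (U.leg v) ∧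
      cid v = cid u - 1 + 1) (Finset.filter_subset _ _) (fun v => by simp [hcid]) ⟨u, by
        rw [Finset.mem_filter, Finset.mem_range]
        exact ⟨hu, h1, (Nat.sub_add_cancel h2).symm⟩⟩).1
    rw [(cen u h1).1]; omega
  have start : ∀ u < U.n, ¬ U.idx u < cl (U.leg u) → _ := fun u hu h1 =>
    LineCell.start (U := U) (V := V) (k := U.idx u - cl (U.leg u)) hr
      (h.line _ (U.leg_lt u hu)).1 (h.line _ (U.leg_lt u hu)).2
      (hcell _ (U.leg_lt u hu)) (by have := U.idx_lt_cnt hu; omega)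
  simp only at start; intro u hu
  · by_cases hc : U.idx u < cl (U.leg u)
    · have h2 := h.cid_pos u hu hc
      have hS : ∀ v, v ∈ (Finset.range U.n).filter (κ · = κ u) ↔ v < U.n ∧ U.idx v < cl (U.leg v) ∧
          cid v = κ u + 1 := by
        intro v; rw [Finset.mem_filter, Finset.mem_range]; refine and_congr_right fun hv => ?_
        by_cases hcv : U.idx v < cl (U.leg v)
        · have h3 := h.cid_pos v hv hcv; rw [(cen v hcv).1, (cen u hc).1]; simp only [hcv, true_and]
          simp only [hcid]; omega
        · have := (lin v hcv).1; have := small u hu hc; simp only [hcv, false_and, iff_false]; omega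
      obtain ⟨hw, hcard, z, hz, h4, h5, h6⟩ := h.cluster (κ u) _ (Finset.filter_subset _ _) hS ⟨u, by simp [hu]⟩
      refine ⟨hcard, Or.inl ⟨κ u, hw, z, hz, h4, ?_, fun v hv hvu => ⟨?_, h6 v (by simp [hv, hvu])⟩⟩⟩
      · rw [(cen u hc).2, ← (cen u hc).1]; exact h5
      · have hcv := ((hS v).1 (by simp [hv, hvu])).2.1
        rw [(cen v hcv).2, (cen u hc).2, ← (cen v hcv).1, ← (cen u hc).1, hvu]
    · obtain ⟨h1, h2, h3, h4, h5, h6, h7, h8⟩ := start u hu hc; have hix := U.idx_lt_cnt hu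
      have hcn := U.cnt_le (U.leg u)
      have same : ∀ v < U.n, κ v = κ u → U.leg v = U.leg u ∧ ¬ U.idx v < cl (U.leg v) ∧ st v = st u := by
        intro v hv hvu; rw [(lin u hc).1] at hvu; by_cases hcv : U.idx v < cl (U.leg v)
        · have := small v hv hcv; omega
        · rw [(lin v hcv).1] at hvu; obtain ⟨g1, g2, -⟩ := start v hv hcv
          have hix' := U.idx_lt_cnt hv; have hcn' := U.cnt_le (U.leg v)
          have := (pair_inj (b := U.n + 1) (by grind) (by grind)).1
            (Nat.add_left_cancel hvu)
          omega
      refine ⟨?_, Or.inr ⟨U.leg u, U.leg_lt u hu, st u, _, by simp only [hst]; omega, h6, h7,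
        by rw [(lin u hc).2]; exact h8, fun v hv hvu => ?_⟩⟩
      · refine le_trans (b := (Finset.Ico (st u) (nxt (U.leg u * (U.n + 1) + st u))).card)
          (by rw [Nat.card_Ico]; simp only [hst]; omega) ?_
        refine Finset.card_le_card_of_injOn (U.usr (U.leg u)) (fun p hp => ?_) fun p hp p' hp' he => ?_
        · rw [Finset.mem_coe, Finset.mem_Ico] at hp
          obtain ⟨e1, e2, e3⟩ := U.usr_spec (l := U.leg u) (i := p) (by grind)
          rw [Finset.mem_coe, Finset.mem_filter, Finset.mem_range]; refine ⟨e1, ?_⟩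
          have hcv : ¬ U.idx (U.usr (U.leg u) p) < cl (U.leg (U.usr (U.leg u) p)) := by
            rw [e2, e3]; simp only [hst] at hp; omega
          rw [(lin _ hcv).1, (lin u hc).1]; simp only [hst, e2, e3]
          rw [lineStart_const h4 h1 (k := p - cl (U.leg u)) (by grind)
            (by grind)]
        · rw [Finset.mem_coe, Finset.mem_Ico] at hp hp'; simp only [hst] at hp hp'
          rw [← (U.usr_spec (l := U.leg u) (i := p) (by omega)).2.2, he,
            (U.usr_spec (l := U.leg u) (i := p') (by omega)).2.2]
      · obtain ⟨e1, e2, e3⟩ := same v hv hvu; obtain ⟨g1, g2, g3, -⟩ := start v hv e2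
        refine ⟨by rw [(lin v e2).2, (lin u hc).2, e1, e3], e1, ?_, ?_⟩
        · rw [← e3]; simp only [hst]; omega
        · have : nxt (U.leg u * (U.n + 1) + st u) = nxt (U.leg v * (U.n + 1) + st v) := by rw [e1, e3]
          simp only [hst] at this g3 ⊢; omega

/-- The users of a leg are met in order, so the cell of the leg in array `25` can be overwritten
with the start of the current line cluster. It never exceeds the numbers still to come, so later
users are not mistaken for central ones. -/
def Program.labelStep (b : Bool) : Program :=
  .setInt 73 0 (.read 1 (iv 74)) ;; .setInt 68 0 (.read 52 (iv 74)) ;;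
  .ite (.intLe (iv 68 + 1) (.read 25 (iv 73)))
    (.ite (.intLe 1 (.read 27 (iv 74))) (.setInt 69 0 (.read 27 (iv 74) - 1))
        (.setInt 69 0 (.read 26 (iv 73) - 1)) ;;
      .setInt 4 (iv 74) (if b then iv 69 else .read 28 (iv 69)))
    (.setInt 69 0 (iv 73 * (.read 0 2 + 1)) ;;
      .ite (.intLe (.read 11 (iv 69 + .read 25 (iv 73))) (iv 68)) (.setInt 25 (iv 73) (iv 68)) .skip ;;
      .setInt 69 0 (iv 69 + .read 25 (iv 73)) ;;
      .setInt 4 (iv 74) (if b then .read 0 2 + iv 69 else .read 12 (iv 69)))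

def Program.labelUsers (b : Bool) : Program := .forUp 74 (.read 0 2) (.labelStep b)

theorem Users.count_succ (U : Users) (l u : ℕ) : Nat.count (fun v => U.leg v = l) (u + 1) =
    Nat.count (fun v => U.leg v = l) u + if U.leg u = l then 1 else 0 := Nat.count_succ ..

theorem labelUsers_spec {s : Store} (b : Bool) (hr : 1 ≤ U.r) (hN : U.n + 1 < N)
    (hdN : U.n + (U.n + 1) * U.d < N)
    (h0 : s.ints 0 2 = U.n) (h1 : ∀ u < U.n, s.ints 1 u = U.leg u) (h52 : ∀ u < U.n, s.ints 52 u = U.idx u)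
    (hlt : ∀ a i, s.ints a i < N)
    (h : Traced U K R mc V LabM (s.ints 25) (s.ints 26) (s.ints 27) (s.ints 28))
    (hcell : ∀ l < U.d, ∀ i ≤ U.cnt l, LineCell (lc l) (Lab l) (R l) (U.cnt l) U.r i
      (s.ints 11 (l * (U.n + 1) + i)) (s.ints 12 (l * (U.n + 1) + i))) :
    Tr N (.labelUsers b) s ((U.n + 1) * 122) fun s' => ∀ u < U.n,
      s'.ints 4 u = outLabel U (s.ints 25) (s.ints 26) (s.ints 27) (s.ints 28) (s.ints 11) (s.ints 12) b u := by
  set cl := s.ints 25 with hcl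
  set S : ℕ → ℕ → ℕ := fun l k => lineStart (fun i => s.ints 11 (l * (U.n + 1) + i)) (cl l) k with hS
  refine Tr.mono (Tr.forUp (m := U.n) 100 (fun u s' => (∀ v < u, s'.ints 4 v = outLabel U cl (s.ints 26)
      (s.ints 27) (s.ints 28) (s.ints 11) (s.ints 12) b v) ∧
      ∀ l < U.d, s'.ints 25 l = if Nat.count (fun v => U.leg v = l) u ≤ cl l then cl l else
        S l (Nat.count (fun v => U.leg v = l) u - 1 - cl l)) (by omega) (by cases b <;> decide) ?_ ?_ ?_) le_rfl
      fun s' _ hQ => hQ.1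
  · simp [hcl]
  · intro u _ s' f _ _; simp only [IExp.val_read]
    rw [f.1 _ (by cases b <;> decide)]
    exact h0
  · intro u hu s' f h74 ⟨hI, hL⟩
    have e : ∀ a ∉ [4, 25, 68, 69, 73, 74], s'.ints a = s.ints a := fun a ha =>
      f.1 a (by revert ha; cases b <;> simp [Program.im, Program.forUp, Program.labelStep] <;> tauto)
    set l := U.leg u with hl; have hld : l < U.d := U.leg_lt u hu
    have hix : U.idx u < U.cnt l := U.idx_lt_cnt hu; have hcn := U.cnt_le l; have hLu := hL l hld
    have hidx : Nat.count (fun v => U.leg v = l) u = U.idx u := rfl; rw [hidx] at hLu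
    have e1 : s'.ints 1 u = l := by rw [e 1 (by decide), h1 u hu]
    have e52 : s'.ints 52 u = U.idx u := by rw [e 52 (by decide), h52 u hu]
    have e0 : s'.ints 0 2 = U.n := by rw [e 0 (by decide), h0]
    refine (Tr.of_wp (Q := fun s'' => s''.ints 4 = Function.update (s'.ints 4) u (outLabel U cl (s.ints 26)
      (s.ints 27) (s.ints 28) (s.ints 11) (s.ints 12) b u) ∧ s''.ints 25 = Function.update (s'.ints 25) l
      (if U.idx u + 1 ≤ cl l then cl l else S l (U.idx u - cl l))) ?_).mono (by cases b <;> decide)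
      fun s'' _ ⟨q1, q2⟩ => ⟨fun v hv => ?_, fun l' hl' => ?_⟩
    · have hltS : ∀ a ∉ [4, 25, 68, 69, 73, 74], ∀ i, s'.ints a i < N := fun a ha i => by
        rw [e a ha]; exact hlt a i
      have hlN : l < N := by nlinarith
      have l26 := hltS 26 (by decide) l; have l27 := hltS 27 (by decide) u
      have hadr : l * (U.n + 1) + U.n < (U.n + 1) * U.d := by
        calc l * (U.n + 1) + U.n < (U.n + 1) * (l + 1) := by rw [mul_comm (U.n + 1), Nat.succ_mul]; omega
          _ ≤ _ := Nat.mul_le_mul_left _ hld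
      unfold Program.labelStep; by_cases hc : U.idx u < cl l
      · rw [if_pos (show U.idx u ≤ cl l by omega)] at hLu
        have ho : outLabel U cl (s.ints 26) (s.ints 27) (s.ints 28) (s.ints 11) (s.ints 12) b u =
            if b then (if 1 ≤ s.ints 27 u then s.ints 27 u else s.ints 26 l) - 1 else
              s.ints 28 ((if 1 ≤ s.ints 27 u then s.ints 27 u else s.ints 26 l) - 1) := by
          simp [outLabel, ← hl, hc]
        rw [ho, ← e 26 (by decide), ← e 27 (by decide), ← e 28 (by decide), if_pos (show U.idx u + 1 ≤ cl l by omega)]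
        have h25 : Function.update (s'.ints 25) l (cl l) = s'.ints 25 := by rw [← hLu, Function.update_eq_self]
        rw [h25]; have l28 := hltS 28 (by decide)
        cases b <;> simp [wp, h74, e1, e52, hLu, Store.ints_setInt_self, show U.idx u + 1 ≤ cl l by omega]
        all_goals
          refine ⟨by omega, by omega, fun h1 => ?_, fun h1 => ?_⟩
          · simp only [h1, if_true]; grind
          · simp only [h1, if_false, show ¬ 1 ≤ 0 by omega]; grind
      · set p := s'.ints 25 l with hp
        obtain ⟨k, hk⟩ : ∃ k, U.idx u = cl l + k := ⟨U.idx u - cl l, by omega⟩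
        have e11 := e 11 (by decide)
        have hstep : (if s.ints 11 (l * (U.n + 1) + p) ≤ U.idx u then U.idx u else p) = S l k ∧ p ≤ U.idx u := by
          have hst := fun k hk => LineCell.start (U := U) (V := V) (k := k) hr
            (h.line l hld).1 (h.line l hld).2 (hcell l hld) hk
          rcases Nat.eq_zero_or_pos k with rfl | hk0
          · rw [if_pos (by omega)] at hLu; have := (hst 0 (by omega)).2.2.1
            rw [hLu, if_neg (by grind)]; grind
          · obtain ⟨j, rfl⟩ : ∃ j, k = j + 1 := ⟨k - 1, by omega⟩
            rw [if_neg (by omega), show U.idx u - 1 - cl l = j by omega] at hLu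
            have : S l j ≤ cl l + j := by grind
            rw [hLu, hk]; exact ⟨rfl, by omega⟩
        have ho : outLabel U cl (s.ints 26) (s.ints 27) (s.ints 28) (s.ints 11) (s.ints 12) b u =
            if b then U.n + (l * (U.n + 1) + S l k) else s.ints 12 (l * (U.n + 1) + S l k) := by
          simp [outLabel, ← hl, hk, hS]
        rw [ho, if_neg (show ¬ U.idx u + 1 ≤ cl l by omega), show U.idx u - cl l = k by omega]
        have l12 := hltS 12 (by decide); have e12 := e 12 (by decide); rw [← e12]
        obtain ⟨hst, hpi⟩ := hstep; have hSn : S l k ≤ U.n := by rw [← hst]; split_ifs <;> omega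
        have hS2 : s.ints 11 (l * (U.n + 1) + p) ≤ U.idx u → S l k = U.idx u := fun h1 => by
          rw [if_pos h1] at hst; exact hst.symm
        have hS3 : ¬ s.ints 11 (l * (U.n + 1) + p) ≤ U.idx u → S l k = p := fun h1 => by
          rw [if_neg h1] at hst; exact hst.symm
        cases b <;> simp [wp, h74, e1, e52, e0, ← hp, e11, Store.ints_setInt_self, show ¬ U.idx u + 1 ≤ p by omega]
        all_goals
          refine ⟨by omega, by omega, by omega, fun h1 => ?_, fun h1 => ?_⟩
          · rw [hS2 h1]; grind
          · rw [hS3 (by omega)]; grind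
    · rw [Store.ints_setInt_ne _ _ _ (by decide), q1]; by_cases h : v = u
      · rw [h, Function.update_self]
      · rw [Function.update_of_ne h]; exact hI v (by omega)
    · rw [Store.ints_setInt_ne _ _ _ (by decide), q2, U.count_succ]; by_cases h : l' = l
      · subst h; rw [Function.update_self, if_pos hl.symm, hidx, Nat.add_sub_cancel]
      · rw [Function.update_of_ne h, if_neg (show ¬ U.leg u = l' from fun h' => h h'.symm)]
        exact hL l' hl'

end

/-! ### Costs of clusters in the two problems -/

section
variable {N : ℕ} {U : Users} {K : ℕ}

/-! ### The table of costs of central clusters -/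

def Program.multiTable (body : Program) : Program := .forUp 60 (iv 56) (.forUp 61 (iv 56) body)

def MultiCell (G : ℕ) (mv : ℕ → ℕ → ℝ) (Lab : ℕ → ℕ → ℕ → Prop) (w z : ℕ) (s : Store) : Prop :=
  s.ext 21 (w * G + z) = (mv w z : ℝ) ∧ Lab w z (s.ints 13 (w * G + z))

theorem multiTable_spec {body : Program} {s : Store} {G T : ℕ} {mv : ℕ → ℕ → ℝ}
    {Lab : ℕ → ℕ → ℕ → Prop} (hG : G < N) (h56 : s.ints 56 0 = G)
    (him : ∀ a ∈ [56, 60, 61], a ∉ body.im)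
    (hbody : ∀ s', Frame (.multiTable body) s s' → ∀ w < G, ∀ z < G, s'.ints 60 0 = w →
      s'.ints 61 0 = z → Tr N body s' T fun s'' => MultiCell G mv Lab w z s'' ∧
        ∀ x ≠ w * G + z, s''.ext 21 x = s'.ext 21 x ∧ s''.ints 13 x = s'.ints 13 x) :
    Tr N (.multiTable body) s ((G + 1) * ((G + 1) * (T + 22) + 22)) fun s' =>
      ∀ w < G, ∀ z < G, MultiCell G mv Lab w z s' := by
  have him' : ∀ a ∈ [56, 60], a ∉ (Program.forUp 61 (iv 56) body).im := by
    intro a ha h; rcases List.mem_append.1 h with h | h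
    · revert ha h; simp [Program.im]; omega
    · rcases List.mem_append.1 h with h | h
      · exact him a (by grind) h
      · revert ha h; simp [Program.im]; omega
  have h56' : 56 ∉ (Program.multiTable body).im := by
    intro h; rcases List.mem_append.1 h with h | h
    · revert h; simp [Program.im]
    · rcases List.mem_append.1 h with h | h
      · grind
      · revert h; simp [Program.im]
  refine (Tr.forUp (m := G) ((G + 1) * (T + 22)) (fun w s' => ∀ w' < w, ∀ z < G, MultiCell G mv Lab w' z s') hG
    (him' 60 (by simp)) (fun w hw => by omega) (fun k _ s' f _ _ => by
      rw [IExp.val_iv, f.1 56 h56', h56]) fun w hw s' f h60 hI => ?_).mono le_rfl fun s' _ hQ => hQ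
  refine (Tr.forUp (m := G) T (fun z s' => (∀ w' < w, ∀ z < G, MultiCell G mv Lab w' z s') ∧
    ∀ z' < z, MultiCell G mv Lab w z' s') hG (him 61 (by simp)) ⟨fun w' hw' z hz => ?_, fun z hz => by omega⟩
    (fun k _ s'' f' _ _ => by rw [IExp.val_iv, f'.1 56 (him' 56 (by simp)), f.1 56 h56', h56])
    fun z hz s'' f' h61 hI => ?_).mono (Nat.mul_le_mul_left _ (Nat.le_of_eq rfl)) fun s'' _ hQ w' hw' z hz => ?_
  · have := hI w' hw' z hz; simpa [MultiCell] using this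
  · have f'' : Frame (.multiTable body) s' s'' := f'.weaken
      (fun a ha => List.mem_append_right _ (List.mem_append_left _ ha))
      (fun a ha => List.mem_append_right _ (List.mem_append_left _ ha))
    refine (hbody s'' (f.trans f'') w hw z hz (by rw [f'.1 60 (him' 60 (by simp)), h60]) h61).mono le_rfl
      fun s₃ _ ⟨q1, q2⟩ => ⟨fun w' hw' z' hz' => ?_, fun z' hz' => ?_⟩
    · have h1 := hI.1 w' hw' z' hz'
      have h2 := q2 (w' * G + z') fun e => by have := (pair_inj hz' hz).1 e; omega
      simpa [MultiCell, h2.1, h2.2] using h1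
    · rcases Nat.lt_succ_iff_lt_or_eq.1 hz' with h | rfl
      · have h1 := hI.2 z' h; have h2 := q2 (w * G + z') (by omega)
        simpa [MultiCell, h2.1, h2.2] using h1
      · simpa [MultiCell] using q1
  · rcases Nat.lt_succ_iff_lt_or_eq.1 hw' with h | rfl
    · simpa [MultiCell] using hQ.1 w' h z hz
    · simpa [MultiCell] using hQ.2 z hz

/-! ### Costs for clustering -/

/-- The positions of the users on leg `l` are in memory, and `l` is the current leg. -/
structure LegIn (U : Users) (l : ℕ) (s : Store) : Prop where
  leg : s.ints 31 0 = l
  base : s.ints 32 0 = l * (U.n + 1)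
  pos : ∀ i < U.cnt l, s.reals 58 (l * (U.n + 1) + i) = U.pos (U.usr l i)

theorem LegIn.congr {l : ℕ} {s s' : Store} (h : LegIn U l s) (h1 : s'.ints 31 = s.ints 31)
    (h2 : s'.ints 32 = s.ints 32) (h3 : s'.reals 58 = s.reals 58) : LegIn U l s' :=
  ⟨by rw [h1]; exact h.leg, by rw [h2]; exact h.base, by rw [h3]; exact h.pos⟩

theorem Users.pos_usr_mono {l i j : ℕ} (hij : i ≤ j) (hj : j < U.cnt l) :
    U.pos (U.usr l i) ≤ U.pos (U.usr l j) := by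
  have h1 := U.usr_spec (l := l) (i := i) (by omega); have h2 := U.usr_spec hj
  exact U.mono ((U.idx_le_idx (h1.2.1.trans h2.2.1.symm)).1 (by omega))

def Program.clusterPhi : Program :=
  .setReal 42 0 (.read 58 (iv 32 + (iv 43 - 1)) - .read 58 (iv 32 + iv 39)) ;; .setInt 44 0 0

noncomputable def diamCost (U : Users) (l i j : ℕ) : ℝ := U.pos (U.usr l (j - 1)) - U.pos (U.usr l i)

theorem clusterPhi_spec {l : ℕ} (hN : 0 < N) : LinePhi N 30 .clusterPhi (LegIn U l) (U.cnt l)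
    (diamCost U l) (fun _ _ _ => True) (fun _ _ _ => True) where
  spec s hs i j e h39 h43 h42 hij hj _ := by
    have h1 := hs.pos i (by omega); have h2 := hs.pos (j - 1) (by omega)
    refine Tm.mono (Tr.of_wp (Q := fun s' => s'.reals 42 0 = diamCost U l i j ∧ s'.ints 44 0 < N) ?_)
      fun s' t f ⟨ht, q1, q2⟩ => ⟨q1, trivial, q2, trivial, fun e' _ => by rw [f.int 36], ?_⟩
    · simp [wp, Program.clusterPhi, h39, h43, hs.base, h1, h2, diamCost, hN]
    · have : Program.clusterPhi.cst ≤ 30 := by decide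
      rw [f.int 36]; omega
  im := by decide
  rm := by decide
  stable s s' h hi hr := h.congr (hi _ (by decide)) (hi _ (by decide)) (hr _ (by decide))
  anti _ _ _ _ _ _ _ _ := trivial
  mono i i' j j' hi hj hij hj' := sub_le_sub (U.pos_usr_mono (by omega) (by omega))
    (U.pos_usr_mono hi (by omega))

def Program.clusterMulti : Program :=
  .setInt 62 0 (.read 54 (iv 60)) ;; .setInt 63 0 (.read 54 (iv 61)) ;;
  .setInt 64 0 (iv 60 * iv 56 + iv 61) ;; .setInt 21 (iv 64) 1 ;;
  .ite (.realLe (.read 0 (iv 62)) (.read 0 (iv 63)))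
    (.setReal 21 (iv 64) (.read 0 (iv 63) + .read 0 (iv 63)))
    (.setReal 21 (iv 64) (.read 0 (iv 62) + .read 0 (iv 63)))

theorem clusterMulti_spec {s : Store} {w z : ℕ} (hN : 1 < N) (hnN : U.n < N)
    (hGN : U.size K U.n * U.size K U.n < N) (h56 : s.ints 56 0 = U.size K U.n)
    (h54 : ∀ g < U.size K U.n, s.ints 54 g = U.tl K g) (hpos : ∀ u < U.n, s.reals 0 u = U.pos u)
    (hw : w < U.size K U.n) (hz : z < U.size K U.n) (h60 : s.ints 60 0 = w) (h61 : s.ints 61 0 = z) :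
    wp N .clusterMulti (fun s' => MultiCell (U.size K U.n)
      (fun w z => max (U.pos (U.tl K w)) (U.pos (U.tl K z)) + U.pos (U.tl K z)) (fun _ _ _ => True) w z s' ∧
      ∀ x ≠ w * U.size K U.n + z, s'.ext 21 x = s.ext 21 x ∧ s'.ints 13 x = s.ints 13 x) s := by
  obtain ⟨hu, -, -⟩ := U.tl_spec hw; obtain ⟨hv, -, -⟩ := U.tl_spec hz
  have hadr : w * U.size K U.n + z < U.size K U.n * U.size K U.n := by
    calc w * U.size K U.n + z < (w + 1) * U.size K U.n := by rw [Nat.succ_mul]; omega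
      _ ≤ _ := Nat.mul_le_mul_right _ hw
  simp [Program.clusterMulti, wp, h60, h61, h56, h54 w hw, h54 z hz, hpos _ hu, hpos _ hv, hN, MultiCell, Store.ext]
  refine ⟨by omega, by omega, by omega, fun h => ?_, fun h => ?_⟩
  · grind
  · grind

end

section
variable {N : ℕ} {U : Users} {K : ℕ}

/-! ### The best facility for two extreme users -/

/-- The least radius of a cluster that has, as seen on leg `l`, its extreme users at `x` and `X`, and
that costs `Z` if it is served by the facility next to the center. -/
noncomputable def facCost (F : Users) (l : ℕ) (x X Z : ℝ) : ℝ :=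
  -- The extra index `F.cnt l` stands for the facility next to the center, and keeps the range
  -- nonempty if the leg has no facility.
  (Finset.range (F.cnt l + 1)).inf' ⟨0, by simp⟩ fun p =>
    if p < F.cnt l then max (X - F.pos (F.usr l p)) (F.pos (F.usr l p) - x) else Z

def FacLab (F : Users) (l : ℕ) (x X Z : ℝ) (k : ℕ) : Prop :=
  k < F.n ∧ ((F.leg k = l ∧ max (X - F.pos k) (F.pos k - x) ≤ facCost F l x X Z) ∨
    (k = 0 ∧ Z ≤ facCost F l x X Z))

variable {F : Users} {l : ℕ} {x X Z : ℝ}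

theorem le_facCost {v : ℝ} (hZ : v ≤ Z)
    (h : ∀ p < F.cnt l, v ≤ max (X - F.pos (F.usr l p)) (F.pos (F.usr l p) - x)) :
    v ≤ facCost F l x X Z := by
  refine Finset.le_inf' _ _ fun p _ => ?_
  split_ifs with hp
  exacts [h p hp, hZ]

theorem facCost_le_far : facCost F l x X Z ≤ Z :=
  (Finset.inf'_le _ (b := F.cnt l) (by simp)).trans (by simp)

theorem facCost_le {k : ℕ} (hk : k < F.n) (hl : F.leg k = l) :
    facCost F l x X Z ≤ max (X - F.pos k) (F.pos k - x) := by
  have h := F.idx_lt_cnt hk; rw [hl] at h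
  refine (Finset.inf'_le _ (b := F.idx k) (by simp; omega)).trans ?_; rw [if_pos h, ← hl, F.usr_idx]

theorem facCost_mono {x' X' Z' : ℝ} (h1 : x' ≤ x) (h2 : X ≤ X') (h3 : Z ≤ Z') :
    facCost F l x X Z ≤ facCost F l x' X' Z' := by
  refine Finset.inf'_mono_fun fun p _ => ?_
  split_ifs
  · grind
  · exact h3

/-- `max (X - y) (y - x)` is the distance of `y` from the midpoint of `x` and `X` plus a constant.
Among sorted facilities the minimum is therefore where the sum of neighbors passes `X + x`, a test
that needs only additions. -/
theorem le_max_of_near {p : ℕ} (hp : p < F.cnt l)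
    (h1 : 1 ≤ p → F.pos (F.usr l (p - 1)) + F.pos (F.usr l p) < X + x)
    (h2 : p + 1 < F.cnt l → X + x ≤ F.pos (F.usr l p) + F.pos (F.usr l (p + 1))) {q : ℕ}
    (hq : q < F.cnt l) : max (X - F.pos (F.usr l p)) (F.pos (F.usr l p) - x) ≤
      max (X - F.pos (F.usr l q)) (F.pos (F.usr l q) - x) := by
  rcases lt_trichotomy q p with h | rfl | h
  · have a1 := h1 (by omega)
    have a2 : (F.pos (F.usr l q) : ℝ) ≤ F.pos (F.usr l (p - 1)) := F.pos_usr_mono (by omega) (by omega)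
    have a3 : (F.pos (F.usr l q) : ℝ) ≤ F.pos (F.usr l p) := F.pos_usr_mono h.le hp; grind
  · exact le_rfl
  · have a1 := h2 (by omega)
    have a2 : (F.pos (F.usr l (p + 1)) : ℝ) ≤ F.pos (F.usr l q) := F.pos_usr_mono (by omega) (by omega)
    have a3 : (F.pos (F.usr l p) : ℝ) ≤ F.pos (F.usr l q) := F.pos_usr_mono h.le hq; grind

/-- The facilities, sorted by their legs, are in memory. -/
structure FacIn (F : Users) (s : Store) : Prop where
  num : s.ints 0 3 = F.n
  cnt : ∀ l < F.d, s.ints 51 l = F.cnt l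
  usr : ∀ l < F.d, ∀ p < F.cnt l, s.ints 59 (l * (F.n + 1) + p) = F.usr l p
  pos : ∀ l < F.d, ∀ p < F.cnt l, s.reals 59 (l * (F.n + 1) + p) = F.pos (F.usr l p)
  first : s.reals 1 0 = F.pos 0

theorem FacIn.congr {s s' : Store} (h : FacIn F s) (h0 : s'.ints 0 = s.ints 0)
    (h1 : s'.ints 51 = s.ints 51) (h2 : s'.ints 59 = s.ints 59) (h3 : s'.reals 59 = s.reals 59)
    (h4 : s'.reals 1 = s.reals 1) : FacIn F s' :=
  ⟨by rw [h0]; exact h.num, by rw [h1]; exact h.cnt, by rw [h2]; exact h.usr, by rw [h3]; exact h.pos,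
    by rw [h4]; exact h.first⟩

/-- Compare the cost of the facility with index `p` on the leg with the current cost. -/
def Program.useFacility : Program :=
  .setInt 46 1 (.read 47 0 + .read 47 1) ;; .setReal 44 1 (.read 59 (.read 46 1)) ;;
  .setReal 44 0 (.read 44 2 - .read 44 1) ;;
  .ite (.realLe (.read 44 0) (.read 44 1 - .read 44 3)) (.setReal 44 0 (.read 44 1 - .read 44 3)) .skip ;;
  .ite (.realLe (.read 44 0) (.read 42 0))
    (.setReal 42 0 (.read 44 0) ;; .setInt 44 0 (.read 59 (.read 46 1))) .skip

structure Search (F : Users) (l : ℕ) (x X Z : ℝ) (s : Store) : Prop where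
  fac : FacIn F s
  base : s.ints 47 0 = l * (F.n + 1)
  val : s.reals 42 0 = Z
  lab : s.ints 44 0 = 0
  far : s.reals 44 2 = X
  near : s.reals 44 3 = x

/-- The facility with index `p` on leg `l` is a nearest one to the middle of `x` and `X`. -/
def Nearest (F : Users) (l : ℕ) (x X : ℝ) (p : ℕ) : Prop :=
  p < F.cnt l ∧ (1 ≤ p → F.pos (F.usr l (p - 1)) + F.pos (F.usr l p) < X + x) ∧
    (p + 1 < F.cnt l → X + x ≤ F.pos (F.usr l p) + F.pos (F.usr l (p + 1)))

theorem useFacility_spec {s : Store} (h : Search F l x X Z s) (hl : l < F.d) (hnN : F.n < N)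
    (hdN : (F.n + 1) * F.d < N) (hp : Nearest F l x X (s.ints 47 1)) :
    wp N .useFacility (fun s' => s'.reals 42 0 = facCost F l x X Z ∧
      FacLab F l x X Z (s'.ints 44 0) ∧ s'.ints 44 0 < N ∧ s'.ints 47 = s.ints 47) s := by
  obtain ⟨hp, hp1, hp2⟩ := hp; have hu := F.usr_spec hp
  have hn : s.ints 47 1 ≤ F.n := hp.le.trans (F.cnt_le l)
  have hadr : l * (F.n + 1) + s.ints 47 1 < N := by
    have : l * (F.n + 1) + (F.n + 1) ≤ (F.n + 1) * F.d := by
      rw [← Nat.succ_mul, mul_comm]; exact Nat.mul_le_mul_left _ hl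
    omega
  have key : min Z (max (X - F.pos (F.usr l (s.ints 47 1))) (F.pos (F.usr l (s.ints 47 1)) - x)) ≤
      facCost F l x X Z := le_facCost (min_le_left _ _) fun q hq =>
    (min_le_right _ _).trans (le_max_of_near hp hp1 hp2 hq)
  have hle := facCost_le (x := x) (X := X) (Z := Z) hu.1 hu.2.1
  have hf : facCost F l x X Z ≤ Z := facCost_le_far; have hN : 0 < N := by omega
  have hn0 : 0 < F.n := by omega
  have fin : ∀ v, max (X - F.pos (F.usr l (s.ints 47 1))) (F.pos (F.usr l (s.ints 47 1)) - x) = v →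
      (v ≤ Z → v = facCost F l x X Z ∧ FacLab F l x X Z (F.usr l (s.ints 47 1)) ∧ F.usr l (s.ints 47 1) < N) ∧
      (¬ v ≤ Z → Z = facCost F l x X Z ∧ FacLab F l x X Z 0) := by
    rintro v rfl; refine ⟨fun h => ?_, fun h => ?_⟩
    · rw [min_eq_right h] at key; exact ⟨le_antisymm key hle, ⟨hu.1, .inl ⟨hu.2.1, key⟩⟩, by omega⟩
    · rw [min_eq_left (not_le.1 h).le] at key; exact ⟨le_antisymm key hf, hn0, .inr ⟨rfl, key⟩⟩
  simp [Program.useFacility, wp, h.base, h.far, h.near, h.val, h.lab, h.fac.pos l hl _ hp, h.fac.usr l hl _ hp, hN, hadr]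
  refine ⟨fun h => ⟨fun h' => ?_, fun h' => ?_⟩, fun h => ⟨fun h' => ?_, fun h' => ?_⟩⟩
  · have := (fin _ (max_eq_right (by linarith))).1 (by linarith); tauto
  · have := (fin _ (max_eq_right (by linarith))).2 (by linarith); tauto
  · have := (fin _ (max_eq_left (by linarith))).1 (by linarith); tauto
  · have := (fin _ (max_eq_left (by linarith))).2 (by linarith); tauto

def Program.serve (e : IExp) (p : Program) : Program :=
  .ite (.intLe 1 (.read 51 e)) (p ;; .useFacility) .skip

theorem serve_spec {s : Store} {e : IExp} {p : Program} {Q : Store → ℕ → Prop} (h : Search F l x X Z s)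
    (hn : 0 < F.n) (hl : l < F.d) (hnN : F.n < N) (hdN : (F.n + 1) * F.d < N) (he : e.val s = l)
    (h0 : F.cnt l = 0 → Q s 0)
    (hp : 0 < F.cnt l → Tm N p s fun s' t => Search F l x X Z s' ∧ Nearest F l x X (s'.ints 47 1) ∧ Q s' t)
    (hQ : ∀ s s' t, s'.ints 47 = s.ints 47 → s'.ints 36 = s.ints 36 → Q s t → Q s' t) :
    Tm N (.serve e p) s fun s' t => s'.reals 42 0 = facCost F l x X Z ∧
      FacLab F l x X Z (s'.ints 44 0) ∧ s'.ints 44 0 < N ∧ ∃ t', t ≤ t' + 60 + e.cost ∧ Q s' t' := by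
  by_cases hc : 0 < F.cnt l
  · obtain ⟨s₁, t₁, e1, h1, h2, h3⟩ := hp hc
    obtain ⟨s₂, t₂, e2, h4, h5⟩ := Tr.of_wp (useFacility_spec h1 hl hnN hdN h2)
    refine ⟨s₂, _, .iteTrue (by simp [he, h.fac.cnt l hl]; omega) (e1.seq e2), h5.1, h5.2.1, h5.2.2.1, t₁, ?_,
      hQ s₁ s₂ t₁ h5.2.2.2 (e2.frame.int 36) h3⟩
    have : Program.useFacility.cst ≤ 50 := by decide
    show 1 + (e.cost + 1) + 1 + _ ≤ _; omega
  · have hc : F.cnt l = 0 := by omega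
    have hZ : Z = facCost F l x X Z := le_antisymm (le_facCost le_rfl fun p hp => by omega) facCost_le_far
    refine ⟨s, _, .iteFalse (by simp [he, h.fac.cnt l hl, hc]) (.skip s), h.val.trans hZ,
      ⟨by rw [h.lab]; exact hn, .inr ⟨h.lab, hZ.le⟩⟩, by rw [h.lab]; omega, 0, ?_, h0 hc⟩
    show 1 + (e.cost + 1) + 1 + _ ≤ _; omega

end

section
variable {N : ℕ} {U : Users} {K : ℕ} {F : Users} {l : ℕ} {x X Z : ℝ}

/-! ### Costs for gathering, on a leg -/

def Program.walkStep : Program :=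
  .ite (.intLe 1 (.read 47 1))
    (.ite (.realLe (.read 44 2 + .read 44 3)
        (.read 59 (.read 47 0 + (.read 47 1 - 1)) + .read 59 (.read 47 0 + .read 47 1)))
      (.setInt 47 1 (.read 47 1 - 1)) (.setInt 46 0 0))
    (.setInt 46 0 0)

/-- The search moves towards the center only, so its length is paid by the fall of the pointer in
`47`. -/
def Program.walkDown : Program := .setInt 46 0 1 ;; .loop (.intLe 1 (iv 46)) .walkStep

theorem Search.congr {s s' : Store} (h : Search F l x X Z s) (h0 : s'.ints 0 = s.ints 0)
    (h1 : s'.ints 51 = s.ints 51) (h2 : s'.ints 59 = s.ints 59) (h3 : s'.reals = s.reals)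
    (h4 : s'.ints 47 0 = s.ints 47 0) (h5 : s'.ints 44 = s.ints 44) : Search F l x X Z s' :=
  ⟨h.fac.congr h0 h1 h2 (by rw [h3]) (by rw [h3]), h4.trans h.base, by rw [h3]; exact h.val,
    by rw [h5]; exact h.lab, by rw [h3]; exact h.far, by rw [h3]; exact h.near⟩

structure Walking (F : Users) (l : ℕ) (x X Z : ℝ) (p₀ : ℕ) (s : Store) : Prop where
  search : Search F l x X Z s
  lt : s.ints 47 1 < F.cnt l
  right : s.ints 47 1 + 1 < F.cnt l →
    X + x ≤ F.pos (F.usr l (s.ints 47 1)) + F.pos (F.usr l (s.ints 47 1 + 1))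
  flag : s.ints 46 0 ≤ 1
  left : s.ints 46 0 = 0 → 1 ≤ s.ints 47 1 →
    F.pos (F.usr l (s.ints 47 1 - 1)) + F.pos (F.usr l (s.ints 47 1)) < X + x
  le : s.ints 47 1 ≤ p₀

theorem walkStep_spec {s : Store} {p₀ : ℕ} (h : Walking F l x X Z p₀ s) (hl : l < F.d) (hN : 1 < N)
    (hnN : F.n < N) (h46 : s.ints 46 0 = 1) :
    wp N .walkStep (fun s' => Walking F l x X Z p₀ s' ∧
      50 * s'.ints 47 1 + 50 * s'.ints 46 0 + 50 ≤ 50 * s.ints 47 1 + 50 * s.ints 46 0) s := by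
  have c : ∀ v, Search F l x X Z (s.setInt 46 0 v) ∧ Search F l x X Z (s.setInt 47 1 v) := fun v =>
    ⟨h.search.congr (by simp) (by simp) (by simp) (by simp) (by simp) (by simp),
      h.search.congr (by simp) (by simp) (by simp) (by simp) (by simp) (by simp)⟩
  have hn := F.cnt_le l; have hlt := h.lt; have hle := h.le; by_cases hp1 : 1 ≤ s.ints 47 1
  · have e1 := h.search.fac.pos l hl (s.ints 47 1 - 1) (by omega)
    have e2 := h.search.fac.pos l hl (s.ints 47 1) h.lt
    simp only [Program.walkStep, wp, Test.holds_intLe, IExp.val_one, IExp.val_read, hp1, Test.holds_realLe,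
      RExp.val_add, RExp.val_read, IExp.val_two, IExp.val_three, IExp.val_add, IExp.val_sub, IExp.val_zero,
      h.search.base, h.search.far, h.search.near, e1, e2, not_true_eq_false, false_imp_iff, and_true,
      forall_const]
    refine ⟨fun h' => ⟨by omega, ⟨(c _).2, by simp; omega, fun _ => ?_, by simp; omega, by simp; omega,
      by simp; omega⟩, by simp; omega⟩, fun h' => ⟨by omega, ⟨(c _).1, by simpa using hlt, by simpa using h.right,
      by simp, fun _ _ => by simpa using h', by simpa using hle⟩, by simp; omega⟩⟩
    simpa [Nat.sub_add_cancel hp1] using h'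
  · simp only [Program.walkStep, wp, Test.holds_intLe, IExp.val_one, IExp.val_read, hp1, false_imp_iff,
      not_false_eq_true, true_and, forall_const, IExp.val_zero]
    exact ⟨by omega, ⟨(c _).1, by simpa using hlt, by simpa using h.right, by simp, by simp; omega, by simpa using hle⟩,
      by simp; omega⟩

theorem walkDown_spec {s : Store} (h : Search F l x X Z s) (hl : l < F.d) (hN : 1 < N) (hnN : F.n < N)
    (hp : s.ints 47 1 < F.cnt l)
    (h2 : s.ints 47 1 + 1 < F.cnt l →
      X + x ≤ F.pos (F.usr l (s.ints 47 1)) + F.pos (F.usr l (s.ints 47 1 + 1))) :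
    Tm N .walkDown s fun s' t => Search F l x X Z s' ∧ Nearest F l x X (s'.ints 47 1) ∧
      s'.ints 47 1 ≤ s.ints 47 1 ∧ t + 50 * s'.ints 47 1 ≤ 100 + 50 * s.ints 47 1 := by
  refine Tm.seq (Tm.mono (Tr.of_wp (Q := fun s' => Walking F l x X Z (s.ints 47 1) s' ∧ s'.ints 46 0 = 1 ∧
    s'.ints 47 1 = s.ints 47 1) ?_)
    fun s₁ t₁ _ ⟨ht, q1, q2, q4⟩ => Tm.mono (Tm.loop (Walking F l x X Z (s.ints 47 1))
      (fun s' => 50 * s'.ints 47 1 + 50 * s'.ints 46 0) q1 fun s' f i hb => Tm.mono (Tr.of_wp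
        (walkStep_spec i hl hN hnN (by have := i.flag; simp at hb; omega))) fun s'' t _ ⟨ht, r1, r2⟩ => ⟨r1, ?_⟩)
      fun s' t _ ⟨r1, r2, r3⟩ => ⟨r1.search, ⟨r1.lt, r1.left (by simp at r2; omega), r1.right⟩, r1.le, ?_⟩)
  · exact ⟨by simpa using hN, ⟨h.congr (by simp) (by simp) (by simp) (by simp) (by simp) (by simp),
      by simpa using hp, by simpa using h2, by simp, by simp, by simp⟩, by simp, by simp⟩
  · have h1 : Program.walkStep.cst ≤ 45 := by decide
    have h2 : (Test.intLe 1 (iv 46)).cost ≤ 5 := by decide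
    omega
  · have h1 : (Program.setInt 46 0 1).cst ≤ 5 := by decide
    have h2 : (Test.intLe 1 (iv 46)).cost ≤ 5 := by decide
    omega

/-- Facility `0`, the one next to the center, serves the interval at cost at most the distance of
its outermost user plus its own distance from the center. -/
noncomputable def legCost (U F : Users) (l i j : ℕ) : ℝ :=
  facCost F l (U.pos (U.usr l i)) (U.pos (U.usr l (j - 1))) (U.pos (U.usr l (j - 1)) + F.pos 0)

def LegLab (U F : Users) (l i j : ℕ) : ℕ → Prop :=
  FacLab F l (U.pos (U.usr l i)) (U.pos (U.usr l (j - 1))) (U.pos (U.usr l (j - 1)) + F.pos 0)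

/-- All facilities that are right of `p` on leg `l` are too far for the clusters up to `i, j`. -/
def FacPtr (U F : Users) (l p i j : ℕ) : Prop :=
  p ≤ F.cnt l - 1 ∧ ∀ i' ≤ i, ∀ j' ≤ j, i' < j' → j' ≤ U.cnt l → p + 1 < F.cnt l →
    U.pos (U.usr l (j' - 1)) + U.pos (U.usr l i') ≤ F.pos (F.usr l p) + F.pos (F.usr l (p + 1))

def Program.gatherInit : Program :=
  .setReal 44 2 (.read 58 (iv 32 + (iv 43 - 1))) ;; .setReal 44 3 (.read 58 (iv 32 + iv 39)) ;;
  .setReal 42 0 (.read 44 2 + .read 1 0) ;; .setInt 44 0 0 ;;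
  .setInt 47 0 (iv 31 * (.read 0 3 + 1)) ;; .setInt 47 1 (.read 36 (iv 42))

def Program.gatherPhi : Program :=
  .gatherInit ;; .serve (iv 31) .walkDown ;; .setInt 36 (iv 42) (.read 47 1)

theorem gatherPhi_spec (hl : l < F.d) (hn : 0 < F.n) (hN : 1 < N) (hnN : F.n < N)
    (hdN : (F.n + 1) * F.d < N) : LinePhi N 300 .gatherPhi (fun s => LegIn U l s ∧ FacIn F s) (U.cnt l)
    (legCost U F l) (LegLab U F l) (FacPtr U F l) where
  spec s hs i j e h39 h43 h42 hij hj hpt := by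
    have h1 := hs.1.pos i (by omega); have h2 := hs.1.pos (j - 1) (by omega); have hc := F.cnt_le l
    have hadr : l * (F.n + 1) < N := by
      have : l * (F.n + 1) ≤ (F.n + 1) * F.d := by rw [mul_comm]; exact Nat.mul_le_mul_left _ hl.le
      omega
    have hp0 := hpt.1
    refine Tm.seq (Tm.mono (Tr.of_wp (Q := fun s' => Search F l (U.pos (U.usr l i)) (U.pos (U.usr l (j - 1)))
        (U.pos (U.usr l (j - 1)) + F.pos 0) s' ∧ s'.ints 47 1 = s.ints 36 e) ?_)
      fun s₁ t₁ f₁ ⟨ht₁, q1, q2⟩ => Tm.seq (Tm.mono (serve_spec (Q := fun s' t => FacPtr U F l (s'.ints 47 1) i j ∧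
        s'.ints 36 = s.ints 36 ∧ s'.ints 47 1 ≤ s.ints 36 e ∧ t + 50 * s'.ints 47 1 ≤ 100 + 50 * s.ints 36 e) q1 hn hl hnN hdN ?_ ?_ ?_ ?_)
        fun s₂ t₂ f₂ ⟨r1, r2, r3, t', ht', r4, r5, r7, r6⟩ =>
          Tm.mono (Tr.of_wp (Q := fun s' => s'.ints 36 = fun e' => if e' = e then s₂.ints 47 1 else s.ints 36 e') ?_)
        fun s₃ t₃ f₃ ⟨ht₃, r8⟩ => ?_))
    · simp [wp, Program.gatherInit, h39, h43, hs.1.base, hs.1.leg, h1, h2, h42, hs.2.num, hs.2.first, hadr]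
      exact ⟨by omega, by omega, hs.2.congr (by simp) (by simp) (by simp) (by simp) (by simp), by simp, by simp, by simp, by simp, by simp⟩
    · rw [IExp.val_iv, f₁.int 31, hs.1.leg]
    · intro h; rw [q2, f₁.int 36]; grind
    · intro h
      refine Tm.mono (walkDown_spec q1 hl hN hnN (by omega) fun h => ?_)
        fun s' t f ⟨r1, r2, r3, r4⟩ => ⟨r1, r2, ⟨by omega, fun i' hi' j' hj' hij' hj'' hp => ?_⟩, ?_, by omega, by omega⟩
      · rw [q2] at h ⊢; exact hpt.2 i le_rfl j le_rfl hij hj h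
      · refine le_trans (add_le_add (U.pos_usr_mono ?_ ?_) (U.pos_usr_mono hi' ?_)) (r2.2.2 hp) <;> omega
      · rw [f.int 36, f₁.int 36]
    · rintro s s' t e1 e2 r; rwa [e1, e2]
    · have : s₂.ints 42 0 = e := by rw [f₂.int 42, f₁.int 42, h42]
      refine ⟨?_, ?_⟩
      · have := r4.1; simp; omega
      · funext e'; simp [this, r5]
    · refine ⟨by rw [f₃.real 42]; exact r1, by rw [f₃.int 44]; exact r2,
        by rw [f₃.int 44]; exact r3, ?_, fun e' h => by rw [r8]; simp [h], ?_⟩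
      · rw [r8]; simpa using r4
      · have h1 : (iv 31).cost ≤ 5 := by decide
        have h2 : Program.gatherInit.cst ≤ 60 := by decide
        have h3 : (Program.setInt 36 (iv 42) (.read 47 1)).cst ≤ 10 := by decide
        have h4 : s₃.ints 36 e = s₂.ints 47 1 := by rw [r8]; simp
        omega
  im := by decide
  rm := by decide
  stable s s' h hi hr := ⟨h.1.congr (hi _ (by decide)) (hi _ (by decide)) (hr _ (by decide)),
    h.2.congr (hi _ (by decide)) (hi _ (by decide)) (hi _ (by decide)) (hr _ (by decide)) (hr _ (by decide))⟩
  anti p i i' j j' hi hj h := ⟨h.1, fun i₁ h1 j₁ h2 => h.2 i₁ (h1.trans hi) j₁ (h2.trans hj)⟩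
  mono i i' j j' hi hj hij hj' := facCost_mono (U.pos_usr_mono hi (by omega))
    (U.pos_usr_mono (by omega) (by omega))
    (add_le_add (U.pos_usr_mono (by omega) (by omega)) le_rfl)

end

section
variable {N : ℕ} {U : Users} {K : ℕ} {F : Users} {l : ℕ} {x X Z : ℝ}

/-! ### Costs for gathering, of central clusters -/

def Program.bisectStep : Program := .setInt 47 3 ((.read 47 1 + .read 47 2) / 2) ;;
  .ite (.realLe (.read 44 2 + .read 44 3)
      (.read 59 (.read 47 0 + .read 47 3) + .read 59 (.read 47 0 + (.read 47 3 + 1))))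
    (.setInt 47 2 (.read 47 3)) (.setInt 47 1 (.read 47 3 + 1))

/-- A nearest facility has its index between the two bounds kept in cells `1` and `2` of array `47`.
-/
def Program.bisect : Program := .setInt 47 1 0 ;; .setInt 47 2 (.read 51 (.read 1 (iv 62)) - 1) ;;
  .loop (.intLe (.read 47 1 + 1) (.read 47 2)) .bisectStep

structure Bisecting (F : Users) (l : ℕ) (x X Z : ℝ) (s : Store) : Prop where
  search : Search F l x X Z s
  le : s.ints 47 1 ≤ s.ints 47 2
  lt : s.ints 47 2 < F.cnt l
  right : s.ints 47 2 + 1 < F.cnt l →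
    X + x ≤ F.pos (F.usr l (s.ints 47 2)) + F.pos (F.usr l (s.ints 47 2 + 1))
  left : 1 ≤ s.ints 47 1 → F.pos (F.usr l (s.ints 47 1 - 1)) + F.pos (F.usr l (s.ints 47 1)) < X + x

theorem bisectStep_spec {s : Store} (h : Bisecting F l x X Z s) (hl : l < F.d) (hN : 2 * F.n + 1 < N)
    (hlt : s.ints 47 1 < s.ints 47 2) :
    wp N .bisectStep (fun s' => Bisecting F l x X Z s' ∧
      s'.ints 47 2 - s'.ints 47 1 ≤ (s.ints 47 2 - s.ints 47 1) / 2) s := by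
  have hn := F.cnt_le l; have h2 := h.lt
  have e1 := h.search.fac.pos l hl ((s.ints 47 1 + s.ints 47 2) / 2) (by omega)
  have e2 := h.search.fac.pos l hl ((s.ints 47 1 + s.ints 47 2) / 2 + 1) (by omega)
  have c : ∀ v a w, Search F l x X Z ((s.setInt 47 3 v).setInt 47 (a + 1) w) := fun v a w =>
    h.search.congr (by simp) (by simp) (by simp) (by simp) (by simp) (by simp)
  simp [Program.bisectStep, wp, h.search.base, h.search.far, h.search.near, e1, e2]
  refine ⟨by omega, fun h' => ⟨by omega, ⟨c _ 1 _, by simp; omega, by simp; omega, fun _ => by simpa using h',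
    by simpa using h.left⟩, by omega⟩, fun h' => ⟨by omega, ⟨c _ 0 _, by simp; omega, by simpa using h2,
      by simpa using h.right, fun _ => by simpa using h'⟩, by omega⟩⟩

theorem bisect_spec {s : Store} (h : Search F l x X Z s) (hl : l < F.d) (hN : 2 * F.n + 1 < N)
    (hc : 0 < F.cnt l) (h62 : s.ints 1 (s.ints 62 0) = l) :
    Tm N .bisect s fun s' t => Search F l x X Z s' ∧ Nearest F l x X (s'.ints 47 1) ∧
      t ≤ 100 * (Nat.log 2 F.n + 2) := by
  have hn := F.cnt_le l; have h51 := h.fac.cnt l hl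
  refine Tm.seq (Tm.mono (Tr.of_wp (Q := fun s' => s' = s.setInt 47 1 0) ?_) fun s₁ t₁ _ ⟨ht₁, q₁⟩ =>
    Tm.seq (Tm.mono (Tr.of_wp (Q := fun s' => Bisecting F l x X Z s' ∧ s'.ints 47 1 = 0 ∧ s'.ints 47 2 = F.cnt l - 1) ?_)
    fun s₂ t₂ _ ⟨ht₂, q2, q3, q4⟩ => Tm.mono (Tm.loop (Bisecting F l x X Z)
      -- The factor `2` makes the logarithm drop also when the length of the range falls from `1` to
      -- `0`.
      (fun s' => 50 * (Nat.log 2 (2 * (s'.ints 47 2 - s'.ints 47 1)))) q2 fun s' f i hb => Tm.mono (Tr.of_wp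
        (bisectStep_spec i hl hN (by simp at hb; omega))) fun s'' t _ ⟨ht, r1, r2⟩ => ⟨r1, ?_⟩)
      fun s' t _ ⟨r1, r2, r3⟩ => ?_))
  · simp [wp]; omega
  · subst q₁
    refine ⟨by simp [h62, h51]; omega, ⟨h.congr (by simp) (by simp) (by simp) (by simp) (by simp) (by simp),
      by simp, by simp [h62, h51]; omega, by simp [h62, h51]; omega, by simp⟩, by simp, by simp [h62, h51]⟩
  · have h1 : Program.bisectStep.cst ≤ 40 := by decide
    have h2 : (Test.intLe (.read 47 1 + 1) (.read 47 2)).cost ≤ 10 := by decide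
    have h3 : s'.ints 47 1 < s'.ints 47 2 := by simp at hb; omega
    have h4 : Nat.log 2 (2 * (s''.ints 47 2 - s''.ints 47 1)) + 1 ≤
        Nat.log 2 (2 * (s'.ints 47 2 - s'.ints 47 1)) := by
      rw [mul_comm 2 (s'.ints 47 2 - s'.ints 47 1), Nat.log_mul_base one_lt_two (by omega)]
      exact Nat.succ_le_succ (Nat.log_mono_right (by omega))
    omega
  · have e : s'.ints 47 1 = s'.ints 47 2 := by have := r1.le; simp at r2; omega
    refine ⟨r1.search, ⟨by rw [e]; exact r1.lt, r1.left, by rw [e]; exact r1.right⟩, ?_⟩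
    have h0 : (Program.setInt 47 1 0).cst ≤ 10 := by decide
    have h1 : (Program.setInt 47 2 (.read 51 (.read 1 (iv 62)) - 1)).cst ≤ 20 := by decide
    have h2 : (Test.intLe (.read 47 1 + 1) (.read 47 2)).cost ≤ 10 := by decide
    have h3 : Nat.log 2 (2 * (s₂.ints 47 2 - s₂.ints 47 1)) ≤ Nat.log 2 F.n + 1 := by
      rw [← Nat.log_mul_base one_lt_two (by omega)]; exact Nat.log_mono_right (by omega)
    omega

noncomputable def multiFar (U F : Users) (K w z : ℕ) : ℝ :=
  max (U.pos (U.tl K w)) (U.pos (U.tl K z)) + F.pos 0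

/-- Seen from the leg of `w`, the users of other legs sit on the negative half-line, the extreme one
at `-pos z`. -/
noncomputable def multiCost (U F : Users) (K w z : ℕ) : ℝ :=
  facCost F (U.leg (U.tl K w)) (-U.pos (U.tl K z)) (U.pos (U.tl K w)) (multiFar U F K w z)

def MultiLab (U F : Users) (K w z : ℕ) : ℕ → Prop :=
  FacLab F (U.leg (U.tl K w)) (-U.pos (U.tl K z)) (U.pos (U.tl K w)) (multiFar U F K w z)

def Program.multiInit : Program :=
  .setInt 62 0 (.read 54 (iv 60)) ;; .setInt 63 0 (.read 54 (iv 61)) ;;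
  .setInt 64 0 (iv 60 * iv 56 + iv 61) ;; .setInt 44 0 0 ;;
  .setInt 47 0 (.read 1 (iv 62) * (.read 0 3 + 1)) ;;
  .setReal 44 2 (.read 0 (iv 62)) ;; .setReal 44 3 (.zero - .read 0 (iv 63)) ;;
  .ite (.realLe (.read 0 (iv 62)) (.read 0 (iv 63))) (.setReal 42 0 (.read 0 (iv 63) + .read 1 0))
    (.setReal 42 0 (.read 0 (iv 62) + .read 1 0))

def Program.gatherMulti : Program := .multiInit ;; .serve (.read 1 (iv 62)) .bisect ;;
  .setInt 13 (iv 64) (iv 44) ;; .setInt 21 (iv 64) 1 ;; .setReal 21 (iv 64) (.read 42 0)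

theorem gatherMulti_spec {s : Store} {w z : ℕ} (hN : 2 * F.n + 1 < N) (hn : 0 < F.n) (hnN : U.n < N)
    (hdN : (F.n + 1) * F.d < N) (hd : F.d = U.d)
    (hGN : U.size K U.n * U.size K U.n < N) (h56 : s.ints 56 0 = U.size K U.n)
    (h54 : ∀ g < U.size K U.n, s.ints 54 g = U.tl K g) (hpos : ∀ u < U.n, s.reals 0 u = U.pos u)
    (hleg : ∀ u < U.n, s.ints 1 u = U.leg u) (hfac : FacIn F s)
    (hw : w < U.size K U.n) (hz : z < U.size K U.n) (h60 : s.ints 60 0 = w) (h61 : s.ints 61 0 = z) :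
    Tr N .gatherMulti s (100 * (Nat.log 2 F.n + 6)) fun s' =>
      MultiCell (U.size K U.n) (multiCost U F K) (MultiLab U F K) w z s' ∧
      ∀ x ≠ w * U.size K U.n + z, s'.ext 21 x = s.ext 21 x ∧ s'.ints 13 x = s.ints 13 x := by
  obtain ⟨hu, -, -⟩ := U.tl_spec hw; obtain ⟨hv, -, -⟩ := U.tl_spec hz
  have hl : U.leg (U.tl K w) < F.d := hd ▸ U.leg_lt _ hu
  have hadr : w * U.size K U.n + z < U.size K U.n * U.size K U.n := by
    calc w * U.size K U.n + z < (w + 1) * U.size K U.n := by rw [Nat.succ_mul]; omega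
      _ ≤ _ := Nat.mul_le_mul_right _ hw
  have hbase : U.leg (U.tl K w) * (F.n + 1) < N := by
    have : U.leg (U.tl K w) * (F.n + 1) ≤ (F.n + 1) * F.d := by
      rw [mul_comm]; exact Nat.mul_le_mul_left _ hl.le
    omega
  refine Tm.seq (Tm.mono (Tr.of_wp (Q := fun s' => Search F (U.leg (U.tl K w)) (-U.pos (U.tl K z))
      (U.pos (U.tl K w)) (multiFar U F K w z) s' ∧ s'.ints 62 0 = U.tl K w ∧
      s'.ints 64 0 = w * U.size K U.n + z) ?_)
    fun s₁ t₁ f₁ ⟨ht₁, q1, q2, q3⟩ => Tm.seq (Tm.mono (serve_spec (Q := fun s' t => t ≤ 100 * (Nat.log 2 F.n + 2))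
      q1 hn hl (by omega) hdN ?_ (fun _ => by omega)
      (fun h => Tm.mono (bisect_spec q1 hl hN h ?_) fun s' t f r => r) fun _ _ _ _ _ h => h)
      fun s₂ t₂ f₂ ⟨r1, r2, r3, t', ht', r4⟩ =>
        Tm.mono (Tr.of_wp (Q := fun s' => s'.ints 13 = (s₂.setInt 13 (w * U.size K U.n + z) (s₂.ints 44 0)).ints 13 ∧
          ∀ x, s'.ext 21 x = (s₂.setExt 21 (w * U.size K U.n + z) (s₂.reals 42 0)).ext 21 x) ?_)
      fun s₃ t₃ f₃ ⟨ht₃, r5, r6⟩ => ?_))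
  · have hf : ∀ s', s'.ints 0 = s.ints 0 → s'.ints 51 = s.ints 51 → s'.ints 59 = s.ints 59 →
        s'.reals 59 = s.reals 59 → s'.reals 1 = s.reals 1 → FacIn F s' := fun s' => hfac.congr
    simp [Program.multiInit, wp, h60, h61, h56, h54 w hw, h54 z hz, hpos _ hu, hpos _ hv, hleg _ hu, hfac.num, hfac.first,
      hbase]
    refine ⟨by omega, by omega, by omega, by omega, fun h => ⟨hf _ ?_ ?_ ?_ ?_ ?_, ?_, ?_, ?_, ?_, ?_⟩,
      fun h => ⟨hf _ ?_ ?_ ?_ ?_ ?_, ?_, ?_, ?_, ?_, ?_⟩⟩ <;>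
      first | simp [multiFar, max_eq_right h] | simp [multiFar, max_eq_left (le_of_lt h)]
  · simp only [IExp.val_read, IExp.val_iv]; rw [q2, f₁.int 1, hleg _ hu]
  · rw [q2, f₁.int 1, hleg _ hu]
  · have e : s₂.ints 64 0 = w * U.size K U.n + z := by rw [f₂.int 64, q3]
    have h13 : s₂.ints 13 = s.ints 13 := by rw [f₂.int 13, f₁.int 13]
    simp [wp, e, r3, Store.ext, Store.setExt]; omega
  · have h13 : s₂.ints 13 = s.ints 13 := by rw [f₂.int 13, f₁.int 13]
    have h21 : ∀ x, s₂.ext 21 x = s.ext 21 x := fun x => by rw [f₂.ext, f₁.ext]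
    refine ⟨?_, ⟨?_, ?_⟩, fun x hx => ⟨?_, ?_⟩⟩
    · have h1 : (IExp.read 1 (iv 62)).cost ≤ 10 := by decide
      have h2 : Program.multiInit.cst ≤ 150 := by decide
      have h3 : (Program.setInt 13 (iv 64) (iv 44) ;; .setInt 21 (iv 64) 1 ;;
        .setReal 21 (iv 64) (.read 42 0)).cst ≤ 40 := by decide
      omega
    · rw [r6]; simp [r1, multiCost]
    · rw [r5]; simpa [MultiLab] using r2
    · rw [r6]; simp [hx, h21]
    · rw [r5]; simp [hx, h13]

end

/-! ### The complete algorithm -/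

section
variable {N : ℕ} {U : Users} {K : ℕ} {F : Users} {l : ℕ}

/-! ### The complete algorithm -/

def Program.prepare : Program :=
  .setInt 16 0 (2 * .read 0 1 * .read 0 0) ;; .bucket 0 ;; .powers ;; .posTable

structure InputIn (U : Users) (s : Store) : Prop where
  d : s.ints 0 0 = U.d
  r : s.ints 0 1 = U.r
  n : s.ints 0 2 = U.n
  leg : ∀ u < U.n, s.ints 1 u = U.leg u
  pos : ∀ u < U.n, s.reals 0 u = U.pos u

theorem InputIn.congr {s s' : Store} (h : InputIn U s) (h0 : s'.ints 0 = s.ints 0)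
    (h1 : s'.ints 1 = s.ints 1) (h2 : s'.reals 0 = s.reals 0) : InputIn U s' :=
  ⟨by rw [h0]; exact h.d, by rw [h0]; exact h.r, by rw [h0]; exact h.n, by rw [h1]; exact h.leg,
    by rw [h2]; exact h.pos⟩

theorem Bucketed.congr {U : Users} {K k j : ℕ} {s s' : Store} (h : Bucketed U K k j s)
    (h0 : s'.ints (50 + k) = s.ints (50 + k)) (h2 : s'.ints (52 + k) = s.ints (52 + k))
    (h6 : s'.ints (56 + k) = s.ints (56 + k)) (h4 : s'.ints (54 + k) = s.ints (54 + k))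
    (h8 : s'.ints (58 + k) = s.ints (58 + k)) (h9 : s'.reals (58 + k) = s.reals (58 + k)) :
    Bucketed U K k j s' :=
  ⟨by rw [h0]; exact h.cnt, by rw [h2]; exact h.idx, by rw [h6]; exact h.size, by rw [h4]; exact h.tl,
    by rw [h8]; exact h.usr, by rw [h9]; exact h.pos⟩

structure Prepared (U : Users) (K : ℕ) (s : Store) : Prop where
  input : InputIn U s
  bucket : Bucketed U K 0 U.n s
  pow : ∀ l ≤ U.d, s.ints 10 l = 2 ^ l
  masks : s.ints 17 0 = 2 ^ U.d
  posn : ∀ g ≤ U.size K U.n, ∀ l < U.d, s.ints 9 (g * U.d + l) = U.posn K g l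

/-- The sizes of all tables are below `N`. -/
structure Fits (N : ℕ) (U : Users) (K : ℕ) : Prop where
  n : 2 * U.n + 2 < N
  d : U.d < N
  r : U.r < N
  k : K < N
  leg : U.n + (U.n + 1) * U.d < N
  pow : (U.size K U.n + 1) * 2 ^ U.d < N
  seg : (U.size K U.n + 1) * segLen U K < N
  multi : U.size K U.n * U.size K U.n < N
  posn : (U.size K U.n + 1) * U.d < N
  three : 3 < N

theorem prepare_spec : ∃ c, ∀ (N : ℕ) (U : Users) (s : Store), Fits N U (2 * U.r * U.d) → InputIn U s →
    (∀ a ∈ [9, 50, 56], ∀ i, s.ints a i = 0) →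
    Tr N .prepare s (c * (U.n + 1 + (U.size (2 * U.r * U.d) U.n + 1) * (U.d + 1)))
      (Prepared U (2 * U.r * U.d)) := by
  obtain ⟨c₁, hc₁⟩ := powers_spec; obtain ⟨c₂, hc₂⟩ := posTable_spec
  refine ⟨20 + (Program.bucketBody 0).cst + 30 + c₁ + c₂, fun N U s h hs h0 => ?_⟩
  have hM : 2 ^ U.d < N := by have := h.pow; nlinarith
  have hn := h.n
  refine (Tr.seq (Tr.of_wp (Q := fun s' => s'.ints 16 0 = 2 * U.r * U.d) ?_) fun s₁ f₁ q₁ => ?_).mono (t :=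
    (Program.setInt 16 0 (2 * .read 0 1 * .read 0 0)).cst + ((U.n + 1) * ((Program.bucketBody 0).cst + 30) +
    (c₁ * (U.d + 1) + c₂ * ((U.size (2 * U.r * U.d) U.n + 1) * (U.d + 1))))) ?_ fun s₄ f₄ q₄ => q₄
  · have := h.k; simp [wp, hs.r, hs.d, this]
  · have i₁ := hs.congr (f₁.int 0) (f₁.int 1) (f₁.real 0)
    refine Tr.seq (bucket_spec (U := U) (Or.inl rfl) i₁.n q₁ i₁.leg i₁.pos
      (fun l => by rw [f₁.int _]; exact h0 _ (by decide) l)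
      (by rw [f₁.int _]; exact h0 _ (by decide) 0) (by omega) h.d) fun s₂ f₂ q₂ => ?_
    have i₂ := i₁.congr (f₂.int 0) (f₂.int 1) (f₂.real 0)
    refine Tr.seq (hc₁ N U.d s₂ i₂.d hM) fun s₃ f₃ q₃ => ?_
    have i₃ := i₂.congr (f₃.int 0) (f₃.int 1) (f₃.real 0)
    have b₃ := q₂.congr (f₃.int _) (f₃.int _) (f₃.int _) (f₃.int _)
      (f₃.int _) (f₃.real _)
    exact (hc₂ N _ U s₃ i₃.d b₃.size b₃.tl i₃.leg (fun l => by
      rw [f₃.int _, f₂.int _, f₁.int _]; exact h0 _ (by decide) l)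
      (by omega) h.posn).mono le_rfl fun s₄ f₄ q₄ =>
      ⟨i₃.congr (f₄.int 0) (f₄.int 1) (f₄.real 0),
        b₃.congr (f₄.int _) (f₄.int _) (f₄.int _) (f₄.int _)
          (f₄.int _) (f₄.real _),
        fun l hl => by rw [f₄.int _]; exact q₃.1 l hl, by rw [f₄.int _]; exact q₃.2, q₄⟩
  · have h1 : (Program.setInt 16 0 (2 * .read 0 1 * .read 0 0)).cst ≤ 20 := by decide
    generalize U.size (2 * U.r * U.d) U.n = G; generalize (Program.bucketBody 0).cst = b
    nlinarith [Nat.zero_le (c₁ * U.n), Nat.zero_le (c₂ * (U.n + 1)), Nat.zero_le ((20 + b + 30) * ((G + 1) * (U.d + 1))),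
      Nat.zero_le (c₁ * (G * (U.d + 1)))]

/-- The first part is optimality: the value is at most every `D` that bounds the local costs of some
feasible threshold. The second part is soundness: an output comes with clusters that witness the
value. For no users there is no cluster from which the sign of the value could be seen, so it is
stated separately. -/
def Solved (U : Users) (K : ℕ) (mv : ℕ → ℕ → ℝ) (lc : ℕ → ℕ → ℕ → ℝ) (LabM : ℕ → ℕ → ℕ → Prop)
    (Lab : ℕ → ℕ → ℕ → ℕ → Prop) (b : Bool) (s : Store) : Prop :=
  (∀ (T : Threshold) (D : ℝ), 0 ≤ D →
    (∀ l < U.d, ∀ i j, i < j → j ≤ U.cnt l → ClusterOk U T {U.usr l i, U.usr l (j - 1)} → lc l i j ≤ D) →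
    (∀ w < U.size K U.n, ∀ z < U.size K U.n, MultiOk U T (U.leg (U.tl K w)) (U.tl K w) (U.tl K z) →
      mv w z ≤ D) → Feas U T (Finset.range U.n) → s.ints 3 0 = 1 ∧ s.reals 2 0 ≤ D) ∧
  (s.ints 3 0 = 0 ∨ s.ints 3 0 = 1 ∧ (U.n = 0 → 0 ≤ s.reals 2 0) ∧ ∃ κ lam,
    Solution U K (fun w z => (mv w z : WithTop ℝ)) lc (s.reals 2 0) LabM Lab κ lam ∧
    ∀ u < U.n, s.ints 4 u = if b then κ u else lam u)

end

section
variable {N : ℕ} {U : Users} {K : ℕ} {F : Users} {l : ℕ}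

theorem Ex.ints_lt {p : Program} {s s' : Store} {t : ℕ} (h : Ex N p s s' t)
    (hs : ∀ a i, s.ints a i < N) : ∀ a i, s'.ints a i < N := by
  induction h with
  | setInt h =>
    intro a i; simp only [Store.setInt]
    split_ifs
    exacts [h, hs a i]
  | seq _ _ ih₁ ih₂ => exact ih₂ (ih₁ hs)
  | iteTrue _ _ ih => exact ih hs
  | iteFalse _ _ ih => exact ih hs
  | loopTrue _ _ _ ih₁ ih₂ => exact ih₂ (ih₁ hs)
  | _ => exact hs

theorem Tr.ints_lt {p : Program} {s : Store} {t : ℕ} {Q : Store → Prop} (h : Tr N p s t Q)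
    (hs : ∀ a i, s.ints a i < N) : Tr N p s t fun s' => Q s' ∧ ∀ a i, s'.ints a i < N := by
  obtain ⟨s', t', h1, h2, h3⟩ := h; exact ⟨s', t', h1, h2, h3, h1.ints_lt hs⟩

/-- The tables used for the answer, with the optimal value. -/
structure Tabled (N : ℕ) (U : Users) (K : ℕ) (R mc : ℕ → ℕ → WithTop ℝ) (mv : ℕ → ℕ → ℝ)
    (lc : ℕ → ℕ → ℕ → ℝ) (LabM : ℕ → ℕ → ℕ → Prop) (Lab : ℕ → ℕ → ℕ → ℕ → Prop) (s : Store) : Prop where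
  dp : DpIn U K R mc s
  best : ∀ k ≤ U.size K U.n, ∀ mask < 2 ^ U.d, VCell U K R mc k mask s
  seg : ∀ k ≤ U.size K U.n, ∀ mask < 2 ^ U.d, ∀ w < U.size K U.n, ∀ need ≤ U.r,
    ICell U K R mc k mask w need s
  line : ∀ l < U.d, LineTable U lc Lab l s
  multi : ∀ w < U.size K U.n, ∀ z < U.size K U.n, MultiCell (U.size K U.n) mv LabM w z s
  lt : ∀ a i, s.ints a i < N

def Program.answer (b : Bool) : Program :=
  .ite (.intLe 1 (.read 23 (iv 56 * iv 17)))
    (.trace ;; .labelUsers b ;; .setInt 3 0 1 ;; .setReal 2 0 (.read 23 (iv 56 * iv 17)))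
    (.setInt 3 0 0)

theorem Tabled.isOptimal {R mc : ℕ → ℕ → WithTop ℝ} {mv : ℕ → ℕ → ℝ} {lc : ℕ → ℕ → ℕ → ℝ}
    {LabM : ℕ → ℕ → ℕ → Prop} {Lab : ℕ → ℕ → ℕ → ℕ → Prop} {s : Store}
    (h : Tabled N U (2 * U.r * U.d) R mc mv lc LabM Lab s) (T : Threshold) (D : ℝ) (hD : 0 ≤ D)
    (hlc : ∀ l < U.d, ∀ i j, i < j → j ≤ U.cnt l → ClusterOk U T {U.usr l i, U.usr l (j - 1)} → lc l i j ≤ D)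
    (hmv : ∀ w < U.size (2 * U.r * U.d) U.n, ∀ z < U.size (2 * U.r * U.d) U.n,
      MultiOk U T (U.leg (U.tl (2 * U.r * U.d) w)) (U.tl (2 * U.r * U.d) w) (U.tl (2 * U.r * U.d) z) → mv w z ≤ D)
    (hf : Feas U T (Finset.range U.n)) :
    bestCost U (2 * U.r * U.d) R mc (U.size (2 * U.r * U.d) U.n) 0 ≤ D := by
  refine bestCost_le_of_feas hD (fun l hl i hi hS => ?_) (fun w z hw hz hok => ?_) le_rfl hf
  · rw [← h.dp.line]; exact (h.line l hl).le_of_feas hD (hlc l hl) i hi hS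
  · rw [← h.dp.multi, (h.multi w hw z hz).1]; exact_mod_cast hmv w hw z hz hok

theorem answer_spec (b : Bool) : ∃ c, ∀ (N : ℕ) (U : Users) (R mc : ℕ → ℕ → WithTop ℝ) (mv : ℕ → ℕ → ℝ)
    (lc : ℕ → ℕ → ℕ → ℝ) (LabM : ℕ → ℕ → ℕ → Prop) (Lab : ℕ → ℕ → ℕ → ℕ → Prop) (s : Store),
    Fits N U (2 * U.r * U.d) → Tabled N U (2 * U.r * U.d) R mc mv lc LabM Lab s →
    (∀ a ∈ [25, 26, 27], ∀ i, s.ints a i = 0) →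
    Tr N (.answer b) s (c * (U.n + 1 + (U.size (2 * U.r * U.d) U.n + 1) * (U.d + 1)))
      (Solved U (2 * U.r * U.d) mv lc LabM Lab b) := by
  obtain ⟨c, hc⟩ := trace_spec; refine ⟨c + 222, fun N U R mc mv lc LabM Lab s h ht h0 => ?_⟩
  set K := 2 * U.r * U.d with hK; set G := U.size K U.n with hG; have hn := h.n; have h3 := h.three
  have hV := ht.best G le_rfl 0 (by positivity)
  have hval : s.ext 23 (G * 2 ^ U.d) = bestCost U K R mc G 0 := by rw [← hV.val]; rfl
  have hadr : (IExp.read 23 (iv 56 * iv 17)).val s = s.ints 23 (G * 2 ^ U.d) := by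
    simp [ht.dp.size, ht.dp.masks, hG]
  refine (Tr.ite (t := 100 + (c * ((G + 1) * (U.d + 1)) + (U.n + 1) * 122)) (fun hb => ?_) fun hb => ?_).mono ?_ fun s' _ h => h
  · have hne : s.ints 23 (G * 2 ^ U.d) ≠ 0 := by
      rw [Test.holds_intLe, hadr, IExp.val_one] at hb; omega
    set V := s.reals 23 (G * 2 ^ U.d) with hVdef
    have hbest : bestCost U K R mc G 0 = (V : WithTop ℝ) := by rw [← hval, Store.ext, if_neg hne]
    have hR : ∀ l < U.d, ∀ i ≤ U.cnt l, LineCell (lc l) (Lab l) (R l) (U.cnt l) U.r i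
        (s.ints 11 (l * (U.n + 1) + i)) (s.ints 12 (l * (U.n + 1) + i)) := fun l hl i hi => by
      rw [show R l = fun j => s.ext 20 (l * (U.n + 1) + j) from funext fun j => (ht.dp.line l j).symm]
      exact (ht.line l hl).cell i hi
    refine (Tr.seq ((hc N U K R mc V LabM s h.three (by omega) h.d h.r h.pow h.seg
      ⟨ht.dp, ht.best, ht.seg, fun w hw z hz _ => (ht.multi w hw z hz).2, ht.lt 13⟩ h0 hbest.le).ints_lt ht.lt)
      fun s₁ f₁ q₁ => Tr.seq (labelUsers_spec (lc := lc) (Lab := Lab) b U.hr (by omega) h.leg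
        (by rw [f₁.int 0]; exact ht.dp.n) (by rw [f₁.int 1]; exact ht.dp.leg)
        (by rw [f₁.int 52]; exact ht.dp.idx) q₁.2 q₁.1
        (by rw [f₁.int 11, f₁.int 12]; exact hR)) fun s₂ f₂ q₂ =>
        (Tr.of_wp (Q := fun s' => s'.ints 3 0 = 1 ∧ s'.reals 2 0 = V ∧ s'.ints 4 = s₂.ints 4) ?_).mono le_rfl
        fun s₃ f₃ q₃ => ?_).mono ?_ fun _ _ h => h
    · have g : ∀ a, a ∉ [4, 25, 26, 27, 28, 48, 60, 61, 62, 63, 64, 65, 66, 67, 68, 69, 70, 71, 72, 73, 74] →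
          s₂.ints a = s.ints a := fun a ha => by
        rw [f₂.ints_eq (by cases b <;> decide) ha, f₁.ints_eq (by decide) ha]
      have r23 : s₂.reals 23 = s.reals 23 := by rw [f₂.2 23 (by cases b <;> decide), f₁.real 23]
      simp [wp, g 56 (by decide), g 17 (by decide), ht.dp.size, ht.dp.masks, ← hG, r23, ← hVdef]
      omega
    · refine ⟨fun T D hD hlc hmv hf => ⟨q₃.1, ?_⟩, .inr ⟨q₃.1, fun hn0 => ?_,
        outLabel U (s₁.ints 25) (s₁.ints 26) (s₁.ints 27) (s₁.ints 28) (s₁.ints 11) (s₁.ints 12) true,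
        outLabel U (s₁.ints 25) (s₁.ints 26) (s₁.ints 27) (s₁.ints 28) (s₁.ints 11) (s₁.ints 12) false,
        ?_, fun u hu => ?_⟩⟩
      · have := ht.isOptimal T D hD hlc hmv hf; rw [← hK, ← hG, hbest] at this; rw [q₃.2.1]
        exact_mod_cast this
      · have h1 : (0 : WithTop ℝ) ≤ V := by
          rw [← hbest]; have : G = 0 := by have : G ≤ U.n := U.size_le; omega
          rw [this, bestCost, ← hG, this]; exact finishCost_nonneg ..
        rw [q₃.2.1]; exact_mod_cast h1
      · have := q₁.1.solution U.hr (lc := lc) (Lab := Lab)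
          (by rw [← f₁.int 11, ← f₁.int 12] at hR; exact hR)
        rw [q₃.2.1]; intro u hu; obtain ⟨g1, g2⟩ := this u hu; refine ⟨g1, g2.imp_left ?_⟩
        rintro ⟨w, hw, z, hz, hle, g3⟩; rw [← ht.dp.multi, (ht.multi w hw z hz).1] at hle
        exact ⟨w, hw, z, hz, hle, g3⟩
      · rw [q₃.2.2, q₂ u hu]
        cases b <;> rfl
    · have : (Program.setInt 3 0 1 ;; .setReal 2 0 (.read 23 (iv 56 * iv 17))).cst ≤ 50 := by decide
      rw [← hG]; omega
  · refine (Tr.of_wp (Q := fun s' => s'.ints 3 0 = 0) (by simp [wp]; omega)).mono ?_ fun s' _ q => ⟨fun T D hD hlc hmv hf => ?_, .inl q⟩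
    · have : (Program.setInt 3 0 0).cst ≤ 50 := by decide
      omega
    · have h1 := ht.isOptimal T D hD hlc hmv hf
      rw [← hK, ← hG, ← hval, Store.ext, if_pos (by rw [Test.holds_intLe, hadr, IExp.val_one] at hb; omega)] at h1
      exact absurd h1 (by simp)
  · have : (Test.intLe 1 (.read 23 (iv 56 * iv 17))).cost ≤ 20 := by decide
    nlinarith [Nat.zero_le (c * (U.n + 1)), Nat.zero_le (G * U.d), Nat.zero_le G, Nat.zero_le U.d]

end

section
variable {N : ℕ} {U : Users} {K : ℕ} {F : Users} {l : ℕ}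

/-- Programs for the costs of clusters; `Fac` describes the memory that they use besides the users. -/
structure Costs (N : ℕ) (U : Users) (K C T : ℕ) (Fac : Store → Prop) (phi : Program) (e : IExp) (body : Program)
    (mv : ℕ → ℕ → ℝ) (lc : ℕ → ℕ → ℕ → ℝ) (LabM : ℕ → ℕ → ℕ → Prop) (Lab Pt : ℕ → ℕ → ℕ → ℕ → Prop)
    (f : ℕ → ℕ) : Prop where
  line_im : ∀ a ∈ (Program.lineTable phi e).im, a ∈ [11, 12, 20, 31, 32, 33, 34, 35, 36, 37, 38, 39,
    40, 41, 42, 43, 44, 45, 46, 47]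
  line_rm : ∀ a ∈ (Program.lineTable phi e).rm, a ∈ [20, 42, 43, 44]
  multi_im : ∀ a ∈ (Program.multiTable body).im, a ∈ [13, 21, 44, 46, 47, 60, 61, 62, 63, 64]
  multi_rm : ∀ a ∈ (Program.multiTable body).rm, a ∈ [21, 42, 44]
  body_im : ∀ a ∈ [56, 60, 61], a ∉ body.im
  stable : ∀ s s', Fac s → (∀ a ∈ [0, 2, 51, 53, 55, 57, 59], s'.ints a = s.ints a) →
    (∀ a ∈ [1, 59], s'.reals a = s.reals a) → Fac s'
  line : ∀ l < U.d, LinePhi N C phi (fun s => LegIn U l s ∧ Fac s) (U.cnt l) (lc l) (Lab l) (Pt l)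
  start : ∀ l < U.d, ∀ s, Fac s → s.ints 31 0 = l → e.val s = f l
  start_lt : ∀ l < U.d, f l < N
  start_pt : ∀ l < U.d, ∀ i j, j ≤ U.cnt l → Pt l (f l) i j
  body : ∀ s, Prepared U K s → Fac s → ∀ w < U.size K U.n, ∀ z < U.size K U.n, s.ints 60 0 = w →
    s.ints 61 0 = z → Tr N body s T fun s' => MultiCell (U.size K U.n) mv LabM w z s' ∧
      ∀ x ≠ w * U.size K U.n + z, s'.ext 21 x = s.ext 21 x ∧ s'.ints 13 x = s.ints 13 x

theorem of_mem {a : ℕ} {L : List ℕ} {P : ℕ → Prop} (h : a ∈ L) (h' : ∀ x ∈ L, P x := by decide) :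
    P a := h' a h

theorem notMem_of_mem {a : ℕ} {L L' : List ℕ} (h : a ∈ L) (h' : ∀ x ∈ L, x ∉ L' := by decide) :
    a ∉ L' := h' a h

theorem Prepared.congr {s s' : Store} (h : Prepared U K s)
    (hi : ∀ a ∈ [0, 1, 9, 10, 17, 50, 52, 54, 56, 58], s'.ints a = s.ints a)
    (hr : ∀ a ∈ [0, 58], s'.reals a = s.reals a) : Prepared U K s' :=
  ⟨h.input.congr (hi _ (by decide)) (hi _ (by decide)) (hr _ (by decide)),
    h.bucket.congr (hi _ (by decide)) (hi _ (by decide)) (hi _ (by decide)) (hi _ (by decide)) (hi _ (by decide))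
      (hr _ (by decide)),
    by rw [hi 10 (by decide)]; exact h.pow, by rw [hi 17 (by decide)]; exact h.masks,
    by rw [hi 9 (by decide)]; exact h.posn⟩

theorem Prepared.legIn {s : Store} (h : Prepared U K s) (h31 : s.ints 31 0 = l)
    (h32 : s.ints 32 0 = l * (U.n + 1)) : LegIn U l s :=
  ⟨h31, h32, fun i hi => by
    obtain ⟨h1, h2, h3⟩ := U.usr_spec hi; have := h.bucket.pos _ h1
    rwa [h2, h3] at this⟩

def Program.solve (phi : Program) (e : IExp) (body : Program) (b : Bool) : Program :=
  .prepare ;; .lineTable phi e ;; .multiTable body ;; .dp ;; .answer b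

theorem solve_spec (b : Bool) : ∃ c, ∀ (N : ℕ) (U : Users) (C T : ℕ) (Fac : Store → Prop) (phi : Program) (e : IExp)
    (body : Program) (mv : ℕ → ℕ → ℝ) (lc : ℕ → ℕ → ℕ → ℝ) (LabM : ℕ → ℕ → ℕ → Prop)
    (Lab Pt : ℕ → ℕ → ℕ → ℕ → Prop) (f : ℕ → ℕ) (s : Store), Fits N U (2 * U.r * U.d) →
    Costs N U (2 * U.r * U.d) C T Fac phi e body mv lc LabM Lab Pt f → InputIn U s → Fac s →
    (∀ a ∈ [9, 20, 22, 23, 25, 26, 27, 50, 56], ∀ i, s.ints a i = 0) → (∀ a i, s.ints a i < N) →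
    Tr N (.solve phi e body b) s
      (c * (U.n + 1 + (U.size (2 * U.r * U.d) U.n + 1) * 2 ^ U.d *
        ((U.size (2 * U.r * U.d) U.n + 1) * (U.r + 1) + U.d + 1)) +
      (7 * C + 4000 + 2 * e.cost) * (U.n + U.d + ∑ l ∈ Finset.range U.d, f l + 1) +
      (U.size (2 * U.r * U.d) U.n + 1) * ((U.size (2 * U.r * U.d) U.n + 1) * (T + 22) + 22))
      (Solved U (2 * U.r * U.d) mv lc LabM Lab b) := by
  obtain ⟨c₁, hc₁⟩ := prepare_spec; obtain ⟨c₂, hc₂⟩ := dp_spec; obtain ⟨c₃, hc₃⟩ := answer_spec b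
  refine ⟨c₁ + c₂ + c₃, fun N U C T Fac phi e body mv lc LabM Lab Pt f s h H hs hf h0 hlt => ?_⟩
  set K := 2 * U.r * U.d with hK; have hn := h.n
  have i0 : ∀ a ∈ [9, 50, 56], ∀ i, s.ints a i = 0 := by grind
  have hleg := h.leg; set G := U.size K U.n with hG
  refine Tr.mono (t := c₁ * (U.n + 1 + (G + 1) * (U.d + 1)) + ((7 * C + 4000 + 2 * e.cost) *
    (U.n + U.d + ∑ l ∈ Finset.range U.d, f l + 1) + ((G + 1) * ((G + 1) * (T + 22) + 22) +
    (c₂ * ((G + 1) * 2 ^ U.d * ((G + 1) * (U.r + 1) + U.d + 1)) + c₃ * (U.n + 1 + (G + 1) * (U.d + 1))))))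
    (Tr.seq ((hc₁ N U s h hs i0).ints_lt hlt) fun s₁ f₁ ⟨q₁, lt₁⟩ => ?_) ?_ fun _ _ h => h
  · have z₁ : ∀ a ∈ [20, 22, 23, 25, 26, 27], ∀ i, s₁.ints a i = 0 := fun a ha i => by
      rw [f₁.ints_eq (L := [9, 10, 16, 17, 30, 31, 32, 50, 52, 54, 56, 58]) (by decide) (notMem_of_mem ha)]
      grind
    have fac₁ : Fac s₁ := H.stable s s₁ hf (fun a ha => f₁.ints_eq (L := [9, 10, 16, 17, 30, 31, 32, 50, 52, 54, 56, 58])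
      (by decide) (notMem_of_mem ha)) fun a ha => f₁.reals_eq (L := [58]) (by decide) (notMem_of_mem ha)
    refine Tr.seq ((lineTable_spec H.line U.hd (by omega) h.d q₁.input.d q₁.input.r q₁.input.n
      (fun l _ => q₁.bucket.cnt l) (by omega) (fun l hl s' hi hr h31 h32 _ => ?_) H.start_lt H.start_pt
      fun a => ?_).ints_lt lt₁) fun s₂ f₂ ⟨q₂, lt₂⟩ => ?_
    · have fac' : Fac s' := H.stable s₁ s' fac₁ (fun a ha => hi a (notMem_of_mem ha))
        fun a ha => hr a (notMem_of_mem ha)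
      have p' : Prepared U K s' := q₁.congr (fun a ha => hi a (notMem_of_mem ha))
        fun a ha => hr a (notMem_of_mem ha)
      exact ⟨⟨p'.legIn h31 h32, fac'⟩, H.start l hl s' fac' h31⟩
    · rw [Store.ext, if_pos (z₁ 20 (by simp) a)]
    have e₂ : ∀ {a}, a ∉ [11, 12, 20, 31, 32, 33, 34, 35, 36, 37, 38, 39, 40, 41, 42, 43, 44, 45, 46, 47] →
      s₂.ints a = s₁.ints a := fun h => f₂.ints_eq H.line_im h
    have r₂ : ∀ {a}, a ∉ [20, 42, 43, 44] → s₂.reals a = s₁.reals a := fun h => f₂.reals_eq H.line_rm h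
    have p₂ : Prepared U K s₂ := q₁.congr (fun a ha => e₂ (notMem_of_mem ha))
      fun a ha => r₂ (notMem_of_mem ha)
    have fac₂ : Fac s₂ := H.stable s₁ s₂ fac₁ (fun a ha => e₂ (notMem_of_mem ha))
      fun a ha => r₂ (notMem_of_mem ha)
    refine Tr.seq ((multiTable_spec (T := T) (by have := h.pow; nlinarith [U.d.two_pow_pos]) p₂.bucket.size H.body_im
      (mv := mv) (Lab := LabM) fun s' f' w hw z hz h60 h61 => H.body s' (p₂.congr
        (fun a ha => f'.ints_eq H.multi_im (notMem_of_mem ha))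
        fun a ha => f'.reals_eq H.multi_rm (notMem_of_mem ha)) (H.stable s₂ s' fac₂
        (fun a ha => f'.ints_eq H.multi_im (notMem_of_mem ha))
        fun a ha => f'.reals_eq H.multi_rm (notMem_of_mem ha)) w hw z hz h60 h61).ints_lt lt₂) fun s₃ f₃ ⟨q₃, lt₃⟩ => ?_
    have e₃ : ∀ {a}, a ∉ [13, 21, 44, 46, 47, 60, 61, 62, 63, 64] → s₃.ints a = s₂.ints a := fun h => f₃.ints_eq H.multi_im h
    have r₃ : ∀ {a}, a ∉ [21, 42, 44] → s₃.reals a = s₂.reals a := fun h => f₃.reals_eq H.multi_rm h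
    have p₃ : Prepared U K s₃ := p₂.congr (fun a ha => e₃ (notMem_of_mem ha))
      fun a ha => r₃ (notMem_of_mem ha)
    have z₃ : ∀ a ∈ [22, 23, 25, 26, 27], ∀ i, s₃.ints a i = 0 := fun a ha i => by
      rw [e₃ (notMem_of_mem ha), e₂ (notMem_of_mem ha)]; grind
    have dp₃ : DpIn U K (fun l i => s₃.ext 20 (l * (U.n + 1) + i)) (fun w z => s₃.ext 21 (w * G + z)) s₃ :=
      ⟨p₃.input.d, p₃.input.r, p₃.input.n, p₃.input.leg, p₃.posn, p₃.pow, p₃.masks, p₃.bucket.idx, p₃.bucket.tl,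
        p₃.bucket.size, fun _ _ => rfl, fun _ _ => rfl⟩
    refine Tr.seq ((hc₂ N U K _ _ s₃ h.three (by omega) h.d (by omega) h.pow h.seg dp₃ (z₃ 22 (by decide))
      (z₃ 23 (by decide))).ints_lt lt₃) fun s₄ f₄ ⟨q₄, lt₄⟩ => ?_
    have e₄ : ∀ a ∈ [0, 1, 9, 10, 11, 12, 13, 17, 20, 21, 25, 26, 27, 52, 54, 56], s₄.ints a = s₃.ints a := fun a ha =>
      f₄.int a (notMem_of_mem ha)
    have x₄ : ∀ i, s₄.ext 20 i = s₂.ext 20 i := fun i => by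
      rw [f₄.ext, Store.ext_congr (e₃ (by decide)) (r₃ (by decide))]
    refine hc₃ N U _ _ mv lc LabM Lab s₄ h ⟨dp₃.congr (fun a ha => e₄ a (of_mem ha)) (fun a ha =>
      f₄.real a (notMem_of_mem ha)), q₄.1, q₄.2, fun l hl => ⟨?_⟩, ?_, lt₄⟩
      fun a ha i => ?_
    · simp only [x₄, e₄ 11 (by decide), e₄ 12 (by decide), e₃ (a := 11) (by decide), e₃ (a := 12) (by decide)]
      exact (q₂ l hl).cell
    · intro w hw z hz; rw [MultiCell, f₄.ext, e₄ 13 (by decide)]; exact q₃ w hw z hz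
    · rw [e₄ a (of_mem ha)]; grind
  · have h1 : (G + 1) * (U.d + 1) ≤ (G + 1) * 2 ^ U.d * ((G + 1) * (U.r + 1) + U.d + 1) := by
      rw [mul_assoc]; refine Nat.mul_le_mul_left _ ?_; have := Nat.one_le_two_pow (n := U.d)
      nlinarith [Nat.zero_le ((G + 1) * (U.r + 1))]
    generalize (G + 1) * 2 ^ U.d * ((G + 1) * (U.r + 1) + U.d + 1) = X at *
    generalize (G + 1) * (U.d + 1) = Y at *; have h2 := Nat.mul_le_mul_left c₁ h1
    have h3 := Nat.mul_le_mul_left c₃ h1; have h4 := Nat.zero_le (c₂ * (U.n + 1))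
    linarith [show c₁ * (U.n + 1 + Y) = c₁ * (U.n + 1) + c₁ * Y by ring,
      show c₃ * (U.n + 1 + Y) = c₃ * (U.n + 1) + c₃ * Y by ring,
      show (c₁ + c₂ + c₃) * (U.n + 1 + X) = c₁ * (U.n + 1) + c₂ * (U.n + 1) + c₃ * (U.n + 1) + c₁ * X + c₂ * X + c₃ * X by ring]

end

section
variable {N : ℕ} {U : Users} {K : ℕ} {F : Users} {l : ℕ}

/-- Users up to `z` may lie on several legs, so two of them can be `2 * pos z` apart. Users beyond
`z` lie on the leg of `w` only, and their distance to a user up to `z` is at most `pos w + pos z`.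
-/
noncomputable def diamMulti (U : Users) (K w z : ℕ) : ℝ :=
  max (U.pos (U.tl K w)) (U.pos (U.tl K z)) + U.pos (U.tl K z)

theorem clustering_costs (h : Fits N U K) : Costs N U K 30 100 (fun _ => True) .clusterPhi 0 .clusterMulti
    (diamMulti U K) (diamCost U) (fun _ _ _ => True) (fun _ _ _ _ => True) (fun _ _ _ _ => True) fun _ => 0 where
  line_im := by decide
  line_rm := by decide
  multi_im := by decide
  multi_rm := by decide
  body_im := by decide
  stable _ _ _ _ _ := trivial
  line l _ := by
    have H := clusterPhi_spec (U := U) (l := l) (N := N) (by have := h.three; omega); grind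
  start _ _ _ _ _ := rfl
  start_lt _ _ := by have := h.three; omega
  start_pt _ _ _ _ _ := trivial
  body s hs _ w hw z hz h60 h61 := (Tr.of_wp (clusterMulti_spec (by have := h.three; omega)
    (by have := h.n; omega) h.multi hs.bucket.size hs.bucket.tl hs.input.pos hw hz h60 h61)).mono (by decide)
    fun _ _ q => q

theorem gathering_costs (h : Fits N U K) (hd : F.d = U.d) (hn : 0 < F.n) (hN : 2 * F.n + 1 < N)
    (hdN : (F.n + 1) * F.d < N) :
    Costs N U K 300 (100 * (Nat.log 2 F.n + 6)) (FacIn F) .gatherPhi (.read 51 (iv 31) - 1) .gatherMulti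
    (multiCost U F K) (legCost U F) (MultiLab U F K) (LegLab U F) (FacPtr U F) fun l => F.cnt l - 1 where
  line_im := by decide
  line_rm := by decide
  multi_im := by decide
  multi_rm := by decide
  body_im := by decide
  stable s s' hs hi hr := hs.congr (hi _ (by decide)) (hi _ (by decide)) (hi _ (by decide)) (hr _ (by decide))
    (hr _ (by decide))
  line l hl := gatherPhi_spec (by omega) hn (by omega) (by omega) hdN
  start l hl s hs h31 := by simp [h31, hs.cnt l (by omega)]
  start_lt l _ := by have := F.cnt_le l; omega
  start_pt l _ i j _ := ⟨le_rfl, fun _ _ _ _ _ _ _ => by omega⟩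
  body s hs hf w hw z hz h60 h61 := gatherMulti_spec hN hn (by have := h.n; omega) hdN hd h.multi hs.bucket.size
    hs.bucket.tl hs.input.pos hs.input.leg hf hw hz h60 h61

def Program.clustering : Program := .solve .clusterPhi 0 .clusterMulti true

/-- The main program presupposes that facility `0` exists. Without facilities only an empty set of
users has a feasible assignment. -/
def Program.gathering : Program :=
  .ite (.intLe 1 (.read 0 3))
    (.bucket 1 ;; .solve .gatherPhi (.read 51 (iv 31) - 1) .gatherMulti false)
    (.ite (.intLe (.read 0 2) 0) (.setInt 3 0 1) .skip)

theorem facIn_of_bucketed {s : Store} (h : Bucketed F 0 1 F.n s) (h0 : s.ints 0 3 = F.n)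
    (h1 : ∀ j < F.n, s.reals 1 j = F.pos j) (hn : 0 < F.n) : FacIn F s where
  num := h0
  cnt l _ := h.cnt l
  usr l _ p hp := by obtain ⟨h1, h2, h3⟩ := F.usr_spec hp; have := h.usr _ h1; rwa [h2, h3] at this
  pos l _ p hp := by obtain ⟨h1, h2, h3⟩ := F.usr_spec hp; have := h.pos _ h1; rwa [h2, h3] at this
  first := h1 0 hn

/-! ### Bounds -/

theorem cube_le_two_pow (d : ℕ) : d ^ 3 ≤ 4 * 2 ^ d := by
  induction d with
  | zero => simp
  | succ d ih =>
    rcases Nat.lt_or_ge d 4 with h | h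
    · interval_cases d <;> simp
    · rw [pow_succ 2]
      nlinarith [mul_le_mul h h (by omega) (by omega), mul_le_mul (mul_le_mul h h (by omega) (by omega)) h (by omega) (by positivity)]

/-- For a positive logarithm `L`, one has `L ^ 2 ≤ L ^ 3 ≤ 4 * 2 ^ L ≤ 4 * m`. -/
theorem sq_log_le (m : ℕ) : (Nat.log 2 m) ^ 2 ≤ 4 * m + 1 := by
  rcases Nat.eq_zero_or_pos m with rfl | h
  · simp
  · have h1 := cube_le_two_pow (Nat.log 2 m); have h2 := Nat.pow_log_le_self 2 h.ne'
    rcases Nat.eq_zero_or_pos (Nat.log 2 m) with h0 | h0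
    · rw [h0]; simp
    · have := Nat.pow_le_pow_right h0 (show 2 ≤ 3 by omega); omega

/-- A listed user is determined by its leg and by its number below `K` on that leg. -/
theorem Users.size_le_mul (U : Users) (K j : ℕ) (hj : j ≤ U.n) : U.size K j ≤ K * U.d := by
  rw [Users.size, Nat.count_eq_card_filter_range, mul_comm, ← Finset.card_range U.d, ← Finset.card_range K,
    ← Finset.card_product]
  refine Finset.card_le_card_of_injOn (fun u => (U.leg u, U.idx u)) (fun u hu => ?_) fun u hu v hv h => ?_
  · simp at hu; simpa using ⟨U.leg_lt u (by omega), hu.2⟩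
  · simp only [Prod.mk.injEq] at h; rw [← U.usr_idx (u := u), ← U.usr_idx (u := v), h.1, h.2]

section

variable {r d : ℕ}

theorem le_measure (hr : 1 ≤ r) (hd : 1 ≤ d) (a b : ℕ) (ha : a ≤ 4 := by decide) (hb : b ≤ 5 := by decide) :
    r ^ a * d ^ b ≤ r ^ 4 * d ^ 5 :=
  Nat.mul_le_mul (Nat.pow_le_pow_right hr ha) (Nat.pow_le_pow_right hd hb)

end

theorem Users.size_succ_le (U : Users) : U.size (2 * U.r * U.d) U.n + 1 ≤ 3 * (U.r * U.d ^ 2) := by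
  have h1 := U.size_le_mul (2 * U.r * U.d) U.n le_rfl; have h2 := Nat.mul_pos U.hr (pow_pos U.hd 2)
  nlinarith

/-- The list has length of order `r * d ^ 2`. Its square times `2 ^ d * r` is of order `2 ^ d * r ^
3 * d ^ 4`, which is less than what is allowed. -/
theorem dp_time_le (U : Users) : (U.size (2 * U.r * U.d) U.n + 1) * 2 ^ U.d *
    ((U.size (2 * U.r * U.d) U.n + 1) * (U.r + 1) + U.d + 1) ≤ 24 * (2 ^ U.d * U.r ^ 4 * U.d ^ 5) := by
  have h1 := U.size_succ_le; have hr := U.hr; have hd := U.hd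
  have h2 : (U.size (2 * U.r * U.d) U.n + 1) * (U.r + 1) + U.d + 1 ≤ 8 * (U.r ^ 2 * U.d ^ 2) := by
    have h3 : (U.size (2 * U.r * U.d) U.n + 1) * (U.r + 1) ≤ 3 * (U.r * U.d ^ 2) * (2 * U.r) :=
      Nat.mul_le_mul h1 (by omega)
    have h4 : U.d * 1 ≤ U.d * (U.d * U.r ^ 2) := Nat.mul_le_mul_left _ (Nat.mul_pos hd (pow_pos hr 2))
    nlinarith
  calc _ ≤ 3 * (U.r * U.d ^ 2) * 2 ^ U.d * (8 * (U.r ^ 2 * U.d ^ 2)) :=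
        Nat.mul_le_mul (Nat.mul_le_mul_right _ h1) h2
    _ = 24 * 2 ^ U.d * (U.r ^ 3 * U.d ^ 4) := by ring
    _ ≤ 24 * 2 ^ U.d * (U.r ^ 4 * U.d ^ 5) := Nat.mul_le_mul_left _ (le_measure hr hd 3 4)
    _ = _ := by ring

/-- One bisection for each pair costs of order `x * log m` with `x = r ^ 2 * d ^ 4`. The product is
at most a sum of squares: `x ^ 2 = r ^ 4 * d ^ 5 * d ^ 3` is absorbed because `d ^ 3 ≤ 4 * 2 ^ d`,
and the square of the logarithm is linear in `m`. -/
theorem multi_time_le (U : Users) (m : ℕ) : (U.size (2 * U.r * U.d) U.n + 1) *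
    ((U.size (2 * U.r * U.d) U.n + 1) * (100 * (Nat.log 2 m + 6) + 22) + 22) ≤
      20000 * (2 ^ U.d * U.r ^ 4 * U.d ^ 5 + m) := by
  have h1 := U.size_succ_le; have hr := U.hr; have hd := U.hd; set x := U.r ^ 2 * U.d ^ 4 with hx
  set L := Nat.log 2 m with hL
  have h2 : x ^ 2 ≤ 4 * (2 ^ U.d * U.r ^ 4 * U.d ^ 5) := by
    calc x ^ 2 = U.r ^ 4 * U.d ^ 5 * U.d ^ 3 := by rw [hx]; ring
      _ ≤ U.r ^ 4 * U.d ^ 5 * (4 * 2 ^ U.d) := Nat.mul_le_mul_left _ (cube_le_two_pow _)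
      _ = _ := by ring
  have h3 : 2 * (x * L) ≤ x ^ 2 + L ^ 2 := by have := two_mul_le_add_sq x L; nlinarith
  have h4 : L ^ 2 ≤ 4 * m + 1 := sq_log_le m
  have h5 : x ≤ 2 ^ U.d * U.r ^ 4 * U.d ^ 5 := by
    rw [mul_assoc]; exact (le_measure hr hd 2 4).trans (Nat.le_mul_of_pos_left _ (by positivity))
  have h6 : 1 ≤ x := Nat.mul_pos (pow_pos hr 2) (pow_pos hd 4)
  calc _ ≤ 3 * (U.r * U.d ^ 2) * (3 * (U.r * U.d ^ 2) * (100 * (L + 6) + 22) + 3 * (U.r * U.d ^ 2) * 22) := by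
        refine Nat.mul_le_mul h1 (Nat.add_le_add (Nat.mul_le_mul_right _ h1) ?_)
        have := Nat.mul_pos hr (pow_pos hd 2); omega
    _ = 900 * (x * L) + 5796 * x := by rw [hx]; ring
    _ ≤ _ := by omega

end

section
variable {N : ℕ} {U : Users} {K : ℕ} {F : Users} {l : ℕ}

/-- The quantity that bounds the time, with `n` the number of points. -/
def measure (d r n : ℕ) : ℕ := 2 ^ d * r ^ 4 * d ^ 5 + n

/-- Most table sizes are linear in the time bound. The products `(n + 1) * d` and `size * d` and the
square of the list length are at most quadratic, whence the square. -/
theorem fits_of_measure (U : Users) {m : ℕ} :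
    Fits (20 * measure U.d U.r (U.n + m) ^ 2) U (2 * U.r * U.d) := by
  have hr := U.hr; have hd := U.hd; set X := 2 ^ U.d * U.r ^ 4 * U.d ^ 5 with hX
  have key : ∀ a b, a ≤ 4 → b ≤ 5 → 2 ^ U.d * (U.r ^ a * U.d ^ b) ≤ X := fun a b ha hb => by
    rw [hX, mul_assoc]; exact Nat.mul_le_mul_left _ (le_measure hr hd a b ha hb)
  have key' : ∀ a b, a ≤ 4 → b ≤ 5 → U.r ^ a * U.d ^ b ≤ X := fun a b ha hb =>
    (Nat.le_mul_of_pos_left _ (by positivity)).trans (key a b ha hb)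
  have h1 := U.size_succ_le; have g : U.size (2 * U.r * U.d) U.n ≤ U.n := U.size_le
  set G := U.size (2 * U.r * U.d) U.n
  have e2 : 2 ≤ X := le_trans (by
    have := Nat.pow_le_pow_right (n := 2) (by omega) hd
    simpa using this) (key 0 0 (by omega) (by omega))
  have er : U.r ≤ X := by simpa using key' 1 0 (by omega) (by omega)
  have ed : U.d ≤ X := by simpa using key' 0 1 (by omega) (by omega)
  have erd : U.r * U.d ≤ X := by simpa using key' 1 1 (by omega) (by omega)
  have erd2 : U.r * U.d ^ 2 ≤ X := by simpa using key' 1 2 (by omega) (by omega)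
  have erd3 : 2 ^ U.d * (U.r * U.d ^ 2) ≤ X := by simpa using key 1 2 (by omega) (by omega)
  have hB : measure U.d U.r (U.n + m) = X + U.n + m := by rw [measure, add_assoc]
  have hB2 : (X + U.n) ^ 2 ≤ measure U.d U.r (U.n + m) ^ 2 := by
    rw [hB]; exact Nat.pow_le_pow_left (by omega) 2
  have hlin : ∀ y, y ≤ 19 * (X + U.n) → y < 20 * measure U.d U.r (U.n + m) ^ 2 := fun y hy => by nlinarith
  constructor
  · exact hlin _ (by omega)
  · exact hlin _ (by omega)
  · exact hlin _ (by omega)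
  · exact hlin _ (by nlinarith)
  · nlinarith
  · exact hlin _ (by nlinarith [Nat.mul_le_mul_right (2 ^ U.d) h1])
  · refine hlin _ ?_
    have h5 : (G + 1) * segLen U (2 * U.r * U.d) ≤ 3 * (U.r * U.d ^ 2) * (2 ^ U.d * (2 * (U.r * U.d ^ 2)) * (2 * U.r)) := by
      refine Nat.mul_le_mul h1 (Nat.mul_le_mul (Nat.mul_le_mul_left _ ?_) (by omega))
      exact (U.size_le_mul _ _ le_rfl).trans (le_of_eq (by ring))
    have := key 3 4 (by omega) (by omega); nlinarith
  · nlinarith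
  · nlinarith
  · exact hlin _ (by omega)

theorem solve_time_le (c C : ℕ) : ∃ c', ∀ (U : Users) (m f : ℕ), f ≤ m →
    c * (U.n + 1 + (U.size (2 * U.r * U.d) U.n + 1) * 2 ^ U.d *
        ((U.size (2 * U.r * U.d) U.n + 1) * (U.r + 1) + U.d + 1)) +
      C * (U.n + U.d + f + 1) +
      (U.size (2 * U.r * U.d) U.n + 1) * ((U.size (2 * U.r * U.d) U.n + 1) * (100 * (Nat.log 2 m + 6) + 22) + 22) ≤
    c' * measure U.d U.r (U.n + m) := by
  refine ⟨25 * c + 2 * C + 20000, fun U m f hf => ?_⟩; have h1 := dp_time_le U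
  have h2 := multi_time_le U m; have hr := U.hr; have hd := U.hd
  have h3 : U.d + 1 ≤ 2 * (2 ^ U.d * U.r ^ 4 * U.d ^ 5) := by
    have h4 : U.d < 2 ^ U.d := Nat.lt_two_pow_self
    have h5 : 2 ^ U.d * 1 ≤ 2 ^ U.d * (U.r ^ 4 * U.d ^ 5) :=
      Nat.mul_le_mul_left _ (Nat.mul_pos (pow_pos hr 4) (pow_pos hd 5))
    rw [mul_assoc]; omega
  unfold measure; set X := 2 ^ U.d * U.r ^ 4 * U.d ^ 5
  calc _ ≤ c * (25 * (X + (U.n + m))) + C * (2 * (X + (U.n + m))) + 20000 * (X + m) :=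
        Nat.add_le_add (Nat.add_le_add (Nat.mul_le_mul_left c (by omega)) (Nat.mul_le_mul_left C (by omega))) h2
    _ ≤ _ := by nlinarith [Nat.zero_le U.n]

end

/-! ### From distances on the spider to thresholds and back -/

section
/-! ### Distances between users -/

noncomputable def legDist (l : ℕ) (x : ℝ) (l' : ℕ) (y : ℝ) : ℝ := if l = l' then |x - y| else x + y

theorem legDist_le {l l' : ℕ} {x y : ℝ} (hx : 0 ≤ x) (hy : 0 ≤ y) : legDist l x l' y ≤ x + y := by
  unfold legDist; grind

variable {N : ℕ} {U F : Users} {K l : ℕ} {D V : ℝ} {T : Threshold}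

/-- A set of diameter at most `D` that meets several legs lies in a ball of radius `D / 2`, whose
center can be chosen within `D / 2` of the center of the spider. -/
noncomputable def diamThreshold (U : Users) (D : ℝ) : Threshold where
  rad := D / 2
  cent _ y := 0 ≤ y ∧ y ≤ D / 2
  cent_nonneg h := h.1
  line i j := U.pos j - U.pos i ≤ D

theorem inBall_diam {C : Finset ℕ} {b : ℕ} {y : ℝ} : InBall U (diamThreshold U D) b y C ↔
    ∀ u ∈ C, U.pos u ≤ if U.leg u = b then D / 2 + y else D / 2 - y := Iff.rfl

theorem clusterOk_of_line {C : Finset ℕ} (hC : C.Nonempty) (hl : ∀ u ∈ C, U.leg u = l)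
    (h : ∀ i ∈ C, ∀ j ∈ C, T.line i j) : ClusterOk U T C :=
  .inr ⟨C.min' hC, C.max' hC, h _ (C.min'_mem hC) _ (C.max'_mem hC),
    (hl _ (C.min'_mem hC)).trans (hl _ (C.max'_mem hC)).symm, fun u hu =>
      ⟨(hl u hu).trans (hl _ (C.min'_mem hC)).symm, C.min'_le u hu, C.le_max' u hu⟩⟩

theorem clusterOk_of_diam {C : Finset ℕ} (hC : C.Nonempty)
    (h : ∀ u ∈ C, ∀ v ∈ C, legDist (U.leg u) (U.pos u) (U.leg v) (U.pos v) ≤ D) :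
    ClusterOk U (diamThreshold U D) C := by
  have ha := C.max'_mem hC; set a := C.max' hC; by_cases hl : ∀ u ∈ C, U.leg u = U.leg a
  · refine clusterOk_of_line hC hl fun i hi j hj => ?_; have := h i hi j hj
    rw [legDist, if_pos ((hl i hi).trans (hl j hj).symm)] at this
    have h1 := neg_abs_le (U.pos i - U.pos j); show U.pos j - U.pos i ≤ D; linarith
  · push Not at hl
    obtain ⟨v, hv, hva⟩ := hl; have h1 := h a ha v hv; rw [legDist, if_neg (Ne.symm hva)] at h1
    have hv0 := U.nonneg v; have ha0 := U.nonneg a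
    have hle : ∀ u ∈ C, U.pos u ≤ U.pos a := fun u hu => U.mono (C.le_max' u hu)
    -- The ball is centered `D / 2` inward from the outermost user `a`, but not beyond the center of
    -- the spider. Since another leg is met, `pos a ≤ D`, so `y ≤ D / 2`. Users on other legs are
    -- bounded through their distance to `a`, or trivially if `pos a ≤ D / 2`.
    refine .inl ⟨U.leg a, max 0 (U.pos a - D / 2), ⟨le_max_left _ _, max_le (by linarith) (by linarith)⟩, inBall_diam.2 fun u hu => ?_⟩
    have h2 := hle u hu; rcases le_total (U.pos a) (D / 2) with h3 | h3
    · rw [max_eq_left (by linarith)]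
      split_ifs <;> linarith
    · rw [max_eq_right (by linarith)]
      split_ifs with h4
      · linarith
      · have h5 := h a ha u hu; rw [legDist, if_neg (Ne.symm h4)] at h5; linarith

theorem diamCost_le {l i j : ℕ} (hij : i < j) (hj : j ≤ U.cnt l)
    (h : ClusterOk U (diamThreshold U D) {U.usr l i, U.usr l (j - 1)}) : diamCost U l i j ≤ D := by
  have h0 := U.nonneg (U.usr l i); unfold diamCost
  rcases h with ⟨b, y, hy, hb⟩ | ⟨i', j', hl, -, h⟩
  · have h1 := inBall_diam.1 hb (U.usr l (j - 1)) (by simp)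
    obtain ⟨h2, h3⟩ : 0 ≤ y ∧ y ≤ D / 2 := hy
    split_ifs at h1 <;> linarith
  · have h1 := U.mono (h (U.usr l i) (by simp)).2.1
    have h2 := U.mono (h (U.usr l (j - 1)) (by simp)).2.2; have h3 : U.pos j' - U.pos i' ≤ D := hl
    linarith

theorem diamMulti_le {w z : ℕ} (h : MultiOk U (diamThreshold U D) (U.leg (U.tl K w)) (U.tl K w) (U.tl K z)) :
    diamMulti U K w z ≤ D := by
  obtain ⟨b, y, ⟨hy0, hy⟩, h⟩ := h
  change ((_ ∧ _ ≤ D / 2 + y ∧ _ ≤ D / 2 - y) ∨ (_ ≤ D / 2 - y ∧ _ ≤ D / 2 - y)) at h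
  have : max (U.pos (U.tl K w)) (U.pos (U.tl K z)) ≤ D - U.pos (U.tl K z) := by grind
  unfold diamMulti; linarith

theorem Within.cases {w z u : ℕ} (h : Within U K w z u) :
    (U.leg u = U.leg (U.tl K w) ∧ U.pos u ≤ U.pos (U.tl K w)) ∨ U.pos u ≤ U.pos (U.tl K z) :=
  h.imp (fun h => ⟨h.1, U.mono h.2⟩) fun h => U.mono h

theorem between_of_idx {i j v : ℕ} (hv : v < U.n) (hi : i ≤ U.idx v) (hj : U.idx v < j)
    (hj' : j ≤ U.cnt (U.leg v)) :
    U.pos (U.usr (U.leg v) i) ≤ U.pos v ∧ U.pos v ≤ U.pos (U.usr (U.leg v) (j - 1)) := by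
  have h := U.usr_idx (u := v); constructor
  · conv_rhs => rw [← h]
    exact U.pos_usr_mono hi (by omega)
  · conv_lhs => rw [← h]
    exact U.pos_usr_mono (by omega) (by omega)

theorem Solution.diam_le {LabM : ℕ → ℕ → ℕ → Prop} {Lab : ℕ → ℕ → ℕ → ℕ → Prop} {κ lam : ℕ → ℕ}
    (h : Solution U K (fun w z => (diamMulti U K w z : WithTop ℝ)) (diamCost U) V LabM Lab κ lam) {u v : ℕ}
    (hu : u < U.n) (hv : v < U.n) (huv : κ u = κ v) :
    legDist (U.leg u) (U.pos u) (U.leg v) (U.pos v) ≤ V := by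
  have hu0 := U.nonneg u; have hv0 := U.nonneg v
  rcases (h u hu).2 with ⟨w, hw, z, hz, hle, -, hin⟩ | ⟨l, hl, i, j, hij, hj, hle, -, hin⟩
  · have hle : diamMulti U K w z ≤ V := WithTop.coe_le_coe.1 hle; unfold diamMulti at hle
    have h1 := le_max_left (U.pos (U.tl K w)) (U.pos (U.tl K z))
    have h2 := le_max_right (U.pos (U.tl K w)) (U.pos (U.tl K z)); have h0 := U.nonneg (U.tl K z)
    have hsum := legDist_le (l := U.leg u) (l' := U.leg v) hu0 hv0
    rcases (hin u hu rfl).2.cases with a | a <;> rcases (hin v hv huv.symm).2.cases with b | b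
    · rw [legDist, if_pos (a.1.trans b.1.symm)]; grind
    · linarith [a.2]
    · linarith [b.2]
    · linarith
  · obtain ⟨-, hlu, a1, a2⟩ := hin u hu rfl; obtain ⟨-, hlv, b1, b2⟩ := hin v hv huv.symm
    rw [← hlu] at hle hj; have a := between_of_idx hu a1 a2 hj; rw [hlu, ← hlv] at hle hj
    have b := between_of_idx hv b1 b2 hj; unfold diamCost at hle; rw [hlu, ← hlv] at a
    rw [legDist, if_pos (hlu.trans hlv.symm)]; grind

/-! ### Distances to facilities -/

/-- A facility at distance more than `D` from the center serves its own leg only. There both extreme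
users of the interval count, which is the purpose of `line`. -/
noncomputable def facThreshold (U F : Users) (D : ℝ) : Threshold where
  rad := D
  cent b y := ∃ k < F.n, F.leg k = b ∧ F.pos k = y ∧ y ≤ D
  cent_nonneg := by rintro b y ⟨k, -, -, rfl, -⟩; exact F.nonneg k
  line i j := ∃ k < F.n, F.leg k = U.leg i ∧ U.pos j - F.pos k ≤ D ∧ F.pos k - U.pos i ≤ D

theorem clusterOk_of_facility {C : Finset ℕ} (hC : C.Nonempty) {k : ℕ} (hk : k < F.n)
    (h : ∀ u ∈ C, legDist (U.leg u) (U.pos u) (F.leg k) (F.pos k) ≤ D) : ClusterOk U (facThreshold U F D) C := by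
  by_cases hl : ∀ u ∈ C, U.leg u = F.leg k
  · have h' : ∀ u ∈ C, |U.pos u - F.pos k| ≤ D := fun u hu => by
      have := h u hu; rwa [legDist, if_pos (hl u hu)] at this
    exact clusterOk_of_line hC hl fun i hi j hj => ⟨k, hk, (hl i hi).symm, (abs_le.1 (h' j hj)).2,
      by linarith [(abs_le.1 (h' i hi)).1]⟩
  · push Not at hl
    obtain ⟨v, hv, hvk⟩ := hl; have h1 := h v hv; rw [legDist, if_neg hvk] at h1
    refine .inl ⟨F.leg k, F.pos k, ⟨k, hk, rfl, rfl, by linarith [U.nonneg v]⟩, fun u hu => ?_⟩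
    have h2 := h u hu; show _ ≤ if _ then D + _ else D - _
    unfold legDist at h2; grind

theorem legCost_le {l i j : ℕ} (hij : i < j) (hj : j ≤ U.cnt l)
    (h : ClusterOk U (facThreshold U F D) {U.usr l i, U.usr l (j - 1)}) : legCost U F l i j ≤ D := by
  have h0 := U.nonneg (U.usr l i); have hli := (U.usr_spec (l := l) (i := i) (by omega)).2.1
  have hlj := (U.usr_spec (l := l) (i := j - 1) (by omega)).2.1
  rcases h with ⟨b, y, ⟨k, hk, rfl, rfl, hy⟩, hb⟩ | ⟨i', j', ⟨k, hk, hkl, h1, h2⟩, -, h⟩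
  · have h1 := hb (U.usr l (j - 1)) (by simp); change U.pos _ ≤ (if _ then D + _ else D - _) at h1
    rw [hlj] at h1
    split_ifs at h1 with h2
    · exact (facCost_le hk h2.symm).trans (max_le (by linarith) (by linarith))
    -- A facility on another leg can be replaced by facility `0`, which is at least as near to the
    -- center.
    · exact facCost_le_far.trans (by linarith [F.mono (Nat.zero_le k)])
  · have a := h (U.usr l i) (by simp); have b := h (U.usr l (j - 1)) (by simp)
    exact (facCost_le hk (by omega)).trans
      (max_le (by linarith [U.mono b.2.2]) (by linarith [U.mono a.2.1]))

theorem multiCost_le {w z : ℕ} (h : MultiOk U (facThreshold U F D) (U.leg (U.tl K w)) (U.tl K w) (U.tl K z)) :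
    multiCost U F K w z ≤ D := by
  obtain ⟨b, y, ⟨k, hk, rfl, rfl, hy⟩, ⟨h1, h2, h3⟩ | ⟨h2, h3⟩⟩ := h
  · change _ ≤ D + _ at h2; change _ ≤ D - _ at h3
    exact (facCost_le hk h1).trans (max_le (by linarith) (by linarith))
  · change _ ≤ D - _ at h2; change _ ≤ D - _ at h3; have h4 := F.mono (Nat.zero_le k)
    refine facCost_le_far.trans ?_
    have : max (U.pos (U.tl K w)) (U.pos (U.tl K z)) ≤ D - F.pos k := max_le h2 h3; unfold multiFar
    linarith

theorem Solution.dist_le {κ lam : ℕ → ℕ} (h : Solution U K (fun w z => (multiCost U F K w z : WithTop ℝ))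
    (legCost U F) V (MultiLab U F K) (LegLab U F) κ lam) {u : ℕ} (hu : u < U.n) :
    lam u < F.n ∧ legDist (U.leg u) (U.pos u) (F.leg (lam u)) (F.pos (lam u)) ≤ V := by
  have hu0 := U.nonneg u; have hk0 := F.nonneg (lam u)
  have hsum := legDist_le (l := U.leg u) (l' := F.leg (lam u)) hu0 hk0
  rcases (h u hu).2 with ⟨w, hw, z, hz, hle, hlab, hin⟩ | ⟨l, hl, i, j, hij, hj, hle, hlab, hin⟩
  · have hle : multiCost U F K w z ≤ V := WithTop.coe_le_coe.1 hle; have hz0 := U.nonneg (U.tl K z)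
    refine ⟨hlab.1, ?_⟩; unfold multiCost at hle; rcases hlab.2 with ⟨h1, h2⟩ | ⟨h1, h2⟩
    · have h3 := (max_le_iff.1 h2).1; have h4 := (max_le_iff.1 h2).2
      rcases (hin u hu rfl).2.cases with a | a
      · rw [legDist, if_pos (a.1.trans h1.symm)]; grind
      · linarith
    · unfold multiFar at h2 hle; rw [← h1] at h2 hle
      have h3 := le_max_left (U.pos (U.tl K w)) (U.pos (U.tl K z))
      have h4 := le_max_right (U.pos (U.tl K w)) (U.pos (U.tl K z))
      rcases (hin u hu rfl).2.cases with a | a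
      · linarith [a.2]
      · linarith
  · obtain ⟨-, hlu, a1, a2⟩ := hin u hu rfl; subst hlu; have a := between_of_idx hu a1 a2 hj
    refine ⟨hlab.1, ?_⟩; unfold legCost at hle; rcases hlab.2 with ⟨h1, h2⟩ | ⟨h1, h2⟩
    · have h3 := (max_le_iff.1 h2).1; have h4 := (max_le_iff.1 h2).2; rw [legDist, if_pos h1.symm]
      grind
    · rw [← h1] at h2 hle; linarith [a.2]

end

section
/-! ### Points of a spider in memory -/

section Points

variable {d n m r : ℕ} {u : Fin n → SpiderPoint d} {f : Fin m → SpiderPoint d}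

/-- Numbers beyond the last point get its distance, which makes the positions monotone on all of
`ℕ`. -/
noncomputable def pointUsers (hr : 1 ≤ r) (hd : 1 ≤ d) (u : Fin n → SpiderPoint d)
    (hu : Monotone fun i => (u i).pos) : Users where
  n := n
  r := r
  d := d
  leg i := if h : i < n then (u ⟨i, h⟩).leg else 0
  pos i := if h : 0 < n then (u ⟨min i (n - 1), by omega⟩).pos else 0
  hr := hr
  hd := hd
  leg_lt i hi := by simp [hi]
  mono i j hij := by
    by_cases h : 0 < n
    · simp only [h, dite_true, NNReal.coe_le_coe]
      exact hu (Fin.mk_le_mk.2 (min_le_min_right _ hij))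
    · simp [h]
  nonneg i := by
    split_ifs
    · exact NNReal.coe_nonneg _
    · exact le_rfl

variable (hr : 1 ≤ r) (hd : 1 ≤ d) (hu : Monotone fun i => (u i).pos)

theorem pointUsers_leg (i : Fin n) : (pointUsers hr hd u hu).leg i = (u i).leg := by
  simp [pointUsers]

theorem pointUsers_pos (i : Fin n) : (pointUsers hr hd u hu).pos i = (u i).pos := by
  have : min (i : ℕ) (n - 1) = i := min_eq_left (by omega); simp [pointUsers, this, i.pos]

theorem dist_eq_legDist (i : Fin n) (q : SpiderPoint d) :
    dist (u i) q = legDist ((pointUsers hr hd u hu).leg i) ((pointUsers hr hd u hu).pos i) q.leg q.pos := by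
  rw [pointUsers_leg, pointUsers_pos, legDist]; simp only [Fin.val_inj]
  rfl

theorem inputIn_inputStore (f : Fin m → SpiderPoint d) :
    InputIn (pointUsers hr hd u hu) (inputStore r u f) := by
  refine ⟨rfl, rfl, rfl, fun i hi => ?_, fun i hi => ?_⟩
  · change i < n at hi; simp [inputStore, pointUsers, hi]
  · change i < n at hi; rw [pointUsers_pos hr hd hu ⟨i, hi⟩]; simp [inputStore, hi]

theorem inputStore_lt {N : ℕ} (hN : 0 < N) (h1 : d < N) (h2 : r < N) (h3 : n < N) (h4 : m < N) (a i : ℕ) :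
    (inputStore r u f).ints a i < N := by
  unfold inputStore; grind

theorem inputStore_ints {a : ℕ} (ha : 3 ≤ a) (i : ℕ) : (inputStore r u f).ints a i = 0 := by
  unfold inputStore; dsimp only
  split <;> first | omega | rfl

theorem card_filter_fin (p : ℕ → Prop) [DecidablePred p] :
    ((Finset.range n).filter p).card = (Finset.univ.filter fun i : Fin n => p i).card := by
  rw [← Finset.card_map Fin.valEmbedding]
  congr 1
  ext i
  simp only [Finset.mem_filter, Finset.mem_range, Finset.mem_map, Finset.mem_univ, true_and, Fin.valEmbedding_apply]
  exact ⟨fun h => ⟨⟨i, h.1⟩, h.2, rfl⟩, by rintro ⟨j, hj, rfl⟩; exact ⟨j.2, hj⟩⟩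

/-- Clusters given by a labelling of the users are admitted if those of all labels in use are. -/
theorem feas_of_labels {α : Type*} [Fintype α] [DecidableEq α] {T : Threshold} (c : Fin n → α)
    (h : ∀ a, r ≤ (Finset.univ.filter (c · = a)).card ∨ (Finset.univ.filter (c · = a)).card = 0)
    (hT : ∀ C : Finset ℕ, C.Nonempty → ∀ a, (∀ v ∈ C, ∃ i : Fin n, v = i ∧ c i = a) →
      ClusterOk (pointUsers hr hd u hu) T C) :
    Feas (pointUsers hr hd u hu) T (Finset.range n) := by
  classical
  let e := Fintype.equivFin α
  refine ⟨fun i => if h : i < n then e (c ⟨i, h⟩) else 0, ?_⟩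
  rintro k ⟨j, hj⟩; simp only [Finset.mem_filter, Finset.mem_range] at hj; obtain ⟨hjn, rfl⟩ := hj
  have key : ∀ i : Fin n, ((if h : (i : ℕ) < n then (e (c ⟨i, h⟩) : ℕ) else 0) =
      if h : j < n then (e (c ⟨j, h⟩) : ℕ) else 0) ↔ c i = c ⟨j, hjn⟩ := fun i => by
    simp only [i.2, hjn, dite_true, Fin.val_inj, EmbeddingLike.apply_eq_iff_eq]
  refine ⟨?_, hT _ ⟨j, by simp [hjn]⟩ (c ⟨j, hjn⟩) fun v hv => ?_⟩
  · rw [card_filter_fin]; simp only [key]; refine (h _).resolve_right ?_; rw [Finset.card_eq_zero]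
    exact Finset.Nonempty.ne_empty ⟨⟨j, hjn⟩, by simp⟩
  all_goals grind

/-- Each competitor makes the threshold at its own cost feasible; this is how the computed value is
compared with all solutions. -/
theorem clustering_feas {P : Finpartition (Finset.univ : Finset (Fin n))} (hP : ClusteringFeasible r P) :
    Feas (pointUsers hr hd u hu) (diamThreshold (pointUsers hr hd u hu) (clusteringCost u P)) (Finset.range n) := by
  refine feas_of_labels hr hd hu P.part (fun a => ?_) fun C hC a ha => clusterOk_of_diam hC fun v hv w hw => ?_
  · by_cases h : ∃ i, P.part i = a
    · obtain ⟨i, rfl⟩ := h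
      refine .inl ((hP _ (P.part_mem.2 (Finset.mem_univ i))).trans (Finset.card_le_card fun j hj => ?_))
      simpa using (P.mem_part_iff_part_eq_part (Finset.mem_univ j) (Finset.mem_univ i)).1 hj
    · exact .inr (Finset.card_eq_zero.2 (Finset.filter_eq_empty_iff.2 fun i _ hi => h ⟨i, hi⟩))
  · obtain ⟨i, rfl, rfl⟩ := ha v hv; obtain ⟨j, rfl, hj⟩ := ha w hw
    have h1 := dist_eq_legDist hr hd hu i (u j)
    rw [← pointUsers_leg hr hd hu, ← pointUsers_pos hr hd hu] at h1
    rw [← h1, ← coe_nndist, NNReal.coe_le_coe]; have hi := P.mem_part (Finset.mem_univ i)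
    have hj' : j ∈ P.part i := hj ▸ P.mem_part (Finset.mem_univ j)
    exact (Finset.le_sup (f := fun p : Fin n × Fin n => nndist (u p.1) (u p.2)) (b := (i, j))
      (Finset.mk_mem_product hi hj')).trans (Finset.le_sup (f := clusterDiam u) (P.part_mem.2 (Finset.mem_univ i)))

theorem clusteringCost_le {V : ℝ} (hV : 0 ≤ V) {P : Finpartition (Finset.univ : Finset (Fin n))}
    (h : ∀ i j, P.part i = P.part j → dist (u i) (u j) ≤ V) : (clusteringCost u P : ℝ) ≤ V := by
  lift V to ℝ≥0 using hV
  rw [NNReal.coe_le_coe]; refine Finset.sup_le fun C hC => Finset.sup_le fun p hp => ?_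
  obtain ⟨h1, h2⟩ := Finset.mem_product.1 hp; rw [← NNReal.coe_le_coe, coe_nndist]
  exact h _ _ ((P.part_eq_of_mem hC h1).trans (P.part_eq_of_mem hC h2).symm)

/-- The value is at least the cost of the output and at most the cost of every competitor. Taking
the output as its own competitor gives equality. -/
theorem clusteringAnswer_of_solved {LabM : ℕ → ℕ → ℕ → Prop} {Lab : ℕ → ℕ → ℕ → ℕ → Prop} {s : Store}
    (h : Solved (pointUsers hr hd u hu) (2 * r * d) (diamMulti (pointUsers hr hd u hu) (2 * r * d))
      (diamCost (pointUsers hr hd u hu)) LabM Lab true s) : ClusteringAnswer r u s := by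
  classical
  set U := pointUsers hr hd u hu with hU; obtain ⟨hopt, hsol⟩ := h
  have opt : ∀ Q : Finpartition (Finset.univ : Finset (Fin n)), ClusteringFeasible r Q →
      s.ints 3 0 = 1 ∧ s.reals 2 0 ≤ clusteringCost u Q := fun Q hQ =>
    hopt _ _ (NNReal.coe_nonneg _) (fun l _ i j => diamCost_le) (fun w _ z _ => diamMulti_le)
      (clustering_feas hr hd hu hQ)
  rcases hsol with h0 | ⟨h1, hn, κ, lam, hκ, hout⟩
  · exact .inr ⟨h0, fun ⟨Q, hQ⟩ => by have := (opt Q hQ).1; omega⟩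
  let P : Finpartition (Finset.univ : Finset (Fin n)) := .ofSetoid (Setoid.ker fun i : Fin n => κ i)
  have hP : ∀ i j, P.part i = P.part j ↔ κ i = κ j := fun i j => by
    rw [← P.mem_part_iff_part_eq_part (Finset.mem_univ i) (Finset.mem_univ j), Finpartition.mem_part_ofSetoid_iff_rel]
    exact ⟨fun h => h.symm, fun h => h.symm⟩
  have hPf : ClusteringFeasible r P := by
    intro C hC; obtain ⟨i, hi⟩ := P.nonempty_of_mem_parts hC; have := (hκ i i.2).1
    rw [show U.n = n from rfl, card_filter_fin] at this
    refine this.trans (Finset.card_le_card fun j hj => ?_)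
    rw [← P.part_eq_of_mem hC hi, P.mem_part_iff_part_eq_part (Finset.mem_univ j) (Finset.mem_univ i), hP]
    simpa using hj
  have hdist : ∀ i j, P.part i = P.part j → dist (u i) (u j) ≤ s.reals 2 0 := fun i j hij => by
    have h1 := dist_eq_legDist hr hd hu i (u j)
    rw [← pointUsers_leg hr hd hu, ← pointUsers_pos hr hd hu] at h1; rw [h1]
    exact hκ.diam_le i.2 j.2 ((hP i j).1 hij)
  have hV : 0 ≤ s.reals 2 0 := by
    rcases Nat.eq_zero_or_pos n with h | h
    · exact hn h
    · exact dist_nonneg.trans (hdist ⟨0, h⟩ ⟨0, h⟩ rfl)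
  have hle := clusteringCost_le hV hdist
  refine .inl ⟨h1, P, ⟨hPf, fun Q hQ => by exact_mod_cast hle.trans (opt Q hQ).2⟩, fun i j => ?_,
    le_antisymm (opt P hPf).2 hle⟩
  rw [hP, hout i i.2, hout j j.2]
  rfl

theorem gathering_feas {f : Fin m → SpiderPoint d} (hf : Monotone fun j => (f j).pos) {π : Fin n → Fin m}
    (hπ : GatheringFeasible r π) : Feas (pointUsers hr hd u hu) (facThreshold (pointUsers hr hd u hu)
      (pointUsers le_rfl hd f hf) (gatheringCost u f π)) (Finset.range n) := by
  refine feas_of_labels hr hd hu π (fun a => (hπ a).symm) fun C hC a ha =>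
    clusterOk_of_facility hC (k := a) a.2 fun v hv => ?_
  obtain ⟨i, rfl, rfl⟩ := ha v hv
  rw [pointUsers_leg le_rfl, pointUsers_pos le_rfl, ← dist_eq_legDist hr hd hu, ← coe_nndist, NNReal.coe_le_coe]
  exact Finset.le_sup (f := fun i => nndist (u i) (f (π i))) (Finset.mem_univ i)

theorem gatheringAnswer_of_solved {f : Fin m → SpiderPoint d} (hf : Monotone fun j => (f j).pos) {s : Store}
    (h : Solved (pointUsers hr hd u hu) (2 * r * d)
      (multiCost (pointUsers hr hd u hu) (pointUsers le_rfl hd f hf) (2 * r * d))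
      (legCost (pointUsers hr hd u hu) (pointUsers le_rfl hd f hf))
      (MultiLab (pointUsers hr hd u hu) (pointUsers le_rfl hd f hf) (2 * r * d))
      (LegLab (pointUsers hr hd u hu) (pointUsers le_rfl hd f hf)) false s) : GatheringAnswer r u f s := by
  set U := pointUsers hr hd u hu with hU; set F := pointUsers le_rfl hd f hf with hF
  obtain ⟨hopt, hsol⟩ := h
  have opt : ∀ ρ : Fin n → Fin m, GatheringFeasible r ρ → s.ints 3 0 = 1 ∧ s.reals 2 0 ≤ gatheringCost u f ρ :=
    fun ρ hρ => hopt _ _ (NNReal.coe_nonneg _) (fun l _ i j => legCost_le) (fun w _ z _ => multiCost_le)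
      (gathering_feas hr hd hu hf hρ)
  rcases hsol with h0 | ⟨h1, hn, κ, lam, hκ, hout⟩
  · exact .inr ⟨h0, fun ⟨Q, hQ⟩ => by have := (opt Q hQ).1; omega⟩
  -- Different clusters may be assigned to the same facility. Its users then still include a whole
  -- cluster, so there are at least `r` of them.
  let π : Fin n → Fin m := fun i => ⟨lam i, (hκ.dist_le i.2).1⟩
  have hπf : GatheringFeasible r π := by
    intro k
    rcases Finset.eq_empty_or_nonempty (Finset.univ.filter fun i => π i = k) with he | ⟨i, hi⟩
    · exact .inl (Finset.card_eq_zero.2 he)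
    · obtain rfl : π i = k := by simpa using hi
      have := hκ i i.2; have hc := this.1; rw [show U.n = n from rfl, card_filter_fin] at hc
      refine .inr (hc.trans (Finset.card_le_card fun j hj => ?_))
      have hj : κ j = κ i := by simpa using hj
      simp only [Finset.mem_filter, Finset.mem_univ, true_and, π]
      rcases this.2 with ⟨w, _, z, _, _, _, h⟩ | ⟨l, _, a, b, _, _, _, _, h⟩
      · exact Fin.ext (h j j.2 hj).1
      · exact Fin.ext (h j j.2 hj).1
  have hdist : ∀ i, dist (u i) (f (π i)) ≤ s.reals 2 0 := fun i => by
    rw [dist_eq_legDist hr hd hu, ← pointUsers_leg le_rfl hd hf, ← pointUsers_pos le_rfl hd hf]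
    exact (hκ.dist_le i.2).2
  have hV : 0 ≤ s.reals 2 0 := by
    rcases Nat.eq_zero_or_pos n with h | h
    · exact hn h
    · exact dist_nonneg.trans (hdist ⟨0, h⟩)
  have hle : (gatheringCost u f π : ℝ) ≤ s.reals 2 0 := by
    rw [← NNReal.coe_mk _ hV, NNReal.coe_le_coe]
    exact Finset.sup_le fun i _ => NNReal.coe_le_coe.1 (by rw [coe_nndist]; exact hdist i)
  refine .inl ⟨h1, π, ⟨hπf, fun Q hQ => by exact_mod_cast hle.trans (opt Q hQ).2⟩, fun i => hout i i.2,
    le_antisymm (opt π hπf).2 hle⟩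

end Points

end

/-! ### Assembly -/

section
/-! ### The two algorithms -/

theorem add_le_measure {d r n : ℕ} (hr : 1 ≤ r) (hd : 1 ≤ d) : d + 1 + n ≤ measure d r n := by
  have h1 : d < 2 ^ d := Nat.lt_two_pow_self
  have h2 : 2 ^ d * 1 ≤ 2 ^ d * (r ^ 4 * d ^ 5) := Nat.mul_le_mul_left _ (Nat.mul_pos (pow_pos hr 4) (pow_pos hd 5))
  unfold measure; rw [mul_assoc]; omega

/-- For `B ≥ 2` one has `20 * B ^ 2 ≤ B ^ 7`. So the word bound is a power of `B` whose exponent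
depends on the program only. -/
theorem Tr.run {p : Program} {s : Store} {t B : ℕ} {Q : Store → Prop} (h : Tr (20 * B ^ 2) p s t Q) (hB : 2 ≤ B)
    (hs : ∀ a i, s.ints a i < 20 * B ^ 2) : ∃ s' t', Run (B ^ (7 * p.size)) p s s' t' ∧ t' ≤ t ∧ Q s' := by
  obtain ⟨s', t', h1, h2, h3⟩ := h; refine ⟨s', t', (h1.run (by nlinarith) hs ?_).1, h2, h3⟩
  rw [pow_mul]; refine Nat.pow_le_pow_left ?_ _; have : 2 ^ 5 ≤ B ^ 5 := Nat.pow_le_pow_left hB 5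
  calc 20 * B ^ 2 ≤ B ^ 5 * B ^ 2 := Nat.mul_le_mul_right _ (by omega)
    _ = B ^ 7 := by ring

theorem clustering_spec : ∃ c, ∀ (d r n : ℕ) (u : Fin n → SpiderPoint d), 1 ≤ d → 1 ≤ r →
    Monotone (fun i => (u i).pos) → ∃ s t, Run (measure d r n ^ (7 * Program.clustering.size)) .clustering
      (inputStore r u ![]) s t ∧ t ≤ c * measure d r n ∧ ClusteringAnswer r u s := by
  obtain ⟨c₁, hc₁⟩ := solve_spec true
  obtain ⟨c, hc⟩ := solve_time_le c₁ (7 * 30 + 4000 + 2 * IExp.cost 0)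
  refine ⟨c, fun d r n u hd hr hu => ?_⟩
  have hF := fits_of_measure (pointUsers hr hd u hu) (m := 0); rw [Nat.add_zero] at hF
  have hlt := fun a i => inputStore_lt (u := u) (f := ![]) (by have := hF.three; omega) hF.d hF.r
    (by have := hF.n; change 2 * n + 2 < _ at this; omega) (by have := hF.three; omega) a i
  obtain ⟨s, t, h1, h2, h3⟩ := Tr.run (hc₁ _ _ _ _ _ _ _ _ _ _ _ _ _ _ _ hF (clustering_costs hF)
    (inputIn_inputStore hr hd hu ![]) trivial (fun a ha => inputStore_ints (of_mem ha)) hlt)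
    (show 2 ≤ measure d r n by have := add_le_measure (n := n) hr hd; omega) hlt
  refine ⟨s, t, h1, h2.trans ((Nat.add_le_add_left (Nat.mul_le_mul_left _ (Nat.add_le_add_right
    (Nat.mul_le_mul_left _ ?_) _)) _).trans (hc (pointUsers hr hd u hu) 0 _ (by simp))), clusteringAnswer_of_solved hr hd hu h3⟩
  omega

theorem gathering_spec : ∃ c, ∀ (d r n m : ℕ) (u : Fin n → SpiderPoint d) (f : Fin m → SpiderPoint d), 1 ≤ d → 1 ≤ r →
    Monotone (fun i => (u i).pos) → Monotone (fun j => (f j).pos) →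
    ∃ s t, Run (measure d r (n + m) ^ (7 * Program.gathering.size)) .gathering (inputStore r u f) s t ∧
      t ≤ c * measure d r (n + m) ∧ GatheringAnswer r u f s := by
  obtain ⟨c₁, hc₁⟩ := solve_spec false
  obtain ⟨c, hc⟩ := solve_time_le c₁ (7 * 300 + 4000 + 2 * (IExp.read 51 (iv 31) - 1).cost)
  refine ⟨c + (Program.bucketBody 1).cst + 50, fun d r n m u f hd hr hu hf => ?_⟩
  set U := pointUsers hr hd u hu with hU; set F := pointUsers le_rfl hd f hf with hF
  have hfit := fits_of_measure U (m := m); set N := 20 * measure U.d U.r (U.n + m) ^ 2 with hN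
  have hmB : d + 1 + (n + m) ≤ measure d r (n + m) := add_le_measure hr hd
  have hB : 2 ≤ measure d r (n + m) := by omega
  have hNB : N = 20 * measure d r (n + m) ^ 2 := rfl; have hmN : 2 * m + 2 < N := by nlinarith
  have hlt := fun a i => inputStore_lt (u := u) (f := f) (N := N) (by omega) hfit.d hfit.r
    (by have := hfit.n; change 2 * n + 2 < _ at this; omega) (by omega) a i
  suffices Tr N .gathering (inputStore r u f) ((c + (Program.bucketBody 1).cst + 50) * measure d r (n + m))
      (GatheringAnswer r u f) from Tr.run this hB hlt
  refine (Tr.ite (t := (m + 1) * ((Program.bucketBody 1).cst + 30) + c * measure d r (n + m)) (fun hm => ?_) fun hm => ?_).mono ?_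
    fun _ _ h => h
  · have hm : 0 < m := hm
    have hdN : (F.n + 1) * F.d < N := by
      have h2 : (m + 1) * d ≤ (measure d r (n + m) + measure d r (n + m)) * measure d r (n + m) :=
        Nat.mul_le_mul (by omega) (by omega)
      change (m + 1) * d < N; nlinarith
    have hin := inputIn_inputStore hr hd hu f; have hinf := inputIn_inputStore le_rfl hd hf u
    refine Tr.seq ((bucket_spec (U := F) (K := 0) (k := 1) (.inr rfl) rfl rfl (fun j hj => ?_) (fun j hj => ?_)
      (fun l => inputStore_ints (by decide) l) (inputStore_ints (by decide) 0) (by change m + 1 < N; omega) hfit.d).ints_lt hlt)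
      fun s₁ f₁ ⟨q₁, lt₁⟩ => (hc₁ N U _ _ _ _ _ _ _ _ _ _ _ _ s₁ hfit (gathering_costs (F := F) hfit rfl hm (by change 2 * m + 1 < N; omega) hdN)
        (hin.congr (f₁.int 0) (f₁.int 1) (f₁.real 0))
        (facIn_of_bucketed q₁ (by rw [f₁.int 0]; rfl) (fun j hj => ?_) hm)
        (fun a ha i => ?_) lt₁).mono ?_ fun s₂ _ q₂ => gatheringAnswer_of_solved hr hd hu hf q₂
    · exact hinf.leg j hj
    · exact hinf.pos j hj
    · rw [f₁.real 1]; exact hinf.pos j hj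
    · rw [f₁.int a (notMem_of_mem ha)]; exact inputStore_ints (of_mem ha) i
    · refine (hc U m _ ?_).trans le_rfl
      calc _ ≤ ∑ l ∈ Finset.range F.d, F.cnt l := Finset.sum_le_sum fun l _ => Nat.sub_le _ _
        _ = m := F.sum_cnt
  · obtain rfl : m = 0 := by have : ¬ 1 ≤ m := hm; omega
    refine (Tr.ite (t := 10) (fun hn => ?_) fun hn => ?_).mono ?_ fun _ _ h => h
    · obtain rfl : n = 0 := Nat.le_zero.1 hn
      refine (Tr.of_wp (Q := fun s => s.ints 3 0 = 1 ∧ s.reals 2 0 = 0) ?_).mono (by decide) fun s _ q => .inl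
        ⟨q.1, fun i => i.elim0, ⟨fun j => j.elim0, fun ρ _ => ?_⟩, fun i => i.elim0, ?_⟩
      · simp [wp, inputStore]; omega
      · exact Finset.sup_le fun i => i.elim0
      · rw [q.2]; simp [gatheringCost]
    · have hn : 0 < n := by have : ¬ n ≤ 0 := hn; omega
      exact (Tr.of_wp (p := .skip) (Q := fun s => s.ints 3 0 = 0) (inputStore_ints (by decide) 0)).mono (by decide)
        fun s _ q => .inr ⟨q, fun ⟨π, _⟩ => (π ⟨0, hn⟩).elim0⟩
    · have : (Test.intLe (.read 0 2) 0).cost ≤ 10 := by decide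
      omega
  · have h1 : (Test.intLe 1 (.read 0 3)).cost ≤ 10 := by decide
    have h2 := Nat.mul_le_mul_left ((Program.bucketBody 1).cst + 30) (show m + 1 ≤ measure d r (n + m) by omega)
    nlinarith

end

end RGather

theorem theorem2 :
    (∃ (p : RGather.Program) (c k : ℕ), ∀ (d r n : ℕ) (u : Fin n → RGather.SpiderPoint d),
      1 ≤ d → 1 ≤ r → Monotone (fun i => (u i).pos) →
      ∃ (s : RGather.Store) (t : ℕ),
        RGather.Run ((2 ^ d * r ^ 4 * d ^ 5 + n) ^ k) p (RGather.inputStore r u ![]) s t ∧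
        t ≤ c * (2 ^ d * r ^ 4 * d ^ 5 + n) ∧
        RGather.ClusteringAnswer r u s) ∧
    (∃ (p : RGather.Program) (c k : ℕ), ∀ (d r n m : ℕ) (u : Fin n → RGather.SpiderPoint d)
      (f : Fin m → RGather.SpiderPoint d),
      1 ≤ d → 1 ≤ r → Monotone (fun i => (u i).pos) → Monotone (fun j => (f j).pos) →
      ∃ (s : RGather.Store) (t : ℕ),
        RGather.Run ((2 ^ d * r ^ 4 * d ^ 5 + n + m) ^ k) p (RGather.inputStore r u f) s t ∧
        t ≤ c * (2 ^ d * r ^ 4 * d ^ 5 + n + m) ∧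
        RGather.GatheringAnswer r u f s) := by
  obtain ⟨c₁, h₁⟩ := RGather.clustering_spec
  obtain ⟨c₂, h₂⟩ := RGather.gathering_spec
  refine ⟨⟨_, c₁, _, h₁⟩, .gathering, c₂, 7 * RGather.Program.gathering.size, fun d r n m u f hd hr hu hf => ?_⟩
  rw [add_assoc]
  exact h₂ d r n m u f hd hr hu hf
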